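/- **Setting.** For even $L\ge 2$ consider a ring of $L$ qubits (sites $x\in\mathbb Z/L$) and $$U_{\rm CZX}=\prod_x X_x\prod_x CZ_{x,x+1},\qquad \rho_{\infty,\pm}=\frac{\mathbb 1\pm U_{\rm CZX}}{2^L}.$$ More generally a *chain* of length $L$ has an arbitrary finite-dimensional Hilbert space at each site of the ring. A *local circuit of range $R$ and depth $D$* is a product of at most $D$ layers, each layer being a product of unitary gates supported on pairwise disjoint arcs of at most $R$ consecutive sites. A pure state is *$(R,D)$-short-range entangled* (SRE) if such a circuit prepares it from a product state $\bigotimes_x|v_x\rangle$. A *local channel of range $R$ and depth $D$* from one chain of length $L$ to another adds a finite-dimensional ancilla at every site, applies a local circuit of range $R$ and depth $D$, and traces out an on-site environment; the ancillas start in a product state or, more generally, in a convex mixture of $(R,D)$-SRE pure states. A state is *separable for a partition* of the sites if it is a convex mixture of pure states that are tensor products over the regions of the partition. On-site dimensions, also those of the ancillas, are arbitrary, and no constant below depends on them. **Theorem.** 1. (*A pure state that prepares $\rho_{\infty,\pm}$ is long-range entangled.*) For all $R,D,R',D'$ there is $\ell$ such that the following holds for every even $L\ge2$ and either sign. Let $|\Psi_1\rangle$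 be a pure state of a chain of length $L$ and $\mathcal E_1$ a local channel of range $R$ and depth $D$ with $\mathcal E_1[|\Psi_1\rangle\langle\Psi_1|]=\rho_{\infty,\pm}$. If $L\ge\ell$, then $|\Psi_1\rangle$ is not $(R',D')$-SRE. Moreover $|\Psi_1\rangle$ is long-range tripartite entangled: $|\Psi_1\rangle\langle\Psi_1|\ne\mathcal E[\sigma]$ for every local channel $\mathcal E$ of range $R'$ and depth $D'$ and every state $\sigma$ of a chain of length $L$ that is separable for a partition of the ring into three connected regions of at least $\ell$ sites each. 2. (*A pure state prepared from $\rho_{\infty,\pm}$ is short-range entangled.*) For all $R,D$ there are $R',D'$ such that, for every even $L\ge2$, either sign, every pure state $|\Psi_2\rangle$ of a chain of length $L$ and every local channel $\mathcal E_2$ of range $R$ and depth $D$ with $\mathcal E_2[\rho_{\infty,\pm}]=|\Psi_2\rangle\langle\Psi_2|$, the state $|\Psi_2\rangle$ is $(R',D')$-SRE. 3. (*$\rho_{\infty,\pm}$ is intrinsically mixed.*) For all $R,D$ there is $L_0$ such that, for every even $L\ge \max(L_0,2)$, either sign and every pure state $|\Psi\rangle$ of a chain of length $L$, there are no local channels $\mathcal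 E_1,\mathcal E_2$ of range $R$ and depth $D$ with $\mathcal E_1[|\Psi\rangle\langle\Psi|]=\rho_{\infty,\pm}$ and $\mathcal E_2[\rho_{\infty,\pm}]=|\Psi\rangle\langle\Psi|$. -/

import Mathlib

/-- Basis configurations of a ring of `L` sites (labelled by `ZMod L`, so that `x` and `x + 1` are
neighbours) whose on-site Hilbert space at `x` is `ℂ^(κ x)`.  State vectors are functions
`Conf κ → ℂ`, operators are matrices indexed by `Conf κ`. -/
abbrev Conf {L : ℕ} (κ : ZMod L → Type) : Type := ∀ x, κ x

/-- The connected arc `{x, x + 1, …, x + k - 1}` of the ring. -/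
def arc {L : ℕ} (x : ZMod L) (k : ℕ) : Finset (ZMod L) :=
  (Finset.range k).image fun i : ℕ => x + (i : ZMod L)

/-- `U = M ⊗ 1`, with `M` acting on the sites in `S` and `1` on all the other sites. -/
def IsSupportedOn {L : ℕ} [NeZero L] {κ : ZMod L → Type} [∀ x, DecidableEq (κ x)]
    (S : Finset (ZMod L)) (U : Matrix (Conf κ) (Conf κ) ℂ) : Prop :=
  ∃ M : Matrix (∀ x : S, κ x) (∀ x : S, κ x) ℂ, ∀ c c' : Conf κ,
    U c c' = if ∀ x, x ∉ S → c x = c' x then M (fun x => c x) (fun x => c' x) else 0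

/-- One layer of a circuit: a product of unitary gates which are supported on pairwise disjoint
arcs of at most `R` sites. -/
def IsLayer {L : ℕ} [NeZero L] {κ : ZMod L → Type} [∀ x, Fintype (κ x)] [∀ x, DecidableEq (κ x)]
    (R : ℕ) (U : Matrix (Conf κ) (Conf κ) ℂ) : Prop :=
  ∃ g : List (Finset (ZMod L) × Matrix (Conf κ) (Conf κ) ℂ),
    (∀ G ∈ g, (∃ x k, k ≤ R ∧ G.1 = arc x k) ∧ IsSupportedOn G.1 G.2 ∧
      G.2 ∈ Matrix.unitaryGroup (Conf κ) ℂ) ∧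
    g.Pairwise (fun G H => Disjoint G.1 H.1) ∧
    U = (g.map Prod.snd).prod

/-- A local unitary circuit of depth at most `D` with gates of range at most `R`. -/
def IsLocalCircuit {L : ℕ} [NeZero L] {κ : ZMod L → Type} [∀ x, Fintype (κ x)]
    [∀ x, DecidableEq (κ x)] (R D : ℕ) (U : Matrix (Conf κ) (Conf κ) ℂ) : Prop :=
  ∃ W : List (Matrix (Conf κ) (Conf κ) ℂ),
    W.length ≤ D ∧ (∀ w ∈ W, IsLayer R w) ∧ U = W.prod

/-- Normalized vectors. -/
def IsUnitVec {ι : Type} [Fintype ι] (ψ : ι → ℂ) : Prop := ∑ i, ‖ψ i‖ ^ 2 = 1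

/-- The density matrix `|ψ⟩⟨ψ|`. -/
def pureState {ι : Type} (ψ : ι → ℂ) : Matrix ι ι ℂ := Matrix.vecMulVec ψ (star ψ)

/-- `ψ` is short-range entangled with range `R` and depth `D`: a local circuit of depth at most `D`
and range at most `R` prepares it from a product state `⨂ₓ v x`. -/
def IsSRE {L : ℕ} [NeZero L] {κ : ZMod L → Type} [∀ x, Fintype (κ x)] [∀ x, DecidableEq (κ x)]
    (R D : ℕ) (ψ : Conf κ → ℂ) : Prop :=
  ∃ (v : ∀ x, κ x → ℂ) (U : Matrix (Conf κ) (Conf κ) ℂ),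
    (∀ x, IsUnitVec (v x)) ∧ IsLocalCircuit R D U ∧
    ψ = U.mulVec (fun c => ∏ x, v x (c x))

/-- The state `ρ ⊗ τ` of a ring and its ancillas, the ancilla `ℂ^(α x)` being placed at site `x`. -/
def withAncilla {L : ℕ} {κ α : ZMod L → Type} (ρ : Matrix (Conf κ) (Conf κ) ℂ)
    (τ : Matrix (Conf α) (Conf α) ℂ) :
    Matrix (Conf fun x => κ x × α x) (Conf fun x => κ x × α x) ℂ :=
  fun c c' => ρ (fun x => (c x).1) (fun x => (c' x).1) * τ (fun x => (c x).2) (fun x => (c' x).2)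

/-- Partial trace over the environments: the space at each site `x` is split as
`ℂ^(η x) ≃ ℂ^(κ x) ⊗ ℂ^(β x)` and the factor `ℂ^(β x)` is traced out. -/
def traceEnv {L : ℕ} [NeZero L] {η κ β : ZMod L → Type} [∀ x, Fintype (β x)]
    (e : ∀ x, η x ≃ κ x × β x) (M : Matrix (Conf η) (Conf η) ℂ) :
    Matrix (Conf κ) (Conf κ) ℂ :=
  fun y y' => ∑ z : Conf β, M (fun x => (e x).symm (y x, z x)) (fun x => (e x).symm (y' x, z x))

/-- `E` is a local channel of range `R` and depth `D` from states of the ring with on-site spaces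
`ℂ^(κ x)` to states of the ring with on-site spaces `ℂ^(κ' x)`: add a finite-dimensional ancilla at
every site, apply a local circuit `V`, and trace out an on-site environment.  The ancillas start in
a convex mixture of short-range entangled pure states; a product state is the case `n = 1`, `φ 0` a
product vector.  A channel that acts within one Hilbert space is the case `κ' = κ`, `b = a`,
`e x = Equiv.refl _`. -/
def IsLocalChannel {L : ℕ} [NeZero L] {κ κ' : ZMod L → Type} [∀ x, Fintype (κ x)]
    [∀ x, DecidableEq (κ x)] (R D : ℕ)
    (E : Matrix (Conf κ) (Conf κ) ℂ → Matrix (Conf κ') (Conf κ') ℂ) : Prop :=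
  ∃ (a b : ZMod L → ℕ) (e : ∀ x, κ x × Fin (a x) ≃ κ' x × Fin (b x))
    (V : Matrix (Conf fun x => κ x × Fin (a x)) (Conf fun x => κ x × Fin (a x)) ℂ)
    (n : ℕ) (w : Fin n → ℝ) (φ : Fin n → (Conf fun x => Fin (a x)) → ℂ),
    IsLocalCircuit R D V ∧
    (∀ j, 0 ≤ w j) ∧ ∑ j, w j = 1 ∧ (∀ j, IsSRE R D (φ j)) ∧
    ∀ ρ, E ρ = traceEnv e
      (V * withAncilla ρ (∑ j, (w j : ℂ) • pureState (φ j)) * V.conjTranspose)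

/-- `ρ` is separable with respect to the regions `P 0, …, P (k - 1)`: it is a convex mixture of
pure states which are tensor products of one normalized vector for each region. -/
def IsPartSeparable {L : ℕ} [NeZero L] {κ : ZMod L → Type} [∀ x, Fintype (κ x)] {k : ℕ}
    (P : Fin k → Finset (ZMod L)) (ρ : Matrix (Conf κ) (Conf κ) ℂ) : Prop :=
  ∃ (n : ℕ) (w : Fin n → ℝ) (f : Fin n → ∀ i : Fin k, (∀ x : P i, κ x) → ℂ),
    (∀ j, 0 ≤ w j) ∧ ∑ j, w j = 1 ∧ (∀ j i, IsUnitVec (f j i)) ∧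
    ρ = ∑ j, (w j : ℂ) • pureState (fun c : Conf κ => ∏ i, f j i (fun x => c x))

/-- `P` is a partition of the ring into connected regions of at least `ℓ` sites each. -/
def IsArcPartition {L : ℕ} [NeZero L] {k : ℕ} (ℓ : ℕ) (P : Fin k → Finset (ZMod L)) : Prop :=
  (∀ i, ℓ ≤ (P i).card ∧ ∃ x m, P i = arc x m) ∧
  (∀ i j, i ≠ j → Disjoint (P i) (P j)) ∧
  (∀ x, ∃ i, x ∈ P i)

/-- The on-site basis `{|0⟩, |1⟩}` of a ring of qubits. -/
abbrev Qubits (L : ℕ) : ZMod L → Type := fun _ => Fin 2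

/-- `∏ᵢ Xᵢ`, the tensor product of the Pauli matrices `X` of all sites. -/
def allX (L : ℕ) [NeZero L] : Matrix (Conf (Qubits L)) (Conf (Qubits L)) ℂ :=
  fun c c' => ∏ x, (!![0, 1; 1, 0] : Matrix (Fin 2) (Fin 2) ℂ) (c x) (c' x)

/-- `∏ᵢ CZ_{i,i+1}`, the product of the (diagonal) controlled-Z gates on all neighbouring pairs. -/
def allCZ (L : ℕ) [NeZero L] : Matrix (Conf (Qubits L)) (Conf (Qubits L)) ℂ :=
  Matrix.diagonal fun c => ∏ x, if c x = 1 ∧ c (x + 1) = 1 then (-1 : ℂ) else 1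

/-- `U_CZX = ∏ᵢ Xᵢ ∏ᵢ CZ_{i,i+1}`. -/
def czx (L : ℕ) [NeZero L] : Matrix (Conf (Qubits L)) (Conf (Qubits L)) ℂ := allX L * allCZ L

/-- The infinite-temperature state `(1 + s U_CZX) / 2^L` of the charge sector `s = ±1`. -/
noncomputable def czxState (L : ℕ) [NeZero L] (s : ℤˣ) :
    Matrix (Conf (Qubits L)) (Conf (Qubits L)) ℂ :=
  ((2 : ℂ) ^ L)⁻¹ • (1 + ((s : ℤ) : ℂ) • czx L)

/-! Channels are first reduced to vectors. If an operator annihilates the output of a local channel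
from the left, then by positivity it annihilates every branch of positive weight before the
environment is traced out (`IsLocalChannel.exists_circ`). A channel that outputs ρ_± thus yields a
vector on system and environment that is an eigenvector of U ⊗ 1, U = U_CZX, and a channel that
outputs |Ψ⟩⟨Ψ| yields Ψ ⊗ (environment vector).

Part 1. If Ψ₁ were short-range or only bipartite-type entangled, some circuit K would map a vector Ψ
that is a product over three long arcs A, B, C to an eigenvector of U. Let G be U truncated to an
interval that starts in A and ends in B, and let Ĝ = K†GK. Since GU = T is a truncation to the
complementary interval, T̂Ψ = ±ĜΨ. Now Ĝ is a product over the arcs up to a unitary at the boundary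
A|B, whereas T̂ is one up to unitaries at the other two boundaries. Comparing Schmidt ranks of χ =
ĜΨ in both descriptions forces χ to be a product over the arcs (`isProductAcross_of_tripartite`), so
ĜΨ = Wl Wr Ψ with Wl and Wr near the two ends of the interval (`exists_local_pair`). This is
impossible because of the anomaly: G² = ± Zp Zq with Pauli matrices Z at the two ends, while G Zp =
−Zp G. Evaluating ĜĜWlΨ in two ways gives opposite signs (`false_of_truncated_symmetry`).

Part 2. The state ρ_± is the uniform mixture of the vectors |c⟩ + z|c̄⟩, where c̄ is the global flip
of c, so K maps all of them to Ψ ⊗ h. An operator whose light cone misses a site cannot distinguish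
such a superposition from the mixture of |c⟩ and |c̄⟩. Hence such an operator that kills Ψ also
kills K|c⟩, and every environment slice of K|c⟩ has the form OΨ with O in a gap that can be placed
anywhere. For two gaps between which Ψ is uncorrelated this leaves only multiples of Ψ
(`Uncorr.eq_smul`), so K|c⟩ = Ψ ⊗ μ (`exists_tens_of_preparesFromFlips`): the state Ψ is invertible.

It remains to see that invertible states in one dimension are short-range entangled
(`isSRE_of_circ`). What an operator on a long interval does to a distant region can be reproduced by
measuring a short arc b at one end of the interval. Choosing a measurement outcome on b with
extremal reduced states removes the correlations across a cut (`exists_uncorr_of_steersTo`). By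
Uhlmann's theorem a unitary near the cut then disentangles the two sides (`exists_disentangler`),
and since b is far away and uncorrelated with that neighbourhood, the same unitary works for Ψ
itself (`exists_cut_unitary`). Applying these unitaries at evenly spaced cuts makes every cell
between neighbouring cuts pure, again by counting Schmidt ranks (`srank_cell_eq_one`).

Part 3 combines the two: Ψ would be short-range entangled by part 2 and not by part 1. -/

open scoped Matrix ComplexOrder Kronecker

set_option linter.unusedSectionVars false
set_option linter.unusedDecidableInType false
set_option linter.unusedFintypeInType false


/-! ### Operators supported on a set of sites -/

section Support

variable {ι : Type} [Fintype ι] [DecidableEq ι] {K : ι → Type} [∀ i, Fintype (K i)]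
  [∀ i, DecidableEq (K i)]

/-- The operator `A` acts as the identity on the tensor factor at `i`. -/
def ActsTriviallyAt (i : ι) (A : Matrix (∀ i, K i) (∀ i, K i) ℂ) : Prop :=
  (∀ c c', c i ≠ c' i → A c c' = 0) ∧
  ∀ c c' k, c i = c' i → A (Function.update c i k) (Function.update c' i k) = A c c'

/-- The operator `A` acts as the identity on all tensor factors outside `S`. -/
def SuppOn (S : Finset ι) (A : Matrix (∀ i, K i) (∀ i, K i) ℂ) : Prop :=
  ∀ i, i ∉ S → ActsTriviallyAt i A

theorem SuppOn.mono {S T : Finset ι} {A : Matrix (∀ i, K i) (∀ i, K i) ℂ} (h : SuppOn S A)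
    (hST : S ⊆ T) : SuppOn T A :=
  fun i hi => h i fun hS => hi (hST hS)

theorem SuppOn.inter {S T : Finset ι} {A : Matrix (∀ i, K i) (∀ i, K i) ℂ} (h : SuppOn S A)
    (h' : SuppOn T A) : SuppOn (S ∩ T) A := by
  intro i hi
  by_cases hS : i ∈ S
  · exact h' i fun hT => hi (Finset.mem_inter.2 ⟨hS, hT⟩)
  · exact h i hS

theorem SuppOn.eq_zero {S : Finset ι} {A : Matrix (∀ i, K i) (∀ i, K i) ℂ} (h : SuppOn S A)
    {c c' : ∀ i, K i} {i : ι} (hi : i ∉ S) (hc : c i ≠ c' i) : A c c' = 0 :=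
  (h i hi).1 c c' hc

theorem SuppOn.eq_of_ne_zero {S : Finset ι} {A : Matrix (∀ i, K i) (∀ i, K i) ℂ} (h : SuppOn S A)
    {c c' : ∀ i, K i} (hA : A c c' ≠ 0) : ∀ i, i ∉ S → c i = c' i := by
  intro i hi
  by_contra hc
  exact hA (h.eq_zero hi hc)

theorem SuppOn.apply_piecewise {S T : Finset ι} {A : Matrix (∀ i, K i) (∀ i, K i) ℂ}
    (h : SuppOn S A) (hT : Disjoint T S) {c c' : ∀ i, K i} (d : ∀ i, K i)
    (hc : ∀ i, i ∉ S → c i = c' i) : A (T.piecewise d c) (T.piecewise d c') = A c c' := by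
  induction T using Finset.induction_on with
  | empty => simp
  | insert i T hi ih =>
    rw [Finset.disjoint_insert_left] at hT
    rw [Finset.piecewise_insert, Finset.piecewise_insert, ← ih hT.2]
    refine (h i hT.1).2 _ _ _ ?_
    simp [Finset.piecewise, hi, hc i hT.1]

/-- The matrix elements of an operator supported on `S` do not depend on the rest. -/
theorem SuppOn.apply_eq {S : Finset ι} {A : Matrix (∀ i, K i) (∀ i, K i) ℂ}
    (h : SuppOn S A) {c c' d d' : ∀ i, K i} (hc : ∀ i, i ∉ S → c i = c' i)
    (hd : ∀ i, i ∉ S → d i = d' i) (h1 : ∀ i ∈ S, c i = d i) (h2 : ∀ i ∈ S, c' i = d' i) :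
    A c c' = A d d' := by
  rw [← h.apply_piecewise (T := Sᶜ) disjoint_compl_left d hc]
  congr 1
  · funext i
    by_cases hi : i ∈ S <;> simp [Finset.piecewise, hi, h1]
  · funext i
    by_cases hi : i ∈ S <;> simp [Finset.piecewise, hi, h2, hd]

/-- The sitewise form of a support is the one used throughout: it is stable under products, and
intersections of supports come for free (`SuppOn.inter`). -/
theorem IsSupportedOn.suppOn {L : ℕ} [NeZero L] {κ : ZMod L → Type} [∀ x, DecidableEq (κ x)]
    {S : Finset (ZMod L)} {U : Matrix (Conf κ) (Conf κ) ℂ} (h : IsSupportedOn S U) :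
    SuppOn S U := by
  obtain ⟨M, hM⟩ := h
  intro i hi
  refine ⟨fun c c' hc => ?_, fun c c' k hc => ?_⟩
  · rw [hM, if_neg fun h => hc (h i hi)]
  · rw [hM, hM]
    have h1 : ∀ (c : Conf κ), (fun x : S => Function.update c i k x) = fun x : S => c x := by
      intro c
      funext x
      rw [Function.update_of_ne]
      rintro rfl
      exact hi x.2
    rw [h1, h1]
    congr 1
    rw [eq_iff_iff]
    refine forall_congr' fun x => imp_congr_right fun _ => ?_
    by_cases hx : x = i
    · subst hx
      simp [hc]
    · simp [hx]

theorem suppOn_one (S : Finset ι) : SuppOn S (1 : Matrix (∀ i, K i) (∀ i, K i) ℂ) := by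
  intro i _
  refine ⟨fun c c' hc => Matrix.one_apply_ne fun h => hc (congrFun h i), fun c c' k hc => ?_⟩
  rw [Matrix.one_apply, Matrix.one_apply]
  congr 1
  rw [eq_iff_iff]
  constructor
  · intro h
    funext j
    by_cases hj : j = i
    · subst hj; exact hc
    · simpa [hj] using congrFun h j
  · rintro rfl
    rfl

theorem SuppOn.smul {S : Finset ι} {A : Matrix (∀ i, K i) (∀ i, K i) ℂ} (h : SuppOn S A) (z : ℂ) :
    SuppOn S (z • A) := by
  intro i hi
  refine ⟨fun c c' hc => ?_, fun c c' k hc => ?_⟩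
  · simp [(h i hi).1 c c' hc]
  · simp [(h i hi).2 c c' k hc]

theorem SuppOn.add {S : Finset ι} {A B : Matrix (∀ i, K i) (∀ i, K i) ℂ} (h : SuppOn S A)
    (h' : SuppOn S B) : SuppOn S (A + B) := by
  intro i hi
  refine ⟨fun c c' hc => ?_, fun c c' k hc => ?_⟩
  · simp [(h i hi).1 c c' hc, (h' i hi).1 c c' hc]
  · simp [(h i hi).2 c c' k hc, (h' i hi).2 c c' k hc]

theorem SuppOn.sub {S : Finset ι} {A B : Matrix (∀ i, K i) (∀ i, K i) ℂ} (h : SuppOn S A)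
    (h' : SuppOn S B) : SuppOn S (A - B) := by
  rw [sub_eq_add_neg, ← neg_one_smul ℂ B]
  exact h.add (h'.smul _)

theorem SuppOn.zero (S : Finset ι) : SuppOn S (0 : Matrix (∀ i, K i) (∀ i, K i) ℂ) :=
  fun _ _ => ⟨fun _ _ _ => rfl, fun _ _ _ _ => rfl⟩

theorem SuppOn.sum {S : Finset ι} {γ : Type*} (s : Finset γ)
    {A : γ → Matrix (∀ i, K i) (∀ i, K i) ℂ} (h : ∀ j ∈ s, SuppOn S (A j)) :
    SuppOn S (∑ j ∈ s, A j) := by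
  classical
  induction s using Finset.induction_on with
  | empty => simpa using SuppOn.zero S
  | insert j s hj ih =>
    rw [Finset.sum_insert hj]
    exact (h j (by simp)).add (ih fun k hk => h k (by simp [hk]))

theorem SuppOn.conjTranspose {S : Finset ι} {A : Matrix (∀ i, K i) (∀ i, K i) ℂ}
    (h : SuppOn S A) : SuppOn S Aᴴ := by
  intro i hi
  refine ⟨fun c c' hc => ?_, fun c c' k hc => ?_⟩
  · simp [(h i hi).1 c' c (Ne.symm hc)]
  · simp [(h i hi).2 c' c k hc.symm]

/-- The permutation of the configurations that swaps `c i` and `d i` at all sites outside `S`. -/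
def swapOff (S : Finset ι) (c d : ∀ i, K i) : (∀ i, K i) ≃ (∀ i, K i) :=
  Equiv.piCongrRight fun i => if i ∈ S then Equiv.refl _ else Equiv.swap (c i) (d i)

theorem swapOff_apply_mem {S : Finset ι} {c d : ∀ i, K i} (e : ∀ i, K i) {i : ι} (hi : i ∈ S) :
    swapOff S c d e i = e i := by
  simp [swapOff, hi]

theorem swapOff_apply_notMem {S : Finset ι} {c d : ∀ i, K i} (e : ∀ i, K i) {i : ι} (hi : i ∉ S) :
    swapOff S c d e i = Equiv.swap (c i) (d i) (e i) := by
  simp [swapOff, hi]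

theorem swapOff_apply_of_eq {S : Finset ι} {c d e : ∀ i, K i} (h : ∀ i, i ∉ S → c i = e i) :
    swapOff S c d e = S.piecewise e d := by
  funext i
  by_cases hi : i ∈ S
  · simp [swapOff_apply_mem e hi, hi]
  · simp [swapOff_apply_notMem e hi, hi, h i hi]

/-- Transport of a sum over configurations that agree with `c` off `S` to one over configurations
that agree with `d` off `S`. -/
theorem sum_transport {S : Finset ι} {c d : ∀ i, K i} {F G : (∀ i, K i) → ℂ}
    (hF : ∀ e i, i ∉ S → c i ≠ e i → F e = 0) (hG : ∀ e i, i ∉ S → d i ≠ e i → G e = 0)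
    (h : ∀ e, (∀ i, i ∉ S → c i = e i) → F e = G (S.piecewise e d)) :
    ∑ e, F e = ∑ e, G e := by
  refine Fintype.sum_equiv (swapOff S c d) _ _ fun e => ?_
  by_cases he : ∀ i, i ∉ S → c i = e i
  · rw [swapOff_apply_of_eq he, h e he]
  · push Not at he
    obtain ⟨i, hi, hc⟩ := he
    rw [hF e i hi hc, hG _ i hi]
    rw [swapOff_apply_notMem e hi]
    intro h'
    apply hc
    have := congrArg (Equiv.swap (c i) (d i)) h'
    simpa using this

theorem SuppOn.mul {S : Finset ι} {A B : Matrix (∀ i, K i) (∀ i, K i) ℂ} (h : SuppOn S A)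
    (h' : SuppOn S B) : SuppOn S (A * B) := by
  intro i hi
  refine ⟨fun c c' hc => ?_, fun c c' k hc => ?_⟩
  · rw [Matrix.mul_apply]
    refine Finset.sum_eq_zero fun d _ => ?_
    by_cases hd : c i = d i
    · rw [(h' i hi).1 d c' (hd ▸ hc), mul_zero]
    · rw [(h i hi).1 c d hd, zero_mul]
  · rw [Matrix.mul_apply, Matrix.mul_apply]
    symm
    have hmem : ∀ j, j ∉ Finset.univ.erase i → j = i := by simp
    refine sum_transport (S := Finset.univ.erase i) (c := c) (d := Function.update c i k)
      (fun e j hj hc' => ?_) (fun e j hj hc' => ?_) fun e he => ?_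
    · obtain rfl := hmem j hj
      rw [(h j hi).1 _ _ hc', zero_mul]
    · obtain rfl := hmem j hj
      rw [(h j hi).1 _ _ hc', zero_mul]
    · have he' := he i (by simp)
      have : (Finset.univ.erase i).piecewise e (Function.update c i k) = Function.update e i k := by
        funext j
        by_cases hj : j = i
        · subst hj; simp
        · simp [hj]
      rw [this, (h i hi).2 _ _ _ he', (h' i hi).2 _ _ _ (he'.symm.trans hc)]

theorem SuppOn.listProd {S : Finset ι} {l : List (Matrix (∀ i, K i) (∀ i, K i) ℂ)}
    (h : ∀ A ∈ l, SuppOn S A) : SuppOn S l.prod := by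
  induction l with
  | nil => exact suppOn_one S
  | cons A l ih =>
    rw [List.prod_cons]
    exact (h A (by simp)).mul (ih fun B hB => h B (by simp [hB]))

/-- Operators with disjoint supports commute. -/
theorem SuppOn.commute {S T : Finset ι} {A B : Matrix (∀ i, K i) (∀ i, K i) ℂ} (h : SuppOn S A)
    (h' : SuppOn T B) (hST : Disjoint S T) : A * B = B * A := by
  -- With disjoint supports a single intermediate configuration contributes: it has already been
  -- changed on `S` and not yet elsewhere.
  have key : ∀ {S T : Finset ι} {A B : Matrix (∀ i, K i) (∀ i, K i) ℂ}, SuppOn S A → SuppOn T B →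
      Disjoint S T → ∀ c c', (A * B) c c' = A c (S.piecewise c' c) * B (S.piecewise c' c) c' := by
    intro S T A B h h' hST c c'
    rw [Matrix.mul_apply]
    refine Finset.sum_eq_single _ (fun d _ hd => ?_) (by simp)
    by_contra hne
    apply hd
    funext i
    by_cases hi : i ∈ S
    · have hT : i ∉ T := Finset.disjoint_left.1 hST hi
      simp [hi, h'.eq_of_ne_zero (right_ne_zero_of_mul hne) i hT]
    · simp [hi, h.eq_of_ne_zero (left_ne_zero_of_mul hne) i hi]
  ext c c'
  rw [key h h' hST, key h' h hST.symm]
  by_cases hc : ∀ i, i ∉ S → i ∉ T → c i = c' i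
  · rw [mul_comm]
    congr 1
    · refine h'.apply_eq ?_ ?_ ?_ ?_
      · intro i hi
        by_cases hS : i ∈ S <;> simp [hS]
        exact hc i hS hi
      · intro i hi
        simp [hi]
      · intro i hi
        have : i ∉ S := Finset.disjoint_right.1 hST hi
        simp [this]
      · intro i hi
        simp [hi]
    · refine h.apply_eq ?_ ?_ ?_ ?_
      · intro i hi
        simp [hi]
      · intro i hi
        by_cases hT : i ∈ T <;> simp [hT]
        exact hc i hi hT
      · intro i hi
        have : i ∉ T := Finset.disjoint_left.1 hST hi
        simp [this]
      · intro i hi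
        simp [hi]
  · push Not at hc
    obtain ⟨i, hS, hT, hne⟩ := hc
    rw [h'.eq_zero (c := S.piecewise c' c) hT (by simpa [hS] using hne),
      h.eq_zero (c := T.piecewise c' c) hS (by simpa [hT] using hne), mul_zero, mul_zero]

/-- Conjugation by a unitary that is disjoint from the support does nothing. -/
theorem SuppOn.conj_eq {S T : Finset ι} {A U : Matrix (∀ i, K i) (∀ i, K i) ℂ} (h : SuppOn S A)
    (hU : SuppOn T U) (hST : Disjoint S T) (hU' : U ∈ Matrix.unitaryGroup (∀ i, K i) ℂ) :
    Uᴴ * A * U = A := by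
  rw [mul_assoc, h.commute hU hST, ← mul_assoc]
  have : Uᴴ * U = 1 := Matrix.mem_unitaryGroup_iff'.1 hU'
  rw [this, one_mul]

/-- The action of an operator supported on `A` on the `A`-rows of a vector. -/
def cutMat (A : Finset ι) (ψ : (∀ i, K i) → ℂ) : Matrix (∀ i, K i) (∀ i, K i) ℂ :=
  fun c d => ψ (A.piecewise c d)

/-- Rows and columns of `cutMat` are indexed by full configurations, although only the part of the
row in `A` and that of the column off `A` matter. These duplicates do not affect ranks, and they let
an operator on `A` act by plain left multiplication. -/
theorem cutMat_mulVec {A : Finset ι} {O : Matrix (∀ i, K i) (∀ i, K i) ℂ} (h : SuppOn A O)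
    (ψ : (∀ i, K i) → ℂ) : cutMat A (O *ᵥ ψ) = O * cutMat A ψ := by
  ext c d
  rw [Matrix.mul_apply]
  simp only [cutMat, Matrix.mulVec, dotProduct]
  symm
  refine sum_transport (S := A) (c := c) (d := d) (fun e i hi hc => ?_) (fun e i hi hc => ?_)
    fun e he => ?_
  · rw [h.eq_zero hi hc, zero_mul]
  · rw [h.eq_zero hi (by simpa [hi] using hc), zero_mul]
  · congr 1
    refine h.apply_eq he ?_ ?_ ?_
    · intro i hi; simp [hi]
    · intro i hi; simp [hi]
    · intro i hi; simp [hi]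

theorem cutMat_compl (A : Finset ι) (ψ : (∀ i, K i) → ℂ) :
    cutMat Aᶜ ψ = (cutMat A ψ)ᵀ := by
  ext c d
  simp [cutMat, Finset.piecewise_compl]

end Support


/-! ### Product vectors and absence of correlations -/

section Products

variable {ι : Type} [Fintype ι] [DecidableEq ι] {K : ι → Type} [∀ i, Fintype (K i)]
  [∀ i, DecidableEq (K i)]

/-- The (unnormalized) expectation value `⟨ψ|O|ψ⟩`. -/
def expVal {n : Type} [Fintype n] (ψ : n → ℂ) (O : Matrix n n ℂ) : ℂ := star ψ ⬝ᵥ (O *ᵥ ψ)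

theorem expVal_one {n : Type} [Fintype n] [DecidableEq n] (ψ : n → ℂ) :
    expVal ψ 1 = star ψ ⬝ᵥ ψ := by simp [expVal]

theorem expVal_mulVec {n : Type} [Fintype n] (ψ : n → ℂ) (U O : Matrix n n ℂ) :
    expVal (U *ᵥ ψ) O = expVal ψ (Uᴴ * O * U) := by
  simp only [expVal, Matrix.star_mulVec, ← Matrix.dotProduct_mulVec, Matrix.mulVec_mulVec,
    mul_assoc]

/-- A vector of a region is represented by a function of full configurations that depends only on
that region. Tensor products are then pointwise products, and an operator passes through factors
that live elsewhere. -/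
theorem SuppOn.mulVec_mul {S : Finset ι} {A : Matrix (∀ i, K i) (∀ i, K i) ℂ} (h : SuppOn S A)
    {f φ : (∀ i, K i) → ℂ} (hφ : DependsOn φ (↑Sᶜ : Set ι)) :
    A *ᵥ (f * φ) = (A *ᵥ f) * φ := by
  funext c
  simp only [Matrix.mulVec, dotProduct, Pi.mul_apply, Finset.sum_mul]
  refine Finset.sum_congr rfl fun e _ => ?_
  by_cases hA : A c e = 0
  · simp [hA]
  · rw [hφ (x := e) (y := c), mul_assoc]
    intro i hi
    exact (h.eq_of_ne_zero hA i (by simpa using hi)).symm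

theorem SuppOn.mulVec_mul' {S : Finset ι} {A : Matrix (∀ i, K i) (∀ i, K i) ℂ} (h : SuppOn S A)
    {f φ : (∀ i, K i) → ℂ} (hf : DependsOn f (↑Sᶜ : Set ι)) :
    A *ᵥ (f * φ) = f * (A *ᵥ φ) := by
  rw [mul_comm, h.mulVec_mul hf, mul_comm]

theorem SuppOn.dependsOn_mulVec {S H : Finset ι} {A : Matrix (∀ i, K i) (∀ i, K i) ℂ}
    (h : SuppOn S A) (hS : S ⊆ H) {f : (∀ i, K i) → ℂ} (hf : DependsOn f (↑H : Set ι)) :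
    DependsOn (A *ᵥ f) (↑H : Set ι) := by
  intro c d hcd
  simp only [Matrix.mulVec, dotProduct]
  refine sum_transport (S := H) (c := c) (d := d) (fun e i hi hc => ?_) (fun e i hi hc => ?_)
    fun e he => ?_
  · rw [h.eq_zero (fun h' => hi (hS h')) hc, zero_mul]
  · rw [h.eq_zero (fun h' => hi (hS h')) hc, zero_mul]
  · congr 1
    · by_cases hH : ∀ i ∈ H, i ∉ S → c i = e i
      · refine h.apply_eq ?_ ?_ ?_ ?_
        · intro i hi
          by_cases hiH : i ∈ H
          · exact hH i hiH hi
          · exact he i hiH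
        · intro i hi
          by_cases hiH : i ∈ H
          · simp only [hiH, Finset.piecewise_eq_of_mem]
            rw [← hcd i (by simpa using hiH)]
            exact hH i hiH hi
          · simp [hiH]
        · intro i hi; exact hcd i (by simpa using hS hi)
        · intro i hi; simp [hS hi]
      · push Not at hH
        obtain ⟨i, hiH, hi, hne⟩ := hH
        rw [h.eq_zero hi hne, h.eq_zero hi]
        simp only [hiH, Finset.piecewise_eq_of_mem]
        rwa [← hcd i (by simpa using hiH)]
    · refine hf fun i hi => ?_
      have : i ∈ H := by simpa using hi
      simp [this]

/-- Exchanging the `H`-parts of two configurations. -/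
def exchange (H : Finset ι) : ((∀ i, K i) × (∀ i, K i)) ≃ ((∀ i, K i) × (∀ i, K i)) where
  toFun p := (H.piecewise p.1 p.2, H.piecewise p.2 p.1)
  invFun p := (H.piecewise p.1 p.2, H.piecewise p.2 p.1)
  left_inv p := by
    ext i <;> by_cases hi : i ∈ H <;> simp [hi]
  right_inv p := by
    ext i <;> by_cases hi : i ∈ H <;> simp [hi]

/-- Exchanging the `H`-parts permutes the pairs of configurations. This replaces splitting a sum
into sums over `H` and over its complement; the cardinality accounts for the two unused halves. -/
theorem card_mul_sum_eq (H : Finset ι) (F : (∀ i, K i) → ℂ) :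
    (Fintype.card (∀ i, K i) : ℂ) * ∑ c, F c = ∑ c, ∑ d, F (H.piecewise c d) := by
  have h1 : ∑ c, ∑ d, F (H.piecewise c d) = ∑ p : (∀ i, K i) × (∀ i, K i), F (exchange H p).1 := by
    rw [Fintype.sum_prod_type]
    rfl
  rw [h1, Equiv.sum_comp (exchange H) (fun p => F p.1), Fintype.sum_prod_type]
  simp [Finset.mul_sum]

theorem dependsOn_piecewise_left {H : Finset ι} {f : (∀ i, K i) → ℂ}
    (hf : DependsOn f (↑H : Set ι)) (c d : ∀ i, K i) : f (H.piecewise c d) = f c :=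
  hf fun i hi => by
    have : i ∈ H := by simpa using hi
    simp [this]

theorem dependsOn_piecewise_right {H : Finset ι} {f : (∀ i, K i) → ℂ}
    (hf : DependsOn f (↑Hᶜ : Set ι)) (c d : ∀ i, K i) : f (H.piecewise c d) = f d :=
  hf fun i hi => by
    have : i ∉ H := by simpa using hi
    simp [this]

theorem card_mul_sum_mul {H : Finset ι} {f g : (∀ i, K i) → ℂ} (hf : DependsOn f (↑H : Set ι))
    (hg : DependsOn g (↑Hᶜ : Set ι)) :
    (Fintype.card (∀ i, K i) : ℂ) * ∑ c, f c * g c = (∑ c, f c) * ∑ c, g c := by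
  rw [card_mul_sum_eq H, Finset.sum_mul_sum]
  simp only [dependsOn_piecewise_left hf, dependsOn_piecewise_right hg]

theorem DependsOn.mul' {s : Set ι} {f g : (∀ i, K i) → ℂ} (hf : DependsOn f s)
    (hg : DependsOn g s) : DependsOn (f * g) s := fun x y h => by
  simp [hf h, hg h]

theorem DependsOn.star' {s : Set ι} {f : (∀ i, K i) → ℂ} (hf : DependsOn f s) :
    DependsOn (star f) s := fun x y h => by
  simp [hf h]

theorem dotProduct_mul_mul {H : Finset ι} {f f' g g' : (∀ i, K i) → ℂ}
    (hf : DependsOn f (↑H : Set ι)) (hf' : DependsOn f' (↑H : Set ι))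
    (hg : DependsOn g (↑Hᶜ : Set ι)) (hg' : DependsOn g' (↑Hᶜ : Set ι)) :
    (Fintype.card (∀ i, K i) : ℂ) * (star (f * g) ⬝ᵥ (f' * g')) = (star f ⬝ᵥ f') * (star g ⬝ᵥ g') := by
  have := card_mul_sum_mul (hf.star'.mul' hf') (hg.star'.mul' hg')
  simp only [dotProduct] at this ⊢
  simp only [Pi.mul_apply] at this
  rw [← this]
  congr 1
  refine Finset.sum_congr rfl fun c _ => ?_
  simp
  ring

/-- `ψ` has no correlations between the regions `A` and `B`. -/
def Uncorr (A B : Finset ι) (ψ : (∀ i, K i) → ℂ) : Prop :=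
  ∀ O O' : Matrix (∀ i, K i) (∀ i, K i) ℂ, SuppOn A O → SuppOn B O' →
    expVal ψ (O * O') * (star ψ ⬝ᵥ ψ) = expVal ψ O * expVal ψ O'

theorem Uncorr.mono {A B A' B' : Finset ι} {ψ : (∀ i, K i) → ℂ} (h : Uncorr A B ψ) (hA : A' ⊆ A)
    (hB : B' ⊆ B) : Uncorr A' B' ψ :=
  fun O O' hO hO' => h O O' (hO.mono hA) (hO'.mono hB)

theorem Uncorr.symm {A B : Finset ι} {ψ : (∀ i, K i) → ℂ} (h : Uncorr A B ψ)
    (hAB : Disjoint A B) : Uncorr B A ψ := fun O O' hO hO' => by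
  rw [hO.commute hO' hAB.symm, h O' O hO' hO, mul_comm]

/-- `ψ` is a product of a state of the region `H` and one of its complement. -/
def IsProductAcross (H : Finset ι) (ψ : (∀ i, K i) → ℂ) : Prop :=
  ∃ f g : (∀ i, K i) → ℂ, DependsOn f (↑H : Set ι) ∧ DependsOn g (↑Hᶜ : Set ι) ∧ ψ = f * g

theorem IsProductAcross.compl {H : Finset ι} {ψ : (∀ i, K i) → ℂ} (h : IsProductAcross H ψ) :
    IsProductAcross Hᶜ ψ := by
  obtain ⟨f, g, hf, hg, rfl⟩ := h
  exact ⟨g, f, hg, by simpa using hf, mul_comm _ _⟩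

theorem SuppOn.mulVec_product {H S T : Finset ι} {A B : Matrix (∀ i, K i) (∀ i, K i) ℂ}
    (hA : SuppOn S A) (hB : SuppOn T B) (hS : S ⊆ H) (hT : Disjoint H T)
    {f g : (∀ i, K i) → ℂ} (hf : DependsOn f (↑H : Set ι)) (hg : DependsOn g (↑Hᶜ : Set ι)) :
    (A * B) *ᵥ (f * g) = (A *ᵥ f) * (B *ᵥ g) := by
  have hT' : T ⊆ Hᶜ := fun i hi => by simpa using Finset.disjoint_right.1 hT hi
  have hB' := hB.dependsOn_mulVec hT' hg
  rw [← Matrix.mulVec_mulVec, hB.mulVec_mul', hA.mulVec_mul]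
  · refine DependsOn.mono ?_ hB'
    simpa using hS
  · refine DependsOn.mono ?_ hf
    intro i hi
    simpa using Finset.disjoint_left.1 hT (by simpa using hi)

theorem IsProductAcross.mulVec {H S T : Finset ι} {A B : Matrix (∀ i, K i) (∀ i, K i) ℂ}
    (hA : SuppOn S A) (hB : SuppOn T B) (hS : S ⊆ H) (hT : Disjoint H T)
    {ψ : (∀ i, K i) → ℂ} (h : IsProductAcross H ψ) : IsProductAcross H ((A * B) *ᵥ ψ) := by
  obtain ⟨f, g, hf, hg, rfl⟩ := h
  have hT' : T ⊆ Hᶜ := fun i hi => by simpa using Finset.disjoint_right.1 hT hi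
  exact ⟨_, _, hA.dependsOn_mulVec hS hf, hB.dependsOn_mulVec hT' hg,
    hA.mulVec_product hB hS hT hf hg⟩

theorem card_conf_ne_zero {ψ : (∀ i, K i) → ℂ} (hψ : ψ ≠ 0) :
    (Fintype.card (∀ i, K i) : ℂ) ≠ 0 := by
  obtain ⟨c, _⟩ := Function.ne_iff.1 hψ
  have : Nonempty (∀ i, K i) := ⟨c⟩
  exact_mod_cast Fintype.card_ne_zero

theorem dotProduct_star_self_ne_zero {n : Type} [Fintype n] {ψ : n → ℂ} (hψ : ψ ≠ 0) :
    star ψ ⬝ᵥ ψ ≠ 0 := by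
  rw [Ne, dotProduct_star_self_eq_zero]
  exact hψ

theorem IsProductAcross.uncorr {H A B : Finset ι} {ψ : (∀ i, K i) → ℂ}
    (h : IsProductAcross H ψ) (hA : A ⊆ H) (hB : Disjoint H B) : Uncorr A B ψ := by
  intro O O' hO hO'
  by_cases hψ : ψ = 0
  · simp [hψ, expVal]
  have hN := card_conf_ne_zero hψ
  obtain ⟨f, g, hf, hg, rfl⟩ := h
  have hB' : B ⊆ Hᶜ := fun i hi => by simpa using Finset.disjoint_right.1 hB hi
  have hOf := hO.dependsOn_mulVec hA hf
  have hOg := hO'.dependsOn_mulVec hB' hg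
  have e1 : expVal (f * g) (O * O') = star (f * g) ⬝ᵥ ((O *ᵥ f) * (O' *ᵥ g)) := by
    rw [expVal, hO.mulVec_product hO' hA hB hf hg]
  have e2 : expVal (f * g) O = star (f * g) ⬝ᵥ ((O *ᵥ f) * g) := by
    rw [expVal, hO.mulVec_mul]
    refine DependsOn.mono ?_ hg
    simpa using hA
  have e3 : expVal (f * g) O' = star (f * g) ⬝ᵥ (f * (O' *ᵥ g)) := by
    rw [expVal, hO'.mulVec_mul']
    refine DependsOn.mono ?_ hf
    intro i hi
    simpa using Finset.disjoint_left.1 hB (by simpa using hi)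
  rw [e1, e2, e3]
  have k1 := dotProduct_mul_mul hf hOf hg hOg
  have k2 := dotProduct_mul_mul hf hOf hg hg
  have k3 := dotProduct_mul_mul hf hf hg hOg
  have k0 := dotProduct_mul_mul hf hf hg hg
  apply mul_left_cancel₀ (mul_ne_zero hN hN)
  calc _ = ((Fintype.card (∀ i, K i) : ℂ) * (star (f * g) ⬝ᵥ (O *ᵥ f * O' *ᵥ g))) *
        ((Fintype.card (∀ i, K i) : ℂ) * (star (f * g) ⬝ᵥ (f * g))) := by ring
    _ = ((Fintype.card (∀ i, K i) : ℂ) * (star (f * g) ⬝ᵥ (O *ᵥ f * g))) *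
        ((Fintype.card (∀ i, K i) : ℂ) * (star (f * g) ⬝ᵥ (f * O' *ᵥ g))) := by
      rw [k0, k1, k2, k3]; ring
    _ = _ := by ring

end Products


/-! ### Schmidt ranks and reduced density matrices -/

section Rank

/-- The matrix factors through its range. The one-sided inverses are kept because they permit
cancelling either factor later on. -/
theorem Matrix.exists_rank_factorization {m n : Type} [Fintype m] [Fintype n] [DecidableEq m]
    [DecidableEq n] (A : Matrix m n ℂ) :
    ∃ (C : Matrix m (Fin A.rank) ℂ) (R : Matrix (Fin A.rank) n ℂ)
      (L : Matrix (Fin A.rank) m ℂ) (S : Matrix n (Fin A.rank) ℂ),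
      A = C * R ∧ L * C = 1 ∧ R * S = 1 := by
  let f := A.mulVecLin
  let V := LinearMap.range f
  have hV : Module.finrank ℂ V = A.rank := rfl
  let b : V ≃ₗ[ℂ] (Fin A.rank → ℂ) := (Module.finBasisOfFinrankEq ℂ V hV).equivFun
  let r : (n → ℂ) →ₗ[ℂ] (Fin A.rank → ℂ) := b.toLinearMap ∘ₗ f.rangeRestrict
  let i : (Fin A.rank → ℂ) →ₗ[ℂ] (m → ℂ) := V.subtype ∘ₗ b.symm.toLinearMap
  have hir : i ∘ₗ r = f := by
    ext x
    simp [i, r]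
  have hr : Function.Surjective r := b.surjective.comp f.surjective_rangeRestrict
  have hi : Function.Injective i := V.injective_subtype.comp b.symm.injective
  obtain ⟨l, hl⟩ := LinearMap.exists_leftInverse_of_injective i (LinearMap.ker_eq_bot.2 hi)
  obtain ⟨s, hs⟩ := LinearMap.exists_rightInverse_of_surjective r (LinearMap.range_eq_top.2 hr)
  refine ⟨i.toMatrix', r.toMatrix', l.toMatrix', s.toMatrix', ?_, ?_, ?_⟩
  · rw [← LinearMap.toMatrix'_comp, hir]
    exact (LinearMap.toMatrix'_toLin' A).symm
  · rw [← LinearMap.toMatrix'_comp, hl, LinearMap.toMatrix'_id]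
  · rw [← LinearMap.toMatrix'_comp, hs, LinearMap.toMatrix'_id]

/-- A factorization through a space of dimension equal to the product of the ranks gives the upper
bound; the one-sided inverses turn the Kronecker product into an identity matrix of that size, which
gives the lower bound. -/
theorem Matrix.rank_kronecker {m n m' n' : Type} [Fintype m] [Fintype n] [DecidableEq m]
    [DecidableEq n] [Fintype m'] [Fintype n'] [DecidableEq m'] [DecidableEq n']
    (A : Matrix m n ℂ) (B : Matrix m' n' ℂ) : (A ⊗ₖ B).rank = A.rank * B.rank := by
  obtain ⟨C, R, L, S, hA, hL, hS⟩ := A.exists_rank_factorization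
  obtain ⟨C', R', L', S', hB, hL', hS'⟩ := B.exists_rank_factorization
  have h : A ⊗ₖ B = (C ⊗ₖ C') * (R ⊗ₖ R') := by
    rw [← Matrix.mul_kronecker_mul, ← hA, ← hB]
  have h1 : (L ⊗ₖ L') * (A ⊗ₖ B) * (S ⊗ₖ S') = 1 := by
    have e : L * A * S = 1 := by
      have := congrArg (fun X => L * X * S) hA
      rwa [← Matrix.mul_assoc L, hL, Matrix.one_mul, hS] at this
    have e' : L' * B * S' = 1 := by
      have := congrArg (fun X => L' * X * S') hB
      rwa [← Matrix.mul_assoc L', hL', Matrix.one_mul, hS'] at this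
    rw [← Matrix.mul_kronecker_mul, ← Matrix.mul_kronecker_mul, e, e', Matrix.one_kronecker_one]
  apply le_antisymm
  · rw [h]
    refine (Matrix.rank_mul_le_left _ _).trans ((Matrix.rank_le_card_width _).trans ?_)
    simp
  · have h2 := congrArg Matrix.rank h1
    rw [Matrix.rank_one] at h2
    have h3 := (Matrix.rank_mul_le_left ((L ⊗ₖ L') * (A ⊗ₖ B)) (S ⊗ₖ S')).trans
      (Matrix.rank_mul_le_right _ _)
    rw [h2] at h3
    simpa using h3

theorem Matrix.rank_smul_of_ne_zero {m n : Type} [Fintype m] [Fintype n] {z : ℂ} (hz : z ≠ 0)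
    (A : Matrix m n ℂ) : (z • A).rank = A.rank :=
  Matrix.rank_smul_of_mem_nonZeroDivisors A (mem_nonZeroDivisors_of_ne_zero hz)

theorem Matrix.exists_eq_mul_of_rank_le_one {m n : Type} [Fintype m] [Fintype n] [DecidableEq m]
    [DecidableEq n] {A : Matrix m n ℂ} (h : A.rank ≤ 1) :
    ∃ (u : m → ℂ) (v : n → ℂ), ∀ i j, A i j = u i * v j := by
  obtain ⟨C, R, -, -, hA, -, -⟩ := A.exists_rank_factorization
  rcases Nat.lt_or_ge A.rank 1 with h0 | h1
  · refine ⟨0, 0, fun i j => ?_⟩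
    have : IsEmpty (Fin A.rank) := by
      rw [Nat.lt_one_iff.1 h0]; infer_instance
    rw [hA, Matrix.mul_apply]
    simp
  · have h2 : A.rank = 1 := le_antisymm h h1
    refine ⟨fun i => C i ⟨0, h1⟩, fun j => R ⟨0, h1⟩ j, fun i j => ?_⟩
    conv_lhs => rw [hA]
    rw [Matrix.mul_apply]
    refine Finset.sum_eq_single _ (fun k _ hk => ?_) (by simp)
    exact absurd (Fin.ext (by have := k.2; omega)) hk

variable {ι : Type} [Fintype ι] [DecidableEq ι] {K : ι → Type} [∀ i, Fintype (K i)]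
  [∀ i, DecidableEq (K i)]

/-- The Schmidt rank of `ψ` across the cut between `A` and its complement. -/
noncomputable def srank (A : Finset ι) (ψ : (∀ i, K i) → ℂ) : ℕ := (cutMat A ψ).rank

theorem srank_compl (A : Finset ι) (ψ : (∀ i, K i) → ℂ) : srank Aᶜ ψ = srank A ψ := by
  rw [srank, cutMat_compl, Matrix.rank_transpose, srank]

theorem srank_mulVec_le {A : Finset ι} {O : Matrix (∀ i, K i) (∀ i, K i) ℂ} (h : SuppOn A O)
    (ψ : (∀ i, K i) → ℂ) : srank A (O *ᵥ ψ) ≤ srank A ψ := by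
  rw [srank, cutMat_mulVec h]
  exact Matrix.rank_mul_le_right _ _

theorem srank_unitary {A : Finset ι} {O : Matrix (∀ i, K i) (∀ i, K i) ℂ} (h : SuppOn A O)
    (hO : O ∈ Matrix.unitaryGroup (∀ i, K i) ℂ) (ψ : (∀ i, K i) → ℂ) :
    srank A (O *ᵥ ψ) = srank A ψ := by
  refine le_antisymm (srank_mulVec_le h ψ) ?_
  have := srank_mulVec_le h.conjTranspose (O *ᵥ ψ)
  rwa [Matrix.mulVec_mulVec, ← Matrix.star_eq_conjTranspose, Matrix.mem_unitaryGroup_iff'.1 hO,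
    Matrix.one_mulVec] at this

theorem srank_unitary_of_disjoint {A S : Finset ι} {O : Matrix (∀ i, K i) (∀ i, K i) ℂ}
    (h : SuppOn S O) (hS : Disjoint A S) (hO : O ∈ Matrix.unitaryGroup (∀ i, K i) ℂ)
    (ψ : (∀ i, K i) → ℂ) : srank A (O *ᵥ ψ) = srank A ψ := by
  rw [← srank_compl A, ← srank_compl A]
  exact srank_unitary (h.mono fun i hi => by simpa using Finset.disjoint_right.1 hS hi) hO ψ

theorem srank_ne_zero {ψ : (∀ i, K i) → ℂ} (hψ : ψ ≠ 0) (A : Finset ι) : srank A ψ ≠ 0 := by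
  intro h
  obtain ⟨C, R, -, -, hA, -, -⟩ := (cutMat A ψ).exists_rank_factorization
  have : IsEmpty (Fin (cutMat A ψ).rank) := by
    have h' : (cutMat A ψ).rank = 0 := h
    rw [h']; infer_instance
  apply hψ
  funext c
  have h1 : cutMat A ψ c c = 0 := by
    conv_lhs => rw [hA]
    rw [Matrix.mul_apply]
    simp
  rwa [cutMat, Finset.piecewise_same] at h1

/-- The two factors are `ψ` with one side frozen at a configuration `c₀` where `ψ` does not vanish,
divided once by `ψ c₀`. -/
theorem isProductAcross_of_srank_le_one {A : Finset ι} {ψ : (∀ i, K i) → ℂ}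
    (h : srank A ψ ≤ 1) : IsProductAcross A ψ := by
  by_cases hψ : ψ = 0
  · exact ⟨0, 0, fun _ _ _ => rfl, fun _ _ _ => rfl, by simp [hψ]⟩
  obtain ⟨c₀, hc₀⟩ := Function.ne_iff.1 hψ
  obtain ⟨u, v, huv⟩ := Matrix.exists_eq_mul_of_rank_le_one h
  refine ⟨fun c => ψ (A.piecewise c c₀), fun c => ψ (A.piecewise c₀ c) / ψ c₀, ?_, ?_, ?_⟩
  · intro c d hcd
    simp only
    congr 1
    exact Finset.piecewise_congr _ (fun i hi => hcd i (by simpa using hi)) fun _ _ => rfl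
  · intro c d hcd
    simp only
    congr 2
    exact Finset.piecewise_congr _ (fun _ _ => rfl) fun i hi => hcd i (by simpa using hi)
  · funext c
    have e : ∀ c d, ψ (A.piecewise c d) = u c * v d := huv
    have e1 : ψ c = u c * v c := by rw [← e, Finset.piecewise_same]
    have e2 : ψ c₀ = u c₀ * v c₀ := by rw [← e, Finset.piecewise_same]
    have hc : ψ c₀ ≠ 0 := hc₀
    simp only [Pi.mul_apply]
    rw [e, e, e1]
    rw [e2] at hc ⊢
    have hu := left_ne_zero_of_mul hc
    have hv := right_ne_zero_of_mul hc
    field_simp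

theorem srank_of_isProductAcross {A : Finset ι} {ψ : (∀ i, K i) → ℂ} (hψ : ψ ≠ 0)
    (h : IsProductAcross A ψ) : srank A ψ = 1 := by
  refine le_antisymm ?_ (Nat.one_le_iff_ne_zero.2 (srank_ne_zero hψ A))
  obtain ⟨f, g, hf, hg, rfl⟩ := h
  have : cutMat A (f * g) = Matrix.vecMulVec f g := by
    ext c d
    simp [cutMat, Matrix.vecMulVec_apply, dependsOn_piecewise_left hf, dependsOn_piecewise_right hg]
  rw [srank, this]
  exact Matrix.rank_vecMulVec_le _ _

/-- The reduced density matrix of `ψ` on `A`, up to normalization. -/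
def redMat (A : Finset ι) (ψ : (∀ i, K i) → ℂ) : Matrix (∀ i, K i) (∀ i, K i) ℂ :=
  cutMat A ψ * (cutMat A ψ)ᴴ

theorem rank_redMat (A : Finset ι) (ψ : (∀ i, K i) → ℂ) : (redMat A ψ).rank = srank A ψ :=
  Matrix.rank_self_mul_conjTranspose _

/-- The matrix unit `|a⟩⟨b| ⊗ 1`, with `|a⟩⟨b|` acting on the region `A`. -/
def matUnit (A : Finset ι) (a b : ∀ i, K i) : Matrix (∀ i, K i) (∀ i, K i) ℂ :=
  fun c c' => if (∀ i ∈ A, c i = a i ∧ c' i = b i) ∧ ∀ i, i ∉ A → c i = c' i then 1 else 0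

theorem suppOn_matUnit (A : Finset ι) (a b : ∀ i, K i) : SuppOn A (matUnit A a b) := by
  intro i hi
  refine ⟨fun c c' hc => if_neg fun h => hc (h.2 i hi), fun c c' k hc => ?_⟩
  unfold matUnit
  congr 1
  rw [eq_iff_iff]
  have h1 : ∀ j ∈ A, j ≠ i := fun j hj h => hi (h ▸ hj)
  constructor
  · rintro ⟨h, h'⟩
    refine ⟨fun j hj => by simpa [h1 j hj] using h j hj, fun j hj => ?_⟩
    by_cases hji : j = i
    · subst hji; exact hc
    · simpa [hji] using h' j hj
  · rintro ⟨h, h'⟩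
    refine ⟨fun j hj => by simpa [h1 j hj] using h j hj, fun j hj => ?_⟩
    by_cases hji : j = i
    · subst hji; simp
    · simpa [hji] using h' j hj

theorem matUnit_mulVec (A : Finset ι) (a b : ∀ i, K i) (ψ : (∀ i, K i) → ℂ) (c : ∀ i, K i) :
    (matUnit A a b *ᵥ ψ) c = if ∀ i ∈ A, c i = a i then ψ (A.piecewise b c) else 0 := by
  simp only [Matrix.mulVec, dotProduct]
  rw [Finset.sum_eq_single (A.piecewise b c)]
  · unfold matUnit
    by_cases h : ∀ i ∈ A, c i = a i
    · rw [if_pos h, if_pos, one_mul]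
      refine ⟨fun i hi => ⟨h i hi, by simp [hi]⟩, fun i hi => by simp [hi]⟩
    · rw [if_neg h, if_neg, zero_mul]
      exact fun h' => h fun i hi => (h'.1 i hi).1
  · intro d _ hd
    rw [matUnit, if_neg, zero_mul]
    rintro ⟨h, h'⟩
    apply hd
    funext i
    by_cases hi : i ∈ A
    · simp [hi, (h i hi).2]
    · simp [hi, h' i hi]
  · simp

theorem matUnit_mul_disjoint {A B : Finset ι} (hAB : Disjoint A B) (a b : ∀ i, K i) :
    matUnit A a b * matUnit B a b = matUnit (A ∪ B) a b := by
  apply Matrix.ext_of_mulVec_single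
  intro d
  rw [← Matrix.mulVec_mulVec]
  funext c
  rw [matUnit_mulVec, matUnit_mulVec, matUnit_mulVec]
  have h1 : (∀ i ∈ B, A.piecewise b c i = a i) ↔ ∀ i ∈ B, c i = a i :=
    forall₂_congr fun i hi => by simp [Finset.disjoint_right.1 hAB hi]
  have h2 : B.piecewise b (A.piecewise b c) = (A ∪ B).piecewise b c := by
    funext i
    by_cases hA : i ∈ A <;> by_cases hB : i ∈ B <;> simp [hA, hB]
  simp only [h1, h2, Finset.mem_union, or_imp, forall_and]
  split_ifs <;> tauto

theorem card_filter_agree (A : Finset ι) (c c' : ∀ i, K i) :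
    (Finset.univ.filter fun e : ∀ i, K i => ∀ i ∈ A, e i = c i).card =
      (Finset.univ.filter fun e : ∀ i, K i => ∀ i ∈ A, e i = c' i).card := by
  have key : ∀ c c' : ∀ i, K i,
      (Finset.univ.filter fun e : ∀ i, K i => ∀ i ∈ A, e i = c i).card ≤
        (Finset.univ.filter fun e : ∀ i, K i => ∀ i ∈ A, e i = c' i).card := by
    intro c c'
    refine Finset.card_le_card_of_injOn (fun e => A.piecewise c' e) ?_ ?_
    · intro e _
      simp only [Finset.coe_filter, Finset.mem_univ, true_and, Set.mem_ofPred_eq]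
      intro i hi
      simp [hi]
    · intro e he e' he' h
      simp only [Finset.coe_filter, Finset.mem_univ, true_and, Set.mem_ofPred_eq] at he he'
      funext i
      by_cases hi : i ∈ A
      · rw [he i hi, he' i hi]
      · simpa [hi] using congrFun h i
  exact le_antisymm (key c c') (key c' c)

theorem card_mul_sum_filter (A : Finset ι) (c : ∀ i, K i) (F : (∀ i, K i) → ℂ) :
    (Fintype.card (∀ i, K i) : ℂ) * (∑ e, if ∀ i ∈ A, e i = c i then F e else 0) =
      ((Finset.univ.filter fun e : ∀ i, K i => ∀ i ∈ A, e i = c i).card : ℂ) *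
        ∑ d, F (A.piecewise c d) := by
  rw [card_mul_sum_eq A, Finset.card_filter]
  push_cast
  rw [Finset.sum_mul]
  refine Finset.sum_congr rfl fun e _ => ?_
  have h1 : ∀ d, (∀ i ∈ A, A.piecewise e d i = c i) ↔ ∀ i ∈ A, e i = c i := fun d =>
    forall₂_congr fun i hi => by simp [hi]
  simp only [h1]
  by_cases h : ∀ i ∈ A, e i = c i
  · simp only [if_pos h, one_mul]
    refine Finset.sum_congr rfl fun d _ => ?_
    congr 1
    exact Finset.piecewise_congr _ h fun _ _ => rfl
  · simp [if_neg h]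

/-- Entries of the reduced density matrix are expectation values of matrix units. The two
cardinalities count the configurations that are summed redundantly on either side. -/
theorem redMat_apply (A : Finset ι) (ψ : (∀ i, K i) → ℂ) (c c' : ∀ i, K i) :
    ((Finset.univ.filter fun e : ∀ i, K i => ∀ i ∈ A, e i = c' i).card : ℂ) * redMat A ψ c c' =
      (Fintype.card (∀ i, K i) : ℂ) * expVal ψ (matUnit A c' c) := by
  have h := card_mul_sum_filter A c' (fun e => star (ψ e) * ψ (A.piecewise c e))
  have h1 : expVal ψ (matUnit A c' c) =
      ∑ e, if ∀ i ∈ A, e i = c' i then star (ψ e) * ψ (A.piecewise c e) else 0 := by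
    simp only [expVal, dotProduct, matUnit_mulVec, Pi.star_apply]
    refine Finset.sum_congr rfl fun e _ => ?_
    split_ifs <;> simp
  rw [h1, h]
  congr 1
  rw [redMat, Matrix.mul_apply]
  refine Finset.sum_congr rfl fun d _ => ?_
  have : A.piecewise c (A.piecewise c' d) = A.piecewise c d := by
    funext i
    by_cases hi : i ∈ A <;> simp [hi]
  simp [cutMat, this, mul_comm]

/-- As `F` sees only `A` and `G` only `B`, the entrywise product is a submatrix of the Kronecker
product (the diagonal one), and conversely the Kronecker product is a submatrix of the entrywise
product, by gluing two configurations along `A`. -/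
theorem rank_hadamard {A B : Finset ι} (hAB : Disjoint A B)
    {F G : Matrix (∀ i, K i) (∀ i, K i) ℂ}
    (hF : ∀ c c' d d', (∀ i ∈ A, c i = d i) → (∀ i ∈ A, c' i = d' i) → F c c' = F d d')
    (hG : ∀ c c' d d', (∀ i ∈ B, c i = d i) → (∀ i ∈ B, c' i = d' i) → G c c' = G d d') :
    (Matrix.of fun c c' => F c c' * G c c').rank = F.rank * G.rank := by
  rw [← Matrix.rank_kronecker]
  apply le_antisymm
  · have : (Matrix.of fun c c' => F c c' * G c c') =
        (F ⊗ₖ G).submatrix (fun c => (c, c)) (fun c => (c, c)) := by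
      ext c c'
      simp
    rw [this]
    exact Matrix.rank_submatrix_le _ _ _
  · have : F ⊗ₖ G = (Matrix.of fun c c' => F c c' * G c c').submatrix
        (fun p => A.piecewise p.1 p.2) (fun p => A.piecewise p.1 p.2) := by
      ext p q
      simp only [Matrix.kroneckerMap_apply, Matrix.submatrix_apply, Matrix.of_apply]
      congr 1
      · apply hF <;> intro i hi <;> simp [hi]
      · apply hG <;> intro i hi <;> simp [Finset.disjoint_right.1 hAB hi]
    rw [this]
    exact Matrix.rank_submatrix_le _ _ _

theorem redMat_congr (A : Finset ι) (ψ : (∀ i, K i) → ℂ) {c c' d d' : ∀ i, K i}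
    (h : ∀ i ∈ A, c i = d i) (h' : ∀ i ∈ A, c' i = d' i) : redMat A ψ c c' = redMat A ψ d d' := by
  simp only [redMat, Matrix.mul_apply, cutMat, Matrix.conjTranspose_apply]
  refine Finset.sum_congr rfl fun e _ => ?_
  rw [A.piecewise_congr h fun _ _ => rfl, A.piecewise_congr h' fun _ _ => rfl]

/-- Without correlations the reduced density matrix of the union is, up to a scalar, the product of
the two reduced density matrices, so ranks multiply. Together with the equality of the ranks of a
region and of its complement, this is the tool for all later rank counts. -/
theorem srank_union {A B : Finset ι} (hAB : Disjoint A B) {ψ : (∀ i, K i) → ℂ} (hψ : ψ ≠ 0)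
    (h : Uncorr A B ψ) : srank (A ∪ B) ψ = srank A ψ * srank B ψ := by
  obtain ⟨c₀, _⟩ := Function.ne_iff.1 hψ
  have hN := card_conf_ne_zero hψ
  have hn : ∀ A : Finset ι,
      ((Finset.univ.filter fun e : ∀ i, K i => ∀ i ∈ A, e i = c₀ i).card : ℂ) ≠ 0 := by
    intro A
    rw [Nat.cast_ne_zero, Finset.card_ne_zero]
    exact ⟨c₀, by simp⟩
  have hp := dotProduct_star_self_ne_zero hψ
  have hr : ∀ (A : Finset ι) (c c' : ∀ i, K i), expVal ψ (matUnit A c' c) =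
      ((Finset.univ.filter fun e : ∀ i, K i => ∀ i ∈ A, e i = c₀ i).card : ℂ) *
        redMat A ψ c c' / (Fintype.card (∀ i, K i) : ℂ) := by
    intro A c c'
    rw [eq_div_iff hN, card_filter_agree A c₀ c', redMat_apply, mul_comm]
  set n : Finset ι → ℂ :=
    fun A => ((Finset.univ.filter fun e : ∀ i, K i => ∀ i ∈ A, e i = c₀ i).card : ℂ) with hn_def
  have key : redMat (A ∪ B) ψ = (n A * n B / (Fintype.card (∀ i, K i) : ℂ) / n (A ∪ B) /
      (star ψ ⬝ᵥ ψ)) • Matrix.of fun c c' => redMat A ψ c c' * redMat B ψ c c' := by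
    ext c c'
    have h1 := h _ _ (suppOn_matUnit A c' c) (suppOn_matUnit B c' c)
    rw [matUnit_mul_disjoint hAB, hr, hr, hr] at h1
    have hA := hn A
    have hB := hn B
    have hC := hn (A ∪ B)
    simp only [Matrix.smul_apply, Matrix.of_apply, smul_eq_mul]
    change n A ≠ 0 at hA
    change n B ≠ 0 at hB
    change n (A ∪ B) ≠ 0 at hC
    field_simp at h1 ⊢
    linear_combination h1
  rw [← rank_redMat, key, Matrix.rank_smul_of_ne_zero, rank_hadamard hAB, rank_redMat, rank_redMat]
  · exact fun c c' d d' => redMat_congr A ψ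
  · exact fun c c' d d' => redMat_congr B ψ
  · exact div_ne_zero (div_ne_zero (div_ne_zero (mul_ne_zero (hn A) (hn B)) hN) (hn _)) hp

end Rank


/-! ### Slicing operators along a region -/

section Slices

variable {ι : Type} [Fintype ι] [DecidableEq ι] {K : ι → Type} [∀ i, Fintype (K i)]
  [∀ i, DecidableEq (K i)]

theorem expVal_smul {n : Type} [Fintype n] (z : ℂ) (ψ : n → ℂ) (O : Matrix n n ℂ) :
    expVal (z • ψ) O = star z * z * expVal ψ O := by
  simp only [expVal, Matrix.mulVec_smul, star_smul, smul_dotProduct, dotProduct_smul, smul_eq_mul]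
  ring

/-- The operator on the region `A` obtained from `T` by fixing the outgoing configuration `β` off
`A` and feeding the vector `φ` into the input off `A`. -/
def slice (A : Finset ι) (T : Matrix (∀ i, K i) (∀ i, K i) ℂ) (φ : (∀ i, K i) → ℂ)
    (β : ∀ i, K i) : Matrix (∀ i, K i) (∀ i, K i) ℂ := fun c c' =>
  if ∀ i, i ∉ A → c i = c' i then
    ∑ e, if ∀ i ∈ A, e i = c' i then T (A.piecewise c β) e * φ e else 0
  else 0

theorem suppOn_slice {A S : Finset ι} {T : Matrix (∀ i, K i) (∀ i, K i) ℂ} (hT : SuppOn S T)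
    {φ : (∀ i, K i) → ℂ} (hφ : DependsOn φ (↑Aᶜ : Set ι)) (β : ∀ i, K i) :
    SuppOn (S ∩ A) (slice A T φ β) := by
  intro i hi
  by_cases hA : i ∈ A
  · have hS : i ∉ S := fun h => hi (Finset.mem_inter.2 ⟨h, hA⟩)
    refine ⟨fun c c' hc => ?_, fun c c' k hc => ?_⟩
    · unfold slice
      split_ifs with h
      · refine Finset.sum_eq_zero fun e _ => ?_
        split_ifs with he
        · rw [hT.eq_zero hS, zero_mul]
          simpa [hA, he i hA] using hc
        · rfl
      · rfl
    · unfold slice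
      have e1 : (∀ j, j ∉ A → Function.update c i k j = Function.update c' i k j) ↔
          ∀ j, j ∉ A → c j = c' j := by
        refine forall₂_congr fun j hj => ?_
        have : j ≠ i := fun h => hj (h ▸ hA)
        simp [this]
      simp only [e1]
      congr 1
      symm
      refine sum_transport (S := Finset.univ.erase i) (c := c') (d := Function.update c' i k)
        (fun e j hj hc' => ?_) (fun e j hj hc' => ?_) fun e he => ?_
      · obtain rfl : j = i := by simpa using hj
        rw [if_neg]
        exact fun h => hc' (h j hA).symm
      · obtain rfl : j = i := by simpa using hj
        rw [if_neg]
        exact fun h => hc' (h j hA).symm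
      · have he' := he i (by simp)
        have e2 : (Finset.univ.erase i).piecewise e (Function.update c' i k) =
            Function.update e i k := by
          funext j
          by_cases hj : j = i
          · subst hj; simp
          · simp [hj]
        have e3 : (∀ j ∈ A, Function.update e i k j = Function.update c' i k j) ↔
            ∀ j ∈ A, e j = c' j := by
          refine forall₂_congr fun j hj => ?_
          by_cases hji : j = i
          · subst hji; simp [he']
          · simp [hji]
        have e4 : A.piecewise (Function.update c i k) β = Function.update (A.piecewise c β) i k := by
          funext j
          by_cases hji : j = i
          · subst hji; simp [hA]
          · by_cases hj : j ∈ A <;> simp [hji, hj]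
        have e5 : φ (Function.update e i k) = φ e := hφ fun j hj => by
          have : j ≠ i := by rintro rfl; simp [hA] at hj
          simp [this]
        rw [e2]
        simp only [e3]
        rw [e4, e5, (hT i hS).2 _ _ _ (by simpa [hA] using hc.trans he')]
  · refine ⟨fun c c' hc => if_neg fun h => hc (h i hA), fun c c' k hc => ?_⟩
    unfold slice
    have e1 : (∀ j, j ∉ A → Function.update c i k j = Function.update c' i k j) ↔
        ∀ j, j ∉ A → c j = c' j := by
      refine forall₂_congr fun j hj => ?_
      by_cases h : j = i
      · subst h; simp [hc]
      · simp [h]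
    have e3 : ∀ e : ∀ i, K i, (∀ j ∈ A, e j = Function.update c' i k j) ↔
        ∀ j ∈ A, e j = c' j := by
      refine fun e => forall₂_congr fun j hj => ?_
      have : j ≠ i := fun h => hA (h ▸ hj)
      simp [this]
    have e4 : A.piecewise (Function.update c i k) β = A.piecewise c β :=
      Finset.piecewise_congr _ (fun j hj => by
        have : j ≠ i := fun h => hA (h ▸ hj)
        simp [this]) fun _ _ => rfl
    simp only [e1, e3, e4]

theorem slice_mulVec {A : Finset ι} (T : Matrix (∀ i, K i) (∀ i, K i) ℂ)
    {f φ φ₂ : (∀ i, K i) → ℂ} (hf : DependsOn f (↑A : Set ι))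
    (hφ₂ : DependsOn φ₂ (↑Aᶜ : Set ι)) (β : ∀ i, K i) :
    slice A T φ β *ᵥ (f * φ₂) = (fun c => (T *ᵥ (f * φ)) (A.piecewise c β)) * φ₂ := by
  funext c
  simp only [Matrix.mulVec, dotProduct, Pi.mul_apply, slice]
  have h1 : ∀ c' : ∀ i, K i, (if ∀ i, i ∉ A → c i = c' i then
      ∑ e, (if ∀ i ∈ A, e i = c' i then T (A.piecewise c β) e * φ e else 0) else 0) *
      (f c' * φ₂ c') = ∑ e, if c' = A.piecewise e c then
        T (A.piecewise c β) e * (f e * φ e) * φ₂ c else 0 := by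
    intro c'
    by_cases h : ∀ i, i ∉ A → c i = c' i
    · rw [if_pos h, Finset.sum_mul]
      refine Finset.sum_congr rfl fun e _ => ?_
      have h2 : (c' = A.piecewise e c) ↔ ∀ i ∈ A, e i = c' i := by
        constructor
        · rintro rfl i hi
          simp [hi]
        · intro h'
          funext i
          by_cases hi : i ∈ A
          · simp [hi, h' i hi]
          · simp [hi, h i hi]
      simp only [h2]
      split_ifs with h'
      · rw [hf (x := c') (y := e) fun i hi => (h' i (by simpa using hi)).symm,
          hφ₂ (x := c') (y := c) fun i hi => (h i (by simpa using hi)).symm]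
        ring
      · simp
    · rw [if_neg h, zero_mul]
      symm
      refine Finset.sum_eq_zero fun e _ => if_neg ?_
      rintro rfl
      exact h fun i hi => by simp [hi]
  simp only [h1]
  rw [Finset.sum_comm]
  simp [Finset.sum_mul]

/-- An operator that maps a product vector to a product vector acts on one of the two factors like
an operator supported there. -/
theorem exists_local_of_product {A S : Finset ι} {T : Matrix (∀ i, K i) (∀ i, K i) ℂ}
    (hT : SuppOn S T) {f φ f₁ φ₁ : (∀ i, K i) → ℂ} (hf : DependsOn f (↑A : Set ι))
    (hφ : DependsOn φ (↑Aᶜ : Set ι)) (hf₁ : DependsOn f₁ (↑A : Set ι))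
    (hφ₁ : DependsOn φ₁ (↑Aᶜ : Set ι)) (h : T *ᵥ (f * φ) = f₁ * φ₁) (hne : φ₁ ≠ 0) :
    ∃ W : Matrix (∀ i, K i) (∀ i, K i) ℂ, SuppOn (S ∩ A) W ∧
      ∀ φ₂, DependsOn φ₂ (↑Aᶜ : Set ι) → W *ᵥ (f * φ₂) = f₁ * φ₂ := by
  obtain ⟨β, hβ⟩ := Function.ne_iff.1 hne
  refine ⟨(φ₁ β)⁻¹ • slice A T φ β, (suppOn_slice hT hφ β).smul _, fun φ₂ hφ₂ => ?_⟩
  rw [Matrix.smul_mulVec, slice_mulVec T hf hφ₂, h]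
  funext c
  simp only [Pi.smul_apply, Pi.mul_apply, smul_eq_mul, dependsOn_piecewise_left hf₁,
    dependsOn_piecewise_right hφ₁]
  have : φ₁ β ≠ 0 := hβ
  field_simp

theorem dependsOn_cutMat (A : Finset ι) (χ : (∀ i, K i) → ℂ) (β : ∀ i, K i) :
    DependsOn (fun c => χ (A.piecewise c β)) (↑A : Set ι) := fun c d h => by
  simp only
  congr 1
  exact A.piecewise_congr (fun i hi => h i (by simpa using hi)) fun _ _ => rfl

/-- An operator on `A` leaves the outside configuration alone, so its expectation value is a sum
over frozen outside configurations. -/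
theorem card_mul_expVal {A : Finset ι} {O : Matrix (∀ i, K i) (∀ i, K i) ℂ} (hO : SuppOn A O)
    (χ : (∀ i, K i) → ℂ) : (Fintype.card (∀ i, K i) : ℂ) * expVal χ O =
      ∑ β : ∀ i, K i, expVal (fun c => χ (A.piecewise c β)) O := by
  simp only [expVal, dotProduct]
  rw [card_mul_sum_eq A, Finset.sum_comm]
  refine Finset.sum_congr rfl fun β _ => Finset.sum_congr rfl fun c _ => ?_
  have := congrFun (congrFun (cutMat_mulVec hO χ) c) β
  simp only [cutMat, Matrix.mul_apply] at this
  rw [this]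
  rfl

theorem card_mul_expVal_mul {A : Finset ι} {O : Matrix (∀ i, K i) (∀ i, K i) ℂ} (hO : SuppOn A O)
    {f φ : (∀ i, K i) → ℂ} (hf : DependsOn f (↑A : Set ι)) (hφ : DependsOn φ (↑Aᶜ : Set ι)) :
    (Fintype.card (∀ i, K i) : ℂ) * expVal (f * φ) O = expVal f O * (star φ ⬝ᵥ φ) := by
  rw [expVal, hO.mulVec_mul hφ, dotProduct_mul_mul hf (hO.dependsOn_mulVec subset_rfl hf) hφ hφ,
    expVal]

/-- The state of the region `A` after the application of an operator `w` to a vector that is a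
product across `A` is a mixture of states obtained by operators supported on `A`. -/
theorem exists_kraus {A S : Finset ι} {w : Matrix (∀ i, K i) (∀ i, K i) ℂ}
    (hw : SuppOn S w) {Φ : (∀ i, K i) → ℂ} (hΦ : IsProductAcross A Φ) :
    ∃ z : (∀ i, K i) → Matrix (∀ i, K i) (∀ i, K i) ℂ, (∀ β, SuppOn (S ∩ A) (z β)) ∧
      ∀ O, SuppOn A O → expVal (w *ᵥ Φ) O = ∑ β, expVal (z β *ᵥ Φ) O := by
  by_cases hne : Φ = 0
  · refine ⟨0, fun _ => SuppOn.zero _, fun O _ => ?_⟩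
    simp [hne, expVal]
  have hN := card_conf_ne_zero hne
  obtain ⟨f, φ, hf, hφ, rfl⟩ := hΦ
  have hφ0 : φ ≠ 0 := by rintro rfl; simp at hne
  have hp := dotProduct_star_self_ne_zero hφ0
  -- The scalar cancels the squared norm of the factor `φ`, which stays attached to each sliced
  -- vector.
  obtain ⟨r, hr⟩ : ∃ r : ℂ, star r * r = (star φ ⬝ᵥ φ)⁻¹ := by
    have h0 : 0 ≤ star φ ⬝ᵥ φ := dotProduct_star_self_nonneg φ
    obtain ⟨x, hx, hx'⟩ : ∃ x : ℝ, 0 ≤ x ∧ (x : ℂ) = star φ ⬝ᵥ φ :=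
      ⟨(star φ ⬝ᵥ φ).re, (Complex.le_def.1 h0).1, Complex.ext rfl (Complex.le_def.1 h0).2⟩
    refine ⟨((Real.sqrt x)⁻¹ : ℝ), ?_⟩
    rw [← hx', Complex.star_def, Complex.conj_ofReal, ← Complex.ofReal_mul, ← mul_inv,
      Real.mul_self_sqrt hx, Complex.ofReal_inv]
  refine ⟨fun β => r • slice A w φ β, fun β => (suppOn_slice hw hφ β).smul _, fun O hO => ?_⟩
  apply mul_left_cancel₀ hN
  rw [card_mul_expVal hO, Finset.mul_sum]
  refine Finset.sum_congr rfl fun β _ => ?_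
  rw [Matrix.smul_mulVec, slice_mulVec w hf hφ, expVal_smul, hr, mul_left_comm,
    card_mul_expVal_mul hO (dependsOn_cutMat A _ β) hφ]
  field_simp

/-- A vector that is a product across each cell of a partition is a product over the cells. -/
theorem eq_prod_of_cells {γ : Type*} [DecidableEq γ] (s : Finset γ) (Z : γ → Finset ι)
    (hZ : ∀ j ∈ s, ∀ k ∈ s, j ≠ k → Disjoint (Z j) (Z k)) {χ : (∀ i, K i) → ℂ}
    {F G : γ → (∀ i, K i) → ℂ} (hF : ∀ j ∈ s, DependsOn (F j) (↑(Z j) : Set ι))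
    (hG : ∀ j ∈ s, DependsOn (G j) (↑(Z j)ᶜ : Set ι)) (h : ∀ j ∈ s, χ = F j * G j)
    {c₀ : ∀ i, K i} (hc₀ : χ c₀ ≠ 0) (c : ∀ i, K i) :
    χ ((s.biUnion Z).piecewise c c₀) = χ c₀ * ∏ j ∈ s, F j c / F j c₀ := by
  induction s using Finset.induction_on with
  | empty =>
    have : (Finset.biUnion ∅ Z).piecewise c c₀ = c₀ :=
      funext fun i => Finset.piecewise_eq_of_notMem _ _ _ (by simp)
    rw [this]; simp
  | insert j s hj ih =>
    have ih' := ih (fun k hk l hl => hZ k (by simp [hk]) l (by simp [hl]))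
      (fun k hk => hF k (by simp [hk])) (fun k hk => hG k (by simp [hk]))
      (fun k hk => h k (by simp [hk]))
    have hFj := hF j (by simp)
    have hGj := hG j (by simp)
    have hj' := h j (by simp)
    have hdis : ∀ i ∈ Z j, i ∉ s.biUnion Z := by
      intro i hi hi'
      obtain ⟨k, hk, hk'⟩ := Finset.mem_biUnion.1 hi'
      exact Finset.disjoint_left.1 (hZ j (by simp) k (by simp [hk])
        (fun h => hj (h ▸ hk))) hi hk'
    have h0 : F j c₀ ≠ 0 := by
      rw [hj'] at hc₀
      exact left_ne_zero_of_mul hc₀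
    rw [Finset.prod_insert hj, mul_left_comm, ← ih', Finset.biUnion_insert]
    have e1 : F j ((Z j ∪ s.biUnion Z).piecewise c c₀) = F j c := hFj fun i hi => by
      have : i ∈ Z j := by simpa using hi
      simp [this]
    have e2 : F j ((s.biUnion Z).piecewise c c₀) = F j c₀ := hFj fun i hi => by
      exact Finset.piecewise_eq_of_notMem _ _ _ (hdis i (by simpa using hi))
    have e3 : G j ((Z j ∪ s.biUnion Z).piecewise c c₀) = G j ((s.biUnion Z).piecewise c c₀) :=
      hGj fun i hi => by
        have : i ∉ Z j := by simpa using hi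
        simp only [Finset.piecewise, Finset.mem_union, this, false_or]
    rw [hj', Pi.mul_apply, Pi.mul_apply, e1, e2, e3]
    field_simp

end Slices


/-! ### Layers and circuits with gates of prescribed supports -/

section Circuits

variable {ι : Type} [Fintype ι] [DecidableEq ι] {K : ι → Type} [∀ i, Fintype (K i)]
  [∀ i, DecidableEq (K i)]

/-- A layer of unitary gates with pairwise disjoint supports satisfying `p`. -/
def Layer (p : Finset ι → Prop) (w : Matrix (∀ i, K i) (∀ i, K i) ℂ) : Prop :=
  ∃ g : List (Finset ι × Matrix (∀ i, K i) (∀ i, K i) ℂ),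
    (∀ G ∈ g, p G.1 ∧ SuppOn G.1 G.2 ∧ G.2 ∈ Matrix.unitaryGroup (∀ i, K i) ℂ) ∧
    g.Pairwise (fun G H => Disjoint G.1 H.1) ∧ w = (g.map Prod.snd).prod

/-- A circuit of `n` layers whose gates have supports satisfying `p`. -/
def Circ (p : Finset ι → Prop) : ℕ → Matrix (∀ i, K i) (∀ i, K i) ℂ → Prop
  | 0, U => U = 1
  | n + 1, U => ∃ w U', Layer p w ∧ Circ p n U' ∧ U = w * U'

theorem Layer.mono {p p' : Finset ι → Prop} (h : ∀ S, p S → p' S)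
    {w : Matrix (∀ i, K i) (∀ i, K i) ℂ} (hw : Layer p w) : Layer p' w := by
  obtain ⟨g, hg, hd, rfl⟩ := hw
  exact ⟨g, fun G hG => ⟨h _ (hg G hG).1, (hg G hG).2⟩, hd, rfl⟩

theorem Circ.mono {p p' : Finset ι → Prop} (h : ∀ S, p S → p' S) {n : ℕ}
    {U : Matrix (∀ i, K i) (∀ i, K i) ℂ} (hU : Circ p n U) : Circ p' n U := by
  induction n generalizing U with
  | zero => exact hU
  | succ n ih =>
    obtain ⟨w, U', hw, hU', rfl⟩ := hU
    exact ⟨w, U', hw.mono h, ih hU', rfl⟩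

theorem Layer.suppOn {p : Finset ι → Prop} {N : Finset ι} (h : ∀ S, p S → S ⊆ N)
    {w : Matrix (∀ i, K i) (∀ i, K i) ℂ} (hw : Layer p w) : SuppOn N w := by
  obtain ⟨g, hg, -, rfl⟩ := hw
  refine SuppOn.listProd fun A hA => ?_
  obtain ⟨G, hG, rfl⟩ := List.mem_map.1 hA
  exact (hg G hG).2.1.mono (h _ (hg G hG).1)

theorem Circ.suppOn {p : Finset ι → Prop} {N : Finset ι} (h : ∀ S, p S → S ⊆ N) {n : ℕ}
    {U : Matrix (∀ i, K i) (∀ i, K i) ℂ} (hU : Circ p n U) : SuppOn N U := by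
  induction n generalizing U with
  | zero => obtain rfl := hU; exact suppOn_one N
  | succ n ih =>
    obtain ⟨w, U', hw, hU', rfl⟩ := hU
    exact (hw.suppOn h).mul (ih hU')

theorem Layer.unitary {p : Finset ι → Prop} {w : Matrix (∀ i, K i) (∀ i, K i) ℂ}
    (hw : Layer p w) : w ∈ Matrix.unitaryGroup (∀ i, K i) ℂ := by
  obtain ⟨g, hg, -, rfl⟩ := hw
  refine list_prod_mem fun A hA => ?_
  obtain ⟨G, hG, rfl⟩ := List.mem_map.1 hA
  exact (hg G hG).2.2

theorem Circ.unitary {p : Finset ι → Prop} {n : ℕ} {U : Matrix (∀ i, K i) (∀ i, K i) ℂ}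
    (hU : Circ p n U) : U ∈ Matrix.unitaryGroup (∀ i, K i) ℂ := by
  induction n generalizing U with
  | zero => obtain rfl := hU; exact one_mem _
  | succ n ih =>
    obtain ⟨w, U', hw, hU', rfl⟩ := hU
    exact mul_mem hw.unitary (ih hU')

theorem layer_one (p : Finset ι → Prop) : Layer p (1 : Matrix (∀ i, K i) (∀ i, K i) ℂ) :=
  ⟨[], by simp, List.Pairwise.nil, rfl⟩

theorem circ_one (p : Finset ι → Prop) (n : ℕ) :
    Circ p n (1 : Matrix (∀ i, K i) (∀ i, K i) ℂ) := by
  induction n with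
  | zero => rfl
  | succ n ih => exact ⟨1, 1, layer_one p, ih, by simp⟩

theorem Circ.mul {p : Finset ι → Prop} {m n : ℕ} {U V : Matrix (∀ i, K i) (∀ i, K i) ℂ}
    (hU : Circ p m U) (hV : Circ p n V) : Circ p (n + m) (U * V) := by
  induction m generalizing U with
  | zero => obtain rfl := hU; simpa using hV
  | succ m ih =>
    obtain ⟨w, U', hw, hU', rfl⟩ := hU
    exact ⟨w, U' * V, hw, ih hU', mul_assoc _ _ _⟩

theorem prod_gates_filter (q : Finset ι → Prop) [DecidablePred q]
    (g : List (Finset ι × Matrix (∀ i, K i) (∀ i, K i) ℂ))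
    (hg : ∀ G ∈ g, SuppOn G.1 G.2) (hd : g.Pairwise (fun G H => Disjoint G.1 H.1)) :
    (g.map Prod.snd).prod = ((g.filter fun G => q G.1).map Prod.snd).prod *
      ((g.filter fun G => ¬ q G.1).map Prod.snd).prod := by
  induction g with
  | nil => simp
  | cons G g ih =>
    have ih' := ih (fun H hH => hg H (by simp [hH])) (List.pairwise_cons.1 hd).2
    rw [List.map_cons, List.prod_cons, ih']
    by_cases hq : q G.1
    · simp [hq, mul_assoc]
    · have hcomm : G.2 * ((g.filter fun G => q G.1).map Prod.snd).prod =
          ((g.filter fun G => q G.1).map Prod.snd).prod * G.2 := by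
        refine Commute.list_prod_right _ _ fun A hA => ?_
        obtain ⟨H, hH, rfl⟩ := List.mem_map.1 hA
        have hH' := List.mem_of_mem_filter hH
        exact (hg G (by simp)).commute (hg H (by simp [hH']))
          ((List.pairwise_cons.1 hd).1 H hH')
      rw [List.filter_cons_of_neg (by simpa using hq), List.filter_cons_of_pos (by simpa using hq),
        List.map_cons, List.prod_cons, ← mul_assoc, ← mul_assoc, hcomm]

/-- A layer is the product of the layer of its gates with property `q` and the layer of all
others. -/
theorem Layer.filter {p : Finset ι → Prop} (q : Finset ι → Prop)
    {w : Matrix (∀ i, K i) (∀ i, K i) ℂ} (hw : Layer p w) :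
    ∃ w₁ w₂, Layer (fun S => p S ∧ q S) w₁ ∧ Layer (fun S => p S ∧ ¬ q S) w₂ ∧ w = w₁ * w₂ ∧
      w = w₂ * w₁ := by
  classical
  obtain ⟨g, hg, hd, rfl⟩ := hw
  have key : ∀ (q : Finset ι → Prop) [DecidablePred q], Layer (fun S => p S ∧ q S)
      ((g.filter fun G => q G.1).map Prod.snd).prod := by
    intro q _
    refine ⟨g.filter fun G => q G.1, fun G hG => ?_, List.Pairwise.filter _ hd, rfl⟩
    have hG' := List.mem_filter.1 hG
    exact ⟨⟨(hg G hG'.1).1, of_decide_eq_true hG'.2⟩, (hg G hG'.1).2⟩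
  refine ⟨_, _, key q, key fun S => ¬ q S,
    prod_gates_filter q g (fun G hG => (hg G hG).2.1) hd, ?_⟩
  have := prod_gates_filter (fun S => ¬ q S) g (fun G hG => (hg G hG).2.1) hd
  simpa only [not_not] using this

theorem unitary_mul_conjTranspose {n : Type} [Fintype n] [DecidableEq n] {U : Matrix n n ℂ}
    (h : U ∈ Matrix.unitaryGroup n ℂ) : U * Uᴴ = 1 := Matrix.mem_unitaryGroup_iff.1 h

theorem unitary_conjTranspose_mul {n : Type} [Fintype n] [DecidableEq n] {U : Matrix n n ℂ}
    (h : U ∈ Matrix.unitaryGroup n ℂ) : Uᴴ * U = 1 := Matrix.mem_unitaryGroup_iff'.1 h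

theorem conjTranspose_mem_unitary {n : Type} [Fintype n] [DecidableEq n] {U : Matrix n n ℂ}
    (h : U ∈ Matrix.unitaryGroup n ℂ) : Uᴴ ∈ Matrix.unitaryGroup n ℂ := by
  rw [← Matrix.star_eq_conjTranspose]
  exact Unitary.star_mem h

theorem SuppOn.conj_eq' {S T : Finset ι} {A U : Matrix (∀ i, K i) (∀ i, K i) ℂ} (h : SuppOn S A)
    (hU : SuppOn T U) (hST : Disjoint S T) (hU' : U ∈ Matrix.unitaryGroup (∀ i, K i) ℂ) :
    U * A * Uᴴ = A := by
  have := h.conj_eq hU.conjTranspose hST (conjTranspose_mem_unitary hU')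
  rwa [Matrix.conjTranspose_conjTranspose] at this

/-- Only the gates that meet the support of an operator matter for its conjugation by a layer. -/
theorem Layer.truncate {p : Finset ι → Prop} {w A : Matrix (∀ i, K i) (∀ i, K i) ℂ}
    (hw : Layer p w) {T : Finset ι} (hA : SuppOn T A) :
    ∃ w₁, Layer (fun S => p S ∧ ¬ Disjoint T S) w₁ ∧ wᴴ * A * w = w₁ᴴ * A * w₁ ∧
      w * A * wᴴ = w₁ * A * w₁ᴴ := by
  obtain ⟨w₂, w₁, h2, h1, h, h'⟩ := hw.filter (fun S => Disjoint T S)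
  have hs : SuppOn Tᶜ w₂ := h2.suppOn fun S hS i hi => by
    simpa using Finset.disjoint_right.1 hS.2 hi
  refine ⟨w₁, h1, ?_, ?_⟩
  · rw [h, Matrix.conjTranspose_mul]
    calc w₁ᴴ * w₂ᴴ * A * (w₂ * w₁) = w₁ᴴ * (w₂ᴴ * A * w₂) * w₁ := by simp only [mul_assoc]
      _ = _ := by rw [hA.conj_eq hs disjoint_compl_right h2.unitary]
  · rw [h', Matrix.conjTranspose_mul]
    calc w₁ * w₂ * A * (w₂ᴴ * w₁ᴴ) = w₁ * (w₂ * A * w₂ᴴ) * w₁ᴴ := by simp only [mul_assoc]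
      _ = _ := by rw [hA.conj_eq' hs disjoint_compl_right h2.unitary]

/-- A layer whose gates lie on either side of a cut is a product across the cut. -/
theorem Circ.factor {p : Finset ι → Prop} {n : ℕ} {U : Matrix (∀ i, K i) (∀ i, K i) ℂ}
    (hU : Circ p n U) {H : Finset ι} (h : ∀ S, p S → S ⊆ H ∨ Disjoint H S) :
    ∃ U₁ U₂, Circ (fun S => p S ∧ S ⊆ H) n U₁ ∧ Circ (fun S => p S ∧ ¬ S ⊆ H) n U₂ ∧
      U = U₁ * U₂ := by
  induction n generalizing U with
  | zero => obtain rfl := hU; exact ⟨1, 1, rfl, rfl, by simp⟩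
  | succ n ih =>
    obtain ⟨w, U', hw, hU', rfl⟩ := hU
    obtain ⟨U₁, U₂, h1, h2, rfl⟩ := ih hU'
    obtain ⟨w₁, w₂, hw1, hw2, rfl, -⟩ := hw.filter (fun S => S ⊆ H)
    refine ⟨w₁ * U₁, w₂ * U₂, ⟨_, _, hw1, h1, rfl⟩, ⟨_, _, hw2, h2, rfl⟩, ?_⟩
    have e1 : SuppOn H U₁ := h1.suppOn fun S hS => hS.2
    have e2 : SuppOn Hᶜ w₂ := hw2.suppOn fun S hS i hi => by
      have := (h S hS.1).resolve_left hS.2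
      simpa using Finset.disjoint_right.1 this hi
    calc w₁ * w₂ * (U₁ * U₂) = w₁ * (w₂ * U₁) * U₂ := by simp only [mul_assoc]
      _ = _ := by rw [← e1.commute e2 disjoint_compl_right]; simp only [mul_assoc]

end Circuits

/-! ### Light cones on the ring -/

section Ring

variable {L : ℕ} [NeZero L] {K : ZMod L → Type} [∀ i, Fintype (K i)] [∀ i, DecidableEq (K i)]

/-- The sites at distance at most `r` from `T`. -/
noncomputable def nbhd (r : ℕ) (T : Finset (ZMod L)) : Finset (ZMod L) :=
  (T ×ˢ Finset.Icc (-(r : ℤ)) r).image fun t => t.1 + (t.2 : ZMod L)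

theorem mem_nbhd {r : ℕ} {T : Finset (ZMod L)} {x : ZMod L} :
    x ∈ nbhd r T ↔ ∃ y ∈ T, ∃ k : ℤ, |k| ≤ r ∧ x = y + k := by
  simp only [nbhd, Finset.mem_image, Finset.mem_product, Finset.mem_Icc, Prod.exists, abs_le]
  constructor
  · rintro ⟨y, k, ⟨hy, hk⟩, rfl⟩
    exact ⟨y, hy, k, hk, rfl⟩
  · rintro ⟨y, hy, k, hk, rfl⟩
    exact ⟨y, k, ⟨hy, hk⟩, rfl⟩

theorem subset_nbhd (r : ℕ) (T : Finset (ZMod L)) : T ⊆ nbhd r T := fun x hx =>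
  mem_nbhd.2 ⟨x, hx, 0, by simp, by simp⟩

theorem nbhd_mono {r r' : ℕ} (hr : r ≤ r') {T T' : Finset (ZMod L)} (hT : T ⊆ T') :
    nbhd r T ⊆ nbhd r' T' := fun x hx => by
  obtain ⟨y, hy, k, hk, rfl⟩ := mem_nbhd.1 hx
  exact mem_nbhd.2 ⟨y, hT hy, k, hk.trans (by exact_mod_cast hr), rfl⟩

theorem nbhd_nbhd (r s : ℕ) (T : Finset (ZMod L)) : nbhd r (nbhd s T) = nbhd (r + s) T := by
  ext x
  constructor
  · intro hx
    obtain ⟨y, hy, k, hk, rfl⟩ := mem_nbhd.1 hx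
    obtain ⟨z, hz, l, hl, rfl⟩ := mem_nbhd.1 hy
    refine mem_nbhd.2 ⟨z, hz, l + k, ?_, by push_cast; ring⟩
    have := abs_add_le l k
    push_cast
    lia
  · intro hx
    obtain ⟨y, hy, k, hk, rfl⟩ := mem_nbhd.1 hx
    rw [abs_le] at hk
    push_cast at hk
    -- The displacement is clipped to [-r, r]; what remains has size at most `s`.
    obtain ⟨a, b, ha, hb, rfl⟩ : ∃ a b : ℤ, |a| ≤ r ∧ |b| ≤ s ∧ k = a + b := by
      refine ⟨max (-(r : ℤ)) (min k r), k - max (-(r : ℤ)) (min k r), abs_le.2 ?_, abs_le.2 ?_,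
        by ring⟩
      · lia
      · lia
    exact mem_nbhd.2 ⟨y + b, mem_nbhd.2 ⟨y, hy, b, hb, rfl⟩, a, ha, by push_cast; ring⟩

/-- All sites of `S` are within distance `R` of each other. -/
def SmallSupp (R : ℕ) (S : Finset (ZMod L)) : Prop :=
  ∀ x ∈ S, ∀ y ∈ S, ∃ k : ℤ, |k| ≤ R ∧ y = x + k

theorem SmallSupp.subset_nbhd {R : ℕ} {S T : Finset (ZMod L)} (h : SmallSupp R S)
    (hT : ¬ Disjoint T S) : S ⊆ nbhd R T := fun y hy => by
  obtain ⟨x, hx, hx'⟩ := Finset.not_disjoint_iff.1 hT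
  exact mem_nbhd.2 ⟨x, hx, h x hx' y hy⟩

variable {p : Finset (ZMod L) → Prop} {R : ℕ}

theorem Layer.conj (hp : ∀ S, p S → SmallSupp R S)
    {w A : Matrix (∀ i, K i) (∀ i, K i) ℂ} (hw : Layer p w)
    {T : Finset (ZMod L)} (hA : SuppOn T A) :
    SuppOn (nbhd R T) (wᴴ * A * w) ∧ SuppOn (nbhd R T) (w * A * wᴴ) := by
  obtain ⟨w₁, h1, e1, e2⟩ := hw.truncate hA
  have hs : SuppOn (nbhd R T) w₁ := h1.suppOn fun S hS => (hp S hS.1).subset_nbhd hS.2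
  have hA' := hA.mono (subset_nbhd R T)
  rw [e1, e2]
  exact ⟨(hs.conjTranspose.mul hA').mul hs, (hs.mul hA').mul hs.conjTranspose⟩

/-- The light cone grows by `R` per layer, since gates disjoint from the current support cancel. -/
theorem Circ.conj (hp : ∀ S, p S → SmallSupp R S)
    {n : ℕ} {U A : Matrix (∀ i, K i) (∀ i, K i) ℂ} (hU : Circ p n U)
    {T : Finset (ZMod L)} (hA : SuppOn T A) :
    SuppOn (nbhd (n * R) T) (Uᴴ * A * U) ∧ SuppOn (nbhd (n * R) T) (U * A * Uᴴ) := by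
  induction n generalizing U A T with
  | zero =>
    obtain rfl := hU
    have := hA.mono (subset_nbhd (0 * R) T)
    simpa using this
  | succ n ih =>
    obtain ⟨w, U', hw, hU', rfl⟩ := hU
    have e : (n + 1) * R = n * R + R := by ring
    constructor
    · have := (ih hU' (hw.conj hp hA).1).1
      rw [nbhd_nbhd, ← e] at this
      convert this using 1
      simp only [Matrix.conjTranspose_mul, mul_assoc]
    · have := (hw.conj hp (ih hU' hA).2).2
      rw [nbhd_nbhd, add_comm, ← e] at this
      convert this using 1
      simp only [Matrix.conjTranspose_mul, mul_assoc]

/-- Gates outside the light cone cancel one layer after the other, so the conjugated operator is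
already produced by the gates inside it. -/
theorem Circ.truncate (hp : ∀ S, p S → SmallSupp R S)
    {n : ℕ} {U A : Matrix (∀ i, K i) (∀ i, K i) ℂ} (hU : Circ p n U)
    {T : Finset (ZMod L)} (hA : SuppOn T A) :
    ∃ U₁, Circ (fun S => p S ∧ S ⊆ nbhd (n * R) T) n U₁ ∧ Uᴴ * A * U = U₁ᴴ * A * U₁ := by
  induction n generalizing U A T with
  | zero => obtain rfl := hU; exact ⟨1, rfl, rfl⟩
  | succ n ih =>
    obtain ⟨w, U', hw, hU', rfl⟩ := hU
    obtain ⟨w₁, h1, e1, -⟩ := hw.truncate hA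
    have e : (n + 1) * R = n * R + R := by ring
    obtain ⟨U₁, h2, e2⟩ := ih hU' (hw.conj hp hA).1
    rw [nbhd_nbhd, ← e] at h2
    refine ⟨w₁ * U₁, ⟨w₁, U₁, h1.mono fun S hS => ⟨hS.1, ?_⟩, h2, rfl⟩, ?_⟩
    · calc (w * U')ᴴ * A * (w * U') = U'ᴴ * (wᴴ * A * w) * U' := by
            simp only [Matrix.conjTranspose_mul, mul_assoc]
        _ = U₁ᴴ * (wᴴ * A * w) * U₁ := e2
        _ = _ := by rw [e1]; simp only [Matrix.conjTranspose_mul, mul_assoc]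
    · refine ((hp S hS.1).subset_nbhd hS.2).trans (nbhd_mono ?_ subset_rfl)
      nlinarith

/-- The gates inside `N` can be collected at the end of the circuit, at the price of a larger
support. -/
theorem Circ.split (hp : ∀ S, p S → SmallSupp R S)
    {n : ℕ} {U : Matrix (∀ i, K i) (∀ i, K i) ℂ} (hU : Circ p n U)
    {N : Finset (ZMod L)} {q : Finset (ZMod L) → Prop} (hq : ∀ S, p S → q S → S ⊆ N) :
    ∃ M U₀, M ∈ Matrix.unitaryGroup (∀ i, K i) ℂ ∧ SuppOn (nbhd (n * R) N) M ∧
      Circ (fun S => p S ∧ ¬ q S) n U₀ ∧ U = M * U₀ := by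
  induction n generalizing U with
  | zero => obtain rfl := hU; exact ⟨1, 1, one_mem _, suppOn_one _, rfl, by simp⟩
  | succ n ih =>
    obtain ⟨w, U', hw, hU', rfl⟩ := hU
    obtain ⟨M, U₀, hM, hMs, h0, rfl⟩ := ih hU'
    obtain ⟨w₁, w₂, h1, h2, rfl, -⟩ := hw.filter q
    have e : (n + 1) * R = R + n * R := by ring
    refine ⟨w₁ * (w₂ * M * w₂ᴴ), w₂ * U₀, ?_, ?_, ⟨_, _, h2, h0, rfl⟩, ?_⟩
    · exact mul_mem h1.unitary
        (mul_mem (mul_mem h2.unitary hM) (conjTranspose_mem_unitary h2.unitary))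
    · have := (h2.conj (fun S hS => hp S hS.1) hMs).2
      rw [nbhd_nbhd, ← e] at this
      exact (h1.suppOn fun S hS => (hq S hS.1 hS.2).trans (subset_nbhd _ _)).mul this
    · calc w₁ * w₂ * (M * U₀) = w₁ * (w₂ * M * (w₂ᴴ * w₂) * U₀) := by
            rw [unitary_conjTranspose_mul h2.unitary]; simp only [mul_assoc, mul_one]
        _ = _ := by simp only [mul_assoc]

/-- The conjugate of an operator `T = T₁ * T₂` by a circuit is that of `T₂` by the circuit without
the gates near the support of `T₁`, up to an operator supported nearby. -/
theorem Circ.split_conj (hp : ∀ S, p S → SmallSupp R S)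
    {n : ℕ} {U T T₁ T₂ : Matrix (∀ i, K i) (∀ i, K i) ℂ} (hU : Circ p n U)
    {N : Finset (ZMod L)} {q : Finset (ZMod L) → Prop} (hq : ∀ S, p S → q S → S ⊆ N)
    (hT : T = T₁ * T₂) (hT₁ : SuppOn N T₁) (hT₁' : T₁ ∈ Matrix.unitaryGroup (∀ i, K i) ℂ)
    (hT' : T ∈ Matrix.unitaryGroup (∀ i, K i) ℂ)
    (hTc : ∀ (N' : Finset (ZMod L)) (M : Matrix (∀ i, K i) (∀ i, K i) ℂ), SuppOn N' M →
      SuppOn (nbhd 1 N') (T * M * Tᴴ)) :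
    ∃ t U₀, t ∈ Matrix.unitaryGroup (∀ i, K i) ℂ ∧ SuppOn (nbhd (2 * (n * R) + 1) N) t ∧
      Circ (fun S => p S ∧ ¬ q S) n U₀ ∧ Uᴴ * T * U = t * (U₀ᴴ * T₂ * U₀) := by
  obtain ⟨M, U₀, hM, hMs, h0, rfl⟩ := hU.split hp hq
  have hM' := conjTranspose_mem_unitary hM
  have h0' := conjTranspose_mem_unitary h0.unitary
  -- Insert `Tᴴ * T` behind `M` and expand the last `T` as `T₁ * T₂`. The bracket lives near `N`:
  -- moving gates to the end gives `M` radius `n * R`, conjugation by `T` adds 1, and conjugation by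
  -- `U₀` adds `n * R` again.
  refine ⟨U₀ᴴ * (Mᴴ * (T * M * Tᴴ) * T₁) * U₀, U₀, ?_, ?_, h0, ?_⟩
  · exact mul_mem (mul_mem h0' (mul_mem (mul_mem hM'
      (mul_mem (mul_mem hT' hM) (conjTranspose_mem_unitary hT'))) hT₁')) h0.unitary
  · have h1 : SuppOn (nbhd 1 (nbhd (n * R) N)) (Mᴴ * (T * M * Tᴴ) * T₁) :=
      ((hMs.conjTranspose.mono (subset_nbhd _ _)).mul (hTc _ _ hMs)).mul
        (hT₁.mono ((subset_nbhd _ _).trans (subset_nbhd _ _)))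
    have h2 := (h0.conj (fun S hS => hp S hS.1) h1).1
    rw [nbhd_nbhd, nbhd_nbhd] at h2
    exact h2.mono (nbhd_mono (by lia) subset_rfl)
  · have e1 : U₀ * U₀ᴴ = 1 := unitary_mul_conjTranspose h0.unitary
    have e2 : Tᴴ * T = 1 := unitary_conjTranspose_mul hT'
    calc (M * U₀)ᴴ * T * (M * U₀) = U₀ᴴ * Mᴴ * T * M * (Tᴴ * T) * U₀ := by
          rw [e2]; simp only [Matrix.conjTranspose_mul, mul_assoc, one_mul]
      _ = U₀ᴴ * Mᴴ * T * M * Tᴴ * T₁ * T₂ * U₀ := by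
          conv_lhs => rw [show Tᴴ * T = Tᴴ * (T₁ * T₂) by rw [← hT]]
          simp only [mul_assoc]
      _ = U₀ᴴ * Mᴴ * T * M * Tᴴ * T₁ * (U₀ * U₀ᴴ) * T₂ * U₀ := by rw [e1, mul_one]
      _ = _ := by simp only [mul_assoc]

end Ring


/-! ### On-site tensor products and environments -/

section Tensor

variable {ι : Type} [Fintype ι] [DecidableEq ι] {τ κ β : ι → Type}
  [∀ i, Fintype (τ i)] [∀ i, DecidableEq (τ i)] [∀ i, Fintype (κ i)] [∀ i, DecidableEq (κ i)]
  [∀ i, Fintype (β i)] [∀ i, DecidableEq (β i)] (e : ∀ i, τ i ≃ κ i × β i)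

/-- Configurations of a ring whose on-site spaces are tensor products are pairs of
configurations. -/
def pairing : (∀ i, τ i) ≃ (∀ i, κ i) × (∀ i, β i) where
  toFun t := (fun i => (e i (t i)).1, fun i => (e i (t i)).2)
  invFun p := fun i => (e i).symm (p.1 i, p.2 i)
  left_inv t := by funext i; simp
  right_inv p := by ext i <;> simp

/-- The operator `O ⊗ 1`. -/
def liftOp (O : Matrix (∀ i, κ i) (∀ i, κ i) ℂ) : Matrix (∀ i, τ i) (∀ i, τ i) ℂ :=
  (O ⊗ₖ (1 : Matrix (∀ i, β i) (∀ i, β i) ℂ)).submatrix (pairing e) (pairing e)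

/-- The vector `ψ ⊗ h`. -/
def tens (ψ : (∀ i, κ i) → ℂ) (h : (∀ i, β i) → ℂ) : (∀ i, τ i) → ℂ :=
  fun t => ψ (pairing e t).1 * h (pairing e t).2

theorem liftOp_one : liftOp e (1 : Matrix (∀ i, κ i) (∀ i, κ i) ℂ) = 1 := by
  rw [liftOp, Matrix.one_kronecker_one, Matrix.submatrix_one_equiv]

theorem liftOp_mul (A B : Matrix (∀ i, κ i) (∀ i, κ i) ℂ) :
    liftOp e (A * B) = liftOp e A * liftOp e B := by
  rw [liftOp, liftOp, liftOp, Matrix.submatrix_mul_equiv, ← Matrix.mul_kronecker_mul, one_mul]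

theorem liftOp_conjTranspose (A : Matrix (∀ i, κ i) (∀ i, κ i) ℂ) :
    liftOp e Aᴴ = (liftOp e A)ᴴ := by
  rw [liftOp, liftOp, Matrix.conjTranspose_submatrix, Matrix.conjTranspose_kronecker,
    Matrix.conjTranspose_one]

theorem liftOp_sub (A B : Matrix (∀ i, κ i) (∀ i, κ i) ℂ) :
    liftOp e (A - B) = liftOp e A - liftOp e B := by
  ext c c'
  simp [liftOp, sub_mul]

theorem liftOp_smul (z : ℂ) (A : Matrix (∀ i, κ i) (∀ i, κ i) ℂ) :
    liftOp e (z • A) = z • liftOp e A := by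
  rw [liftOp, Matrix.smul_kronecker]; rfl

theorem liftOp_unitary {U : Matrix (∀ i, κ i) (∀ i, κ i) ℂ}
    (h : U ∈ Matrix.unitaryGroup (∀ i, κ i) ℂ) :
    liftOp e U ∈ Matrix.unitaryGroup (∀ i, τ i) ℂ := by
  rw [Matrix.mem_unitaryGroup_iff, Matrix.star_eq_conjTranspose, ← liftOp_conjTranspose,
    ← liftOp_mul, unitary_mul_conjTranspose h, liftOp_one]

theorem liftOp_mulVec (O : Matrix (∀ i, κ i) (∀ i, κ i) ℂ) (Θ : (∀ i, τ i) → ℂ) (y : ∀ i, κ i)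
    (z : ∀ i, β i) : (liftOp e O *ᵥ Θ) ((pairing e).symm (y, z)) =
      (O *ᵥ fun y' => Θ ((pairing e).symm (y', z))) y := by
  simp only [Matrix.mulVec, dotProduct, liftOp]
  rw [← Equiv.sum_comp (pairing e).symm, Fintype.sum_prod_type]
  refine Finset.sum_congr rfl fun y' _ => ?_
  rw [Finset.sum_eq_single z]
  · simp
  · intro z' _ hz'
    simp [Matrix.one_apply_ne hz'.symm]
  · simp

theorem liftOp_mulVec_tens (O : Matrix (∀ i, κ i) (∀ i, κ i) ℂ) (ψ : (∀ i, κ i) → ℂ)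
    (h : (∀ i, β i) → ℂ) : liftOp e O *ᵥ tens e ψ h = tens e (O *ᵥ ψ) h := by
  funext t
  obtain ⟨⟨y, z⟩, rfl⟩ := (pairing e).symm.surjective t
  rw [liftOp_mulVec]
  simp [tens, Matrix.mulVec, dotProduct, Finset.sum_mul, mul_assoc]

theorem suppOn_liftOp {S : Finset ι} {O : Matrix (∀ i, κ i) (∀ i, κ i) ℂ} (h : SuppOn S O) :
    SuppOn S (liftOp e O) := by
  intro i hi
  have hu : ∀ (c : ∀ i, τ i) (k : τ i), (pairing e (Function.update c i k)) =
      (Function.update (pairing e c).1 i (e i k).1, Function.update (pairing e c).2 i (e i k).2) := by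
    intro c k
    ext j
    all_goals
      by_cases hj : j = i
      · subst hj; simp [pairing]
      · simp [pairing, hj]
  refine ⟨fun c c' hc => ?_, fun c c' k hc => ?_⟩
  · have : (pairing e c).1 i ≠ (pairing e c').1 i ∨ (pairing e c).2 i ≠ (pairing e c').2 i := by
      by_contra! h'
      exact hc ((e i).injective (Prod.ext h'.1 h'.2))
    simp only [liftOp, Matrix.submatrix_apply, Matrix.kroneckerMap_apply]
    rcases this with h1 | h1
    · rw [h.eq_zero hi h1, zero_mul]
    · rw [Matrix.one_apply_ne fun h' => h1 (congrFun h' i), mul_zero]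
  · simp only [liftOp, Matrix.submatrix_apply, Matrix.kroneckerMap_apply, hu]
    rw [(h i hi).2 _ _ _ (by simp [pairing, hc]), (suppOn_one ∅ i (by simp)).2 _ _ _
      (by simp [pairing, hc])]

theorem Layer.liftOp {p : Finset ι → Prop} {w : Matrix (∀ i, κ i) (∀ i, κ i) ℂ}
    (hw : Layer p w) : Layer p (liftOp e w) := by
  obtain ⟨g, hg, hd, rfl⟩ := hw
  refine ⟨g.map fun G => (G.1, _root_.liftOp e G.2), fun G hG => ?_, ?_, ?_⟩
  · obtain ⟨H, hH, rfl⟩ := List.mem_map.1 hG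
    exact ⟨(hg H hH).1, suppOn_liftOp e (hg H hH).2.1, liftOp_unitary e (hg H hH).2.2⟩
  · rw [List.pairwise_map]
    exact hd
  · clear hg hd
    induction g with
    | nil => simp [liftOp_one]
    | cons G g ih => simp [liftOp_mul, ih]

theorem Circ.liftOp {p : Finset ι → Prop} {n : ℕ} {U : Matrix (∀ i, κ i) (∀ i, κ i) ℂ}
    (hU : Circ p n U) : Circ p n (liftOp e U) := by
  induction n generalizing U with
  | zero => obtain rfl := hU; exact liftOp_one e
  | succ n ih =>
    obtain ⟨w, U', hw, hU', rfl⟩ := hU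
    exact ⟨_, _, hw.liftOp e, ih hU', liftOp_mul e _ _⟩

theorem tens_swap (ψ : (∀ i, κ i) → ℂ) (h : (∀ i, β i) → ℂ) :
    tens e ψ h = tens (fun i => (e i).trans (Equiv.prodComm _ _)) h ψ := by
  funext t
  exact mul_comm _ _

/-- Every environment slice of `Θ` is fixed by |Ψ⟩⟨Ψ| and hence is a multiple of `Ψ`; the
coefficients form the environment vector. -/
theorem exists_tens_of_liftOp_eq_zero {Ψ : (∀ i, κ i) → ℂ} {Θ : (∀ i, τ i) → ℂ}
    (h : liftOp e (1 - pureState Ψ) *ᵥ Θ = 0) : ∃ g, Θ = tens e Ψ g := by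
  refine ⟨fun z => star Ψ ⬝ᵥ fun y => Θ ((pairing e).symm (y, z)), ?_⟩
  funext t
  obtain ⟨⟨y, z⟩, rfl⟩ := (pairing e).symm.surjective t
  have h1 := congrFun h ((pairing e).symm (y, z))
  rw [liftOp_mulVec, Matrix.sub_mulVec, Matrix.one_mulVec, pureState,
    Matrix.vecMulVec_mulVec] at h1
  simp only [Pi.sub_apply, Pi.zero_apply, sub_eq_zero] at h1
  rw [h1]
  simp [tens]

/-- The operator on the first tensor factor obtained by feeding `h` into the second factor and
projecting it on the configuration `b` afterwards. -/
def sliceTens (T : Matrix (∀ i, τ i) (∀ i, τ i) ℂ) (h : (∀ i, β i) → ℂ) (b : ∀ i, β i) :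
    Matrix (∀ i, κ i) (∀ i, κ i) ℂ :=
  fun c c' => ∑ d, T ((pairing e).symm (c, b)) ((pairing e).symm (c', d)) * h d

theorem sliceTens_mulVec (T : Matrix (∀ i, τ i) (∀ i, τ i) ℂ) (h : (∀ i, β i) → ℂ) (b : ∀ i, β i)
    (ψ : (∀ i, κ i) → ℂ) :
    sliceTens e T h b *ᵥ ψ = fun c => (T *ᵥ tens e ψ h) ((pairing e).symm (c, b)) := by
  funext c
  simp only [Matrix.mulVec, dotProduct, sliceTens]
  rw [← Equiv.sum_comp (pairing e).symm, Fintype.sum_prod_type]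
  refine Finset.sum_congr rfl fun y' _ => ?_
  rw [Finset.sum_mul]
  refine Finset.sum_congr rfl fun d _ => ?_
  simp [tens]
  ring

theorem suppOn_sliceTens {S : Finset ι} {T : Matrix (∀ i, τ i) (∀ i, τ i) ℂ} (hT : SuppOn S T)
    (h : (∀ i, β i) → ℂ) (b : ∀ i, β i) : SuppOn S (sliceTens e T h b) := by
  intro i hi
  refine ⟨fun c c' hc => Finset.sum_eq_zero fun d _ => ?_,
    fun c c' k hc => Finset.sum_congr rfl fun d _ => ?_⟩
  · rw [hT.eq_zero hi, zero_mul]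
    intro h'
    exact hc (by simpa [pairing] using congrArg (fun t => (e i t).1) h')
  · congr 1
    by_cases hb : b i = d i
    · have hu : ∀ (c : ∀ i, κ i) (d : ∀ i, β i), (pairing e).symm (Function.update c i k, d) =
          Function.update ((pairing e).symm (c, d)) i ((e i).symm (k, d i)) := by
        intro c d
        funext j
        by_cases hj : j = i
        · subst hj; simp [pairing]
        · simp [pairing, hj]
      rw [hu, hu, hb, (hT i hi).2]
      simp [pairing, hc, hb]
    · have : ∀ c c' : ∀ i, κ i, T ((pairing e).symm (c, b)) ((pairing e).symm (c', d)) = 0 := by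
        intro c c'
        refine hT.eq_zero hi fun h' => hb ?_
        simpa [pairing] using congrArg (fun t => (e i t).2) h'
      rw [this, this]

/-- Summing over a basis of the second factor turns an operator on both factors into Kraus operators
on the first one. -/
theorem expVal_tens (T : Matrix (∀ i, τ i) (∀ i, τ i) ℂ) (h : (∀ i, β i) → ℂ)
    (ψ : (∀ i, κ i) → ℂ) (O : Matrix (∀ i, κ i) (∀ i, κ i) ℂ) :
    expVal (T *ᵥ tens e ψ h) (liftOp e O) = ∑ b, expVal (sliceTens e T h b *ᵥ ψ) O := by
  simp only [sliceTens_mulVec, expVal, dotProduct]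
  rw [← Equiv.sum_comp (pairing e).symm, Fintype.sum_prod_type, Finset.sum_comm]
  refine Finset.sum_congr rfl fun b _ => Finset.sum_congr rfl fun y _ => ?_
  rw [liftOp_mulVec]
  rfl

theorem expVal_tens_liftOp (h : (∀ i, β i) → ℂ) (ψ : (∀ i, κ i) → ℂ)
    (O : Matrix (∀ i, κ i) (∀ i, κ i) ℂ) :
    expVal (tens e ψ h) (liftOp e O) = expVal ψ O * (star h ⬝ᵥ h) := by
  rw [expVal, liftOp_mulVec_tens]
  simp only [dotProduct]
  rw [← Equiv.sum_comp (pairing e).symm, Fintype.sum_prod_type]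
  simp only [tens, Pi.star_apply, Equiv.apply_symm_apply, expVal, dotProduct, Finset.sum_mul_sum]
  refine Finset.sum_congr rfl fun b _ => Finset.sum_congr rfl fun y _ => ?_
  simp only [star_mul']
  ring

end Tensor

/-! ### From local channels to circuits acting on vectors -/

section Channels

variable {L : ℕ} [NeZero L]

/-- The arcs of at most `R` sites. -/
def IsArc (R : ℕ) (S : Finset (ZMod L)) : Prop := ∃ x k, k ≤ R ∧ S = arc x k

theorem smallSupp_of_isArc {R : ℕ} {S : Finset (ZMod L)} (h : IsArc R S) : SmallSupp R S := by
  obtain ⟨x, k, hk, rfl⟩ := h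
  intro y hy z hz
  simp only [arc, Finset.mem_image, Finset.mem_range] at hy hz
  obtain ⟨i, hi, rfl⟩ := hy
  obtain ⟨j, hj, rfl⟩ := hz
  exact ⟨(j : ℤ) - i, abs_le.2 ⟨by lia, by lia⟩, by push_cast; ring⟩

theorem IsLayer.layer {κ : ZMod L → Type} [∀ x, Fintype (κ x)] [∀ x, DecidableEq (κ x)] {R : ℕ}
    {w : Matrix (Conf κ) (Conf κ) ℂ} (h : IsLayer R w) : Layer (IsArc R) w := by
  obtain ⟨g, hg, hd, rfl⟩ := h
  exact ⟨g, fun G hG => ⟨(hg G hG).1, (hg G hG).2.1.suppOn, (hg G hG).2.2⟩, hd, rfl⟩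

theorem IsLocalCircuit.circ {κ : ZMod L → Type} [∀ x, Fintype (κ x)] [∀ x, DecidableEq (κ x)]
    {R D : ℕ} {U : Matrix (Conf κ) (Conf κ) ℂ} (h : IsLocalCircuit R D U) :
    Circ (IsArc R) D U := by
  obtain ⟨W, hD, hW, rfl⟩ := h
  induction W generalizing D with
  | nil => exact circ_one _ D
  | cons w W ih =>
    obtain ⟨D, rfl⟩ : ∃ D', D = D' + 1 := ⟨D - 1, by simp at hD; omega⟩
    exact ⟨w, W.prod, (hW w (by simp)).layer,
      ih (by simpa using hD) (fun w' hw' => hW w' (by simp [hw'])), by simp⟩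

/-- The product vector `⨂ₓ v x`. -/
def prodVec {κ : ZMod L → Type} (v : ∀ x, κ x → ℂ) : Conf κ → ℂ := fun c => ∏ x, v x (c x)

variable {κ κ' : ZMod L → Type} [∀ x, Fintype (κ x)] [∀ x, DecidableEq (κ x)]
  [∀ x, Fintype (κ' x)] [∀ x, DecidableEq (κ' x)]

/-- A diagonal entry of AρA† is a sum of nonnegative terms, one for each branch and environment
configuration. If it vanishes, so does every term. -/
theorem liftOp_mulVec_eq_zero_of_traceEnv {η β : ZMod L → Type} [∀ x, Fintype (η x)]
    [∀ x, DecidableEq (η x)] [∀ x, Fintype (β x)] [∀ x, DecidableEq (β x)]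
    (e : ∀ x, η x ≃ κ x × β x) {γ : Type} [Fintype γ] {w : γ → ℝ} (hw : ∀ j, 0 ≤ w j)
    {Θ : γ → Conf η → ℂ} {A : Matrix (Conf κ) (Conf κ) ℂ}
    (h : A * traceEnv e (∑ j, (w j : ℂ) • pureState (Θ j)) = 0) {j : γ} (hj : 0 < w j) :
    liftOp e A *ᵥ Θ j = 0 := by
  have h1 : ∀ y, ((A * traceEnv e (∑ j, (w j : ℂ) • pureState (Θ j))) * Aᴴ) y y =
      ((∑ z, ∑ j, w j * ‖(liftOp e A *ᵥ Θ j) ((pairing e).symm (y, z))‖ ^ 2 : ℝ) : ℂ) := by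
    intro y
    simp only [Matrix.mul_apply, traceEnv, Matrix.sum_apply, Matrix.smul_apply, pureState,
      Matrix.vecMulVec_apply, Pi.star_apply, smul_eq_mul, Matrix.conjTranspose_apply,
      Finset.mul_sum, Finset.sum_mul]
    push_cast
    have h2 : ∀ y1, ∑ x, ∑ z : Conf β, ∑ j, A y x * (w j * (Θ j (fun i => (e i).symm (x i, z i)) *
        star (Θ j fun i => (e i).symm (y1 i, z i)))) * star (A y y1) =
        ∑ z : Conf β, ∑ j, ∑ x, A y x * (w j * (Θ j (fun i => (e i).symm (x i, z i)) *
        star (Θ j fun i => (e i).symm (y1 i, z i)))) * star (A y y1) := by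
      intro y1
      rw [Finset.sum_comm]
      exact Finset.sum_congr rfl fun z _ => Finset.sum_comm
    simp only [h2]
    rw [Finset.sum_comm]
    refine Finset.sum_congr rfl fun z _ => ?_
    rw [Finset.sum_comm]
    refine Finset.sum_congr rfl fun j _ => ?_
    rw [← Complex.mul_conj', liftOp_mulVec, ← Complex.star_def]
    simp only [Matrix.mulVec, dotProduct, star_sum, Finset.mul_sum, Finset.sum_mul]
    refine Finset.sum_congr rfl fun y1 _ => Finset.sum_congr rfl fun x _ => ?_
    simp only [star_mul']
    simp only [pairing, Equiv.coe_fn_symm_mk]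
    ring
  funext t
  obtain ⟨⟨y, z⟩, rfl⟩ := (pairing e).symm.surjective t
  have h2 := h1 y
  rw [h, Matrix.zero_mul, Matrix.zero_apply] at h2
  have h3 := (Complex.ofReal_eq_zero.1 h2.symm)
  rw [Finset.sum_eq_zero_iff_of_nonneg fun z _ => Finset.sum_nonneg fun j _ =>
    mul_nonneg (hw j) (by positivity)] at h3
  have h4 := h3 z (Finset.mem_univ _)
  rw [Finset.sum_eq_zero_iff_of_nonneg fun j _ => mul_nonneg (hw j) (by positivity)] at h4
  simpa [hj.ne'] using h4 j (Finset.mem_univ _)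

theorem mul_pureState_mul {n : Type} [Fintype n] (V : Matrix n n ℂ) (ψ : n → ℂ) :
    V * pureState ψ * Vᴴ = pureState (V *ᵥ ψ) := by
  rw [pureState, pureState, Matrix.mul_vecMulVec, Matrix.vecMulVec_mul, Matrix.star_mulVec]

theorem withAncilla_sum {α : ZMod L → Type} {γ δ : Type} [Fintype γ] [Fintype δ] (σ : γ → ℝ)
    (f : γ → Conf κ → ℂ) (w : δ → ℝ) (φ : δ → Conf α → ℂ) :
    withAncilla (∑ j, (σ j : ℂ) • pureState (f j)) (∑ k, (w k : ℂ) • pureState (φ k)) =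
      ∑ p : γ × δ, ((σ p.1 * w p.2 : ℝ) : ℂ) •
        pureState (tens (fun x => Equiv.refl (κ x × α x)) (f p.1) (φ p.2)) := by
  ext c c'
  simp only [withAncilla, Matrix.sum_apply, Matrix.smul_apply, pureState, Matrix.vecMulVec_apply,
    Pi.star_apply, smul_eq_mul, Fintype.sum_prod_type, Finset.sum_mul_sum]
  refine Finset.sum_congr rfl fun j _ => Finset.sum_congr rfl fun k _ => ?_
  simp only [tens, pairing, Equiv.coe_fn_mk, Equiv.refl_apply, star_mul']
  push_cast
  ring

/-- This is the only way in which channels enter. A single ancilla branch of positive weight is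
kept, and the circuit that prepares it is put in front of the circuit of the channel, which accounts
for the depth `D + D`. Annihilators of the output state remain annihilators of each purified input
branch. -/
theorem IsLocalChannel.exists_circ {R D : ℕ}
    {E : Matrix (Conf κ) (Conf κ) ℂ → Matrix (Conf κ') (Conf κ') ℂ} (hE : IsLocalChannel R D E) :
    ∃ (a b : ZMod L → ℕ) (e : ∀ x, κ x × Fin (a x) ≃ κ' x × Fin (b x))
      (U : Matrix (Conf fun x => κ x × Fin (a x)) (Conf fun x => κ x × Fin (a x)) ℂ)
      (v : ∀ x, Fin (a x) → ℂ), Circ (IsArc R) (D + D) U ∧ (∀ x, IsUnitVec (v x)) ∧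
      ∀ (γ : Type) [Fintype γ] (σ : γ → ℝ) (f : γ → Conf κ → ℂ) (A : Matrix (Conf κ') (Conf κ') ℂ),
        (∀ j, 0 ≤ σ j) → A * E (∑ j, (σ j : ℂ) • pureState (f j)) = 0 → ∀ j, 0 < σ j →
        liftOp e A *ᵥ (U *ᵥ tens (fun x => Equiv.refl (κ x × Fin (a x))) (f j) (prodVec v)) = 0 := by
  obtain ⟨a, b, e, V, n, w, φ, hV, hw, hw1, hφ, hE⟩ := hE
  obtain ⟨k, hk⟩ : ∃ k, 0 < w k := by
    by_contra! h
    have : ∑ j, w j ≤ 0 := Finset.sum_nonpos fun j _ => h j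
    linarith
  obtain ⟨v, W, hv, hW, hvW⟩ := hφ k
  let e₀ : ∀ x, κ x × Fin (a x) ≃ κ x × Fin (a x) := fun x => Equiv.refl _
  refine ⟨a, b, e, V * liftOp (fun x => (e₀ x).trans (Equiv.prodComm _ _)) W, v,
    hV.circ.mul (hW.circ.liftOp _), hv, fun γ _ σ f A hσ hA j hj => ?_⟩
  have h1 := hE (∑ j, (σ j : ℂ) • pureState (f j))
  rw [h1, withAncilla_sum, Finset.mul_sum, Finset.sum_mul] at hA
  simp only [Matrix.mul_smul, Matrix.smul_mul, mul_pureState_mul] at hA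
  have h2 := liftOp_mulVec_eq_zero_of_traceEnv e (fun p : γ × Fin n => mul_nonneg (hσ p.1) (hw p.2))
    hA (j := (j, k)) (mul_pos hj hk)
  rw [← Matrix.mulVec_mulVec, tens_swap, liftOp_mulVec_tens, ← tens_swap]
  simp only at h2
  rw [hvW] at h2
  exact h2

end Channels


/-! ### Arcs of the ring given by integer end points -/

section Geometry

variable {L : ℕ} [NeZero L]

/-- The sites `a, a + 1, …, b - 1` of the ring. -/
noncomputable def seg (L : ℕ) (a b : ℤ) : Finset (ZMod L) := (Finset.Ico a b).image fun i : ℤ => (i : ZMod L)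

theorem mem_seg {a b : ℤ} {x : ZMod L} : x ∈ seg L a b ↔ ∃ i : ℤ, a ≤ i ∧ i < b ∧ (i : ZMod L) = x := by
  simp [seg, and_assoc]

theorem cast_mem_seg {a b i : ℤ} (h : a ≤ i) (h' : i < b) : (i : ZMod L) ∈ seg L a b :=
  mem_seg.2 ⟨i, h, h', rfl⟩

theorem seg_mono {a b c d : ℤ} (h : c ≤ a) (h' : b ≤ d) : seg L a b ⊆ seg L c d :=
  Finset.image_subset_image (Finset.Ico_subset_Ico h h')

theorem exists_eq_add_mul_of_cast_eq {i j : ℤ} (h : (i : ZMod L) = (j : ZMod L)) :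
    ∃ t : ℤ, j = i + t * L := by
  rw [ZMod.intCast_eq_intCast_iff_dvd_sub] at h
  obtain ⟨t, ht⟩ := h
  exact ⟨t, by linarith⟩

theorem eq_of_cast_eq {i j : ℤ} (h : (i : ZMod L) = (j : ZMod L)) (h1 : i < j + L)
    (h2 : j < i + L) : i = j := by
  obtain ⟨t, rfl⟩ := exists_eq_add_mul_of_cast_eq h
  have hL : (0 : ℤ) < L := by exact_mod_cast NeZero.pos L
  have : t < 1 := by nlinarith
  have : -1 < t := by nlinarith
  obtain rfl : t = 0 := by lia
  simp

theorem exists_cast_eq (a : ℤ) (x : ZMod L) : ∃ i : ℤ, a ≤ i ∧ i < a + L ∧ (i : ZMod L) = x := by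
  have hL : (0 : ℤ) < L := by exact_mod_cast NeZero.pos L
  refine ⟨a + ((x.val : ℤ) - a) % L, by have := Int.emod_nonneg ((x.val : ℤ) - a) hL.ne'; lia,
    by have := Int.emod_lt_of_pos ((x.val : ℤ) - a) hL; lia, ?_⟩
  have h : ((((x.val : ℤ) - a) % L : ℤ) : ZMod L) = (((x.val : ℤ) - a : ℤ) : ZMod L) := by
    rw [ZMod.intCast_eq_intCast_iff]
    exact Int.mod_modEq _ _
  rw [Int.cast_add, h]
  simp

theorem seg_eq_univ {a b : ℤ} (h : a + L ≤ b) : seg L a b = Finset.univ := by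
  ext x
  obtain ⟨i, h1, h2, rfl⟩ := exists_cast_eq a x
  simp [cast_mem_seg h1 (h2.trans_le h)]

theorem seg_disjoint {a b c d : ℤ} (h : b ≤ c) (h' : d ≤ a + L) :
    Disjoint (seg L a b) (seg L c d) := by
  rw [Finset.disjoint_left]
  intro x hx hx'
  obtain ⟨i, hi1, hi2, rfl⟩ := mem_seg.1 hx
  obtain ⟨j, hj1, hj2, hij⟩ := mem_seg.1 hx'
  have := eq_of_cast_eq hij (by lia) (by lia)
  lia

theorem seg_union {a b c : ℤ} (h : a ≤ b) (h' : b ≤ c) : seg L a b ∪ seg L b c = seg L a c := by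
  rw [seg, seg, ← Finset.image_union, Finset.Ico_union_Ico_eq_Ico h h', seg]

theorem seg_add (a b : ℤ) : seg L (a + L) (b + L) = seg L a b := by
  ext x
  simp only [mem_seg]
  constructor
  · rintro ⟨i, h1, h2, rfl⟩
    exact ⟨i - L, by lia, by lia, by simp⟩
  · rintro ⟨i, h1, h2, rfl⟩
    exact ⟨i + L, by lia, by lia, by simp⟩

theorem seg_compl (a b : ℤ) : (seg L a b)ᶜ = seg L b (a + L) := by
  ext x
  rw [Finset.mem_compl]
  constructor
  · intro hx
    obtain ⟨i, h1, h2, rfl⟩ := exists_cast_eq a x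
    refine cast_mem_seg ?_ h2
    by_contra! hc
    exact hx (cast_mem_seg h1 hc)
  · exact fun hx hx' => Finset.disjoint_left.1 (seg_disjoint le_rfl le_rfl) hx' hx

theorem nbhd_seg (r : ℕ) (a b : ℤ) : nbhd r (seg L a b) ⊆ seg L (a - r) (b + r) := by
  intro x hx
  obtain ⟨y, hy, k, hk, rfl⟩ := mem_nbhd.1 hx
  obtain ⟨i, h1, h2, rfl⟩ := mem_seg.1 hy
  rw [abs_le] at hk
  exact mem_seg.2 ⟨i + k, by lia, by lia, by push_cast; rfl⟩

theorem arc_eq_seg (a : ℤ) (k : ℕ) : arc (a : ZMod L) k = seg L a (a + k) := by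
  ext x
  simp only [arc, mem_seg, Finset.mem_image, Finset.mem_range]
  constructor
  · rintro ⟨i, hi, rfl⟩
    exact ⟨a + i, by lia, by lia, by push_cast; rfl⟩
  · rintro ⟨i, h1, h2, rfl⟩
    refine ⟨(i - a).toNat, by lia, ?_⟩
    have : ((i - a).toNat : ℤ) = i - a := by lia
    rw [← Int.cast_natCast, this]
    push_cast
    ring

theorem seg_eq_arc {a b : ℤ} (h : a ≤ b) : seg L a b = arc (a : ZMod L) (b - a).toNat := by
  rw [arc_eq_seg]
  congr 1
  lia

theorem card_seg_le (a b : ℤ) : (seg L a b).card ≤ (b - a).toNat := by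
  refine Finset.card_image_le.trans ?_
  simp

/-- Every site of `S` is near both `i` and `j`. The bound `3 * R < L` ensures that the two integer
lifts obtained in this way coincide, so the set cannot wrap around the ring. -/
theorem SmallSupp.subset_seg {R : ℕ} (hR : 3 * R < L) {S : Finset (ZMod L)} (hS : SmallSupp R S)
    {i j m : ℤ} (hi : (i : ZMod L) ∈ S) (hj : (j : ZMod L) ∈ S) (him : i < m) (hmj : m ≤ j)
    (hij : j - i ≤ R) : S ⊆ seg L (m - R) (m + R) := by
  intro s hs
  obtain ⟨k, hk, rfl⟩ := hS _ hi _ hs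
  obtain ⟨l, hl, hkl⟩ := hS _ hj _ hs
  rw [abs_le] at hk hl
  have h : ((i + k : ℤ) : ZMod L) = ((j + l : ℤ) : ZMod L) := by push_cast; exact hkl
  have := eq_of_cast_eq h (by lia) (by lia)
  exact mem_seg.2 ⟨i + k, by lia, by lia, by push_cast; rfl⟩

/-- A small set that is not near the cut `m` lies on one side of it. -/
theorem SmallSupp.subset_or_subset {R : ℕ} (hR : 3 * R < L) {S : Finset (ZMod L)}
    (hS : SmallSupp R S) {x m y : ℤ} (hSxy : S ⊆ seg L x y) (hxy : y + R ≤ x + L)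
    (hq : ¬ S ⊆ seg L (m - R) (m + R)) : S ⊆ seg L x m ∨ S ⊆ seg L m y := by
  by_contra! h
  obtain ⟨s, hs, hs'⟩ := Finset.not_subset.1 h.1
  obtain ⟨t, ht, ht'⟩ := Finset.not_subset.1 h.2
  obtain ⟨j, hj1, hj2, rfl⟩ := mem_seg.1 (hSxy hs)
  obtain ⟨i, hi1, hi2, rfl⟩ := mem_seg.1 (hSxy ht)
  have hj : m ≤ j := by
    by_contra! hc
    exact hs' (cast_mem_seg hj1 hc)
  have hi : i < m := by
    by_contra! hc
    exact ht' (cast_mem_seg hc hi2)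
  obtain ⟨k, hk, hk'⟩ := hS _ ht _ hs
  rw [abs_le] at hk
  have := eq_of_cast_eq (L := L) (i := j) (j := i + k) (by push_cast; exact hk') (by lia) (by lia)
  exact hq (hS.subset_seg hR ht hs hi hj (by lia))

/-- A small set that is neither near the cut `m` nor near the cut `m'` does not cross them. -/
theorem SmallSupp.subset_or_disjoint {R : ℕ} (hR : 3 * R < L) {S : Finset (ZMod L)}
    (hS : SmallSupp R S) {m m' : ℤ}
    (hq : ¬ S ⊆ seg L (m - R) (m + R)) (hq' : ¬ S ⊆ seg L (m' - R) (m' + R)) :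
    S ⊆ seg L m m' ∨ Disjoint (seg L m m') S := by
  by_contra! h
  obtain ⟨s, hs, hs'⟩ := Finset.not_subset.1 h.1
  obtain ⟨t, ht', ht⟩ := Finset.not_disjoint_iff.1 h.2
  obtain ⟨j, hj1, hj2, rfl⟩ := exists_cast_eq m s
  obtain ⟨i, hi1, hi2, rfl⟩ := mem_seg.1 ht'
  have hj : m' ≤ j := by
    by_contra! hc
    exact hs' (cast_mem_seg hj1 hc)
  obtain ⟨k, hk, hk'⟩ := hS _ ht _ hs
  rw [abs_le] at hk
  obtain ⟨u, hu⟩ := exists_eq_add_mul_of_cast_eq (L := L) (i := i + k) (j := j)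
    (by push_cast; exact hk'.symm)
  have hu1 : u < 2 := by nlinarith
  have hu0 : -1 < u := by nlinarith
  -- The set leaves the segment either through its end `m'` or, one turn around the ring, through
  -- its beginning `m`.
  obtain rfl | rfl : u = 0 ∨ u = 1 := by lia
  · exact hq' (hS.subset_seg hR ht hs hi2 hj (by lia))
  · apply hq
    rw [← seg_add]
    have := hS.subset_seg hR (i := j) (j := i + L) (m := m + L) hs (by simpa using ht) (by lia)
      (by lia) (by lia)
    convert this using 2 <;> ring

/-- Region 0 is written as a segment; the region that contains the site right after it comes next,
and the remaining one fills the complement. The permutation records this cyclic order. -/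
theorem exists_seg_of_isArcPartition {ℓ : ℕ} (hℓ : 0 < ℓ) {P : Fin 3 → Finset (ZMod L)}
    (hP : IsArcPartition ℓ P) : ∃ (σ : Equiv.Perm (Fin 3)) (a b c : ℤ), a + ℓ ≤ b ∧ b + ℓ ≤ c ∧
      c + ℓ ≤ a + L ∧ P (σ 0) = seg L a b ∧ P (σ 1) = seg L b c ∧ P (σ 2) = seg L c (a + L) := by
  obtain ⟨h1, h2, h3⟩ := hP
  -- An arc that contains `b` but not `b - 1` must begin at `b`.
  have hstart : ∀ i (b : ℤ), (b : ZMod L) ∈ P i → ((b - 1 : ℤ) : ZMod L) ∉ P i →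
      ∃ m : ℕ, P i = seg L b (b + m) := by
    intro i b hb hb'
    obtain ⟨-, x, m, hx⟩ := h1 i
    refine ⟨m, ?_⟩
    rw [hx, arc] at hb hb'
    obtain ⟨k, hk, hkb⟩ := Finset.mem_image.1 hb
    rcases Nat.eq_zero_or_pos k with rfl | hk0
    · rw [hx, ← arc_eq_seg, ← hkb]
      simp
    · exfalso
      apply hb'
      refine Finset.mem_image.2 ⟨k - 1, by simp at hk ⊢; omega, ?_⟩
      push_cast
      rw [← hkb, Nat.cast_sub hk0]
      push_cast
      ring
  have hne : ∀ i, (P i).Nonempty := fun i => Finset.card_pos.1 (hℓ.trans_le (h1 i).1)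
  obtain ⟨a, m, hm⟩ : ∃ (a : ℤ) (m : ℕ), P 0 = seg L a (a + m) := by
    obtain ⟨-, x, m, hx⟩ := h1 0
    refine ⟨(x.val : ℤ), m, ?_⟩
    rw [hx, ← arc_eq_seg]
    simp
  have hmL : (m : ℤ) < L := by
    by_contra! hc
    obtain ⟨y, hy⟩ := hne 1
    have h01 := h2 0 1 (by decide)
    rw [hm, seg_eq_univ (by lia)] at h01
    exact Finset.disjoint_left.1 h01 (Finset.mem_univ _) hy
  have hm0 : (ℓ : ℤ) ≤ m := by
    have := (h1 0).1.trans (hm ▸ card_seg_le _ _)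
    lia
  have key : ∀ i j : Fin 3, (∀ k, k = 0 ∨ k = i ∨ k = j) → i ≠ 0 → j ≠ 0 → i ≠ j →
      ((a + m : ℤ) : ZMod L) ∈ P i → ∃ b c : ℤ, a + ℓ ≤ b ∧ b + ℓ ≤ c ∧
      c + ℓ ≤ a + L ∧ P 0 = seg L a b ∧ P i = seg L b c ∧ P j = seg L c (a + L) := by
    intro i j hk hi hj hij hmem
    obtain ⟨n, hn⟩ := hstart i (a + m) hmem (by
      refine Finset.disjoint_left.1 (h2 0 i hi.symm) ?_
      rw [hm]
      exact cast_mem_seg (by lia) (by lia))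
    have hn0 : (ℓ : ℤ) ≤ n := by
      have := (h1 i).1.trans (hn ▸ card_seg_le _ _)
      lia
    have hn1 : a + m + n ≤ a + L := by
      by_contra! hc
      have h0i := h2 0 i hi.symm
      rw [Finset.disjoint_left] at h0i
      refine h0i (a := (a : ZMod L)) ?_ ?_
      · rw [hm]
        exact cast_mem_seg (by lia) (by lia)
      · rw [hn]
        refine mem_seg.2 ⟨a + L, by lia, by lia, by simp⟩
    have hPj : P j = seg L (a + m + n) (a + L) := by
      rw [← seg_compl, ← seg_union (b := a + m) (by lia) (by lia), ← hm, ← hn]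
      ext x
      simp only [Finset.mem_compl, Finset.mem_union]
      constructor
      · rintro hx (hx' | hx')
        · exact Finset.disjoint_left.1 (h2 j 0 hj) hx hx'
        · exact Finset.disjoint_left.1 (h2 j i hij.symm) hx hx'
      · intro hx
        obtain ⟨k, hk'⟩ := h3 x
        rcases hk k with rfl | rfl | rfl
        · exact absurd (Or.inl hk') hx
        · exact absurd (Or.inr hk') hx
        · exact hk'
    refine ⟨a + m, a + m + n, by lia, by lia, ?_, hm, hn, hPj⟩
    have := (h1 j).1.trans (hPj ▸ card_seg_le _ _)
    lia
  obtain ⟨k, hk⟩ := h3 ((a + m : ℤ) : ZMod L)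
  have hk0 : k ≠ 0 := by
    rintro rfl
    rw [hm] at hk
    exact Finset.disjoint_left.1 (seg_disjoint (L := L) (a := a) (b := a + m) (c := a + m)
      (d := a + m + 1) le_rfl (by lia)) hk (cast_mem_seg le_rfl (by lia))
  fin_cases k
  · simp at hk0
  · obtain ⟨b, c, h⟩ := key 1 2 (by decide) (by decide) (by decide) (by decide) hk
    exact ⟨1, a, b, c, h⟩
  · obtain ⟨b, c, h⟩ := key 2 1 (by decide) (by decide) (by decide) (by decide) hk
    exact ⟨Equiv.swap 1 2, a, b, c, h⟩

end Geometry


/-! ### The symmetry U_CZX, its truncations and its anomaly -/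

section QubitRing

variable {L : ℕ} [NeZero L]

/-- Flipping all qubits in `I`. -/
def flipOn (I : Finset (ZMod L)) (c : Conf (Qubits L)) : Conf (Qubits L) :=
  fun x => if x ∈ I then c x + 1 else c x

theorem fin_two_add_one_add_one (a : Fin 2) : a + 1 + 1 = a := by
  fin_cases a <;> rfl

theorem flipOn_flipOn (I : Finset (ZMod L)) (c : Conf (Qubits L)) : flipOn I (flipOn I c) = c := by
  funext x
  by_cases hx : x ∈ I <;> simp [flipOn, hx, fin_two_add_one_add_one]

theorem flipOn_eq_iff {I : Finset (ZMod L)} {c d : Conf (Qubits L)} :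
    flipOn I c = d ↔ c = flipOn I d :=
  ⟨fun h => by rw [← h, flipOn_flipOn], fun h => by rw [h, flipOn_flipOn]⟩

theorem flipOn_union {I J : Finset (ZMod L)} (h : Disjoint I J) (c : Conf (Qubits L)) :
    flipOn (I ∪ J) c = flipOn I (flipOn J c) := by
  funext x
  by_cases hI : x ∈ I
  · have hJ : x ∉ J := Finset.disjoint_left.1 h hI
    simp [flipOn, hI, hJ]
  · simp [flipOn, hI]

/-- The product of the Pauli matrices `X` of the sites in `I`. -/
def xOn (I : Finset (ZMod L)) : Matrix (Conf (Qubits L)) (Conf (Qubits L)) ℂ :=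
  fun c c' => if c' = flipOn I c then 1 else 0

theorem xOn_mul (I : Finset (ZMod L)) (A : Matrix (Conf (Qubits L)) (Conf (Qubits L)) ℂ)
    (c c' : Conf (Qubits L)) : (xOn I * A) c c' = A (flipOn I c) c' := by
  simp [Matrix.mul_apply, xOn]

theorem mul_xOn (I : Finset (ZMod L)) (A : Matrix (Conf (Qubits L)) (Conf (Qubits L)) ℂ)
    (c c' : Conf (Qubits L)) : (A * xOn I) c c' = A c (flipOn I c') := by
  have : ∀ d, (c' = flipOn I d) = (d = flipOn I c') := fun d =>
    propext ⟨fun h => by rw [h, flipOn_flipOn], fun h => by rw [h, flipOn_flipOn]⟩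
  simp [Matrix.mul_apply, xOn, this]

theorem xOn_mul_self (I : Finset (ZMod L)) : xOn I * xOn I = 1 := by
  ext c c'
  rw [xOn_mul, xOn, flipOn_flipOn, Matrix.one_apply]
  simp only [eq_comm]

theorem xOn_union {I J : Finset (ZMod L)} (h : Disjoint I J) :
    xOn (I ∪ J) = xOn I * xOn J := by
  ext c c'
  rw [xOn_mul, xOn, xOn, Finset.union_comm, flipOn_union h.symm]

theorem xOn_conjTranspose (I : Finset (ZMod L)) : (xOn I)ᴴ = xOn I := by
  ext c c'
  rw [Matrix.conjTranspose_apply, xOn, xOn, apply_ite star, star_one, star_zero]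
  congr 1
  rw [eq_iff_iff, eq_comm, flipOn_eq_iff]

theorem xOn_unitary (I : Finset (ZMod L)) :
    xOn I ∈ Matrix.unitaryGroup (Conf (Qubits L)) ℂ := by
  rw [Matrix.mem_unitaryGroup_iff, Matrix.star_eq_conjTranspose, xOn_conjTranspose, xOn_mul_self]

theorem suppOn_xOn (I : Finset (ZMod L)) : SuppOn I (xOn I) := by
  intro i hi
  have h1 : ∀ c : Conf (Qubits L), flipOn I c i = c i := fun c => by simp [flipOn, hi]
  refine ⟨fun c c' hc => if_neg fun h => hc (by rw [h, h1]), fun c c' k hc => ?_⟩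
  unfold xOn
  congr 1
  have : flipOn I (Function.update c i k) = Function.update (flipOn I c) i k := by
    funext j
    by_cases hj : j = i
    · subst hj; simp [flipOn, hi]
    · simp [flipOn, hj]
  rw [this, eq_iff_iff]
  constructor
  · intro h
    funext j
    by_cases hj : j = i
    · subst hj; rw [h1, hc]
    · simpa [hj] using congrFun h j
  · rintro rfl
    rfl

theorem suppOn_diagonal {ι : Type} [Fintype ι] [DecidableEq ι] {K : ι → Type}
    [∀ i, Fintype (K i)] [∀ i, DecidableEq (K i)] {S : Finset ι} {d : (∀ i, K i) → ℂ}
    (hd : DependsOn d (↑S : Set ι)) : SuppOn S (Matrix.diagonal d) := by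
  intro i hi
  refine ⟨fun c c' hc => Matrix.diagonal_apply_ne _ fun h => hc (congrFun h i),
    fun c c' k hc => ?_⟩
  have h1 := (suppOn_one (K := K) S i hi).2 c c' k hc
  rw [Matrix.diagonal_apply, Matrix.diagonal_apply]
  rw [Matrix.one_apply, Matrix.one_apply] at h1
  have h2 : d (Function.update c i k) = d c := hd fun j hj => by
    have : j ≠ i := by rintro rfl; exact hi (by simpa using hj)
    simp [this]
  rw [h2]
  split_ifs at h1 ⊢ <;> simp_all

/-- A family of diagonal sign gates on the bonds `{x, x + 1}`. -/
structure BondSigns (L : ℕ) [NeZero L] where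
  /-- the sign of a configuration at a bond -/
  sign : ZMod L → Conf (Qubits L) → ℂ
  sign_mul_self : ∀ x c, sign x c * sign x c = 1
  star_sign : ∀ x c, star (sign x c) = sign x c
  dependsOn : ∀ x, DependsOn (sign x) (↑({x, x + 1} : Finset (ZMod L)) : Set (ZMod L))

variable (β : BondSigns L)

/-- The product of the sign gates on the bonds in `F`. -/
def BondSigns.gate (F : Finset (ZMod L)) : Matrix (Conf (Qubits L)) (Conf (Qubits L)) ℂ :=
  Matrix.diagonal fun c => ∏ x ∈ F, β.sign x c

theorem BondSigns.gate_union {F F' : Finset (ZMod L)} (h : Disjoint F F') :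
    β.gate (F ∪ F') = β.gate F * β.gate F' := by
  rw [gate, gate, gate, Matrix.diagonal_mul_diagonal]
  congr 1
  funext c
  exact Finset.prod_union h

theorem BondSigns.gate_conjTranspose (F : Finset (ZMod L)) : (β.gate F)ᴴ = β.gate F := by
  rw [gate, Matrix.diagonal_conjTranspose]
  congr 1
  funext c
  simp [β.star_sign, star_prod]

theorem BondSigns.gate_mul_self (F : Finset (ZMod L)) : β.gate F * β.gate F = 1 := by
  rw [gate, Matrix.diagonal_mul_diagonal, ← Matrix.diagonal_one]
  congr 1
  funext c
  rw [← Finset.prod_mul_distrib]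
  exact Finset.prod_eq_one fun x _ => β.sign_mul_self x c

theorem BondSigns.gate_unitary (F : Finset (ZMod L)) :
    β.gate F ∈ Matrix.unitaryGroup (Conf (Qubits L)) ℂ := by
  rw [Matrix.mem_unitaryGroup_iff, Matrix.star_eq_conjTranspose, gate_conjTranspose, gate_mul_self]

theorem BondSigns.suppOn_gate {F S : Finset (ZMod L)} (h : ∀ x ∈ F, x ∈ S ∧ x + 1 ∈ S) :
    SuppOn S (β.gate F) := by
  refine suppOn_diagonal fun c c' hc => Finset.prod_congr rfl fun x hx => β.dependsOn x ?_
  intro i hi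
  simp only [Finset.coe_insert, Finset.coe_singleton, Set.mem_insert_iff,
    Set.mem_singleton_iff] at hi
  rcases hi with rfl | rfl
  · exact hc _ (by simpa using (h _ hx).1)
  · exact hc _ (by simpa using (h _ hx).2)

theorem BondSigns.suppOn_gate_seg (a b : ℤ) : SuppOn (seg L a (b + 1)) (β.gate (seg L a b)) := by
  refine β.suppOn_gate fun x hx => ?_
  obtain ⟨i, h1, h2, rfl⟩ := mem_seg.1 hx
  exact ⟨cast_mem_seg h1 (by lia), mem_seg.2 ⟨i + 1, by lia, by lia, by push_cast; rfl⟩⟩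

/-- The product of the sign gates on the bonds in `F` and the Pauli matrices `X` of the sites in
`I`. -/
def BondSigns.op (F I : Finset (ZMod L)) : Matrix (Conf (Qubits L)) (Conf (Qubits L)) ℂ :=
  β.gate F * xOn I

theorem BondSigns.op_unitary (F I : Finset (ZMod L)) :
    β.op F I ∈ Matrix.unitaryGroup (Conf (Qubits L)) ℂ :=
  mul_mem (β.gate_unitary F) (xOn_unitary I)

theorem BondSigns.op_erase {F I : Finset (ZMod L)} {x : ZMod L} (hx : x ∈ F) :
    β.op F I = β.gate {x} * β.op (F.erase x) I := by
  rw [op, op, ← mul_assoc, ← gate_union, ← Finset.insert_eq, Finset.insert_erase hx]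
  simp

theorem BondSigns.op_union {F F' I I' S S' : Finset (ZMod L)} (hS : Disjoint S S')
    (hF : ∀ x ∈ F, x ∈ S ∧ x + 1 ∈ S) (hF' : ∀ x ∈ F', x ∈ S' ∧ x + 1 ∈ S') (hI : I ⊆ S)
    (hI' : I' ⊆ S') : β.op (F ∪ F') (I ∪ I') = β.op F I * β.op F' I' := by
  have h1 : Disjoint F F' := hS.mono (fun x hx => (hF x hx).1) (fun x hx => (hF' x hx).1)
  have h2 : Disjoint I I' := hS.mono hI hI'
  rw [op, op, op, gate_union _ h1, xOn_union h2]
  have := ((suppOn_xOn I).mono hI).commute (β.suppOn_gate hF') hS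
  calc β.gate F * β.gate F' * (xOn I * xOn I') = β.gate F * (β.gate F' * xOn I) * xOn I' := by
        simp only [mul_assoc]
    _ = _ := by rw [← this]; simp only [mul_assoc]

theorem BondSigns.suppOn_op {F I S : Finset (ZMod L)} (hF : ∀ x ∈ F, x ∈ S ∧ x + 1 ∈ S)
    (hI : I ⊆ S) : SuppOn S (β.op F I) :=
  (β.suppOn_gate hF).mul ((suppOn_xOn I).mono hI)

/-- The matrix elements of the controlled-Z gate. -/
def czVal (a b : Fin 2) : ℂ := if a = 1 ∧ b = 1 then -1 else 1

/-- The matrix elements of the Pauli matrix `Z`. -/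
def zVal (a : Fin 2) : ℂ := if a = 1 then -1 else 1

/-- Source of the anomaly: a controlled-Z gate times its conjugate under X ⊗ X is −Z ⊗ Z, not the
identity. -/
theorem czVal_mul (a b : Fin 2) : czVal a b * czVal (a + 1) (b + 1) = -(zVal a * zVal b) := by
  fin_cases a <;> fin_cases b <;> simp [czVal, zVal]

/-- The signs of the controlled-Z gates after flipping the qubits in `J`. -/
def czSigns (L : ℕ) [NeZero L] (J : Finset (ZMod L)) : BondSigns L where
  sign x c := czVal (flipOn J c x) (flipOn J c (x + 1))
  sign_mul_self x c := by unfold czVal; split_ifs <;> simp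
  star_sign x c := by unfold czVal; split_ifs <;> simp
  dependsOn x c c' h := by
    have h1 := h x (by simp)
    have h2 := h (x + 1) (by simp)
    simp only [flipOn]
    rw [h1, h2]

theorem flipOn_empty (c : Conf (Qubits L)) : flipOn ∅ c = c := by
  funext x; simp [flipOn]

/-- Moving the flips past the controlled-Z gates changes the signs on the bonds. General sign
families are introduced so that both orders of the factors have the same form. -/
theorem xOn_mul_gate (J F : Finset (ZMod L)) :
    xOn J * (czSigns L ∅).gate F = (czSigns L J).op F J := by
  ext c c'
  rw [xOn_mul, BondSigns.op, mul_xOn, BondSigns.gate, BondSigns.gate, Matrix.diagonal_apply,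
    Matrix.diagonal_apply]
  simp only [flipOn_eq_iff, czSigns, flipOn_empty]

theorem allX_eq : allX L = xOn Finset.univ := by
  ext c c'
  rw [allX, xOn]
  have h : ∀ a b : Fin 2, (!![0, 1; 1, 0] : Matrix (Fin 2) (Fin 2) ℂ) a b =
      if b = a + 1 then 1 else 0 := by
    intro a b
    fin_cases a <;> fin_cases b <;> simp
  simp only [h]
  rw [Fintype.prod_boole]
  congr 1
  rw [eq_iff_iff, funext_iff]
  simp [flipOn]

theorem allCZ_eq : allCZ L = (czSigns L ∅).gate Finset.univ := by
  simp only [allCZ, BondSigns.gate, czSigns, flipOn_empty, czVal]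

/-- The sign `(-1)^(c x)`, for `x` an integer. -/
def zSign (x : ZMod L) (c : Conf (Qubits L)) : ℂ := zVal (c x)

theorem zSign_mul_self (x : ZMod L) (c : Conf (Qubits L)) : zSign x c * zSign x c = 1 := by
  unfold zSign zVal; split_ifs <;> simp

theorem czSigns_mul_flip {I : Finset (ZMod L)} {x : ZMod L} (hx : x ∈ I) (hx' : x + 1 ∈ I)
    (c : Conf (Qubits L)) : (czSigns L ∅).sign x c * (czSigns L ∅).sign x (flipOn I c) =
      - (zSign x c * zSign (x + 1) c) := by
  have h : ∀ y ∈ I, flipOn I c y = c y + 1 := fun y hy => if_pos hy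
  simp only [czSigns, flipOn_empty, zSign]
  rw [h x hx, h _ hx', czVal_mul]

theorem seg_succ {a b : ℤ} (h : a ≤ b) : seg L a (b + 1) = insert (b : ZMod L) (seg L a b) := by
  rw [← seg_union h (by lia : b ≤ b + 1), Finset.insert_eq, Finset.union_comm]
  congr 1
  ext x
  simp only [mem_seg, Finset.mem_singleton]
  constructor
  · rintro ⟨i, h1, h2, rfl⟩
    congr 1
    lia
  · rintro rfl
    exact ⟨b, by lia, by lia, rfl⟩

/-- The product over the bonds telescopes: each interior Z occurs twice and drops out, leaving one
sign per bond and the Z at either end. -/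
theorem prod_czSigns_mul_flip (p : ℤ) (n : ℕ) (hn : n ≤ L) {I : Finset (ZMod L)}
    (hI : seg L p (p + n + 1) ⊆ I) (c : Conf (Qubits L)) :
    ∏ x ∈ seg L p (p + n), ((czSigns L ∅).sign x c * (czSigns L ∅).sign x (flipOn I c)) =
      (-1) ^ n * (zSign (p : ZMod L) c * zSign ((p + n : ℤ) : ZMod L) c) := by
  induction n with
  | zero => simp [seg, zSign_mul_self]
  | succ n ih =>
    have ih' := ih (by lia) ((seg_mono le_rfl (by push_cast; lia)).trans hI)
    have e : (p + ((n + 1 : ℕ) : ℤ)) = p + n + 1 := by push_cast; ring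
    have hnot : ((p + n : ℤ) : ZMod L) ∉ seg L p (p + n) := by
      refine Finset.disjoint_right.1 (seg_disjoint (a := p) (b := p + n) (c := p + n)
        (d := p + n + 1) le_rfl (by lia)) (cast_mem_seg le_rfl (by lia))
    rw [e, seg_succ (by lia), Finset.prod_insert hnot, ih', czSigns_mul_flip]
    · have h := zSign_mul_self ((p + n : ℤ) : ZMod L) c
      rw [show ((p + n + 1 : ℤ) : ZMod L) = ((p + n : ℤ) : ZMod L) + 1 by push_cast; ring, pow_succ]
      linear_combination (-(-1) ^ n * zSign (p : ZMod L) c *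
        zSign (((p + n : ℤ) : ZMod L) + 1) c) * h
    · exact hI (cast_mem_seg (by lia) (by lia))
    · exact hI (mem_seg.2 ⟨p + n + 1, by lia, by lia, by push_cast; rfl⟩)

/-- The Pauli matrix `Z` at the site `x`. -/
def zOp (x : ZMod L) : Matrix (Conf (Qubits L)) (Conf (Qubits L)) ℂ := Matrix.diagonal (zSign x)

theorem suppOn_zOp (x : ZMod L) : SuppOn {x} (zOp x) :=
  suppOn_diagonal fun c c' h => by rw [zSign, zSign, h x (by simp)]

theorem zOp_mul_self (x : ZMod L) : zOp x * zOp x = 1 := by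
  rw [zOp, Matrix.diagonal_mul_diagonal, ← Matrix.diagonal_one]
  congr 1
  funext c
  exact zSign_mul_self x c

theorem zOp_conjTranspose (x : ZMod L) : (zOp x)ᴴ = zOp x := by
  rw [zOp, Matrix.diagonal_conjTranspose]
  congr 1
  funext c
  simp only [Pi.star_apply, zSign, zVal]
  split_ifs <;> simp

theorem zOp_unitary (x : ZMod L) : zOp x ∈ Matrix.unitaryGroup (Conf (Qubits L)) ℂ := by
  rw [Matrix.mem_unitaryGroup_iff, Matrix.star_eq_conjTranspose, zOp_conjTranspose, zOp_mul_self]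

theorem op_mul_zOp {I F : Finset (ZMod L)} {x : ZMod L} (hx : x ∈ I) (β : BondSigns L) :
    β.op F I * zOp x = -(zOp x * β.op F I) := by
  have h : xOn I * zOp x = -(zOp x * xOn I) := by
    ext c c'
    rw [xOn_mul, Matrix.neg_apply, mul_xOn, zOp, Matrix.diagonal_apply, Matrix.diagonal_apply]
    simp only [flipOn_eq_iff]
    split_ifs
    · have h1 : ∀ a : Fin 2, zVal (a + 1) = -zVal a := by
        intro a
        fin_cases a <;> simp [zVal]
      have h2 : flipOn I c x = c x + 1 := if_pos hx
      rw [zSign, zSign, h2, h1]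
    · simp
  have h' : β.gate F * zOp x = zOp x * β.gate F := by
    rw [BondSigns.gate, zOp, Matrix.diagonal_mul_diagonal, Matrix.diagonal_mul_diagonal]
    congr 1
    funext c
    exact mul_comm _ _
  rw [BondSigns.op, mul_assoc, h, mul_neg, ← mul_assoc, h', mul_assoc]

/-- The full symmetry squares to one, but its truncation squares to charges at the two ends of the
interval. The charge at one end alone anticommutes with the truncation (`op_mul_zOp`), and this will
be contradictory. -/
theorem op_mul_self (p : ℤ) (n : ℕ) (hn : n ≤ L) :
    (czSigns L ∅).op (seg L p (p + n)) (seg L p (p + n + 1)) *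
      (czSigns L ∅).op (seg L p (p + n)) (seg L p (p + n + 1)) =
      ((-1) ^ n : ℂ) • (zOp (p : ZMod L) * zOp ((p + n : ℤ) : ZMod L)) := by
  rw [BondSigns.op, mul_assoc, ← mul_assoc (xOn _)]
  ext c c'
  rw [BondSigns.gate, Matrix.diagonal_mul, mul_xOn, xOn_mul, Matrix.diagonal_apply,
    Matrix.smul_apply, zOp, zOp, Matrix.diagonal_mul_diagonal, Matrix.diagonal_apply]
  simp only [flipOn_eq_iff, flipOn_flipOn]
  split_ifs with h
  · subst h
    rw [← Finset.prod_mul_distrib, prod_czSigns_mul_flip p n hn subset_rfl, smul_eq_mul]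
  · simp

/-- `U_CZX` squares to one on a ring of even length. -/
theorem czx_mul_self (hL : Even L) : czx L * czx L = 1 := by
  rw [czx, allX_eq, allCZ_eq]
  ext c c'
  rw [mul_assoc, xOn_mul, BondSigns.gate, Matrix.diagonal_mul, xOn_mul, Matrix.diagonal_apply,
    Matrix.one_apply, flipOn_flipOn]
  split_ifs with h
  · subst h
    rw [mul_comm, ← Finset.prod_mul_distrib]
    -- On the closed ring the first and the last Z sit on the same site and cancel; the sign (-1)^L
    -- is 1 because `L` is even.
    have h0 := prod_czSigns_mul_flip (L := L) 0 L le_rfl (Finset.subset_univ _) c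
    rw [seg_eq_univ (by lia)] at h0
    rw [h0, hL.neg_one_pow]
    simp [zSign_mul_self]
  · simp

theorem czx_conjTranspose (hL : Even L) : (czx L)ᴴ = czx L := by
  have hu : czx L ∈ Matrix.unitaryGroup (Conf (Qubits L)) ℂ := by
    rw [czx, allX_eq, allCZ_eq]
    exact mul_mem (xOn_unitary _) (BondSigns.gate_unitary _ _)
  calc (czx L)ᴴ = (czx L)ᴴ * (czx L * czx L) := by rw [czx_mul_self hL, mul_one]
    _ = _ := by rw [← mul_assoc, unitary_conjTranspose_mul hu, one_mul]

end QubitRing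


/-! ### Rank rigidity for three regions, and the contradiction with the anomaly -/

section Tripartite

variable {ι : Type} [Fintype ι] [DecidableEq ι] {K : ι → Type} [∀ i, Fintype (K i)]
  [∀ i, DecidableEq (K i)]

theorem srank_smul {z : ℂ} (hz : z ≠ 0) (A : Finset ι) (ψ : (∀ i, K i) → ℂ) :
    srank A (z • ψ) = srank A ψ := by
  have : cutMat A (z • ψ) = z • cutMat A ψ := rfl
  rw [srank, this, Matrix.rank_smul_of_ne_zero hz, srank]

theorem IsProductAcross.mulVec_of_disjoint {C S : Finset ι} {O : Matrix (∀ i, K i) (∀ i, K i) ℂ}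
    (hO : SuppOn S O) (hS : Disjoint C S) {ψ : (∀ i, K i) → ℂ} (h : IsProductAcross C ψ) :
    IsProductAcross C (O *ᵥ ψ) := by
  have := h.mulVec (suppOn_one ∅) hO (Finset.empty_subset C) hS
  rwa [one_mul] at this

theorem IsProductAcross.mulVec_of_subset {C S : Finset ι} {O : Matrix (∀ i, K i) (∀ i, K i) ℂ}
    (hO : SuppOn S O) (hS : S ⊆ C) {ψ : (∀ i, K i) → ℂ} (h : IsProductAcross C ψ) :
    IsProductAcross C (O *ᵥ ψ) := by
  have := h.mulVec hO (suppOn_one ∅) hS (by simp)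
  rwa [mul_one] at this

theorem mulVec_unitary_ne_zero {n : Type} [Fintype n] [DecidableEq n] {U : Matrix n n ℂ}
    (hU : U ∈ Matrix.unitaryGroup n ℂ) {ψ : n → ℂ} (hψ : ψ ≠ 0) : U *ᵥ ψ ≠ 0 := by
  intro h
  apply hψ
  have := congrArg (Uᴴ *ᵥ ·) h
  simpa [unitary_conjTranspose_mul hU] using this

/-- Schmidt ranks of a state that is uncorrelated between `A₁ ∪ A₂` and `C` and agrees, up to a
unitary acting between `A₁` and `C`, with a product state. -/
theorem srank_eq_mul_of_product {A₁ A₂ C : Finset ι} (hA : Disjoint A₁ A₂)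
    (hC : Disjoint (A₁ ∪ A₂) C) {χ φ : (∀ i, K i) → ℂ} (hχ : χ ≠ 0) (hφ : φ ≠ 0)
    (huc : Uncorr (A₁ ∪ A₂) C χ) (hp : IsProductAcross (A₁ ∪ A₂) φ)
    (h1 : srank (A₁ ∪ A₂ ∪ C) χ = srank (A₁ ∪ A₂ ∪ C) φ)
    (h2 : srank (A₁ ∪ C) χ = srank (A₁ ∪ C) φ) (h3 : srank A₂ χ = srank A₂ φ) :
    srank A₁ χ = srank A₂ χ * srank (A₁ ∪ A₂) χ := by
  have hC1 : Disjoint A₁ C := (Finset.disjoint_union_left.1 hC).1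
  have hpA := srank_of_isProductAcross hφ hp
  have e1 := srank_union hC hχ huc
  have e2 := srank_union hC hφ (hp.uncorr subset_rfl hC)
  have e3 := srank_union hC1 hχ (huc.mono Finset.subset_union_left subset_rfl)
  have e4 := srank_union hC1 hφ (hp.uncorr Finset.subset_union_left hC)
  have hd : Disjoint A₂ (A₁ ∪ A₂)ᶜ := disjoint_compl_right.mono_left Finset.subset_union_right
  have e5 := srank_union hd hφ (hp.uncorr Finset.subset_union_right disjoint_compl_right)
  have hcompl : A₂ ∪ (A₁ ∪ A₂)ᶜ = A₁ᶜ := by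
    ext x
    have h12 : x ∈ A₁ → x ∉ A₂ := fun h => Finset.disjoint_left.1 hA h
    simp only [Finset.mem_union, Finset.mem_compl]
    tauto
  -- In `φ` the region `A₁ ∪ A₂` is pure, so its two halves have equal rank.
  rw [hcompl, srank_compl, srank_compl, hpA, mul_one] at e5
  rw [h1, e2, hpA, one_mul] at e1
  rw [h2, e4, e5, e1, ← h3, ← mul_assoc] at e3
  exact (Nat.eq_of_mul_eq_mul_right (Nat.pos_of_ne_zero (srank_ne_zero hχ C)) e3).symm

/-- A tripartite state that is obtained from a tripartite product state in two ways, by unitaries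
acting across disjoint sets of boundaries of the tripartition, is a product state. -/
theorem isProductAcross_of_tripartite {A₁ A₂ B₁ B₂ C₁ C₂ : Finset ι}
    (hd : [A₁, A₂, B₁, B₂, C₁, C₂].Pairwise Disjoint)
    (hu : A₁ ∪ A₂ ∪ (B₁ ∪ B₂) ∪ (C₁ ∪ C₂) = Finset.univ)
    {S t t' : Matrix (∀ i, K i) (∀ i, K i) ℂ} (hS : SuppOn (A₂ ∪ B₁) S) (ht : SuppOn (C₂ ∪ A₁) t)
    (ht' : SuppOn (B₂ ∪ C₁) t') (hSu : S ∈ Matrix.unitaryGroup (∀ i, K i) ℂ)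
    (htu : t ∈ Matrix.unitaryGroup (∀ i, K i) ℂ) (htu' : t' ∈ Matrix.unitaryGroup (∀ i, K i) ℂ)
    {φ φ' χ : (∀ i, K i) → ℂ} {z : ℂ} (hz : z ≠ 0) (hχ : χ ≠ 0) (hφ : S *ᵥ φ = χ)
    (hφ' : t *ᵥ (t' *ᵥ φ') = z • χ) (hA : IsProductAcross (A₁ ∪ A₂) φ)
    (hC : IsProductAcross (C₁ ∪ C₂) φ)
    (hA' : IsProductAcross (A₁ ∪ A₂) φ') (hB' : IsProductAcross (B₁ ∪ B₂) φ') :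
    IsProductAcross (A₁ ∪ A₂) χ ∧ IsProductAcross (B₁ ∪ B₂) χ := by
  simp only [List.pairwise_cons, List.mem_cons, List.not_mem_nil, or_false, forall_eq_or_imp,
    forall_eq, false_imp_iff, implies_true, List.Pairwise.nil, and_true] at hd
  obtain ⟨⟨d12, d13, d14, d15, d16⟩, ⟨d23, d24, d25, d26⟩, ⟨d34, d35, d36⟩, ⟨d45, d46⟩, d56⟩ := hd
  have hφ0 : φ ≠ 0 := by
    rintro rfl
    exact hχ (by rw [← hφ, Matrix.mulVec_zero])
  have hφ0' : φ' ≠ 0 := by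
    rintro rfl
    rw [Matrix.mulVec_zero, Matrix.mulVec_zero] at hφ'
    exact smul_ne_zero hz hχ hφ'.symm
  have inv : ∀ T : Finset ι, (Disjoint T (A₂ ∪ B₁)) → srank T χ = srank T φ := by
    intro T hT
    rw [← hφ, srank_unitary_of_disjoint hS hT hSu]
  have invt : ∀ T : Finset ι, (Disjoint T (C₂ ∪ A₁) ∨ C₂ ∪ A₁ ⊆ T) →
      (Disjoint T (B₂ ∪ C₁) ∨ B₂ ∪ C₁ ⊆ T) → srank T χ = srank T φ' := by
    intro T h1 h2
    rw [← srank_smul hz, ← hφ']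
    rcases h1 with h1 | h1 <;> rcases h2 with h2 | h2
    · rw [srank_unitary_of_disjoint ht h1 htu, srank_unitary_of_disjoint ht' h2 htu']
    · rw [srank_unitary_of_disjoint ht h1 htu, srank_unitary (ht'.mono h2) htu']
    · rw [srank_unitary (ht.mono h1) htu, srank_unitary_of_disjoint ht' h2 htu']
    · rw [srank_unitary (ht.mono h1) htu, srank_unitary (ht'.mono h2) htu']
  have hCχ : IsProductAcross (C₁ ∪ C₂) χ := by
    rw [← hφ]
    refine hC.mulVec_of_disjoint hS ?_
    simp only [Finset.disjoint_union_left, Finset.disjoint_union_right]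
    exact ⟨⟨d25.symm, d26.symm⟩, ⟨d35.symm, d36.symm⟩⟩
  -- The region C₂ serves as a probe. It is uncorrelated with A in `χ`, and the unitary `t` between
  -- C₂ and A₁ is invisible to ranks of regions that contain or avoid both.
  have k1 : srank A₁ χ = srank A₂ χ * srank (A₁ ∪ A₂) χ := by
    refine srank_eq_mul_of_product (C := C₂) (φ := φ') d12 ?_ hχ hφ0' ?_ hA' ?_ ?_ ?_
    · exact Finset.disjoint_union_left.2 ⟨d16, d26⟩
    · refine Uncorr.symm (hCχ.uncorr Finset.subset_union_right ?_) ?_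
      · simp only [Finset.disjoint_union_left, Finset.disjoint_union_right]
        exact ⟨⟨d15.symm, d16.symm⟩, ⟨d25.symm, d26.symm⟩⟩
      · exact (Finset.disjoint_union_left.2 ⟨d16, d26⟩).symm
    · apply invt
      · right
        intro x; simp only [Finset.mem_union]; tauto
      · left
        simp only [Finset.disjoint_union_left, Finset.disjoint_union_right]
        exact ⟨⟨⟨d14, d24⟩, d46.symm⟩, ⟨d15, d25⟩, d56.symm⟩
    · apply invt
      · right
        intro x; simp only [Finset.mem_union]; tauto
      · left
        simp only [Finset.disjoint_union_left, Finset.disjoint_union_right]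
        exact ⟨⟨d14, d46.symm⟩, d15, d56.symm⟩
    · apply invt
      · left
        simp only [Finset.disjoint_union_right]
        exact ⟨d26, d12.symm⟩
      · left
        simp only [Finset.disjoint_union_right]
        exact ⟨d24, d25⟩
  -- The same comparison at the boundary between B and C, with C₁ as the probe.
  have k2 : srank B₂ χ = srank B₁ χ * srank (B₂ ∪ B₁) χ := by
    refine srank_eq_mul_of_product (C := C₁) (φ := φ') d34.symm ?_ hχ hφ0' ?_ ?_ ?_ ?_ ?_
    · exact Finset.disjoint_union_left.2 ⟨d45, d35⟩
    · refine Uncorr.symm (hCχ.uncorr Finset.subset_union_left ?_) ?_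
      · simp only [Finset.disjoint_union_left, Finset.disjoint_union_right]
        exact ⟨⟨d45.symm, d46.symm⟩, ⟨d35.symm, d36.symm⟩⟩
      · exact (Finset.disjoint_union_left.2 ⟨d45, d35⟩).symm
    · rwa [Finset.union_comm]
    · apply invt
      · left
        simp only [Finset.disjoint_union_left, Finset.disjoint_union_right]
        exact ⟨⟨⟨d46, d36⟩, d56⟩, ⟨d14.symm, d13.symm⟩, d15.symm⟩
      · right
        intro x; simp only [Finset.mem_union]; tauto
    · apply invt
      · left
        simp only [Finset.disjoint_union_left, Finset.disjoint_union_right]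
        exact ⟨⟨d46, d56⟩, d14.symm, d15.symm⟩
      · right
        intro x; simp only [Finset.mem_union]; tauto
    · apply invt
      · left
        simp only [Finset.disjoint_union_right]
        exact ⟨d36, d13.symm⟩
      · left
        simp only [Finset.disjoint_union_right]
        exact ⟨d34, d35⟩
  rw [Finset.union_comm B₂] at k2
  have d1423 : Disjoint (A₁ ∪ B₂) (A₂ ∪ B₁) := by
    simp only [Finset.disjoint_union_left, Finset.disjoint_union_right]
    exact ⟨⟨d12, d24.symm⟩, d13, d34.symm⟩
  -- The halves far from the boundary A|B are compared with `φ`; the halves next to it are compared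
  -- with `φ'` in `k4`. As C is pure in `χ`, both unions have the same rank (`k5`).
  have k3 : srank (A₁ ∪ B₂) χ = srank A₁ χ * srank B₂ χ := by
    rw [inv _ d1423, inv A₁ (d1423.mono_left Finset.subset_union_left),
      inv B₂ (d1423.mono_left Finset.subset_union_right)]
    refine srank_union d14 hφ0 (hA.uncorr Finset.subset_union_left ?_)
    exact Finset.disjoint_union_left.2 ⟨d14, d24⟩
  have d23CA : Disjoint (A₂ ∪ B₁) (C₂ ∪ A₁) := by
    simp only [Finset.disjoint_union_left, Finset.disjoint_union_right]
    exact ⟨⟨d26, d36⟩, d12.symm, d13.symm⟩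
  have d23BC : Disjoint (A₂ ∪ B₁) (B₂ ∪ C₁) := by
    simp only [Finset.disjoint_union_left, Finset.disjoint_union_right]
    exact ⟨⟨d24, d34⟩, d25, d35⟩
  have k4 : srank (A₂ ∪ B₁) χ = srank A₂ χ * srank B₁ χ := by
    rw [invt _ (Or.inl d23CA) (Or.inl d23BC),
      invt A₂ (Or.inl (d23CA.mono_left Finset.subset_union_left))
        (Or.inl (d23BC.mono_left Finset.subset_union_left)),
      invt B₁ (Or.inl (d23CA.mono_left Finset.subset_union_right))
        (Or.inl (d23BC.mono_left Finset.subset_union_right))]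
    refine srank_union d23 hφ0' (hA'.uncorr Finset.subset_union_right ?_)
    exact Finset.disjoint_union_left.2 ⟨d13, d23⟩
  have k5 : srank (A₂ ∪ B₁) χ = srank (A₁ ∪ B₂) χ := by
    have hc : (A₂ ∪ B₁)ᶜ = A₁ ∪ B₂ ∪ (C₁ ∪ C₂) := by
      refine IsCompl.compl_eq ⟨?_, codisjoint_iff.2 ?_⟩
      · simp only [Finset.disjoint_union_left, Finset.disjoint_union_right]
        exact ⟨⟨⟨d12.symm, d13.symm⟩, d24, d34⟩, ⟨d25, d35⟩, d26, d36⟩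
      · rw [Finset.top_eq_univ, Finset.sup_eq_union, ← hu]
        ac_rfl
    have hd14C : Disjoint (A₁ ∪ B₂) (C₁ ∪ C₂) := by
      simp only [Finset.disjoint_union_left, Finset.disjoint_union_right]
      exact ⟨⟨d15, d45⟩, d16, d46⟩
    rw [← srank_compl, hc, srank_union hd14C hχ, srank_of_isProductAcross hχ hCχ, mul_one]
    exact Uncorr.symm (hCχ.uncorr subset_rfl hd14C.symm) hd14C.symm
  -- With r the Schmidt rank in `χ`, `k5` now reads r(A₂)r(B₁) = r(A₂)r(A) · r(B₁)r(B), so r(A)r(B)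
  -- = 1.
  rw [k3, k4, k1, k2] at k5
  have p2 := Nat.pos_of_ne_zero (srank_ne_zero hχ A₂)
  have p3 := Nat.pos_of_ne_zero (srank_ne_zero hχ B₁)
  have k6 : srank (A₁ ∪ A₂) χ * srank (B₁ ∪ B₂) χ = 1 := by
    have h : (srank A₂ χ * srank B₁ χ) * 1 =
        (srank A₂ χ * srank B₁ χ) * (srank (A₁ ∪ A₂) χ * srank (B₁ ∪ B₂) χ) := by
      rw [mul_one]
      exact k5.trans (by ring)
    exact (Nat.eq_of_mul_eq_mul_left (Nat.mul_pos p2 p3) h).symm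
  exact ⟨isProductAcross_of_srank_le_one (Nat.dvd_one.1 (Dvd.intro _ k6)).le,
    isProductAcross_of_srank_le_one (Nat.dvd_one.1 (Dvd.intro_left _ k6)).le⟩

/-- The factors of a nonzero product vector are unique up to a scalar and its inverse; gluing
configurations along `A` decouples the two arguments. -/
theorem eq_smul_of_mul_eq_mul {A : Finset ι} {f g f' g' : (∀ i, K i) → ℂ}
    (hf : DependsOn f (↑A : Set ι)) (hg : DependsOn g (↑Aᶜ : Set ι))
    (hf' : DependsOn f' (↑A : Set ι)) (hg' : DependsOn g' (↑Aᶜ : Set ι)) (h : f * g = f' * g')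
    (hne : f * g ≠ 0) : ∃ μ : ℂ, μ ≠ 0 ∧ f = μ • f' ∧ g = μ⁻¹ • g' := by
  obtain ⟨c₀, hc₀⟩ := Function.ne_iff.1 hne
  have hf0 : f c₀ ≠ 0 := left_ne_zero_of_mul hc₀
  have hg0 : g c₀ ≠ 0 := right_ne_zero_of_mul hc₀
  have key : ∀ c d, f c * g d = f' c * g' d := by
    intro c d
    have := congrFun h (A.piecewise c d)
    simpa only [Pi.mul_apply, dependsOn_piecewise_left hf, dependsOn_piecewise_right hg,
      dependsOn_piecewise_left hf', dependsOn_piecewise_right hg'] using this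
  have k0 := key c₀ c₀
  have hf0' : f' c₀ ≠ 0 := by
    intro h0
    rw [h0, zero_mul] at k0
    exact mul_ne_zero hf0 hg0 k0
  have hg0' : g' c₀ ≠ 0 := by
    intro h0
    rw [h0, mul_zero] at k0
    exact mul_ne_zero hf0 hg0 k0
  refine ⟨g' c₀ / g c₀, div_ne_zero hg0' hg0, ?_, ?_⟩
  · funext c
    have := key c c₀
    simp only [Pi.smul_apply, smul_eq_mul]
    field_simp
    linear_combination this
  · funext d
    have := key c₀ d
    simp only [Pi.smul_apply, smul_eq_mul, inv_div]
    have e : g c₀ / g' c₀ = f' c₀ / f c₀ := by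
      field_simp
      linear_combination k0
    rw [e]
    field_simp
    linear_combination this

/-- The anomaly of the symmetry: if the truncated symmetry operator `G` acts on a product state
like a product of two operators near its two ends, then the charges at the ends contradict
`G Z = -Z G`. -/
theorem false_of_truncated_symmetry {A B : Finset ι} (hAB : Disjoint A B)
    {G Zp Zq Wl Wr P Q : Matrix (∀ i, K i) (∀ i, K i) ℂ} {ε : ℂ} (hε : ε ≠ 0)
    (hG : G ∈ Matrix.unitaryGroup (∀ i, K i) ℂ) (hZp : SuppOn A Zp) (hZq : SuppOn B Zq)
    (hZpu : Zp ∈ Matrix.unitaryGroup (∀ i, K i) ℂ) (hZqu : Zq ∈ Matrix.unitaryGroup (∀ i, K i) ℂ)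
    (hGG : G * G = ε • (Zp * Zq)) (hGZ : G * Zp = -(Zp * G)) (hWl : SuppOn A Wl)
    (hWr : SuppOn B Wr) (hP : SuppOn A P) (hQ : SuppOn B Q) (hPG : P * G = G * Wl)
    (hQG : Q * G = G * Wr) {Ψ : (∀ i, K i) → ℂ} (hΨ : Ψ ≠ 0) (hprod : IsProductAcross A Ψ)
    (h : Wl *ᵥ (Wr *ᵥ Ψ) = G *ᵥ Ψ) : False := by
  obtain ⟨f, g, hf, hg, hfg⟩ := hprod
  have hBA : B ⊆ Aᶜ := fun i hi => by simpa using Finset.disjoint_right.1 hAB hi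
  have hfB : DependsOn f (↑Bᶜ : Set ι) := hf.mono fun i hi => by
    simpa using Finset.disjoint_left.1 hAB (by simpa using hi)
  have hPGv : ∀ v, G *ᵥ (Wl *ᵥ v) = P *ᵥ (G *ᵥ v) := fun v => by
    rw [Matrix.mulVec_mulVec, Matrix.mulVec_mulVec, hPG]
  have hQGv : ∀ v, G *ᵥ (Wr *ᵥ v) = Q *ᵥ (G *ᵥ v) := fun v => by
    rw [Matrix.mulVec_mulVec, Matrix.mulVec_mulVec, hQG]
  have c1 : ∀ v, Q *ᵥ (Wl *ᵥ v) = Wl *ᵥ (Q *ᵥ v) := fun v => by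
    rw [Matrix.mulVec_mulVec, Matrix.mulVec_mulVec, hQ.commute hWl hAB.symm]
  have c2 : ∀ v, Wl *ᵥ (Zq *ᵥ v) = Zq *ᵥ (Wl *ᵥ v) := fun v => by
    rw [Matrix.mulVec_mulVec, Matrix.mulVec_mulVec, hZq.commute hWl hAB.symm]
  have c4 : ∀ v, Wr *ᵥ (Wl *ᵥ v) = Wl *ᵥ (Wr *ᵥ v) := fun v => by
    rw [Matrix.mulVec_mulVec, Matrix.mulVec_mulVec, hWr.commute hWl hAB.symm]
  have hGGv : ∀ v, G *ᵥ (G *ᵥ v) = ε • (Zp *ᵥ (Zq *ᵥ v)) := fun v => by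
    rw [Matrix.mulVec_mulVec, hGG, Matrix.smul_mulVec, Matrix.mulVec_mulVec]
  have hGZv : ∀ v, G *ᵥ (Zp *ᵥ v) = -(Zp *ᵥ (G *ᵥ v)) := fun v => by
    rw [Matrix.mulVec_mulVec, hGZ, Matrix.neg_mulVec, Matrix.mulVec_mulVec]
  -- `P` and `Q` are the conjugates of `Wl` and `Wr` under `G`, so GGΨ = G Wl Wr Ψ = PQ GΨ = (P
  -- Wl)(Q Wr)Ψ. This splits between the two ends.
  have e1 : (P * Wl * (Q * Wr)) *ᵥ Ψ = G *ᵥ (G *ᵥ Ψ) := by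
    rw [← Matrix.mulVec_mulVec, ← Matrix.mulVec_mulVec, ← Matrix.mulVec_mulVec, ← c1, h, ← hQGv,
      ← hPGv, h]
  have e0 := (hP.mul hWl).mulVec_product (hQ.mul hWr) subset_rfl hAB hf hg
  rw [← hfg] at e0
  have e0' := hZp.mulVec_product (hZq.smul ε) subset_rfl hAB hf hg
  rw [← hfg, ← Matrix.mulVec_mulVec, Matrix.smul_mulVec, Matrix.mulVec_smul] at e0'
  have e2 : (P * Wl) *ᵥ f * (Q * Wr) *ᵥ g = (Zp *ᵥ f) * (ε • Zq) *ᵥ g := by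
    rw [← e0, ← e0', e1, hGGv]
  have hne : (P * Wl) *ᵥ f * (Q * Wr) *ᵥ g ≠ 0 := by
    rw [← e0, e1]
    exact mulVec_unitary_ne_zero hG (mulVec_unitary_ne_zero hG hΨ)
  -- Compare with GGΨ = ε Zp Zq Ψ, factor by factor: on `Ψ` the operator P Wl acts like μ Zp and Q
  -- Wr like μ⁻¹ε Zq.
  obtain ⟨μ, hμ, h1, h2⟩ := eq_smul_of_mul_eq_mul ((hP.mul hWl).dependsOn_mulVec subset_rfl hf)
    ((hQ.mul hWr).dependsOn_mulVec hBA hg) (hZp.dependsOn_mulVec subset_rfl hf)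
    ((hZq.smul ε).dependsOn_mulVec hBA hg) e2 hne
  have hWrg : DependsOn (Wr *ᵥ g) (↑Aᶜ : Set ι) := hWr.dependsOn_mulVec hBA hg
  have e3 : P *ᵥ (Wl *ᵥ (Wr *ᵥ Ψ)) = μ • (Zp *ᵥ (Wr *ᵥ Ψ)) := by
    rw [Matrix.mulVec_mulVec, hfg, hWr.mulVec_mul' hfB, (hP.mul hWl).mulVec_mul hWrg, h1,
      hZp.mulVec_mul hWrg, smul_mul_assoc]
  have e4 : Q *ᵥ (Wr *ᵥ Ψ) = (μ⁻¹ * ε) • (Zq *ᵥ Ψ) := by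
    rw [Matrix.mulVec_mulVec, hfg, (hQ.mul hWr).mulVec_mul' hfB, h2, hZq.mulVec_mul' hfB,
      Matrix.smul_mulVec, mul_smul_comm, mul_smul_comm, smul_smul]
  have l1 : G *ᵥ (G *ᵥ (Wl *ᵥ Ψ)) = ε • (Zp *ᵥ (Zq *ᵥ (Wl *ᵥ Ψ))) := hGGv _
  -- The second evaluation replaces P Wl by μ Zp before the outer `G` is applied. Moving that `G`
  -- past Zp produces the sign, and the scalars μ and μ⁻¹ cancel.
  have l2 : G *ᵥ (G *ᵥ (Wl *ᵥ Ψ)) = -(ε • (Zp *ᵥ (Zq *ᵥ (Wl *ᵥ Ψ)))) := by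
    rw [hPGv, ← h, e3, Matrix.mulVec_smul, hGZv, hQGv, ← h, c1, e4, Matrix.mulVec_smul, c2,
      Matrix.mulVec_smul, smul_neg, smul_smul, mul_inv_cancel_left₀ hμ]
  rw [l1] at l2
  have l3 : (2 : ℂ) • (ε • (Zp *ᵥ (Zq *ᵥ (Wl *ᵥ Ψ)))) = 0 := by
    rw [two_smul]
    nth_rewrite 1 [l2]
    exact neg_add_cancel _
  have l4 : Zp *ᵥ (Zq *ᵥ (Wl *ᵥ Ψ)) = 0 := by
    rcases smul_eq_zero.1 l3 with h' | h'
    · norm_num at h'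
    · exact (smul_eq_zero.1 h').resolve_left hε
  have l5 : Wl *ᵥ Ψ = 0 := by
    by_contra hne'
    exact mulVec_unitary_ne_zero hZpu (mulVec_unitary_ne_zero hZqu hne') l4
  apply mulVec_unitary_ne_zero hG hΨ
  rw [← h, ← c4, l5, Matrix.mulVec_zero]

end Tripartite


/-! ### Conjugation of products with disjoint supports -/

section Hat

variable {ι : Type} [Fintype ι] [DecidableEq ι] {K : ι → Type} [∀ i, Fintype (K i)]
  [∀ i, DecidableEq (K i)]

/-- The factor `T₂` is disjoint from `M` and drops out, so only the part of `T` that touches `M`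
enlarges the support. -/
theorem SuppOn.conj_mul {N N' : Finset ι} {M T T₁ T₂ : Matrix (∀ i, K i) (∀ i, K i) ℂ}
    (hM : SuppOn N M) (hN : N ⊆ N') (hT : T = T₁ * T₂) (h1 : SuppOn N' T₁) (h2 : SuppOn Nᶜ T₂)
    (h2u : T₂ ∈ Matrix.unitaryGroup (∀ i, K i) ℂ) : SuppOn N' (T * M * Tᴴ) := by
  have : T * M * Tᴴ = T₁ * (T₂ * M * T₂ᴴ) * T₁ᴴ := by
    rw [hT, Matrix.conjTranspose_mul]; simp only [mul_assoc]
  rw [this, hM.conj_eq' h2 disjoint_compl_right h2u]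
  exact (h1.mul (hM.mono hN)).mul h1.conjTranspose

theorem conj_mul_of_disjoint {S S' : Finset ι} (hS : Disjoint S S')
    {k k' o o' : Matrix (∀ i, K i) (∀ i, K i) ℂ} (hk : SuppOn S k) (hk' : SuppOn S' k')
    (ho : SuppOn S o) (ho' : SuppOn S' o') :
    (k * k')ᴴ * (o * o') * (k * k') = (kᴴ * o * k) * (k'ᴴ * o' * k') := by
  have h1 : k'ᴴ * (kᴴ * o * k) = (kᴴ * o * k) * k'ᴴ :=
    (((hk.conjTranspose.mul ho).mul hk).commute hk'.conjTranspose hS).symm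
  have h2 : o' * k = k * o' := (hk.commute ho' hS).symm
  calc (k * k')ᴴ * (o * o') * (k * k') = k'ᴴ * kᴴ * o * (o' * k) * k' := by
        simp only [Matrix.conjTranspose_mul, mul_assoc]
    _ = (k'ᴴ * (kᴴ * o * k)) * o' * k' := by rw [h2]; simp only [mul_assoc]
    _ = _ := by rw [h1]; simp only [mul_assoc]

theorem conj_mul_conj {n : Type} [Fintype n] [DecidableEq n] {U : Matrix n n ℂ}
    (hU : U ∈ Matrix.unitaryGroup n ℂ) (A B : Matrix n n ℂ) :
    Uᴴ * A * U * (Uᴴ * B * U) = Uᴴ * (A * B) * U := by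
  calc Uᴴ * A * U * (Uᴴ * B * U) = Uᴴ * A * (U * Uᴴ) * B * U := by simp only [mul_assoc]
    _ = _ := by rw [unitary_mul_conjTranspose hU, mul_one]; simp only [mul_assoc]

theorem inter_subset_of_disjoint {S A A₁ A₂ : Finset ι} (hA : A = A₁ ∪ A₂) (h : Disjoint A₂ S) :
    S ∩ A ⊆ A₁ := by
  intro x hx
  rw [hA, Finset.mem_inter, Finset.mem_union] at hx
  exact hx.2.resolve_right fun h' => Finset.disjoint_left.1 h h' hx.1

end Hat

/-! ### Splitting the truncated symmetries at the region boundaries -/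

section RingHat

variable {L : ℕ} [NeZero L] {τ η : ZMod L → Type} [∀ x, Fintype (τ x)] [∀ x, DecidableEq (τ x)]
  [∀ x, Fintype (η x)] [∀ x, DecidableEq (η x)] (e : ∀ x, τ x ≃ Qubits L x × η x)

/-- The on-site flips do not spread supports at all, and of the bond gates only those that touch `N`
act, which adds one site on each side. -/
theorem BondSigns.op_conj (β : BondSigns L) (F I : Finset (ZMod L)) (N : Finset (ZMod L))
    (M : Matrix (∀ x, τ x) (∀ x, τ x) ℂ) (hM : SuppOn N M) :
    SuppOn (nbhd 1 N) (liftOp e (β.op F I) * M * (liftOp e (β.op F I))ᴴ) := by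
  classical
  have h1 : SuppOn N (liftOp e (xOn I) * M * (liftOp e (xOn I))ᴴ) := by
    have hI : I = (I ∩ N) ∪ (I \ N) := by ext x; simp; tauto
    have hd : Disjoint (I ∩ N) (I \ N) := by
      rw [Finset.disjoint_left]; intro x; simp; tauto
    refine hM.conj_mul subset_rfl (T₁ := liftOp e (xOn (I ∩ N))) (T₂ := liftOp e (xOn (I \ N))) ?_
      (suppOn_liftOp e ((suppOn_xOn _).mono Finset.inter_subset_right))
      (suppOn_liftOp e ((suppOn_xOn _).mono fun x hx => by simp at hx ⊢; exact hx.2))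
      (liftOp_unitary e (xOn_unitary _))
    rw [← liftOp_mul, ← xOn_union hd, ← hI]
  have h3 : liftOp e (β.op F I) * M * (liftOp e (β.op F I))ᴴ =
      liftOp e (β.gate F) * (liftOp e (xOn I) * M * (liftOp e (xOn I))ᴴ) *
        (liftOp e (β.gate F))ᴴ := by
    rw [op, liftOp_mul, Matrix.conjTranspose_mul]
    simp only [mul_assoc]
  rw [h3]
  let q : ZMod L → Prop := fun x => x ∈ N ∨ x + 1 ∈ N
  have hd : Disjoint (F.filter q) (F.filter fun x => ¬ q x) := Finset.disjoint_filter_filter_not _ _ _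
  refine h1.conj_mul (subset_nbhd 1 N) (T₁ := liftOp e (β.gate (F.filter q)))
    (T₂ := liftOp e (β.gate (F.filter fun x => ¬ q x))) ?_ (suppOn_liftOp e ?_)
    (suppOn_liftOp e ?_) (liftOp_unitary e (β.gate_unitary _))
  · rw [← liftOp_mul, ← β.gate_union hd, Finset.filter_union_filter_not_eq]
  · refine β.suppOn_gate fun x hx => ?_
    rcases (Finset.mem_filter.1 hx).2 with h | h
    · exact ⟨subset_nbhd _ _ h, mem_nbhd.2 ⟨x, h, 1, by simp, by simp⟩⟩
    · exact ⟨mem_nbhd.2 ⟨x + 1, h, -1, by simp, by simp⟩, subset_nbhd _ _ h⟩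
  · refine β.suppOn_gate fun x hx => ?_
    have := (Finset.mem_filter.1 hx).2
    simpa [q] using this

theorem suppOn_gate_singleton (β : BondSigns L) {m : ℤ} {R : ℕ} (hR : 1 ≤ R) :
    SuppOn (seg L (m - R) (m + R)) (β.gate {((m - 1 : ℤ) : ZMod L)}) := by
  refine β.suppOn_gate fun x hx => ?_
  rw [Finset.mem_singleton] at hx
  subst hx
  exact ⟨cast_mem_seg (by lia) (by lia), mem_seg.2 ⟨m, by lia, by lia, by push_cast; ring⟩⟩

theorem mem_seg_and_succ {a b a' b' : ℤ} (h : a' ≤ a) (h' : b + 1 ≤ b') :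
    ∀ x ∈ seg L a b, x ∈ seg L a' b' ∧ x + 1 ∈ seg L a' b' := by
  intro x hx
  obtain ⟨i, h1, h2, rfl⟩ := mem_seg.1 hx
  exact ⟨cast_mem_seg (by lia) (by lia), mem_seg.2 ⟨i + 1, by lia, by lia, by push_cast; rfl⟩⟩

theorem seg_erase {a b m : ℤ} (h : a < m) (h' : m ≤ b) (hL : b ≤ a + L) :
    (seg L a b).erase ((m - 1 : ℤ) : ZMod L) = seg L a (m - 1) ∪ seg L m b := by
  have h1 : seg L a b = insert ((m - 1 : ℤ) : ZMod L) (seg L a (m - 1) ∪ seg L m b) := by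
    rw [← Finset.insert_union, ← seg_succ (by lia), sub_add_cancel, seg_union h.le h']
  have h2 : ((m - 1 : ℤ) : ZMod L) ∈ seg L (m - 1) m := cast_mem_seg le_rfl (by lia)
  rw [h1, Finset.erase_insert]
  rw [Finset.mem_union, not_or]
  exact ⟨fun h => Finset.disjoint_left.1 (seg_disjoint le_rfl (by lia)) h h2,
    fun h => Finset.disjoint_left.1 (seg_disjoint le_rfl (by lia)) h2 h⟩

/-- The truncation of `U_CZX` to the interval `[p, p + m]` times `U_CZX` is the truncation to the
complement. -/
theorem op_mul_czx {p q : ℤ} (h : p ≤ q) (h' : q + 1 ≤ p + L) :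
    (czSigns L ∅).op (seg L p q) (seg L p (q + 1)) * czx L =
      (czSigns L (seg L (q + 1) (p + L))).op (seg L q (p + L)) (seg L (q + 1) (p + L)) := by
  rw [← xOn_mul_gate, czx, allX_eq, allCZ_eq]
  have u1 : Finset.univ = seg L p (q + 1) ∪ seg L (q + 1) (p + L) := by
    rw [seg_union (by lia) h', seg_eq_univ le_rfl]
  have u2 : Finset.univ = seg L p q ∪ seg L q (p + L) := by
    rw [seg_union h (by lia), seg_eq_univ le_rfl]
  have d1 : Disjoint (seg L p (q + 1)) (seg L (q + 1) (p + L)) := seg_disjoint le_rfl le_rfl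
  have d2 : Disjoint (seg L p q) (seg L q (p + L)) := seg_disjoint le_rfl le_rfl
  have e1 : xOn Finset.univ = xOn (seg L p (q + 1)) * xOn (seg L (q + 1) (p + L)) := by
    rw [← xOn_union d1, ← u1]
  have e2 : (czSigns L ∅).gate Finset.univ =
      (czSigns L ∅).gate (seg L p q) * (czSigns L ∅).gate (seg L q (p + L)) := by
    rw [← BondSigns.gate_union _ d2, ← u2]
  have hc := ((czSigns L ∅).suppOn_gate_seg p q).commute (suppOn_xOn (seg L (q + 1) (p + L))) d1
  rw [e1, e2, BondSigns.op]
  set X := xOn (seg L p (q + 1))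
  set Y := xOn (seg L (q + 1) (p + L))
  set g := (czSigns L ∅).gate (seg L p q)
  set g' := (czSigns L ∅).gate (seg L q (p + L))
  calc g * X * (X * Y * (g * g')) = g * (X * X) * Y * g * g' := by simp only [mul_assoc]
    _ = g * Y * g * g' := by rw [xOn_mul_self, mul_one]
    _ = Y * (g * g) * g' := by rw [hc]; simp only [mul_assoc]
    _ = Y * g' := by rw [BondSigns.gate_mul_self, mul_one]

variable {e}

/-- The decomposition of the truncated symmetry into two pieces and an operator at the boundary
between them. -/
theorem exists_hat_truncated {R n : ℕ} (hR : 1 ≤ R) {K : Matrix (∀ x, τ x) (∀ x, τ x) ℂ}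
    (hK : Circ (IsArc R) n K) {a b c : ℤ} {r : ℕ} (hr : r = 2 * (n * R) + R + 2)
    (hab : a + 4 * r ≤ b) (hbc : b + 4 * r ≤ c) (hca : c + 4 * r ≤ a + L) :
    ∃ t sA sB : Matrix (∀ x, τ x) (∀ x, τ x) ℂ, t ∈ Matrix.unitaryGroup (∀ x, τ x) ℂ ∧ SuppOn (seg L (a + 2 * r) (c - 2 * r)) t ∧
      SuppOn (seg L a b) sA ∧ SuppOn (seg L b c) sB ∧
      Kᴴ * liftOp e ((czSigns L ∅).op (seg L (a + r) (c - r - 1)) (seg L (a + r) (c - r))) * K =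
        t * (sA * sB) := by
  have hRL : 3 * R < L := by lia
  set G := (czSigns L ∅).op (seg L (a + r) (c - r - 1)) (seg L (a + r) (c - r)) with hG
  have hGs : SuppOn (seg L (a + r) (c - r)) G :=
    BondSigns.suppOn_op _ (mem_seg_and_succ le_rfl (by lia)) subset_rfl
  obtain ⟨K₁, hK₁, e1⟩ := hK.truncate (fun S hS => smallSupp_of_isArc hS) (suppOn_liftOp e hGs)
  have hnb : nbhd (n * R) (seg L (a + r) (c - r)) ⊆ seg L a c :=
    (nbhd_seg _ _ _).trans (seg_mono (by lia) (by lia))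
  -- The bond {b - 1, b} carries the only gate of the truncated symmetry that crosses the cut at
  -- `b`. It is removed together with the gates of the circuit near the cut.
  have hmem : ((b - 1 : ℤ) : ZMod L) ∈ seg L (a + r) (c - r - 1) :=
    cast_mem_seg (by lia) (by lia)
  obtain ⟨t, K₂, ht, hts, hK₂, e2⟩ := hK₁.split_conj (R := R)
    (fun S hS => smallSupp_of_isArc hS.1)
    (N := seg L (b - R) (b + R)) (q := fun S => S ⊆ seg L (b - R) (b + R))
    (fun S _ h => h) (T := liftOp e G)
    (T₁ := liftOp e ((czSigns L ∅).gate {((b - 1 : ℤ) : ZMod L)}))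
    (T₂ := liftOp e ((czSigns L ∅).op ((seg L (a + r) (c - r - 1)).erase ((b - 1 : ℤ) : ZMod L))
      (seg L (a + r) (c - r)))) (by rw [← liftOp_mul, hG, BondSigns.op_erase _ hmem])
    (suppOn_liftOp e (suppOn_gate_singleton _ hR))
    (liftOp_unitary e (BondSigns.gate_unitary _ _)) (liftOp_unitary e (BondSigns.op_unitary _ _ _))
    (BondSigns.op_conj e _ _ _)
  have hside : ∀ S, (IsArc R S ∧ S ⊆ nbhd (n * R) (seg L (a + r) (c - r))) ∧
      ¬ S ⊆ seg L (b - R) (b + R) → S ⊆ seg L a b ∨ S ⊆ seg L b c := fun S hS =>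
    (smallSupp_of_isArc hS.1.1).subset_or_subset hRL (hS.1.2.trans hnb) (by lia) hS.2
  have hdis : Disjoint (seg L a b) (seg L b c) := seg_disjoint le_rfl (by lia)
  obtain ⟨kA, kB, hkA, hkB, rfl⟩ := hK₂.factor (H := seg L a b) fun S hS =>
    (hside S hS).imp_right fun h => hdis.mono_right h
  have hkA' : SuppOn (seg L a b) kA := hkA.suppOn fun S hS => hS.2
  have hkB' : SuppOn (seg L b c) kB := hkB.suppOn fun S hS => (hside S hS.1).resolve_left hS.2
  have e3 : (czSigns L ∅).op ((seg L (a + r) (c - r - 1)).erase ((b - 1 : ℤ) : ZMod L))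
      (seg L (a + r) (c - r)) = (czSigns L ∅).op (seg L (a + r) (b - 1)) (seg L (a + r) b) *
      (czSigns L ∅).op (seg L b (c - r - 1)) (seg L b (c - r)) := by
    rw [seg_erase (by lia) (by lia) (by lia), ← seg_union (b := b) (by lia) (by lia : b ≤ c - r)]
    exact BondSigns.op_union _ hdis (mem_seg_and_succ (by lia) (by lia))
      (mem_seg_and_succ (by lia) (by lia)) (seg_mono (by lia) (by lia)) (seg_mono (by lia) (by lia))
  have hoA : SuppOn (seg L a b)
      (liftOp e ((czSigns L ∅).op (seg L (a + r) (b - 1)) (seg L (a + r) b))) :=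
    suppOn_liftOp e (BondSigns.suppOn_op _ (mem_seg_and_succ (by lia) (by lia))
      (seg_mono (by lia) (by lia)))
  have hoB : SuppOn (seg L b c)
      (liftOp e ((czSigns L ∅).op (seg L b (c - r - 1)) (seg L b (c - r)))) :=
    suppOn_liftOp e (BondSigns.suppOn_op _ (mem_seg_and_succ (by lia) (by lia))
      (seg_mono (by lia) (by lia)))
  rw [e1, e2, e3, liftOp_mul, conj_mul_of_disjoint hdis hkA' hkB' hoA hoB]
  refine ⟨t, _, _, ht, hts.mono ((nbhd_seg _ _ _).trans (seg_mono ?_ ?_)),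
    (hkA'.conjTranspose.mul hoA).mul hkA', (hkB'.conjTranspose.mul hoB).mul hkB', rfl⟩
  · push_cast; lia
  · push_cast; lia

/-- The decomposition of the complementary truncation of the symmetry. -/
theorem exists_hat_complement {R n : ℕ} (hR : 1 ≤ R) {K : Matrix (∀ x, τ x) (∀ x, τ x) ℂ}
    (hK : Circ (IsArc R) n K) {a b c : ℤ} {r : ℕ} (hr : r = 2 * (n * R) + R + 2)
    (hab : a + 4 * r ≤ b) (hbc : b + 4 * r ≤ c) (hca : c + 4 * r ≤ a + L) (β : BondSigns L) :
    ∃ t t' sA sB sC : Matrix (∀ x, τ x) (∀ x, τ x) ℂ, t ∈ Matrix.unitaryGroup (∀ x, τ x) ℂ ∧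
      t' ∈ Matrix.unitaryGroup (∀ x, τ x) ℂ ∧
      SuppOn (seg L (c + r) (a + L + 2 * r)) t ∧ SuppOn (seg L (c - 2 * r) (c + r)) t' ∧
      SuppOn (seg L a b) sA ∧ SuppOn (seg L b c) sB ∧ SuppOn (seg L c (a + L)) sC ∧
      Kᴴ * liftOp e (β.op (seg L (c - r - 1) (a + r + L)) (seg L (c - r) (a + r + L))) * K =
        t * (t' * (sB * (sC * sA))) := by
  have hRL : 3 * R < L := by lia
  set F := seg L (c - r - 1) (a + r + L) with hF
  set J := seg L (c - r) (a + r + L) with hJ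
  have hTs : SuppOn (seg L (c - r - 1) (a + r + L + 1)) (β.op F J) :=
    BondSigns.suppOn_op _ (mem_seg_and_succ le_rfl (by lia)) (seg_mono (by lia) (by lia))
  obtain ⟨K₁, hK₁, e1⟩ := hK.truncate (fun S hS => smallSupp_of_isArc hS) (suppOn_liftOp e hTs)
  have hnb : nbhd (n * R) (seg L (c - r - 1) (a + r + L + 1)) ⊆
      seg L (c - 2 * r) (a + L + 2 * r) := (nbhd_seg _ _ _).trans (seg_mono (by lia) (by lia))
  -- The complementary interval crosses two cuts, at `a + L` and at `c`. The crossing bond and the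
  -- nearby circuit gates are removed at one cut and then at the other.
  have hmem : ((a + L - 1 : ℤ) : ZMod L) ∈ F := cast_mem_seg (by lia) (by lia)
  have hne : ((c - 1 : ℤ) : ZMod L) ≠ ((a + L - 1 : ℤ) : ZMod L) := fun h => by
    have := eq_of_cast_eq h (by lia) (by lia)
    lia
  have hmem' : ((c - 1 : ℤ) : ZMod L) ∈ F.erase ((a + L - 1 : ℤ) : ZMod L) :=
    Finset.mem_erase.2 ⟨hne, cast_mem_seg (by lia) (by lia)⟩
  obtain ⟨t, K₂, ht, hts, hK₂, e2⟩ := hK₁.split_conj (R := R)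
    (fun S hS => smallSupp_of_isArc hS.1)
    (N := seg L (a + L - R) (a + L + R)) (q := fun S => S ⊆ seg L (a + L - R) (a + L + R))
    (fun S _ h => h) (T := liftOp e (β.op F J))
    (T₁ := liftOp e (β.gate {((a + L - 1 : ℤ) : ZMod L)}))
    (T₂ := liftOp e (β.op (F.erase ((a + L - 1 : ℤ) : ZMod L)) J))
    (by rw [← liftOp_mul, BondSigns.op_erase _ hmem])
    (suppOn_liftOp e (suppOn_gate_singleton _ hR))
    (liftOp_unitary e (BondSigns.gate_unitary _ _)) (liftOp_unitary e (BondSigns.op_unitary _ _ _))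
    (BondSigns.op_conj e _ _ _)
  obtain ⟨t', K₃, ht', hts', hK₃, e3⟩ := hK₂.split_conj (R := R)
    (fun S hS => smallSupp_of_isArc hS.1.1)
    (N := seg L (c - R) (c + R)) (q := fun S => S ⊆ seg L (c - R) (c + R))
    (fun S _ h => h) (T := liftOp e (β.op (F.erase ((a + L - 1 : ℤ) : ZMod L)) J))
    (T₁ := liftOp e (β.gate {((c - 1 : ℤ) : ZMod L)}))
    (T₂ := liftOp e (β.op ((F.erase ((a + L - 1 : ℤ) : ZMod L)).erase ((c - 1 : ℤ) : ZMod L)) J))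
    (by rw [← liftOp_mul, BondSigns.op_erase _ hmem'])
    (suppOn_liftOp e (suppOn_gate_singleton _ hR))
    (liftOp_unitary e (BondSigns.gate_unitary _ _)) (liftOp_unitary e (BondSigns.op_unitary _ _ _))
    (BondSigns.op_conj e _ _ _)
  have hside : ∀ S, ((IsArc R S ∧ S ⊆ nbhd (n * R) (seg L (c - r - 1) (a + r + L + 1))) ∧
      ¬ S ⊆ seg L (a + L - R) (a + L + R)) ∧ ¬ S ⊆ seg L (c - R) (c + R) →
      S ⊆ seg L b c ∨ S ⊆ seg L c (a + L) ∨ S ⊆ seg L a b := by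
    intro S hS
    have hsm := smallSupp_of_isArc hS.1.1.1
    rcases hsm.subset_or_subset hRL (hS.1.1.2.trans hnb) (by lia) hS.2 with h | h
    · exact Or.inl (h.trans (seg_mono (by lia) le_rfl))
    · right
      refine (hsm.subset_or_subset hRL h (by lia) hS.1.2).imp_right fun h' => ?_
      rw [← seg_add a b]
      exact h'.trans (seg_mono le_rfl (by lia))
  have hdAB : Disjoint (seg L a b) (seg L b c) := seg_disjoint le_rfl (by lia)
  have hdBC : Disjoint (seg L b c) (seg L c (a + L)) := seg_disjoint le_rfl (by lia)
  have hdAC : Disjoint (seg L a b) (seg L c (a + L)) := seg_disjoint (by lia) le_rfl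
  obtain ⟨kB, kCA, hkB, hkCA, rfl⟩ := hK₃.factor (H := seg L b c) fun S hS =>
    (hside S hS).imp_right fun h => h.elim (fun h => hdBC.mono_right h)
      fun h => hdAB.symm.mono_right h
  obtain ⟨kC, kA, hkC, hkA, rfl⟩ := hkCA.factor (H := seg L c (a + L)) fun S hS =>
    ((hside S hS.1).resolve_left hS.2).imp_right fun h => hdAC.symm.mono_right h
  have hkA' : SuppOn (seg L a b) kA := hkA.suppOn fun S hS =>
    ((hside S hS.1.1).resolve_left hS.1.2).resolve_left hS.2
  have hkB' : SuppOn (seg L b c) kB := hkB.suppOn fun S hS => hS.2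
  have hkC' : SuppOn (seg L c (a + L)) kC := hkC.suppOn fun S hS => hS.2
  have e4 : β.op ((F.erase ((a + L - 1 : ℤ) : ZMod L)).erase ((c - 1 : ℤ) : ZMod L)) J =
      β.op (seg L (c - r - 1) (c - 1)) (seg L (c - r) c) *
      (β.op (seg L c (a + L - 1)) (seg L c (a + L)) *
        β.op (seg L (a + L) (a + r + L)) (seg L (a + L) (a + r + L))) := by
    have d1 : Disjoint (seg L c (a + L)) (seg L (a + L) (b + L)) := seg_disjoint le_rfl (by lia)
    have d2 : Disjoint (seg L b c) (seg L c (b + L)) := seg_disjoint le_rfl (by lia)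
    rw [← BondSigns.op_union _ d1 (mem_seg_and_succ (by lia) (by lia))
      (mem_seg_and_succ (by lia) (by lia)) subset_rfl (seg_mono (by lia) (by lia)),
      ← seg_erase (by lia) (by lia) (by lia), seg_union (by lia) (by lia),
      ← BondSigns.op_union _ d2 (mem_seg_and_succ (by lia) (by lia)) (fun x hx =>
        mem_seg_and_succ (by lia) (by lia) x (Finset.mem_of_mem_erase hx))
        (seg_mono (by lia) (by lia)) (seg_mono (by lia) (by lia)), seg_union (by lia) (by lia), hJ]
    congr 1
    rw [Finset.erase_right_comm, hF, seg_erase (by lia) (by lia) (by lia), Finset.erase_union_distrib]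
    congr 1
    refine Finset.erase_eq_of_notMem fun h => ?_
    refine Finset.disjoint_left.1 (seg_disjoint (L := L) (a := c - r - 1) (b := c - 1)
      (c := c - 1) (d := a + L) (by lia) (by lia)) h (cast_mem_seg (by lia) (by lia))
  have hoB : SuppOn (seg L b c)
      (liftOp e (β.op (seg L (c - r - 1) (c - 1)) (seg L (c - r) c))) :=
    suppOn_liftOp e (BondSigns.suppOn_op _ (mem_seg_and_succ (by lia) (by lia))
      (seg_mono (by lia) (by lia)))
  have hoC : SuppOn (seg L c (a + L)) (liftOp e (β.op (seg L c (a + L - 1)) (seg L c (a + L)))) :=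
    suppOn_liftOp e (BondSigns.suppOn_op _ (mem_seg_and_succ (by lia) (by lia))
      (seg_mono (by lia) (by lia)))
  have hoA : SuppOn (seg L a b)
      (liftOp e (β.op (seg L (a + L) (a + r + L)) (seg L (a + L) (a + r + L)))) := by
    rw [← seg_add a b]
    exact suppOn_liftOp e (BondSigns.suppOn_op _ (mem_seg_and_succ (by lia) (by lia))
      (seg_mono (by lia) (by lia)))
  have hdB : Disjoint (seg L b c) (seg L c (a + L) ∪ seg L a b) :=
    Finset.disjoint_union_right.2 ⟨hdBC, hdAB.symm⟩
  have iC : seg L c (a + L) ⊆ seg L c (a + L) ∪ seg L a b := Finset.subset_union_left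
  have iA : seg L a b ⊆ seg L c (a + L) ∪ seg L a b := Finset.subset_union_right
  rw [e1, e2, e3, e4, liftOp_mul, liftOp_mul,
    conj_mul_of_disjoint hdB hkB' ((hkC'.mono iC).mul (hkA'.mono iA)) hoB
      ((hoC.mono iC).mul (hoA.mono iA)), conj_mul_of_disjoint hdAC.symm hkC' hkA' hoC hoA]
  refine ⟨t, t', _, _, _, ht, ht', hts.mono ((nbhd_seg _ _ _).trans (seg_mono ?_ ?_)),
    hts'.mono ((nbhd_seg _ _ _).trans (seg_mono ?_ ?_)),
    (hkA'.conjTranspose.mul hoA).mul hkA', (hkB'.conjTranspose.mul hoB).mul hkB',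
    (hkC'.conjTranspose.mul hoC).mul hkC', rfl⟩
  all_goals push_cast; lia

end RingHat


/-! ### Locality of the two end operators -/

section RingTripartite

variable {L : ℕ} [NeZero L] {K : ZMod L → Type} [∀ x, Fintype (K x)] [∀ x, DecidableEq (K x)]
  {a b c : ℤ} {r : ℕ}

theorem coe_subset_coe_compl {ι : Type} [Fintype ι] [DecidableEq ι] {S T : Finset ι}
    (h : Disjoint S T) : (↑S : Set ι) ⊆ ↑Tᶜ := by
  intro i hi
  simpa using Finset.disjoint_left.1 h (by simpa using hi)

/-- Each arc is cut into two, at `a + 2 * r`, `c - 2 * r` and `c + r`, so that every boundary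
unitary lies on the two pieces next to its boundary. -/
theorem isProductAcross_of_tripartite_seg (hab : a + 4 * r ≤ b) (hbc : b + 4 * r ≤ c)
    (hca : c + 4 * r ≤ a + L) {Ψ χ : (∀ x, K x) → ℂ} (hΨA : IsProductAcross (seg L a b) Ψ)
    (hΨB : IsProductAcross (seg L b c) Ψ) (hΨC : IsProductAcross (seg L c (a + L)) Ψ)
    {t sA sB t₁ t₂ sA' sB' sC' : Matrix (∀ x, K x) (∀ x, K x) ℂ}
    (htu : t ∈ Matrix.unitaryGroup (∀ x, K x) ℂ) (ht1u : t₁ ∈ Matrix.unitaryGroup (∀ x, K x) ℂ)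
    (ht2u : t₂ ∈ Matrix.unitaryGroup (∀ x, K x) ℂ)
    (hts : SuppOn (seg L (a + 2 * r) (c - 2 * r)) t) (hsA : SuppOn (seg L a b) sA)
    (hsB : SuppOn (seg L b c) sB) (ht1 : SuppOn (seg L (c + r) (a + L + 2 * r)) t₁)
    (ht2 : SuppOn (seg L (c - 2 * r) (c + r)) t₂) (hsA' : SuppOn (seg L a b) sA')
    (hsB' : SuppOn (seg L b c) sB') (hsC' : SuppOn (seg L c (a + L)) sC') {s : ℂ} (hs : s ≠ 0)
    (hχ0 : χ ≠ 0) (hG : (t * (sA * sB)) *ᵥ Ψ = χ)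
    (hT : (t₁ * (t₂ * (sB' * (sC' * sA')))) *ᵥ Ψ = s • χ) :
    IsProductAcross (seg L a b) χ ∧ IsProductAcross (seg L b c) χ := by
  have dAB : Disjoint (seg L a b) (seg L b c) := seg_disjoint le_rfl (by lia)
  have dBC : Disjoint (seg L b c) (seg L c (a + L)) := seg_disjoint le_rfl (by lia)
  have dAC : Disjoint (seg L a b) (seg L c (a + L)) := seg_disjoint (by lia) le_rfl
  have hA12 : seg L a (a + 2 * r) ∪ seg L (a + 2 * r) b = seg L a b :=
    seg_union (by lia) (by lia)
  have hB12 : seg L b (c - 2 * r) ∪ seg L (c - 2 * r) c = seg L b c :=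
    seg_union (by lia) (by lia)
  have hC12 : seg L c (c + r) ∪ seg L (c + r) (a + L) = seg L c (a + L) :=
    seg_union (by lia) (by lia)
  have hd : [seg L a (a + 2 * r), seg L (a + 2 * r) b, seg L b (c - 2 * r), seg L (c - 2 * r) c,
      seg L c (c + r), seg L (c + r) (a + L)].Pairwise Disjoint := by
    simp only [List.pairwise_cons, List.mem_cons, List.not_mem_nil, or_false, forall_eq_or_imp,
      forall_eq, false_imp_iff, implies_true, List.Pairwise.nil, and_true]
    refine ⟨⟨?_, ?_, ?_, ?_, ?_⟩, ⟨?_, ?_, ?_, ?_⟩, ⟨?_, ?_, ?_⟩, ⟨?_, ?_⟩, ?_⟩ <;>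
      exact seg_disjoint (by lia) (by lia)
  have hu : seg L a (a + 2 * r) ∪ seg L (a + 2 * r) b ∪ (seg L b (c - 2 * r) ∪
      seg L (c - 2 * r) c) ∪ (seg L c (c + r) ∪ seg L (c + r) (a + L)) = Finset.univ := by
    rw [hA12, hB12, hC12, seg_union (by lia) (by lia), seg_union (by lia) (by lia),
      seg_eq_univ le_rfl]
  rw [← Matrix.mulVec_mulVec, ← Matrix.mulVec_mulVec] at hG
  iterate 4 rw [← Matrix.mulVec_mulVec] at hT
  have h1 : SuppOn (seg L (a + 2 * r) b ∪ seg L b (c - 2 * r)) t := by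
    rwa [seg_union (by lia) (by lia)]
  have h2 : SuppOn (seg L (c + r) (a + L) ∪ seg L a (a + 2 * r)) t₁ := by
    rw [← seg_add a, seg_union (by lia) (by lia)]
    exact ht1.mono (seg_mono le_rfl (by lia))
  have h3 : SuppOn (seg L (c - 2 * r) c ∪ seg L c (c + r)) t₂ := by
    rwa [seg_union (by lia) (by lia)]
  have := isProductAcross_of_tripartite hd hu h1 h2 h3 htu ht1u ht2u hs hχ0 hG hT
    (by rw [hA12]; exact (hΨA.mulVec_of_disjoint hsB dAB).mulVec_of_subset hsA subset_rfl)
    (by rw [hC12]; exact (hΨC.mulVec_of_disjoint hsB dBC.symm).mulVec_of_disjoint hsA dAC.symm)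
    (by
      rw [hA12]
      exact ((hΨA.mulVec_of_subset hsA' subset_rfl).mulVec_of_disjoint hsC'
        dAC).mulVec_of_disjoint hsB' dAB)
    (by
      rw [hB12]
      exact ((hΨB.mulVec_of_disjoint hsA' dAB.symm).mulVec_of_disjoint hsC'
        dBC).mulVec_of_subset hsB' subset_rfl)
  rwa [hA12, hB12] at this

theorem eq_smul_of_product_across {ι : Type} [Fintype ι] [DecidableEq ι] {K : ι → Type}
    [∀ i, Fintype (K i)] [∀ i, DecidableEq (K i)] {A B C : Finset ι} (dAB : Disjoint A B)
    (dAC : Disjoint A C) (dBC : Disjoint B C) (hABC : A ∪ B ∪ C = Finset.univ)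
    {χ FA GA FB GB FC GC : (∀ i, K i) → ℂ} (hχ0 : χ ≠ 0) (hFA : DependsOn FA (↑A : Set ι))
    (hGA : DependsOn GA (↑Aᶜ : Set ι)) (hFB : DependsOn FB (↑B : Set ι))
    (hGB : DependsOn GB (↑Bᶜ : Set ι)) (hFC : DependsOn FC (↑C : Set ι))
    (hGC : DependsOn GC (↑Cᶜ : Set ι)) (hA : χ = FA * GA) (hB : χ = FB * GB) (hC : χ = FC * GC) :
    ∃ z : ℂ, χ = z • (FA * (FB * FC)) := by
  obtain ⟨c₀, hc₀⟩ := Function.ne_iff.1 hχ0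
  have key := eq_prod_of_cells (Finset.univ : Finset (Fin 3)) ![A, B, C] (χ := χ)
    (F := ![FA, FB, FC]) (G := ![GA, GB, GC]) ?_ ?_ ?_ ?_ hc₀
  · refine ⟨χ c₀ / (FA c₀ * (FB c₀ * FC c₀)), funext fun d => ?_⟩
    have h1 := key d
    have h2 : (Finset.univ : Finset (Fin 3)).biUnion ![A, B, C] = Finset.univ := by
      rw [← hABC]
      ext x
      simp [Fin.exists_fin_succ]
    rw [h2, Finset.piecewise_univ, Fin.prod_univ_three] at h1
    rw [h1]
    simp only [Matrix.cons_val_zero, Matrix.cons_val_one, Matrix.cons_val, Pi.mul_apply,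
      Pi.smul_apply, smul_eq_mul]
    ring
  · intro i _ j _ hij
    fin_cases i <;> fin_cases j <;> simp at hij ⊢ <;>
      first | exact dAB | exact dAC | exact dBC | exact dAB.symm | exact dAC.symm | exact dBC.symm
  · intro i _
    fin_cases i
    exacts [hFA, hFB, hFC]
  · intro i _
    fin_cases i
    exacts [hGA, hGB, hGC]
  · intro i _
    fin_cases i
    exacts [hA, hB, hC]

/-- If `G` maps a tripartite product state to a product state and `T` does the same, then two
operators in the intersection of the support of `T` with the first two regions do the same, too. -/
theorem exists_local_pair {ι : Type} [Fintype ι] [DecidableEq ι] {K : ι → Type}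
    [∀ i, Fintype (K i)] [∀ i, DecidableEq (K i)] {A B C S : Finset ι} (dAB : Disjoint A B)
    (dAC : Disjoint A C) (dBC : Disjoint B C) (hABC : A ∪ B ∪ C = Finset.univ)
    {fA fB fC : (∀ i, K i) → ℂ} (hfA : DependsOn fA (↑A : Set ι))
    (hfB : DependsOn fB (↑B : Set ι)) (hfC : DependsOn fC (↑C : Set ι))
    {G T : Matrix (∀ i, K i) (∀ i, K i) ℂ} (hG : SuppOn (A ∪ B) G) (hT : SuppOn S T) {s : ℂ}
    (hs : s ≠ 0) (hχ0 : G *ᵥ (fA * (fB * fC)) ≠ 0)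
    (hTχ : T *ᵥ (fA * (fB * fC)) = s • (G *ᵥ (fA * (fB * fC))))
    (hA : IsProductAcross A (G *ᵥ (fA * (fB * fC)))) (hB : IsProductAcross B (G *ᵥ (fA * (fB * fC)))) :
    ∃ Wl Wr, SuppOn (S ∩ A) Wl ∧ SuppOn (S ∩ B) Wr ∧
      Wl *ᵥ (Wr *ᵥ (fA * (fB * fC))) = G *ᵥ (fA * (fB * fC)) := by
  have hfBA := hfB.mono (coe_subset_coe_compl dAB.symm)
  have hfCA := hfC.mono (coe_subset_coe_compl dAC.symm)
  have hfAB := hfA.mono (coe_subset_coe_compl dAB)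
  have hfCB := hfC.mono (coe_subset_coe_compl dBC.symm)
  have dABC : Disjoint (A ∪ B) C := Finset.disjoint_union_left.2 ⟨dAC, dBC⟩
  obtain ⟨FA, GA, hFA, hGA, hχA⟩ := hA
  obtain ⟨FB, GB, hFB, hGB, hχB⟩ := hB
  have hχC : G *ᵥ (fA * (fB * fC)) = fC * (G *ᵥ (fA * fB)) := by
    rw [show fA * (fB * fC) = fC * (fA * fB) by ring]
    exact hG.mulVec_mul' (hfC.mono (coe_subset_coe_compl dABC.symm))
  have hGC : DependsOn (G *ᵥ (fA * fB)) (↑Cᶜ : Set ι) := by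
    refine (hG.dependsOn_mulVec subset_rfl ?_).mono (coe_subset_coe_compl dABC)
    rw [Finset.coe_union]
    exact (hfA.mono Set.subset_union_left).mul' (hfB.mono Set.subset_union_right)
  -- As `G` does not touch `C`, the factor there is still `fC`. Hence only the factors on `A` and
  -- `B` have to be produced, each by an operator cut out of `T`; the scalar `z` is absorbed into
  -- `Wl`.
  obtain ⟨z, hz⟩ := eq_smul_of_product_across dAB dAC dBC hABC hχ0 hFA hGA hFB hGB hfC hGC hχA hχB
    hχC
  have hGA0 : GA ≠ 0 := by rintro rfl; exact hχ0 (by rw [hχA, mul_zero])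
  have hGB0 : GB ≠ 0 := by rintro rfl; exact hχ0 (by rw [hχB, mul_zero])
  have hcomm : fA * (fB * fC) = fB * (fA * fC) := by ring
  obtain ⟨Wl, hWl, hWl'⟩ := exists_local_of_product hT hfA (hfBA.mul' hfCA) hFA
    (φ₁ := s • GA) (fun x y hxy => by simp [hGA hxy])
    (by rw [hTχ, hχA, mul_smul_comm]) (smul_ne_zero hs hGA0)
  obtain ⟨Wr, hWr, hWr'⟩ := exists_local_of_product hT hfB (hfAB.mul' hfCB) hFB
    (φ₁ := s • GB) (fun x y hxy => by simp [hGB hxy])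
    (by rw [← hcomm, hTχ, hχB, mul_smul_comm])
    (smul_ne_zero hs hGB0)
  refine ⟨z • Wl, Wr, hWl.smul z, hWr, ?_⟩
  rw [hz]
  conv_lhs => rw [hcomm]
  rw [hWr' _ (hfAB.mul' hfCB), show FB * (fA * fC) = fA * (FB * fC) by ring, Matrix.smul_mulVec,
    hWl' _ ((hFB.mono (coe_subset_coe_compl dAB.symm)).mul' hfCA)]

/-- The operators cut out of `T` live near the outer ends of `A` and `B`. Their conjugates under `G`
stay inside `A` and `B`, as `false_of_truncated_symmetry` requires. -/
theorem false_of_hat_decomposition {x : ℕ} (hx : x + 1 ≤ r) (hab : a + 4 * r ≤ b)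
    (hbc : b + 4 * r ≤ c) (hca : c + 4 * r ≤ a + L) {fA fB fC : (∀ x, K x) → ℂ}
    (hfA : DependsOn fA (↑(seg L a b) : Set (ZMod L)))
    (hfB : DependsOn fB (↑(seg L b c) : Set (ZMod L)))
    (hfC : DependsOn fC (↑(seg L c (a + L)) : Set (ZMod L))) (hne : fA * (fB * fC) ≠ 0) {s : ℂ}
    (hs : s ≠ 0) {G T Zp Zq : Matrix (∀ x, K x) (∀ x, K x) ℂ}
    (hG : G ∈ Matrix.unitaryGroup (∀ x, K x) ℂ) (hGs : SuppOn (seg L a c) G)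
    (hGc : ∀ N M, SuppOn N M → SuppOn (nbhd x N) (G * M * Gᴴ))
    (hTs : SuppOn (seg L (c - 2 * r) (a + 2 * r + L)) T)
    (hTχ : T *ᵥ (fA * (fB * fC)) = s • (G *ᵥ (fA * (fB * fC))))
    (hA : IsProductAcross (seg L a b) (G *ᵥ (fA * (fB * fC))))
    (hB : IsProductAcross (seg L b c) (G *ᵥ (fA * (fB * fC)))) (hZp : SuppOn (seg L a b) Zp)
    (hZq : SuppOn (seg L b c) Zq) (hZpu : Zp ∈ Matrix.unitaryGroup (∀ x, K x) ℂ)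
    (hZqu : Zq ∈ Matrix.unitaryGroup (∀ x, K x) ℂ) {ε : ℂ} (hε : ε ≠ 0)
    (hGG : G * G = ε • (Zp * Zq)) (hGZ : G * Zp = -(Zp * G)) : False := by
  have dAB : Disjoint (seg L a b) (seg L b c) := seg_disjoint le_rfl (by lia)
  have dBC : Disjoint (seg L b c) (seg L c (a + L)) := seg_disjoint le_rfl (by lia)
  have dAC : Disjoint (seg L a b) (seg L c (a + L)) := seg_disjoint (by lia) le_rfl
  have hABs : seg L a b ∪ seg L b c = seg L a c := seg_union (by lia) (by lia)
  have hχ0 := mulVec_unitary_ne_zero hG hne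
  have hΨA : IsProductAcross (seg L a b) (fA * (fB * fC)) := ⟨fA, fB * fC, hfA,
    (hfB.mono (coe_subset_coe_compl dAB.symm)).mul' (hfC.mono (coe_subset_coe_compl dAC.symm)), rfl⟩
  obtain ⟨Wl, Wr, hWl, hWr, hW⟩ := exists_local_pair dAB dAC dBC
    (by rw [hABs, seg_union (by lia) (by lia), seg_eq_univ le_rfl]) hfA hfB hfC
    (by rwa [hABs]) hTs hs hχ0 hTχ hA hB
  replace hWl := hWl.mono (inter_subset_of_disjoint
    (seg_union (by lia) (by lia : a + 2 * r ≤ b)).symm (by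
      rw [disjoint_comm]
      have := seg_disjoint (L := L) (a := c - 2 * r) (b := a + 2 * r + L) (c := a + 2 * r + L)
        (d := b + L) le_rfl (by lia)
      rwa [seg_add (a + 2 * r) b] at this))
  replace hWr := hWr.mono (inter_subset_of_disjoint
    ((seg_union (by lia) (by lia : c - 2 * r ≤ c)).symm.trans (Finset.union_comm _ _))
    (seg_disjoint (L := L) (a := b) (b := c - 2 * r) le_rfl (by lia)))
  have hconjs : ∀ {M : Matrix (∀ x, K x) (∀ x, K x) ℂ}, SuppOn (seg L a c) M →
      SuppOn (seg L a c) (G * M * Gᴴ) := fun hM => (hGs.mul hM).mul hGs.conjTranspose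
  -- Two bounds are intersected: the light cone keeps the conjugate away from `b`, and since `G` and
  -- `Wl` live on [a, c), nothing leaks beyond `a`.
  have hP : SuppOn (seg L a b) (G * Wl * Gᴴ) := by
    have h1 := (hGc _ _ hWl).mono (nbhd_seg _ _ _)
    have h2 := hconjs (hWl.mono (seg_mono le_rfl (by lia)))
    refine (h2.inter h1).mono ?_
    refine (inter_subset_of_disjoint (A₁ := seg L a (a + 2 * r + x))
      (A₂ := seg L (a - x) a) ?_ ?_).trans (seg_mono le_rfl (by lia))
    · rw [Finset.union_comm, seg_union (by lia) (by lia)]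
    · exact seg_disjoint le_rfl (by lia)
  have hQ : SuppOn (seg L b c) (G * Wr * Gᴴ) := by
    have h1 := (hGc _ _ hWr).mono (nbhd_seg _ _ _)
    have h2 := hconjs (hWr.mono (seg_mono (by lia) le_rfl))
    refine (h2.inter h1).mono ?_
    refine (inter_subset_of_disjoint (A₁ := seg L (c - 2 * r - x) c)
      (A₂ := seg L c (c + x)) ?_ ?_).trans (seg_mono (by lia) le_rfl)
    · rw [seg_union (by lia) (by lia)]
    · exact (seg_disjoint le_rfl (by lia)).symm
  have hGi : Gᴴ * G = 1 := unitary_conjTranspose_mul hG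
  exact false_of_truncated_symmetry dAB hε hG hZp hZq hZpu hZqu hGG hGZ
    (hWl.mono (seg_mono le_rfl (by lia))) (hWr.mono (seg_mono (by lia) le_rfl)) hP hQ
    (by rw [mul_assoc, hGi, mul_one]) (by rw [mul_assoc, hGi, mul_one]) hne hΨA hW

end RingTripartite

/-! ### No eigenvector of U_CZX comes from a tripartite product -/

section NoTripartite

variable {L : ℕ} [NeZero L] {τ η : ZMod L → Type} [∀ x, Fintype (τ x)] [∀ x, DecidableEq (τ x)]
  [∀ x, Fintype (η x)] [∀ x, DecidableEq (η x)] {e : ∀ x, τ x ≃ Qubits L x × η x}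

theorem liftOp_neg (A : Matrix (Conf (Qubits L)) (Conf (Qubits L)) ℂ) :
    liftOp e (-A) = -liftOp e A := by
  rw [← neg_one_smul ℂ, liftOp_smul, neg_one_smul]

theorem suppOn_hat_conj {R n : ℕ} {K : Matrix (∀ x, τ x) (∀ x, τ x) ℂ} (hK : Circ (IsArc R) n K)
    (β : BondSigns L) (F I : Finset (ZMod L)) {N : Finset (ZMod L)}
    {M : Matrix (∀ x, τ x) (∀ x, τ x) ℂ} (hM : SuppOn N M) :
    SuppOn (nbhd (2 * (n * R) + 1) N)
      (Kᴴ * liftOp e (β.op F I) * K * M * (Kᴴ * liftOp e (β.op F I) * K)ᴴ) := by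
  have hp : ∀ S : Finset (ZMod L), IsArc R S → SmallSupp R S := fun S hS => smallSupp_of_isArc hS
  have h1 := (hK.conj hp (BondSigns.op_conj e β F I _ _ (hK.conj hp hM).2)).1
  rw [nbhd_nbhd, nbhd_nbhd] at h1
  have h2 : Kᴴ * liftOp e (β.op F I) * K * M * (Kᴴ * liftOp e (β.op F I) * K)ᴴ =
      Kᴴ * (liftOp e (β.op F I) * (K * M * Kᴴ) * (liftOp e (β.op F I))ᴴ) * K := by
    simp only [Matrix.conjTranspose_mul, Matrix.conjTranspose_conjTranspose, mul_assoc]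
  rw [h2]
  exact h1.mono (nbhd_mono (by lia) subset_rfl)

theorem hat_mul_self {K : Matrix (∀ x, τ x) (∀ x, τ x) ℂ}
    (hK : K ∈ Matrix.unitaryGroup (∀ x, τ x) ℂ) {p q : ℤ} (h : p ≤ q) (hL : q ≤ p + L) :
    ∃ ε : ℂ, ε ≠ 0 ∧ Kᴴ * liftOp e ((czSigns L ∅).op (seg L p q) (seg L p (q + 1))) * K *
      (Kᴴ * liftOp e ((czSigns L ∅).op (seg L p q) (seg L p (q + 1))) * K) =
      ε • (Kᴴ * liftOp e (zOp (p : ZMod L)) * K * (Kᴴ * liftOp e (zOp (q : ZMod L)) * K)) := by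
  obtain ⟨m, rfl⟩ : ∃ m : ℕ, q = p + m := ⟨(q - p).toNat, by lia⟩
  refine ⟨(-1) ^ m, pow_ne_zero m (by norm_num), ?_⟩
  rw [conj_mul_conj hK, conj_mul_conj hK, ← liftOp_mul, op_mul_self p m (by lia), ← liftOp_mul,
    liftOp_smul]
  simp only [Matrix.mul_smul, Matrix.smul_mul]

theorem hat_mul_zOp {K : Matrix (∀ x, τ x) (∀ x, τ x) ℂ}
    (hK : K ∈ Matrix.unitaryGroup (∀ x, τ x) ℂ) (β : BondSigns L) {F I : Finset (ZMod L)}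
    {x : ZMod L} (hx : x ∈ I) : Kᴴ * liftOp e (β.op F I) * K * (Kᴴ * liftOp e (zOp x) * K) =
      -(Kᴴ * liftOp e (zOp x) * K * (Kᴴ * liftOp e (β.op F I) * K)) := by
  rw [conj_mul_conj hK, conj_mul_conj hK, ← liftOp_mul, op_mul_zOp hx, liftOp_neg, ← liftOp_mul,
    mul_neg, neg_mul]

theorem suppOn_hat_zOp {R n : ℕ} {K : Matrix (∀ x, τ x) (∀ x, τ x) ℂ} (hK : Circ (IsArc R) n K)
    (i : ℤ) : SuppOn (seg L (i - (n * R : ℕ)) (i + 1 + (n * R : ℕ)))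
      (Kᴴ * liftOp e (zOp (i : ZMod L)) * K) := by
  refine (hK.conj (fun S hS => smallSupp_of_isArc hS)
    (suppOn_liftOp e ((suppOn_zOp _).mono (T := seg L i (i + 1)) ?_))).1.mono (nbhd_seg _ _ _)
  intro x hx
  rw [Finset.mem_singleton.1 hx]
  exact cast_mem_seg le_rfl (by lia)

/-- A tripartite product state prepared by a circuit is not an eigenvector of `U_CZX`. -/
theorem false_of_tripartite_eigenvector {R n : ℕ} (hR : 1 ≤ R)
    {K : Matrix (∀ x, τ x) (∀ x, τ x) ℂ} (hK : Circ (IsArc R) n K) {a b c : ℤ} {r : ℕ}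
    (hr : r = 2 * (n * R) + R + 2) (hab : a + 4 * r ≤ b) (hbc : b + 4 * r ≤ c)
    (hca : c + 4 * r ≤ a + L) {fA fB fC : (∀ x, τ x) → ℂ}
    (hfA : DependsOn fA (↑(seg L a b) : Set (ZMod L)))
    (hfB : DependsOn fB (↑(seg L b c) : Set (ZMod L)))
    (hfC : DependsOn fC (↑(seg L c (a + L)) : Set (ZMod L))) (hne : fA * (fB * fC) ≠ 0) {s : ℂ}
    (hs : s ≠ 0)
    (h : liftOp e (czx L) *ᵥ (K *ᵥ (fA * (fB * fC))) = s • (K *ᵥ (fA * (fB * fC)))) : False := by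
  have dAB : Disjoint (seg L a b) (seg L b c) := seg_disjoint le_rfl (by lia)
  have dBC : Disjoint (seg L b c) (seg L c (a + L)) := seg_disjoint le_rfl (by lia)
  have dAC : Disjoint (seg L a b) (seg L c (a + L)) := seg_disjoint (by lia) le_rfl
  have hfBA := hfB.mono (coe_subset_coe_compl dAB.symm)
  have hfCA := hfC.mono (coe_subset_coe_compl dAC.symm)
  have hfAB := hfA.mono (coe_subset_coe_compl dAB)
  have hfCB := hfC.mono (coe_subset_coe_compl dBC.symm)
  have hfAC := hfA.mono (coe_subset_coe_compl dAC)
  have hfBC := hfB.mono (coe_subset_coe_compl dBC)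
  have hΨA : IsProductAcross (seg L a b) (fA * (fB * fC)) := ⟨fA, fB * fC, hfA, hfBA.mul' hfCA, rfl⟩
  have hΨB : IsProductAcross (seg L b c) (fA * (fB * fC)) :=
    ⟨fB, fA * fC, hfB, hfAB.mul' hfCB, by ring⟩
  have hΨC : IsProductAcross (seg L c (a + L)) (fA * (fB * fC)) :=
    ⟨fC, fA * fB, hfC, hfAC.mul' hfBC, by ring⟩
  have hp : ∀ S : Finset (ZMod L), IsArc R S → SmallSupp R S := fun S hS => smallSupp_of_isArc hS
  have hKu := hK.unitary
  have hKu' := conjTranspose_mem_unitary hKu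
  obtain ⟨t, sA, sB, htu, hts, hsA, hsB, eG⟩ :=
    exists_hat_truncated (e := e) hR hK hr hab hbc hca
  obtain ⟨t₁, t₂, sA', sB', sC', ht1u, ht2u, ht1, ht2, hsA', hsB', hsC', eT⟩ :=
    exists_hat_complement (e := e) hR hK hr hab hbc hca (czSigns L (seg L (c - r) (a + r + L)))
  have hGU := op_mul_czx (L := L) (p := a + r) (q := c - r - 1) (by lia) (by lia)
  obtain ⟨ε, hε, hGG⟩ := hat_mul_self (e := e) hKu (p := a + r) (q := c - r - 1) (by lia) (by lia)
  rw [sub_add_cancel] at hGU hGG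
  have hGZ := hat_mul_zOp (e := e) hKu (czSigns L ∅) (F := seg L (a + r) (c - r - 1))
    (I := seg L (a + r) (c - r)) (cast_mem_seg (L := L) le_rfl (by lia : a + r < c - r))
  have hGc : ∀ N M, SuppOn N M → _ := fun N M hM => suppOn_hat_conj (e := e) hK (czSigns L ∅)
    (seg L (a + r) (c - r - 1)) (seg L (a + r) (c - r)) (N := N) (M := M) hM
  have hGs : SuppOn (seg L (a + r) (c - r))
      ((czSigns L ∅).op (seg L (a + r) (c - r - 1)) (seg L (a + r) (c - r))) :=
    BondSigns.suppOn_op _ (mem_seg_and_succ le_rfl (by lia)) subset_rfl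
  have hGhs := (hK.conj hp (suppOn_liftOp e hGs)).1.mono
    ((nbhd_seg _ _ _).trans (seg_mono (c := a) (d := c) (by lia) (by lia)))
  have hGhu := mul_mem (mul_mem hKu' (liftOp_unitary e (BondSigns.op_unitary (czSigns L ∅)
    (seg L (a + r) (c - r - 1)) (seg L (a + r) (c - r))))) hKu
  have hThs : SuppOn (seg L (c - 2 * r) (a + 2 * r + L)) (Kᴴ * liftOp e ((czSigns L
      (seg L (c - r) (a + r + L))).op (seg L (c - r - 1) (a + r + L))
        (seg L (c - r) (a + r + L))) * K) := by
    refine (hK.conj hp (T := seg L (c - r - 1) (a + r + L + 1)) (suppOn_liftOp e ?_)).1.mono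
      ((nbhd_seg _ _ _).trans (seg_mono (by lia) (by lia)))
    exact BondSigns.suppOn_op _ (mem_seg_and_succ le_rfl (by lia)) (seg_mono (by lia) (by lia))
  have hTχ : (Kᴴ * liftOp e ((czSigns L
      (seg L (c - r) (a + r + L))).op (seg L (c - r - 1) (a + r + L))
        (seg L (c - r) (a + r + L))) * K) *ᵥ (fA * (fB * fC)) =
      s • ((Kᴴ * liftOp e ((czSigns L ∅).op (seg L (a + r) (c - r - 1)) (seg L (a + r) (c - r))) *
        K) *ᵥ (fA * (fB * fC))) := by
    -- The complementary truncation is `G` times U_CZX, and U_CZX acts on the prepared vector as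
    -- `s`.
    rw [← hGU, liftOp_mul]
    simp only [← Matrix.mulVec_mulVec]
    rw [h, Matrix.mulVec_smul, Matrix.mulVec_smul]
  generalize Kᴴ * liftOp e ((czSigns L ∅).op (seg L (a + r) (c - r - 1)) (seg L (a + r) (c - r))) *
    K = Gh at *
  generalize Kᴴ * liftOp e ((czSigns L
      (seg L (c - r) (a + r + L))).op (seg L (c - r - 1) (a + r + L))
        (seg L (c - r) (a + r + L))) * K = Th at *
  have hχ0 := mulVec_unitary_ne_zero hGhu hne
  obtain ⟨hA, hB⟩ := isProductAcross_of_tripartite_seg hab hbc hca hΨA hΨB hΨC htu ht1u ht2u hts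
    hsA hsB ht1 ht2 hsA' hsB' hsC' hs hχ0 (by rw [← eG]) (by rw [← eT, hTχ])
  exact false_of_hat_decomposition (x := 2 * (n * R) + 1) (by lia) hab hbc hca hfA hfB hfC hne hs
    hGhu hGhs hGc hThs hTχ hA hB
    ((suppOn_hat_zOp hK (a + r)).mono (seg_mono (by push_cast; lia) (by push_cast; lia)))
    ((suppOn_hat_zOp hK (c - r - 1)).mono (seg_mono (by push_cast; lia) (by push_cast; lia)))
    (mul_mem (mul_mem hKu' (liftOp_unitary e (zOp_unitary _))) hKu)
    (mul_mem (mul_mem hKu' (liftOp_unitary e (zOp_unitary _))) hKu) hε hGG hGZ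

end NoTripartite


/-! ### Nested environments -/

section NestedTensor

variable {ι : Type} [Fintype ι] [DecidableEq ι] {τ κ β κ₁ β₁ : ι → Type}
  [∀ i, Fintype (τ i)] [∀ i, DecidableEq (τ i)] [∀ i, Fintype (κ i)] [∀ i, DecidableEq (κ i)]
  [∀ i, Fintype (β i)] [∀ i, DecidableEq (β i)] [∀ i, Fintype (κ₁ i)] [∀ i, DecidableEq (κ₁ i)]
  [∀ i, Fintype (β₁ i)] [∀ i, DecidableEq (β₁ i)]

/-- The splitting `τ ≃ κ₁ ⊗ (β₁ ⊗ β)` obtained from `τ ≃ κ ⊗ β` and `κ ≃ κ₁ ⊗ β₁`. -/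
def nestTensor (e : ∀ i, τ i ≃ κ i × β i) (e₁ : ∀ i, κ i ≃ κ₁ i × β₁ i) (i : ι) :
    τ i ≃ κ₁ i × (β₁ i × β i) :=
  ((e i).trans ((e₁ i).prodCongr (Equiv.refl _))).trans (Equiv.prodAssoc _ _ _)

theorem liftOp_nestTensor (e : ∀ i, τ i ≃ κ i × β i) (e₁ : ∀ i, κ i ≃ κ₁ i × β₁ i)
    (O : Matrix (∀ i, κ₁ i) (∀ i, κ₁ i) ℂ) :
    liftOp (nestTensor e e₁) O = liftOp e (liftOp e₁ O) := by
  ext c c'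
  simp only [liftOp, Matrix.submatrix_apply, Matrix.kroneckerMap_apply, pairing, Equiv.coe_fn_mk,
    nestTensor, Equiv.trans_apply, Equiv.prodCongr_apply, Prod.map_fst, Prod.map_snd,
    Equiv.refl_apply, Equiv.prodAssoc_apply, Matrix.one_apply, mul_assoc]
  congr 1
  by_cases h1 : (fun i => ((e₁ i) ((e i) (c i)).1).2) = fun i => ((e₁ i) ((e i) (c' i)).1).2
  · by_cases h2 : (fun i => ((e i) (c i)).2) = fun i => ((e i) (c' i)).2
    · rw [if_pos h1, if_pos h2, if_pos, one_mul]
      funext i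
      exact Prod.ext (congrFun h1 i) (congrFun h2 i)
    · rw [if_neg h2, if_neg, mul_zero]
      exact fun h => h2 (funext fun i => (Prod.ext_iff.1 (congrFun h i)).2)
  · rw [if_neg h1, if_neg, zero_mul]
    exact fun h => h1 (funext fun i => (Prod.ext_iff.1 (congrFun h i)).1)

end NestedTensor

/-! ### First part of the theorem -/

section PreparedFromTripartite

variable {L : ℕ} [NeZero L]

/-- The vector is a product of vectors on the arcs `[a, b)`, `[b, c)` and `[c, a + L)`. -/
def IsTripartite {κ : ZMod L → Type} (a b c : ℤ) (f : Conf κ → ℂ) : Prop :=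
  ∃ fA fB fC : Conf κ → ℂ, DependsOn fA (↑(seg L a b) : Set (ZMod L)) ∧
    DependsOn fB (↑(seg L b c) : Set (ZMod L)) ∧
    DependsOn fC (↑(seg L c (a + L)) : Set (ZMod L)) ∧ f = fA * (fB * fC)

variable {κ κ' μ β : ZMod L → Type} [∀ x, Fintype (κ x)] [∀ x, DecidableEq (κ x)]
  [∀ x, Fintype (κ' x)] [∀ x, DecidableEq (κ' x)] [∀ x, Fintype (μ x)] [∀ x, DecidableEq (μ x)]
  [∀ x, Fintype (β x)] [∀ x, DecidableEq (β x)]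

theorem isTripartite_prodVec {a b c : ℤ} (hab : a ≤ b) (hbc : b ≤ c) (hca : c ≤ a + L)
    (v : ∀ x, κ x → ℂ) : IsTripartite a b c (prodVec v) := by
  refine ⟨fun d => ∏ x ∈ seg L a b, v x (d x), fun d => ∏ x ∈ seg L b c, v x (d x),
    fun d => ∏ x ∈ seg L c (a + L), v x (d x), ?_, ?_, ?_, ?_⟩
  · exact fun d d' h => Finset.prod_congr rfl fun x hx => by rw [h x (by simpa using hx)]
  · exact fun d d' h => Finset.prod_congr rfl fun x hx => by rw [h x (by simpa using hx)]
  · exact fun d d' h => Finset.prod_congr rfl fun x hx => by rw [h x (by simpa using hx)]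
  · funext d
    simp only [Pi.mul_apply]
    rw [← Finset.prod_union (seg_disjoint le_rfl (by lia)), seg_union hbc hca,
      ← Finset.prod_union (seg_disjoint le_rfl (by lia)), seg_union hab (by lia),
      seg_eq_univ le_rfl]
    rfl

theorem IsTripartite.tens {a b c : ℤ} {f : Conf κ → ℂ} {h : Conf β → ℂ}
    (hf : IsTripartite a b c f) (hh : IsTripartite a b c h) (e : ∀ x, μ x ≃ κ x × β x) :
    IsTripartite a b c (tens e f h) := by
  obtain ⟨fA, fB, fC, hA, hB, hC, rfl⟩ := hf
  obtain ⟨gA, gB, gC, hA', hB', hC', rfl⟩ := hh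
  have key : ∀ {T : Set (ZMod L)} {f : Conf κ → ℂ} {g : Conf β → ℂ}, DependsOn f T →
      DependsOn g T → DependsOn (_root_.tens e f g) T := by
    intro T f g hf hg t t' h
    simp only [_root_.tens]
    rw [hf (x := (pairing e t).1) (y := (pairing e t').1) fun x hx => by simp [pairing, h x hx],
      hg (x := (pairing e t).2) (y := (pairing e t').2) fun x hx => by simp [pairing, h x hx]]
  refine ⟨_, _, _, key hA hA', key hB hB', key hC hC', ?_⟩
  funext t
  simp only [_root_.tens, Pi.mul_apply]
  ring

theorem prodVec_ne_zero {v : ∀ x, κ x → ℂ} (hv : ∀ x, IsUnitVec (v x)) : prodVec v ≠ 0 := by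
  have : ∀ x, ∃ k, v x k ≠ 0 := by
    intro x
    by_contra! h
    have := hv x
    simp [IsUnitVec, h] at this
  choose k hk using this
  exact fun h => Finset.prod_ne_zero_iff.2 (fun x _ => hk x) (congrFun h k)

theorem tens_ne_zero (e : ∀ x, μ x ≃ κ x × β x) {f : Conf κ → ℂ} {h : Conf β → ℂ} (hf : f ≠ 0)
    (hh : h ≠ 0) : tens e f h ≠ 0 := by
  obtain ⟨y, hy⟩ := Function.ne_iff.1 hf
  obtain ⟨z, hz⟩ := Function.ne_iff.1 hh
  refine Function.ne_iff.2 ⟨(pairing e).symm (y, z), ?_⟩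
  simpa [tens] using And.intro hy hz

theorem intUnit_cast_mul_self (s : ℤˣ) : (((s : ℤ) : ℂ)) * ((s : ℤ) : ℂ) = 1 := by
  rcases Int.units_eq_one_or s with rfl | rfl <;> simp

theorem czx_sub_mul_czxState (hL : Even L) (s : ℤˣ) :
    (czx L - ((s : ℤ) : ℂ) • 1) * czxState L s = 0 := by
  rw [czxState, Matrix.mul_smul, mul_add, sub_mul, sub_mul, Matrix.mul_smul, czx_mul_self hL,
    Matrix.smul_mul, one_mul, Matrix.smul_mul, one_mul, smul_smul, intUnit_cast_mul_self]
  simp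

/-- The circuit may produce `Ψ` together with an environment vector `h`. This covers both claims of
the first part: a trivial environment for short-range entangled states, and the traced-out one for
channels. The range is at least 1 so that a bond gate fits into the neighbourhood of a cut. -/
theorem false_of_prepared_from_tripartite {R D R' D' : ℕ} (hL : Even L) {s : ℤˣ}
    {Ψ : Conf κ → ℂ}
    {E : Matrix (Conf κ) (Conf κ) ℂ → Matrix (Conf (Qubits L)) (Conf (Qubits L)) ℂ}
    (hE : IsLocalChannel R D E) (hEΨ : E (pureState Ψ) = czxState L s)
    {a b c : ℤ} {r R₁ : ℕ} (hR₁ : R₁ = max (max R R') 1)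
    (hr : r = 2 * ((D' + (D + D)) * R₁) + R₁ + 2) (hab : a + 4 * r ≤ b)
    (hbc : b + 4 * r ≤ c) (hca : c + 4 * r ≤ a + L) {f : Conf μ → ℂ} (hf : IsTripartite a b c f)
    (hf0 : f ≠ 0) (e : ∀ x, μ x ≃ κ x × β x) {K : Matrix (Conf μ) (Conf μ) ℂ}
    (hK : Circ (IsArc R') D' K) {h : Conf β → ℂ} (hKf : K *ᵥ f = tens e Ψ h) : False := by
  obtain ⟨α, α', e', U, v, hU, hv, hker⟩ := hE.exists_circ
  have h1 := hker Unit (fun _ => 1) (fun _ => Ψ) (czx L - ((s : ℤ) : ℂ) • 1) (by simp)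
    (by simp [hEΨ, czx_sub_mul_czxState hL]) () (by simp)
  rw [liftOp_sub, liftOp_smul, liftOp_one, Matrix.sub_mulVec, Matrix.smul_mulVec,
    Matrix.one_mulVec, sub_eq_zero] at h1
  let e₀ : ∀ x, μ x × Fin (α x) ≃ μ x × Fin (α x) := fun x => Equiv.refl _
  -- The tensor factors are regrouped so that the circuit of the channel, which acts on `κ` and its
  -- ancillas, extends to the space that also contains the environment `β`.
  let eU : ∀ x, μ x × Fin (α x) ≃ (κ x × Fin (α x)) × β x := fun x =>
    { toFun := fun p => (((e x p.1).1, p.2), (e x p.1).2)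
      invFun := fun q => ((e x).symm (q.1.1, q.2), q.1.2)
      left_inv := fun p => by simp
      right_inv := fun q => by simp }
  have hU' : Circ (IsArc R₁) (D + D) (liftOp eU U) := (hU.liftOp eU).mono
    fun S ⟨x, k, hk, hS⟩ => ⟨x, k, by lia, hS⟩
  have hK' : Circ (IsArc R₁) D' (liftOp e₀ K) := (hK.liftOp e₀).mono
    fun S ⟨x, k, hk, hS⟩ => ⟨x, k, by lia, hS⟩
  have hvec : (liftOp eU U * liftOp e₀ K) *ᵥ tens e₀ f (prodVec v) =
      tens eU (U *ᵥ tens (fun x => Equiv.refl (κ x × Fin (α x))) Ψ (prodVec v)) h := by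
    rw [← Matrix.mulVec_mulVec, liftOp_mulVec_tens, hKf, ← liftOp_mulVec_tens]
    congr 1
    funext t
    simp only [tens, pairing, eU, e₀, Equiv.coe_fn_mk, Equiv.refl_apply]
    ring
  obtain ⟨fA, fB, fC, hA, hB, hC, hfe⟩ :=
    hf.tens (isTripartite_prodVec (by lia) (by lia) (by lia) v) e₀
  have hne := tens_ne_zero e₀ hf0 (prodVec_ne_zero hv)
  rw [hfe] at hvec hne
  refine false_of_tripartite_eigenvector (e := nestTensor eU e') (R := R₁) (by lia) (hU'.mul hK')
    hr hab hbc hca hA hB hC hne (s := ((s : ℤ) : ℂ))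
    (fun h0 => by simpa [h0] using intUnit_cast_mul_self s) ?_
  rw [hvec, liftOp_nestTensor, liftOp_mulVec_tens, h1]
  funext t
  simp [tens, mul_assoc]

theorem czx_preparation_not_sre {R D R' D' : ℕ} (hL : Even L) {s : ℤˣ} {Ψ : Conf κ → ℂ}
    {E : Matrix (Conf κ) (Conf κ) ℂ → Matrix (Conf (Qubits L)) (Conf (Qubits L)) ℂ}
    (hE : IsLocalChannel R D E) (hEΨ : E (pureState Ψ) = czxState L s)
    {r R₁ : ℕ} (hR₁ : R₁ = max (max R R') 1)
    (hr : r = 2 * ((D' + (D + D)) * R₁) + R₁ + 2) (hrL : 12 * r ≤ L) : ¬ IsSRE R' D' Ψ := by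
  rintro ⟨v, U, hv, hU, rfl⟩
  -- A product vector is a product over any three arcs; the arcs are taken to start at 0, 4r and 8r,
  -- which uses `12 * r ≤ L`.
  refine false_of_prepared_from_tripartite (β := fun _ => Unit) hL hE hEΨ hR₁ hr (a := 0)
    (b := 4 * r) (c := 8 * r) (by lia) (by lia) (by lia)
    (isTripartite_prodVec (by lia) (by lia) (by lia) v) (prodVec_ne_zero hv)
    (fun x => (Equiv.prodUnique _ _).symm) hU.circ (h := 1) ?_
  funext t
  simp only [tens, pairing, Pi.one_apply, mul_one]
  rfl

/-- A single branch of the separable mixture with positive weight suffices: a circuit maps this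
tripartite product, with product ancillas, to `Ψ` times an environment vector. -/
theorem czx_preparation_not_tripartite {R D R' D' : ℕ} (hL : Even L) {s : ℤˣ} {Ψ : Conf κ → ℂ}
    {E : Matrix (Conf κ) (Conf κ) ℂ → Matrix (Conf (Qubits L)) (Conf (Qubits L)) ℂ}
    (hΨ : IsUnitVec Ψ) (hE : IsLocalChannel R D E) (hEΨ : E (pureState Ψ) = czxState L s)
    {r R₁ : ℕ} (hR₁ : R₁ = max (max R R') 1)
    (hr : r = 2 * (((D' + D') + (D + D)) * R₁) + R₁ + 2) {P : Fin 3 → Finset (ZMod L)}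
    {σ : Matrix (Conf κ') (Conf κ') ℂ} {E' : Matrix (Conf κ') (Conf κ') ℂ → Matrix (Conf κ) (Conf κ) ℂ}
    (hP : IsArcPartition (12 * r) P) (hσ : IsPartSeparable P σ) (hE' : IsLocalChannel R' D' E') :
    E' σ ≠ pureState Ψ := by
  intro hσΨ
  obtain ⟨n, w, f, hw, hw1, hf, rfl⟩ := hσ
  obtain ⟨k, hk⟩ : ∃ k, 0 < w k := by
    by_contra! h
    have : ∑ j, w j ≤ 0 := Finset.sum_nonpos fun j _ => h j
    linarith
  obtain ⟨a, b, c, hab, hbc, hca, hA, hB, hC⟩ := exists_seg_of_isArcPartition (by lia) hP |>.choose_spec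
  set π := (exists_seg_of_isArcPartition (by lia) hP).choose
  obtain ⟨α, α', e, U, v, hU, hv, hker⟩ := hE'.exists_circ
  have hΨ1 : star Ψ ⬝ᵥ Ψ = 1 := by
    have : star Ψ ⬝ᵥ Ψ = ((∑ i, ‖Ψ i‖ ^ 2 : ℝ) : ℂ) := by
      push_cast
      exact Finset.sum_congr rfl fun i _ => by
        rw [← Complex.conj_mul', Pi.star_apply, Complex.star_def]
    rw [this, hΨ, Complex.ofReal_one]
  have h1 := hker (Fin n) w _ (1 - pureState Ψ) hw (by
    rw [hσΨ, sub_mul, one_mul, pureState, Matrix.vecMulVec_mul_vecMulVec, hΨ1]; simp) k hk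
  obtain ⟨g, hg⟩ := exists_tens_of_liftOp_eq_zero e h1
  have hdep : ∀ i, DependsOn (fun c : Conf κ' => f k i fun x => c x) (↑(P i) : Set (ZMod L)) := by
    intro i c c' h
    exact congrArg (f k i) (funext fun x => h x.1 x.2)
  have hdep' : ∀ {i} {S : Finset (ZMod L)}, P i = S →
      DependsOn (fun c : Conf κ' => f k i fun x => c x) (↑S : Set (ZMod L)) := by
    rintro i S rfl
    exact hdep i
  have htri : IsTripartite a b c (fun c : Conf κ' => ∏ i, f k i fun x => c x) := by
    refine ⟨_, _, _, hdep' hA, hdep' hB, hdep' hC, ?_⟩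
    funext d
    rw [← Equiv.prod_comp π, Fin.prod_univ_three]
    simp [mul_assoc]
  refine false_of_prepared_from_tripartite hL hE hEΨ hR₁ hr (by lia) (by lia) (by lia)
    (htri.tens (isTripartite_prodVec (by lia) (by lia) (by lia) v) _)
    (tens_ne_zero _ ?_ (prodVec_ne_zero hv)) e hU hg
  have hne : ∀ i, ∃ d, f k i d ≠ 0 := by
    intro i
    by_contra! h
    have := hf k i
    simp [IsUnitVec, h] at this
  choose d hd using hne
  have hmem : ∀ x, ∃ i, x ∈ P i := hP.2.2
  choose i hi using hmem
  refine Function.ne_iff.2 ⟨fun x => d (i x) ⟨x, hi x⟩, ?_⟩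
  refine Finset.prod_ne_zero_iff.2 fun j _ => ?_
  convert hd j using 2
  funext x
  obtain ⟨x, hx⟩ := x
  have : i x = j := by
    by_contra h
    exact Finset.disjoint_left.1 (hP.2.1 _ _ h) (hi x) hx
  subst this
  rfl

end PreparedFromTripartite


/-! ### Matrices with equal Gram matrices -/

section GramMatrices

/-- Equal Gram matrices make A x ↦ B x a well-defined isometry on the range of `A`, and in finite
dimensions it extends to a unitary of the whole space. -/
theorem Matrix.exists_unitary_of_gram_eq {m n : Type} [Fintype m] [Fintype n] [DecidableEq m]
    [DecidableEq n] {A B : Matrix m n ℂ} (h : Aᴴ * A = Bᴴ * B) :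
    ∃ U ∈ Matrix.unitaryGroup m ℂ, U * A = B := by
  let a : EuclideanSpace ℂ n →ₗ[ℂ] EuclideanSpace ℂ m := Matrix.toEuclideanLin A
  let b : EuclideanSpace ℂ n →ₗ[ℂ] EuclideanSpace ℂ m := Matrix.toEuclideanLin B
  have key : ∀ M : Matrix m n ℂ, ∀ x : EuclideanSpace ℂ n,
      inner ℂ (Matrix.toEuclideanLin M x) (Matrix.toEuclideanLin M x) =
        star x.ofLp ⬝ᵥ ((Mᴴ * M) *ᵥ x.ofLp) := by
    intro M x
    rw [EuclideanSpace.inner_eq_star_dotProduct, dotProduct_comm]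
    simp only [Matrix.toLpLin_apply]
    rw [Matrix.star_mulVec, ← Matrix.mulVec_mulVec, ← Matrix.dotProduct_mulVec]
  have hnorm : ∀ x, ‖a x‖ = ‖b x‖ := by
    intro x
    have h1 : inner ℂ (a x) (a x) = inner ℂ (b x) (b x) := by
      simp only [a, b, key, h]
    rw [inner_self_eq_norm_sq_to_K, inner_self_eq_norm_sq_to_K] at h1
    have h2 : ‖a x‖ ^ 2 = ‖b x‖ ^ 2 := by exact_mod_cast h1
    exact (sq_eq_sq₀ (norm_nonneg _) (norm_nonneg _)).1 h2
  have hker : LinearMap.ker a ≤ LinearMap.ker b := by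
    intro x hx
    rw [LinearMap.mem_ker] at hx ⊢
    rw [← norm_eq_zero, ← hnorm, hx, norm_zero]
  let f : LinearMap.range a →ₗ[ℂ] EuclideanSpace ℂ m :=
    ((LinearMap.ker a).liftQ b hker).comp (LinearMap.quotKerEquivRange a).symm.toLinearMap
  have hf : ∀ x, f ⟨a x, x, rfl⟩ = b x := by
    intro x
    have : (LinearMap.quotKerEquivRange a).symm ⟨a x, x, rfl⟩ = Submodule.Quotient.mk x := by
      rw [LinearEquiv.symm_apply_eq]
      rfl
    simp only [f, LinearMap.comp_apply, LinearEquiv.coe_coe, this]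
    rfl
  let g : LinearMap.range a →ₗᵢ[ℂ] EuclideanSpace ℂ m :=
    { f with
      norm_map' := by
        rintro ⟨_, x, rfl⟩
        change ‖f _‖ = ‖a x‖
        rw [hf, hnorm] }
  let u := g.extend
  have hu : ∀ x, u (a x) = b x := by
    intro x
    rw [← hf x]
    exact g.extend_apply ⟨a x, x, rfl⟩
  let U : Matrix m m ℂ := Matrix.toEuclideanLin.symm u.toLinearMap
  have hU : ∀ y, Matrix.toEuclideanLin U y = u y := by
    intro y
    simp only [U, LinearEquiv.apply_symm_apply]
    rfl
  have hUB : U * A = B := by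
    apply Matrix.toEuclideanLin.injective
    apply LinearMap.ext
    intro x
    have h1 := hu x
    rw [← hU] at h1
    rw [← h1]
    simp [a, Matrix.toLpLin_apply]
  refine ⟨U, ?_, hUB⟩
  rw [Matrix.mem_unitaryGroup_iff', Matrix.star_eq_conjTranspose]
  ext i j
  have h1 := u.inner_map_map (EuclideanSpace.single i 1) (EuclideanSpace.single j 1)
  rw [← hU, ← hU, EuclideanSpace.inner_eq_star_dotProduct, dotProduct_comm] at h1
  simp only [Matrix.toLpLin_apply, PiLp.ofLp_single, Matrix.mulVec_single_one] at h1
  simp only [Matrix.mul_apply, Matrix.conjTranspose_apply]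
  have h2 : inner ℂ (EuclideanSpace.single i (1 : ℂ)) (EuclideanSpace.single j (1 : ℂ)) =
      (1 : Matrix m m ℂ) i j := by
    rw [EuclideanSpace.inner_single_left]
    simp [Matrix.one_apply]
  exact h1.trans h2

open scoped MatrixOrder Matrix.Norms.L2Operator in
-- Writing M = CR by the rank factorization, only the square matrix RR† matters. A square root of
-- it, embedded into the columns indexed by `m`, replaces `R`; the right inverse of `R` expresses
-- the result through `M`.
theorem Matrix.exists_mul_conjTranspose_eq {n l m : Type} [Fintype n] [Fintype l] [Fintype m]
    [DecidableEq n] [DecidableEq l] [DecidableEq m] {M : Matrix n l ℂ}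
    (h : M.rank ≤ Fintype.card m) :
    ∃ T : Matrix l m ℂ, (M * T) * (M * T)ᴴ = M * Mᴴ := by
  obtain ⟨C, R, -, S, hM, -, hRS⟩ := M.exists_rank_factorization
  have hC : M * S = C := by
    calc M * S = (C * R) * S := congrArg (· * S) hM
      _ = C := by rw [Matrix.mul_assoc, hRS, Matrix.mul_one]
  obtain ⟨Q, hQ⟩ : ∃ Q : Matrix (Fin M.rank) (Fin M.rank) ℂ, Q * Qᴴ = R * Rᴴ := by
    obtain ⟨Q, hQ⟩ := (CStarAlgebra.nonneg_iff_eq_star_mul_self (a := R * Rᴴ)).1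
      (Matrix.nonneg_iff_posSemidef.2 (Matrix.posSemidef_self_mul_conjTranspose R))
    exact ⟨Qᴴ, by rw [hQ, Matrix.conjTranspose_conjTranspose]; rfl⟩
  obtain ⟨ι⟩ : Nonempty (Fin M.rank ↪ m) :=
    Function.Embedding.nonempty_of_card_le (by simpa using h)
  let J : Matrix (Fin M.rank) m ℂ := (1 : Matrix m m ℂ).submatrix ι id
  have hJ : J * Jᴴ = 1 := by
    ext i j
    simp [J, Matrix.mul_apply, Matrix.one_apply, ι.injective.eq_iff]
  refine ⟨S * (Q * J), ?_⟩
  calc M * (S * (Q * J)) * (M * (S * (Q * J)))ᴴ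
      = (M * S) * (Q * (J * Jᴴ) * Qᴴ) * (M * S)ᴴ := by
        simp only [Matrix.conjTranspose_mul, Matrix.mul_assoc]
    _ = C * (R * Rᴴ) * Cᴴ := by rw [hJ, Matrix.mul_one, hQ, hC]
    _ = (C * R) * (C * R)ᴴ := by simp only [Matrix.conjTranspose_mul, Matrix.mul_assoc]
    _ = M * Mᴴ := by rw [← hM]

end GramMatrices


/-! ### Operators on a region, purification and Uhlmann's theorem -/

section LocalOperators

variable {ι : Type} [Fintype ι] [DecidableEq ι] {K : ι → Type} [∀ i, Fintype (K i)]
  [∀ i, DecidableEq (K i)]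

/-- The restriction of a configuration to the sites in `S`. -/
def restr (S : Finset ι) (c : ∀ i, K i) : ∀ i : {i // i ∈ S}, K i := fun i => c i

/-- A configuration is a configuration on `S` together with one on the other sites. -/
def splitConf (K : ι → Type) (S : Finset ι) :
    (∀ i, K i) ≃ (∀ i : {i // i ∈ S}, K i) × (∀ i : {i // i ∉ S}, K i) :=
  Equiv.piEquivPiSubtypeProd (fun i => i ∈ S) K

theorem splitConf_fst (S : Finset ι) (c : ∀ i, K i) : (splitConf K S c).1 = restr S c := rfl

theorem splitConf_snd_eq_iff (S : Finset ι) (c c' : ∀ i, K i) :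
    (splitConf K S c).2 = (splitConf K S c').2 ↔ ∀ i, i ∉ S → c i = c' i :=
  ⟨fun h i hi => congrFun h ⟨i, hi⟩, fun h => funext fun i => h i i.2⟩

/-- The operator `V ⊗ 1` with `V` acting on the sites in `S`. -/
def extOp (S : Finset ι) (V : Matrix (∀ i : {i // i ∈ S}, K i) (∀ i : {i // i ∈ S}, K i) ℂ) :
    Matrix (∀ i, K i) (∀ i, K i) ℂ :=
  (V ⊗ₖ (1 : Matrix (∀ i : {i // i ∉ S}, K i) _ ℂ)).submatrix (splitConf K S) (splitConf K S)

theorem extOp_apply (S : Finset ι) (V : Matrix (∀ i : {i // i ∈ S}, K i) _ ℂ) (c c' : ∀ i, K i) :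
    extOp S V c c' = if ∀ i, i ∉ S → c i = c' i then V (restr S c) (restr S c') else 0 := by
  rw [extOp, Matrix.submatrix_apply, Matrix.kroneckerMap_apply, Matrix.one_apply]
  simp only [splitConf_snd_eq_iff, splitConf_fst]
  split_ifs <;> simp

theorem extOp_unitary {S : Finset ι} {V : Matrix (∀ i : {i // i ∈ S}, K i) _ ℂ}
    (h : V ∈ Matrix.unitaryGroup (∀ i : {i // i ∈ S}, K i) ℂ) :
    extOp S V ∈ Matrix.unitaryGroup (∀ i, K i) ℂ := by
  rw [Matrix.mem_unitaryGroup_iff, Matrix.star_eq_conjTranspose, extOp,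
    Matrix.conjTranspose_submatrix, Matrix.conjTranspose_kronecker, Matrix.submatrix_mul_equiv,
    ← Matrix.mul_kronecker_mul, unitary_mul_conjTranspose h, Matrix.conjTranspose_one, mul_one,
    Matrix.one_kronecker_one, Matrix.submatrix_one_equiv]

theorem suppOn_extOp (S : Finset ι) (V : Matrix (∀ i : {i // i ∈ S}, K i) _ ℂ) :
    SuppOn S (extOp (K := K) S V) := by
  intro i hi
  refine ⟨fun c c' hc => ?_, fun c c' k hc => ?_⟩
  · rw [extOp_apply, if_neg]
    exact fun h => hc (h i hi)
  · rw [extOp_apply, extOp_apply]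
    have h1 : ∀ c : ∀ i, K i, restr S (Function.update c i k) = restr S c := by
      intro c
      funext j
      have : (j : ι) ≠ i := fun h => hi (h ▸ j.2)
      simp [restr, this]
    have h2 : (∀ j, j ∉ S → Function.update c i k j = Function.update c' i k j) ↔
        ∀ j, j ∉ S → c j = c' j := by
      refine forall_congr' fun j => ?_
      by_cases hj : j = i
      · subst hj; simp [hc]
      · simp [hj]
    simp only [h1, h2]

theorem SuppOn.eq_extOp {S : Finset ι} {A : Matrix (∀ i, K i) (∀ i, K i) ℂ} (h : SuppOn S A)
    (c₀ : ∀ i, K i) : A = extOp S (Matrix.of fun p q =>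
      A ((splitConf K S).symm (p, (splitConf K S c₀).2))
        ((splitConf K S).symm (q, (splitConf K S c₀).2))) := by
  ext c c'
  rw [extOp_apply, Matrix.of_apply]
  have hS : ∀ (c : ∀ i, K i), ∀ i ∈ S, c i =
      (splitConf K S).symm (restr S c, (splitConf K S c₀).2) i := by
    intro c i hi
    simp [splitConf, Equiv.piEquivPiSubtypeProd, hi, restr]
  have hS' : ∀ (c : ∀ i, K i), ∀ i, i ∉ S → c₀ i =
      (splitConf K S).symm (restr S c, (splitConf K S c₀).2) i := by
    intro c i hi
    simp [splitConf, Equiv.piEquivPiSubtypeProd, hi]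
  split_ifs with hc
  · exact h.apply_eq hc (fun i hi => by rw [← hS' c i hi, ← hS' c' i hi]) (hS c) (hS c')
  · by_contra h0
    exact hc (h.eq_of_ne_zero h0)

theorem SuppOn.isSupportedOn {L : ℕ} [NeZero L] {κ : ZMod L → Type} [∀ x, Fintype (κ x)]
    [∀ x, DecidableEq (κ x)] {S : Finset (ZMod L)} {U : Matrix (Conf κ) (Conf κ) ℂ}
    (h : SuppOn S U) : IsSupportedOn S U := by
  rcases isEmpty_or_nonempty (Conf κ) with he | ⟨⟨c₀⟩⟩
  · exact ⟨0, fun c => (he.false c).elim⟩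
  · have h1 := h.eq_extOp c₀
    generalize (Matrix.of fun p q => U ((splitConf κ S).symm (p, (splitConf κ S c₀).2))
      ((splitConf κ S).symm (q, (splitConf κ S c₀).2))) = V at h1
    refine ⟨V, fun c c' => ?_⟩
    rw [h1, extOp_apply]
    exact if_congr Iff.rfl rfl rfl

theorem sum_restr (S : Finset ι) (F : (∀ i : {i // i ∈ S}, K i) → ℂ) :
    ∑ c : ∀ i, K i, F (restr S c) = (Fintype.card (∀ i : {i // i ∉ S}, K i) : ℂ) * ∑ p, F p := by
  rw [← Equiv.sum_comp (splitConf K S).symm, Fintype.sum_prod_type]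
  simp only [← splitConf_fst, Equiv.apply_symm_apply]
  simp [Finset.mul_sum]

theorem piecewise_congr_restr {S : Finset ι} {c c' : ∀ i, K i} (h : restr S c = restr S c')
    (d : ∀ i, K i) : S.piecewise c d = S.piecewise c' d :=
  S.piecewise_congr (fun i hi => congrFun h ⟨i, hi⟩) fun _ _ => rfl

theorem srank_le_card (S : Finset ι) (ψ : (∀ i, K i) → ℂ) :
    srank S ψ ≤ Fintype.card (∀ i : {i // i ∈ S}, K i) := by
  rcases isEmpty_or_nonempty (∀ i, K i) with he | ⟨⟨c₀⟩⟩
  · have : cutMat S ψ = 0 := by ext c; exact (he.false c).elim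
    simp [srank, this]
  · have : cutMat S ψ = (Matrix.of fun c p => if restr S c = p then (1 : ℂ) else 0 :
        Matrix (∀ i, K i) (∀ i : {i // i ∈ S}, K i) ℂ) * (Matrix.of fun p d =>
          ψ (S.piecewise ((splitConf K S).symm (p, (splitConf K S c₀).2)) d) :
            Matrix (∀ i : {i // i ∈ S}, K i) (∀ i, K i) ℂ) := by
      ext c d
      simp only [cutMat, Matrix.mul_apply, Matrix.of_apply, ite_mul, one_mul, zero_mul,
        Finset.sum_ite_eq, Finset.mem_univ, if_true]
      congr 1
      refine piecewise_congr_restr ?_ d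
      rw [← splitConf_fst S ((splitConf K S).symm _), Equiv.apply_symm_apply]
    rw [srank, this]
    exact (Matrix.rank_mul_le_right _ _).trans (Matrix.rank_le_card_height _)

theorem card_mul_expVal_eq_trace {S : Finset ι} {O : Matrix (∀ i, K i) (∀ i, K i) ℂ}
    (hO : SuppOn S O) (ψ : (∀ i, K i) → ℂ) :
    (Fintype.card (∀ i, K i) : ℂ) * expVal ψ O = (O * redMat S ψ).trace := by
  rw [card_mul_expVal hO, redMat, ← Matrix.mul_assoc, Matrix.trace_mul_comm, Matrix.trace]
  refine Finset.sum_congr rfl fun β _ => ?_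
  rw [Matrix.diag_apply, Matrix.mul_apply, expVal, dotProduct]
  refine Finset.sum_congr rfl fun c _ => ?_
  rfl

theorem expVal_eq_of_redMat_eq {S : Finset ι} {O : Matrix (∀ i, K i) (∀ i, K i) ℂ}
    (hO : SuppOn S O) {ψ φ : (∀ i, K i) → ℂ} (h : redMat S ψ = redMat S φ) :
    expVal ψ O = expVal φ O := by
  rcases isEmpty_or_nonempty (∀ i, K i) with he | hne
  · simp [expVal, dotProduct]
  · have h0 : (Fintype.card (∀ i, K i) : ℂ) ≠ 0 := by exact_mod_cast Fintype.card_ne_zero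
    apply mul_left_cancel₀ h0
    rw [card_mul_expVal_eq_trace hO, card_mul_expVal_eq_trace hO, h]

/-- A region with a sufficiently large Hilbert space can purify the reduced state of another
one. -/
theorem exists_purification {X S : Finset ι} (hXS : Disjoint X S) {ψ : (∀ i, K i) → ℂ}
    (hψ : ψ ≠ 0) (h : srank X ψ ≤ Fintype.card (∀ i : {i // i ∈ S}, K i)) :
    ∃ φ : (∀ i, K i) → ℂ, DependsOn φ (↑(X ∪ S) : Set ι) ∧ redMat X φ = redMat X ψ := by
  obtain ⟨T, hT⟩ := Matrix.exists_mul_conjTranspose_eq h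
  set F := cutMat X ψ * T with hF
  have hFX : ∀ {c c' : ∀ i, K i} (p), (∀ i ∈ X, c i = c' i) → F c p = F c' p := by
    intro c c' p hc
    simp only [hF, Matrix.mul_apply, cutMat]
    refine Finset.sum_congr rfl fun d _ => ?_
    rw [X.piecewise_congr (fun i hi => hc i hi) fun _ _ => rfl]
  obtain ⟨c₀, -⟩ := Function.ne_iff.1 hψ
  have hN : (0 : ℝ) < (Fintype.card (∀ i : {i // i ∉ S}, K i) : ℝ) := by
    have : Nonempty (∀ i : {i // i ∉ S}, K i) := ⟨fun i => c₀ i⟩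
    exact_mod_cast Fintype.card_pos
  set N : ℝ := (Fintype.card (∀ i : {i // i ∉ S}, K i) : ℝ) with hNdef
  have hz : (((√N)⁻¹ : ℝ) : ℂ) * (((√N)⁻¹ : ℝ) : ℂ) * (N : ℂ) = 1 := by
    norm_cast
    rw [← mul_inv, Real.mul_self_sqrt hN.le, inv_mul_cancel₀ hN.ne']
  -- The column index is read off from the configuration on `S`. Each such configuration is met `N`
  -- times among the full ones, which the prefactor compensates.
  refine ⟨fun c => (((√N)⁻¹ : ℝ) : ℂ) * F c (restr S c), fun c c' hc => ?_, ?_⟩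
  · have : restr S c = restr S c' := funext fun i => hc i (by simp)
    simp only [this]
    rw [hFX _ fun i hi => hc i (by simp [hi])]
  · rw [redMat, redMat, ← hT]
    ext c c'
    simp only [Matrix.mul_apply, Matrix.conjTranspose_apply, cutMat]
    have h1 : ∀ c d : ∀ i, K i, F (X.piecewise c d) (restr S (X.piecewise c d)) =
        F c (restr S d) := by
      intro c d
      have : restr S (X.piecewise c d) = restr S d := by
        funext i
        simp [restr, Finset.disjoint_right.1 hXS i.2]
      rw [this]
      exact hFX _ fun i hi => by simp [hi]
    simp only [h1]
    have h2 := sum_restr S fun p => (((√N)⁻¹ : ℝ) : ℂ) * F c p * star ((((√N)⁻¹ : ℝ) : ℂ) * F c' p)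
    rw [h2, Finset.mul_sum]
    refine Finset.sum_congr rfl fun p _ => ?_
    simp only [star_mul', Complex.star_def, Complex.conj_ofReal]
    have hNC : (Fintype.card (∀ i : {i // i ∉ S}, K i) : ℂ) = (N : ℂ) := by simp [hNdef]
    rw [hNC]
    linear_combination (F c p * (starRingEnd ℂ) (F c' p)) * hz

/-- Two vectors with the same reduced state on the complement of `S` differ by a unitary on `S`. -/
theorem exists_suppOn_unitary {S : Finset ι} {ψ φ : (∀ i, K i) → ℂ}
    (h : redMat Sᶜ ψ = redMat Sᶜ φ) :
    ∃ U ∈ Matrix.unitaryGroup (∀ i, K i) ℂ, SuppOn S U ∧ U *ᵥ ψ = φ := by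
  rcases isEmpty_or_nonempty (∀ i, K i) with he | ⟨⟨c₀⟩⟩
  · exact ⟨1, one_mem _, suppOn_one _, funext fun c => (he.false c).elim⟩
  let ex : (∀ i : {i // i ∈ S}, K i) → ∀ i, K i := fun p =>
    (splitConf K S).symm (p, (splitConf K S c₀).2)
  have hex : ∀ p, restr S (ex p) = p := fun p => by
    rw [← splitConf_fst, Equiv.apply_symm_apply]
  -- Rows are indexed by configurations of `S` alone, so that the unitary found from the Gram
  -- matrices acts on `S`.
  let m : ((∀ i, K i) → ℂ) → Matrix (∀ i : {i // i ∈ S}, K i) (∀ i, K i) ℂ :=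
    fun ψ => Matrix.of fun p d => ψ (S.piecewise (ex p) d)
  have hm : ∀ (ψ : (∀ i, K i) → ℂ) d d', redMat Sᶜ ψ d' d =
      (Fintype.card (∀ i : {i // i ∉ S}, K i) : ℂ) * ((m ψ)ᴴ * m ψ) d d' := by
    intro ψ d d'
    rw [redMat, cutMat_compl, Matrix.mul_apply, Matrix.mul_apply, ← sum_restr S fun p =>
      (m ψ)ᴴ d p * m ψ p d']
    refine Finset.sum_congr rfl fun c _ => ?_
    simp only [Matrix.transpose_apply, Matrix.conjTranspose_apply, cutMat, m, Matrix.of_apply]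
    rw [piecewise_congr_restr (hex (restr S c)), piecewise_congr_restr (hex (restr S c)), mul_comm]
  have h0 : (Fintype.card (∀ i : {i // i ∉ S}, K i) : ℂ) ≠ 0 := by
    have : Nonempty (∀ i : {i // i ∉ S}, K i) := ⟨fun i => c₀ i⟩
    exact_mod_cast Fintype.card_ne_zero
  have hg : (m ψ)ᴴ * m ψ = (m φ)ᴴ * m φ := by
    ext d d'
    apply mul_left_cancel₀ h0
    rw [← hm, ← hm, h]
  obtain ⟨V, hV, hVm⟩ := Matrix.exists_unitary_of_gram_eq hg
  refine ⟨extOp S V, extOp_unitary hV, suppOn_extOp S V, ?_⟩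
  have key : ∀ ψ : (∀ i, K i) → ℂ, ∀ c, ψ c = m ψ (restr S c) c := by
    intro ψ c
    simp only [m, Matrix.of_apply]
    rw [piecewise_congr_restr (hex (restr S c)), Finset.piecewise_same]
  funext c
  rw [key φ, ← hVm, Matrix.mul_apply, Matrix.mulVec, dotProduct,
    ← Equiv.sum_comp (splitConf K S).symm, Fintype.sum_prod_type]
  refine Finset.sum_congr rfl fun p _ => ?_
  rw [Finset.sum_eq_single (splitConf K S c).2]
  · have h1 : restr S ((splitConf K S).symm (p, (splitConf K S c).2)) = p := by
      rw [← splitConf_fst, Equiv.apply_symm_apply]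
    have h2 : S.piecewise (ex p) c = (splitConf K S).symm (p, (splitConf K S c).2) := by
      funext i
      by_cases hi : i ∈ S
      · simp [hi, ex, splitConf, Equiv.piEquivPiSubtypeProd]
      · simp [hi, splitConf, Equiv.piEquivPiSubtypeProd]
    rw [extOp_apply, if_pos, h1]
    · simp only [m, Matrix.of_apply, h2]
    · rw [← splitConf_snd_eq_iff, Equiv.apply_symm_apply]
  · intro q _ hq
    rw [extOp_apply, if_neg, zero_mul]
    rw [← splitConf_snd_eq_iff, Equiv.apply_symm_apply]
    exact fun h => hq h.symm
  · simp

end LocalOperators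


/-! ### Disentangling two uncorrelated regions -/

section Disentangling

variable {ι : Type} [Fintype ι] [DecidableEq ι] {K : ι → Type} [∀ i, Fintype (K i)]
  [∀ i, DecidableEq (K i)]

theorem redMat_smul (A : Finset ι) (z : ℂ) (ψ : (∀ i, K i) → ℂ) :
    redMat A (z • ψ) = (z * star z) • redMat A ψ := by
  have : cutMat A (z • ψ) = z • cutMat A ψ := rfl
  rw [redMat, this, Matrix.conjTranspose_smul, Matrix.smul_mul, Matrix.mul_smul, smul_smul]
  rfl

theorem dotProduct_star_self_eq_ofReal {n : Type} [Fintype n] (ψ : n → ℂ) :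
    star ψ ⬝ᵥ ψ = ((∑ i, ‖ψ i‖ ^ 2 : ℝ) : ℂ) := by
  push_cast
  exact Finset.sum_congr rfl fun i _ => by
    rw [← Complex.conj_mul', Pi.star_apply, Complex.star_def]

theorem sum_norm_sq_pos {n : Type} [Fintype n] {ψ : n → ℂ} (h : ψ ≠ 0) : 0 < ∑ i, ‖ψ i‖ ^ 2 := by
  refine lt_of_le_of_ne (by positivity) fun h' => dotProduct_star_self_ne_zero h ?_
  rw [dotProduct_star_self_eq_ofReal, ← h', Complex.ofReal_zero]

theorem redMat_eq_of_expVal {A : Finset ι} {ψ φ : (∀ i, K i) → ℂ} {z : ℂ}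
    (h : ∀ a b, expVal ψ (matUnit A a b) = z * expVal φ (matUnit A a b)) :
    redMat A ψ = z • redMat A φ := by
  ext c c'
  have h0 : ((Finset.univ.filter fun e : ∀ i, K i => ∀ i ∈ A, e i = c' i).card : ℂ) ≠ 0 := by
    have : 0 < (Finset.univ.filter fun e : ∀ i, K i => ∀ i ∈ A, e i = c' i).card :=
      Finset.card_pos.2 ⟨c', by simp⟩
    exact_mod_cast this.ne'
  apply mul_left_cancel₀ h0
  rw [redMat_apply, h, Matrix.smul_apply, smul_eq_mul]
  linear_combination (-z) * redMat_apply A φ c c'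

/-- Two uncorrelated regions `X` and `Y` can be disentangled from each other by a unitary on the
remaining regions `B₁` and `B₂` if these are large enough to purify them separately. -/
theorem exists_disentangler {X Y B₁ B₂ : Finset ι} (hXY : Disjoint X Y) (hXB : Disjoint X B₁)
    (hYB : Disjoint Y B₂) (hc : (X ∪ B₁)ᶜ = Y ∪ B₂) (hc' : (B₁ ∪ B₂)ᶜ = X ∪ Y)
    {u : (∀ i, K i) → ℂ} (hu : u ≠ 0) (huc : Uncorr X Y u)
    (hX : srank X u ≤ Fintype.card (∀ i : {i // i ∈ B₁}, K i))
    (hY : srank Y u ≤ Fintype.card (∀ i : {i // i ∈ B₂}, K i)) :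
    ∃ U ∈ Matrix.unitaryGroup (∀ i, K i) ℂ, SuppOn (B₁ ∪ B₂) U ∧
      IsProductAcross (X ∪ B₁) (U *ᵥ u) := by
  obtain ⟨w₁, hw₁, h₁⟩ := exists_purification hXB hu hX
  obtain ⟨w₂, hw₂, h₂⟩ := exists_purification hYB hu hY
  rw [← hc] at hw₂
  have hdYX : Disjoint (X ∪ B₁) Y := by
    have : Y ⊆ (X ∪ B₁)ᶜ := by rw [hc]; exact Finset.subset_union_left
    exact (disjoint_compl_right.mono_right this)
  have hcard : (Fintype.card (∀ i, K i) : ℂ) ≠ 0 := card_conf_ne_zero hu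
  have hN := sum_norm_sq_pos hu
  set N : ℝ := ∑ i, ‖u i‖ ^ 2 with hNdef
  have hcpos : (0 : ℝ) < (Fintype.card (∀ i, K i) : ℝ) := by
    have : Fintype.card (∀ i, K i) ≠ 0 := by exact_mod_cast hcard
    exact_mod_cast Nat.pos_of_ne_zero this
  -- With this rescaling the product of the two purifications has the same unnormalized reduced
  -- matrix on `X ∪ Y` as `u`. Since `X` and `Y` are uncorrelated, that matrix is determined by the
  -- two separate ones.
  set t : ℝ := √((Fintype.card (∀ i, K i) : ℝ) / N) with ht
  have ht2 : t * t = (Fintype.card (∀ i, K i) : ℝ) / N := Real.mul_self_sqrt (by positivity)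
  have hred : redMat (X ∪ Y) u = redMat (X ∪ Y) ((t : ℂ) • (w₁ * w₂)) := by
    rw [redMat_smul]
    refine redMat_eq_of_expVal fun a b => ?_
    rw [← matUnit_mul_disjoint hXY]
    have hO := suppOn_matUnit X a b
    have hO' := suppOn_matUnit Y a b
    have e1 := huc _ _ hO hO'
    have e2 : (Fintype.card (∀ i, K i) : ℂ) * expVal (w₁ * w₂) (matUnit X a b * matUnit Y a b) =
        expVal w₁ (matUnit X a b) * expVal w₂ (matUnit Y a b) := by
      rw [expVal, hO.mulVec_product hO' Finset.subset_union_left hdYX hw₁ hw₂]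
      refine dotProduct_mul_mul hw₁ (hO.dependsOn_mulVec Finset.subset_union_left hw₁) hw₂
        (hO'.dependsOn_mulVec ?_ hw₂)
      rw [hc]; exact Finset.subset_union_left
    rw [expVal_eq_of_redMat_eq hO h₁, expVal_eq_of_redMat_eq hO' h₂, ← e1,
      dotProduct_star_self_eq_ofReal, ← hNdef] at e2
    have hNC : (N : ℂ) ≠ 0 := by exact_mod_cast hN.ne'
    have ht2' : (t : ℂ) * t * N = (Fintype.card (∀ i, K i) : ℂ) := by
      norm_cast
      rw [ht2, div_mul_cancel₀ _ hN.ne']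
    rw [Complex.star_def, Complex.conj_ofReal]
    apply mul_right_cancel₀ hNC
    rw [← e2, ← ht2']
    ring
  rw [← hc'] at hred
  obtain ⟨U, hU, hUs, hUu⟩ := exists_suppOn_unitary hred
  refine ⟨U, hU, hUs, (t : ℂ) • w₁, w₂, fun x y h => ?_, hw₂, ?_⟩
  · simp [hw₁ h]
  · rw [hUu, smul_mul_assoc]

end Disentangling

/-! ### Spanning sets of local operators -/

section OperatorSpan

variable {ι : Type} [Fintype ι] [DecidableEq ι] {K : ι → Type} [∀ i, Fintype (K i)]
  [∀ i, DecidableEq (K i)]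

theorem SuppOn.mem_span_matUnit {S : Finset ι} {O : Matrix (∀ i, K i) (∀ i, K i) ℂ}
    (h : SuppOn S O) : O ∈ Submodule.span ℂ (Set.range fun p : (∀ i, K i) × (∀ i, K i) =>
      matUnit S p.1 p.2) := by
  rcases isEmpty_or_nonempty (∀ i, K i) with he | ⟨⟨c₀⟩⟩
  · have : O = 0 := by ext c; exact (he.false c).elim
    rw [this]; exact zero_mem _
  -- A matrix unit depends only on its labels in `S`. The labels are fixed to `c₀` off `S` so that
  -- every matrix unit is counted once.
  have : O = ∑ a, ∑ b, if (∀ i, i ∉ S → a i = c₀ i) ∧ ∀ i, i ∉ S → b i = c₀ i then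
      O a b • matUnit S a b else 0 := by
    ext c c'
    rw [Matrix.sum_apply, Finset.sum_eq_single (S.piecewise c c₀)]
    · rw [Matrix.sum_apply, Finset.sum_eq_single (S.piecewise c' c₀)]
      · rw [if_pos (by constructor <;> intro i hi <;> simp [hi]), Matrix.smul_apply, matUnit,
          smul_eq_mul]
        split_ifs with hcc
        · rw [mul_one]
          exact h.apply_eq hcc.2 (fun i hi => by simp [hi]) (fun i hi => by simp [hi])
            (fun i hi => by simp [hi])
        · rw [mul_zero]
          by_contra h0
          refine hcc ⟨fun i hi => by simp [hi], h.eq_of_ne_zero h0⟩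
      · intro b _ hb
        split_ifs with hab
        · rw [Matrix.smul_apply, matUnit, if_neg, smul_zero]
          rintro ⟨h1, h2⟩
          refine hb (funext fun i => ?_)
          by_cases hi : i ∈ S
          · simp [hi, (h1 i hi).2]
          · simp [hi, hab.2 i hi]
        · rfl
      · simp
    · intro a _ ha
      rw [Matrix.sum_apply]
      refine Finset.sum_eq_zero fun b _ => ?_
      split_ifs with hab
      · rw [Matrix.smul_apply, matUnit, if_neg, smul_zero]
        rintro ⟨h1, h2⟩
        refine ha (funext fun i => ?_)
        by_cases hi : i ∈ S
        · simp [hi, (h1 i hi).1]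
        · simp [hi, hab.1 i hi]
      · rfl
    · simp
  rw [this]
  refine Submodule.sum_mem _ fun a _ => Submodule.sum_mem _ fun b _ => ?_
  split_ifs
  · exact Submodule.smul_mem _ _ (Submodule.subset_span ⟨(a, b), rfl⟩)
  · exact zero_mem _

theorem matUnit_conjTranspose (S : Finset ι) (a b : ∀ i, K i) :
    (matUnit S a b)ᴴ = matUnit S b a := by
  ext c c'
  rw [Matrix.conjTranspose_apply, matUnit, matUnit]
  have : ((∀ i ∈ S, c' i = a i ∧ c i = b i) ∧ ∀ i, i ∉ S → c' i = c i) ↔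
      ((∀ i ∈ S, c i = b i ∧ c' i = a i) ∧ ∀ i, i ∉ S → c i = c' i) := by
    constructor <;> rintro ⟨h1, h2⟩ <;>
      exact ⟨fun i hi => (h1 i hi).symm, fun i hi => (h2 i hi).symm⟩
  simp only [this]
  split_ifs <;> simp

theorem matUnit_mul_matUnit (S : Finset ι) (a b b' d : ∀ i, K i) :
    matUnit S a b * matUnit S b' d = if ∀ i ∈ S, b i = b' i then matUnit S a d else 0 := by
  ext c c'
  have h1 : (matUnit S a b * matUnit S b' d) c c' =
      (matUnit S a b *ᵥ fun e => matUnit S b' d e c') c := rfl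
  rw [h1, matUnit_mulVec]
  split_ifs with h2 h3 h3
  · simp only [matUnit]
    congr 1
    rw [eq_iff_iff]
    constructor
    · rintro ⟨h4, h5⟩
      exact ⟨fun i hi => ⟨h2 i hi, (h4 i hi).2⟩, fun i hi => by simpa [hi] using h5 i hi⟩
    · rintro ⟨h4, h5⟩
      exact ⟨fun i hi => ⟨by simp [hi, h3 i hi], (h4 i hi).2⟩, fun i hi => by simp [hi, h5 i hi]⟩
  · rw [matUnit, if_neg, Matrix.zero_apply]
    rintro ⟨h4, -⟩
    exact h3 fun i hi => by simpa [hi] using (h4 i hi).1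
  · rw [matUnit, if_neg]
    rintro ⟨h4, -⟩
    exact h2 fun i hi => (h4 i hi).1
  · rfl

/-- The operators on a region are spanned by the orthogonal projections on that region. -/
theorem SuppOn.mem_span_projection {S : Finset ι} {O : Matrix (∀ i, K i) (∀ i, K i) ℂ}
    (h : SuppOn S O) : O ∈ Submodule.span ℂ {P | SuppOn S P ∧ Pᴴ = P ∧ P * P = P} := by
  refine Submodule.span_le.2 ?_ h.mem_span_matUnit
  rintro _ ⟨⟨a, b⟩, rfl⟩
  simp only [SetLike.mem_coe]
  have hs := fun a b : ∀ i, K i => suppOn_matUnit S a b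
  by_cases hab : ∀ i ∈ S, a i = b i
  · refine Submodule.subset_span ⟨hs a b, ?_, ?_⟩
    · rw [matUnit_conjTranspose]
      ext c c'
      rw [matUnit, matUnit]
      congr 1
      rw [eq_iff_iff]
      exact and_congr_left fun _ => forall₂_congr fun i hi => by rw [hab i hi]
    · rw [matUnit_mul_matUnit, if_pos fun i hi => (hab i hi).symm]
  have hba : ¬ ∀ i ∈ S, b i = a i := fun h => hab fun i hi => (h i hi).symm
  -- For a phase ω this projects onto a balanced superposition of the configurations `a` and `b`;
  -- polarization over ω = 1, -1, i, -i recovers the matrix unit.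
  let Q : ℂ → Matrix (∀ i, K i) (∀ i, K i) ℂ := fun ω =>
    (1 / 2 : ℂ) • (matUnit S a a + matUnit S b b + ω • matUnit S a b + star ω • matUnit S b a)
  have hQ : ∀ ω : ℂ, ω * star ω = 1 → Q ω ∈ {P | SuppOn S P ∧ Pᴴ = P ∧ P * P = P} := by
    intro ω hω
    refine ⟨((((hs a a).add (hs b b)).add ((hs a b).smul _)).add ((hs b a).smul _)).smul _, ?_, ?_⟩
    · simp only [Q, Matrix.conjTranspose_smul, Matrix.conjTranspose_add, matUnit_conjTranspose,
        star_star]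
      congr 1
      · simp
      · abel
    · simp only [Q, Matrix.smul_mul, Matrix.mul_smul, add_mul, mul_add, matUnit_mul_matUnit, hab,
        hba, if_false, implies_true, if_true, smul_zero, add_zero, zero_add, smul_smul]
      match_scalars <;> first | ring1 | linear_combination (1 / 4 : ℂ) * hω
  have key : matUnit S a b = (1 / 2 : ℂ) • (Q 1 - Q (-1)) - (Complex.I / 2) • (Q Complex.I - Q (-Complex.I)) := by
    have hI : star Complex.I = -Complex.I := by simp
    simp only [Q, star_one, star_neg, hI, smul_add, smul_sub, smul_smul]
    match_scalars <;> ring_nf <;> simp <;> ring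
  rw [key]
  have hm := fun ω hω => Submodule.subset_span (R := ℂ) (hQ ω hω)
  refine sub_mem (Submodule.smul_mem _ _ (sub_mem (hm 1 (by simp)) (hm (-1) (by simp))))
    (Submodule.smul_mem _ _ (sub_mem (hm _ (by simp)) (hm _ (by simp))))

end OperatorSpan


/-! ### Strict convexity and lexicographic maxima -/

section ConvexExtremality

/-- All inequalities become equalities, and by strict convexity the two vectors lie on a common ray.
-/
theorem eq_smul_add_of_norm_extremal {E : Type*} [NormedAddCommGroup E] [NormedSpace ℝ E]
    [StrictConvexSpace ℝ E] {x y : E} {α β m : ℝ} (hm : 0 < m) (hx : ‖x‖ ≤ m * α)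
    (hy : ‖y‖ ≤ m * β) (hαβ : α + β = 1) (hxy : ‖x + y‖ = m) : x = α • (x + y) := by
  have h1 := norm_add_le x y
  have h2 : m * α + m * β = m := by rw [← mul_add, hαβ, mul_one]
  have h3 : SameRay ℝ x y := sameRay_iff_norm_add.2 (by linarith)
  have h4 : ‖x‖ = m * α := by linarith
  have h5 : ‖y‖ = m * β := by linarith
  have h6 := h3.norm_smul_eq
  rw [h4, h5] at h6
  have h7 : m • x = m • (α • (x + y)) := by
    rw [smul_smul, smul_add, h6, ← add_smul, h2]
  exact smul_right_injective E hm.ne' h7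

theorem IsCompact.exists_lexicographic_max {E : Type*} [TopologicalSpace E] {C : Set E}
    (hC : IsCompact C) (hne : C.Nonempty) {f g : E → ℝ} (hf : Continuous f) (hg : Continuous g) :
    ∃ u ∈ C, (∀ v ∈ C, f v ≤ f u) ∧ ∀ v ∈ C, f v = f u → g v ≤ g u := by
  obtain ⟨w, hw, hmax⟩ := hC.exists_isMaxOn hne hf.continuousOn
  have hC' : IsCompact (C ∩ {v | f v = f w}) :=
    hC.inter_right (isClosed_eq hf continuous_const)
  obtain ⟨u, ⟨hu, hfu⟩, hmax'⟩ := hC'.exists_isMaxOn ⟨w, hw, rfl⟩ hg.continuousOn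
  have hfu : f u = f w := hfu
  refine ⟨u, hu, fun v hv => hfu ▸ hmax hv, fun v hv h => hmax' ⟨hv, ?_⟩⟩
  exact h.trans hfu

end ConvexExtremality

/-! ### Removing correlations by an extremal measurement outcome -/

section Steering

variable {ι : Type} [Fintype ι] [DecidableEq ι] {K : ι → Type} [∀ i, Fintype (K i)]
  [∀ i, DecidableEq (K i)]

theorem expVal_op_add {n : Type} [Fintype n] (ψ : n → ℂ) (A B : Matrix n n ℂ) :
    expVal ψ (A + B) = expVal ψ A + expVal ψ B := by
  rw [expVal, Matrix.add_mulVec, dotProduct_add]; rfl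

theorem expVal_op_smul {n : Type} [Fintype n] (ψ : n → ℂ) (z : ℂ) (A : Matrix n n ℂ) :
    expVal ψ (z • A) = z * expVal ψ A := by
  rw [expVal, Matrix.smul_mulVec, dotProduct_smul]; rfl

theorem expVal_op_zero {n : Type} [Fintype n] (ψ : n → ℂ) : expVal ψ (0 : Matrix n n ℂ) = 0 := by
  simp [expVal]

theorem continuous_expVal {n : Type} [Fintype n] (O : Matrix n n ℂ) :
    Continuous fun ψ : n → ℂ => expVal ψ O := by
  unfold expVal
  simp only [dotProduct, Matrix.mulVec]
  fun_prop

/-- The expectation values of all matrix units on the region `S`. -/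
noncomputable def momentVec (S : Finset ι) (u : (∀ i, K i) → ℂ) :
    EuclideanSpace ℂ ((∀ i, K i) × (∀ i, K i)) :=
  WithLp.toLp 2 fun p => expVal u (matUnit S p.1 p.2)

theorem continuous_momentVec (S : Finset ι) :
    Continuous (momentVec S : ((∀ i, K i) → ℂ) → _) := by
  unfold momentVec
  exact (PiLp.continuous_toLp 2 _).comp (continuous_pi fun p => continuous_expVal _)

theorem momentVec_smul (S : Finset ι) (t : ℝ) (u : (∀ i, K i) → ℂ) :
    momentVec S ((t : ℂ) • u) = (t * t) • momentVec S u := by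
  ext p
  simp only [momentVec, expVal_smul, PiLp.smul_apply, Complex.real_smul, Complex.star_def,
    Complex.conj_ofReal, Complex.ofReal_mul]

theorem momentVec_ne_zero (S : Finset ι) {u : (∀ i, K i) → ℂ} (hu : u ≠ 0) :
    momentVec S u ≠ 0 := by
  intro h
  have h1 : ∀ O ∈ Submodule.span ℂ (Set.range fun p : (∀ i, K i) × (∀ i, K i) =>
      matUnit S p.1 p.2), expVal u O = 0 := by
    intro O hO
    induction hO using Submodule.span_induction with
    | mem O hO =>
      obtain ⟨p, rfl⟩ := hO
      exact congrArg (fun v => v.ofLp p) h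
    | zero => exact expVal_op_zero u
    | add A B _ _ hA hB => rw [expVal_op_add, hA, hB, add_zero]
    | smul z A _ hA => rw [expVal_op_smul, hA, mul_zero]
  have h2 := h1 1 (suppOn_one S).mem_span_matUnit
  rw [expVal_one] at h2
  exact dotProduct_star_self_ne_zero hu h2

/-- On the region `T`, the effect of the operator `W` on `Ψ` is that of a quantum instrument acting
on the region `b`. -/
def SteersTo (b T : Finset ι) (Ψ : (∀ i, K i) → ℂ) (W : Matrix (∀ i, K i) (∀ i, K i) ℂ) : Prop :=
  ∃ (γ : Type) (_ : Fintype γ) (Z : γ → Matrix (∀ i, K i) (∀ i, K i) ℂ), (∀ k, SuppOn b (Z k)) ∧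
    ∀ O, SuppOn T O → expVal (W *ᵥ Ψ) O = ∑ k, expVal (Z k *ᵥ Ψ) O

/-- The squared norm of a vector. -/
noncomputable def vecNormSq {n : Type} [Fintype n] (u : n → ℂ) : ℝ := ∑ i, ‖u i‖ ^ 2

theorem expVal_one_eq_vecNormSq {n : Type} [Fintype n] [DecidableEq n] (u : n → ℂ) :
    expVal u 1 = (vecNormSq u : ℂ) := by
  rw [expVal_one, dotProduct_star_self_eq_ofReal, vecNormSq]

theorem expVal_projection {P O : Matrix (∀ i, K i) (∀ i, K i) ℂ} (hP : Pᴴ = P)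
    (hPP : P * P = P) (hc : P * O = O * P) (u : (∀ i, K i) → ℂ) :
    expVal (P *ᵥ u) O = expVal u (P * O) := by
  rw [expVal_mulVec, hP, mul_assoc, ← hc, ← mul_assoc, hPP]

theorem vecNormSq_projection {P : Matrix (∀ i, K i) (∀ i, K i) ℂ} (hP : Pᴴ = P)
    (hPP : P * P = P) (u : (∀ i, K i) → ℂ) : (vecNormSq (P *ᵥ u) : ℂ) = expVal u P := by
  rw [← expVal_one_eq_vecNormSq, expVal_mulVec, hP, mul_one, hPP]

/-- If no outcome of a measurement on `X` changes the state of `T`, there are no correlations,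
because projections span the operators on `X` and matrix units those on `T`. -/
theorem uncorr_of_projections {X T : Finset ι} (hXT : Disjoint X T) {u : (∀ i, K i) → ℂ}
    (hu : vecNormSq u = 1) (h : ∀ P, SuppOn X P → Pᴴ = P → P * P = P →
      momentVec T (P *ᵥ u) = vecNormSq (P *ᵥ u) • momentVec T u) : Uncorr X T u := by
  have h1 : ∀ P, SuppOn X P → Pᴴ = P → P * P = P → ∀ O ∈ Submodule.span ℂ
      (Set.range fun p : (∀ i, K i) × (∀ i, K i) => matUnit T p.1 p.2),
      expVal u (P * O) = expVal u P * expVal u O := by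
    intro P hPs hP hPP O hO
    induction hO using Submodule.span_induction with
    | mem O hO =>
      obtain ⟨p, rfl⟩ := hO
      have h2 := congrArg (fun v => v.ofLp p) (h P hPs hP hPP)
      simp only [momentVec, PiLp.smul_apply, Complex.real_smul] at h2
      rw [expVal_projection hP hPP (hPs.commute (suppOn_matUnit T _ _) hXT),
        vecNormSq_projection hP hPP] at h2
      exact h2
    | zero => rw [mul_zero, expVal_op_zero, mul_zero]
    | add A B _ _ hA hB => rw [mul_add, expVal_op_add, expVal_op_add, hA, hB, mul_add]
    | smul z A _ hA => rw [Matrix.mul_smul, expVal_op_smul, expVal_op_smul, hA]; ring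
  intro O O' hO hO'
  have hu1 : star u ⬝ᵥ u = 1 := by
    rw [← expVal_one, expVal_one_eq_vecNormSq, hu, Complex.ofReal_one]
  rw [hu1, mul_one]
  have h2 := hO.mem_span_projection
  clear hO
  induction h2 using Submodule.span_induction with
  | mem P hP => exact h1 P hP.1 hP.2.1 hP.2.2 O' hO'.mem_span_matUnit
  | zero => rw [zero_mul, expVal_op_zero, zero_mul]
  | add A B _ _ ihA ihB => rw [add_mul, expVal_op_add, expVal_op_add, ihA, ihB, add_mul]
  | smul z A _ ihA => rw [Matrix.smul_mul, expVal_op_smul, expVal_op_smul, ihA]; ring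

theorem vecNormSq_smul {n : Type} [Fintype n] (t : ℝ) (u : n → ℂ) :
    vecNormSq ((t : ℂ) • u) = t * t * vecNormSq u := by
  simp only [vecNormSq, Pi.smul_apply, smul_eq_mul, norm_mul, Complex.norm_real, mul_pow,
    Finset.mul_sum]
  refine Finset.sum_congr rfl fun i _ => ?_
  rw [Real.norm_eq_abs, sq_abs]; ring

theorem continuous_vecNormSq {n : Type} [Fintype n] :
    Continuous (vecNormSq : (n → ℂ) → ℝ) := by
  unfold vecNormSq
  fun_prop

theorem vecNormSq_pos {n : Type} [Fintype n] {u : n → ℂ} (h : u ≠ 0) : 0 < vecNormSq u :=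
  sum_norm_sq_pos h

theorem vecNormSq_nonneg {n : Type} [Fintype n] (u : n → ℂ) : 0 ≤ vecNormSq u :=
  Finset.sum_nonneg fun _ _ => by positivity

theorem SteersTo.exists_momentVec {b T : Finset ι} {Ψ : (∀ i, K i) → ℂ}
    {W : Matrix (∀ i, K i) (∀ i, K i) ℂ} (h : SteersTo b T Ψ W) :
    ∃ (γ : Type) (_ : Fintype γ) (Z : γ → Matrix (∀ i, K i) (∀ i, K i) ℂ),
      (∀ k, SuppOn b (Z k)) ∧ (∀ S ⊆ T, momentVec S (W *ᵥ Ψ) = ∑ k, momentVec S (Z k *ᵥ Ψ)) ∧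
      vecNormSq (W *ᵥ Ψ) = ∑ k, vecNormSq (Z k *ᵥ Ψ) := by
  obtain ⟨γ, hγ, Z, hZ, h⟩ := h
  refine ⟨γ, hγ, Z, hZ, fun S hS => ?_, ?_⟩
  · ext p
    simp only [momentVec, WithLp.ofLp_sum, Finset.sum_apply]
    exact h _ ((suppOn_matUnit S _ _).mono hS)
  · have := h 1 (suppOn_one T)
    simp only [expVal_one_eq_vecNormSq] at this
    exact_mod_cast this

theorem momentVec_add_of_projection {X T : Finset ι} (hXT : Disjoint X T)
    {P : Matrix (∀ i, K i) (∀ i, K i) ℂ} (hPs : SuppOn X P) (hP : Pᴴ = P) (hPP : P * P = P)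
    (u : (∀ i, K i) → ℂ) :
    momentVec T (P *ᵥ u) + momentVec T ((1 - P) *ᵥ u) = momentVec T u ∧
      vecNormSq (P *ᵥ u) + vecNormSq ((1 - P) *ᵥ u) = vecNormSq u := by
  have hQ : (1 - P)ᴴ = 1 - P := by rw [Matrix.conjTranspose_sub, Matrix.conjTranspose_one, hP]
  have hQQ : (1 - P) * (1 - P) = 1 - P := by
    rw [mul_sub, sub_mul, sub_mul, hPP]; simp
  constructor
  · ext p
    have hc := hPs.commute (suppOn_matUnit T p.1 p.2) hXT
    simp only [momentVec, PiLp.add_apply]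
    rw [expVal_projection hP hPP hc, expVal_projection hQ hQQ (by rw [sub_mul, mul_sub, hc]; simp),
      ← expVal_op_add, ← add_mul]
    simp
  · have : ((vecNormSq (P *ᵥ u) + vecNormSq ((1 - P) *ᵥ u) : ℝ) : ℂ) = (vecNormSq u : ℂ) := by
      push_cast
      rw [vecNormSq_projection hP hPP, vecNormSq_projection hQ hQQ, ← expVal_op_add,
        ← expVal_one_eq_vecNormSq]
      simp
    exact_mod_cast this

/-- The normalized vectors reachable by operators on `b` form the unit sphere of a
finite-dimensional subspace, so a lexicographic maximum exists. Both sides of the bounds are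
quadratic in the vector, which extends them to unnormalized vectors. -/
theorem exists_extremal_steered {b T T' : Finset ι} {Ψ : (∀ i, K i) → ℂ} (hΨ : Ψ ≠ 0) :
    ∃ Z, SuppOn b Z ∧ vecNormSq (Z *ᵥ Ψ) = 1 ∧
      (∀ Z', SuppOn b Z' → ‖momentVec T (Z' *ᵥ Ψ)‖ ≤
        ‖momentVec T (Z *ᵥ Ψ)‖ * vecNormSq (Z' *ᵥ Ψ)) ∧
      ∀ Z', SuppOn b Z' → ‖momentVec T (Z' *ᵥ Ψ)‖ =
        ‖momentVec T (Z *ᵥ Ψ)‖ * vecNormSq (Z' *ᵥ Ψ) → ‖momentVec T' (Z' *ᵥ Ψ)‖ ≤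
        ‖momentVec T' (Z *ᵥ Ψ)‖ * vecNormSq (Z' *ᵥ Ψ) := by
  let V : Submodule ℂ ((∀ i, K i) → ℂ) :=
    { carrier := {u | ∃ Z, SuppOn b Z ∧ Z *ᵥ Ψ = u}
      add_mem' := by
        rintro _ _ ⟨Z, hZ, rfl⟩ ⟨Z', hZ', rfl⟩
        exact ⟨Z + Z', hZ.add hZ', Matrix.add_mulVec _ _ _⟩
      zero_mem' := ⟨0, SuppOn.zero b, Matrix.zero_mulVec _⟩
      smul_mem' := by
        rintro z _ ⟨Z, hZ, rfl⟩
        exact ⟨z • Z, hZ.smul z, Matrix.smul_mulVec _ _ _⟩ }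
  have hscale : ∀ u : (∀ i, K i) → ℂ, u ≠ 0 →
      (√(vecNormSq u))⁻¹ * (√(vecNormSq u))⁻¹ * vecNormSq u = 1 := fun u hu => by
    rw [← mul_inv, Real.mul_self_sqrt (vecNormSq_nonneg u), inv_mul_cancel₀ (vecNormSq_pos hu).ne']
  have hC : IsCompact ((V : Set ((∀ i, K i) → ℂ)) ∩ {u | vecNormSq u = 1}) := by
    refine Metric.isCompact_of_isClosed_isBounded ((Submodule.closed_of_finiteDimensional V).inter
      (isClosed_eq continuous_vecNormSq continuous_const)) ?_
    refine (Metric.isBounded_closedBall (x := 0) (r := 1)).subset fun u hu => ?_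
    rw [mem_closedBall_zero_iff, pi_norm_le_iff_of_nonneg zero_le_one]
    intro i
    have h1 : ‖u i‖ ^ 2 ≤ 1 := by
      rw [← show vecNormSq u = 1 from hu.2, vecNormSq]
      exact Finset.single_le_sum (f := fun i => ‖u i‖ ^ 2) (fun _ _ => by positivity)
        (Finset.mem_univ i)
    exact (sq_le_one_iff₀ (norm_nonneg _)).1 h1
  have hmem : ∀ u ∈ V, u ≠ 0 → (((√(vecNormSq u))⁻¹ : ℝ) : ℂ) • u ∈
      (V : Set ((∀ i, K i) → ℂ)) ∩ {u | vecNormSq u = 1} := fun u hu hu0 =>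
    ⟨V.smul_mem _ hu, by rw [Set.mem_ofPred_eq, vecNormSq_smul, hscale u hu0]⟩
  have hne : ((V : Set ((∀ i, K i) → ℂ)) ∩ {u | vecNormSq u = 1}).Nonempty :=
    ⟨_, hmem Ψ ⟨1, suppOn_one b, Matrix.one_mulVec _⟩ hΨ⟩
  obtain ⟨_, ⟨⟨Z, hZ, rfl⟩, hu1⟩, hmax, hmax'⟩ := hC.exists_lexicographic_max hne
    (continuous_momentVec T).norm (continuous_momentVec T').norm
  have hnorm : ∀ (S : Finset ι) (u : (∀ i, K i) → ℂ), u ≠ 0 →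
      ‖momentVec S u‖ = ‖momentVec S ((((√(vecNormSq u))⁻¹ : ℝ) : ℂ) • u)‖ * vecNormSq u := by
    intro S u hu
    rw [momentVec_smul, norm_smul, Real.norm_of_nonneg (by positivity)]
    linear_combination -‖momentVec S u‖ * hscale u hu
  refine ⟨Z, hZ, hu1, fun Z' hZ' => ?_, fun Z' hZ' h => ?_⟩
  · by_cases h0 : Z' *ᵥ Ψ = 0
    · have : momentVec T (0 : (∀ i, K i) → ℂ) = 0 := by ext p; simp [momentVec, expVal]
      simp [h0, this, vecNormSq]
    · rw [hnorm T _ h0]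
      exact mul_le_mul_of_nonneg_right (hmax _ (hmem _ ⟨Z', hZ', rfl⟩ h0)) (vecNormSq_nonneg _)
  · by_cases h0 : Z' *ᵥ Ψ = 0
    · have : momentVec T' (0 : (∀ i, K i) → ℂ) = 0 := by ext p; simp [momentVec, expVal]
      simp [h0, this, vecNormSq]
    · rw [hnorm T _ h0] at h
      rw [hnorm T' _ h0]
      exact mul_le_mul_of_nonneg_right (hmax' _ (hmem _ ⟨Z', hZ', rfl⟩ h0)
        (mul_right_cancel₀ (vecNormSq_pos h0).ne' h)) (vecNormSq_nonneg _)

/-- If operators on a large region can be steered from `b`, then a measurement on `b` removes the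
correlations of that region with its surroundings. -/
theorem exists_uncorr_of_steersTo {b X X' T T' : Finset ι} {Ψ : (∀ i, K i) → ℂ} (hΨ : Ψ ≠ 0)
    (hb : b ⊆ X) (hX : X ⊆ X') (hT : T ⊆ T') (hXT : Disjoint X T') (hXT' : Disjoint X' T)
    (h : ∀ W, SuppOn X W → SteersTo b T' Ψ W) (h' : ∀ W, SuppOn X' W → SteersTo b T Ψ W) :
    ∃ Z, SuppOn b Z ∧ vecNormSq (Z *ᵥ Ψ) = 1 ∧ Uncorr X T' (Z *ᵥ Ψ) ∧ Uncorr X' T (Z *ᵥ Ψ) := by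
  obtain ⟨Z, hZ, hu, hmax, hmax'⟩ := exists_extremal_steered (b := b) (T := T) (T' := T') hΨ
  have hu0 : Z *ᵥ Ψ ≠ 0 := fun h => by simp [h, vecNormSq] at hu
  have hm := norm_pos_iff.2 (momentVec_ne_zero T hu0)
  have hm' := norm_pos_iff.2 (momentVec_ne_zero T' hu0)
  -- By steering, the state of `T` after `W` is a sum of states reachable from `b`; the bound passes
  -- to the sum by the triangle inequality.
  have hW : ∀ W, SuppOn X' W → ‖momentVec T (W *ᵥ Ψ)‖ ≤
      ‖momentVec T (Z *ᵥ Ψ)‖ * vecNormSq (W *ᵥ Ψ) := by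
    intro W hW
    obtain ⟨γ, _, V, hV, h1, h2⟩ := (h' W hW).exists_momentVec
    rw [h1 T le_rfl, h2, Finset.mul_sum]
    exact (norm_sum_le _ _).trans (Finset.sum_le_sum fun k _ => hmax _ (hV k))
  -- A measurement on `X'` decomposes the extremal state of `T` into two pieces obeying the same
  -- bound, so both are proportional to it.
  have hT1 : ∀ P, SuppOn X' P → Pᴴ = P → P * P = P →
      momentVec T (P *ᵥ (Z *ᵥ Ψ)) = vecNormSq (P *ᵥ (Z *ᵥ Ψ)) • momentVec T (Z *ᵥ Ψ) := by
    intro P hPs hP hPP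
    obtain ⟨e1, e2⟩ := momentVec_add_of_projection hXT' hPs hP hPP (Z *ᵥ Ψ)
    have hZ' := hZ.mono (hb.trans hX)
    rw [← e1]
    refine eq_smul_add_of_norm_extremal hm (β := vecNormSq ((1 - P) *ᵥ (Z *ᵥ Ψ))) ?_ ?_
      (e2.trans hu) (by rw [e1])
    · rw [Matrix.mulVec_mulVec]
      exact hW _ (hPs.mul hZ')
    · rw [Matrix.mulVec_mulVec]
      exact hW _ (((suppOn_one X').sub hPs).mul hZ')
  -- On `T'` the bound is known only for maximizers on `T`. By `hT1` the projected vector is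
  -- extremal on `T`, hence so is every one of its steered components, and the second maximality
  -- applies to each.
  have hW' : ∀ P, SuppOn X P → Pᴴ = P → P * P = P → ‖momentVec T' (P *ᵥ (Z *ᵥ Ψ))‖ ≤
      ‖momentVec T' (Z *ᵥ Ψ)‖ * vecNormSq (P *ᵥ (Z *ᵥ Ψ)) := by
    intro P hPs hP hPP
    have h0 := hT1 P (hPs.mono hX) hP hPP
    rw [Matrix.mulVec_mulVec] at h0 ⊢
    obtain ⟨γ, _, V, hV, h1, h2⟩ := (h _ (hPs.mul (hZ.mono hb))).exists_momentVec
    have h3 : ∑ k, ‖momentVec T (V k *ᵥ Ψ)‖ =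
        ∑ k, ‖momentVec T (Z *ᵥ Ψ)‖ * vecNormSq (V k *ᵥ Ψ) := by
      refine le_antisymm (Finset.sum_le_sum fun k _ => hmax _ (hV k)) ?_
      rw [← Finset.mul_sum, ← h2]
      refine le_trans (le_of_eq ?_) (norm_sum_le _ _)
      rw [← h1 T hT, h0, norm_smul, Real.norm_of_nonneg (vecNormSq_nonneg _), mul_comm]
    have h4 := (Finset.sum_eq_sum_iff_of_le fun k _ => hmax _ (hV k)).1 h3
    rw [h1 T' le_rfl, h2, Finset.mul_sum]
    exact (norm_sum_le _ _).trans (Finset.sum_le_sum fun k hk => hmax' _ (hV k) (h4 k hk))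
  refine ⟨Z, hZ, hu, uncorr_of_projections hXT hu fun P hPs hP hPP => ?_,
    uncorr_of_projections hXT' hu hT1⟩
  obtain ⟨e1, e2⟩ := momentVec_add_of_projection hXT hPs hP hPP (Z *ᵥ Ψ)
  conv_rhs => rw [← e1]
  refine eq_smul_add_of_norm_extremal hm' (β := vecNormSq ((1 - P) *ᵥ (Z *ᵥ Ψ))) (hW' P hPs hP hPP)
    (hW' (1 - P) ((suppOn_one X).sub hPs) ?_ ?_) (e2.trans hu) (by rw [e1])
  · rw [Matrix.conjTranspose_sub, Matrix.conjTranspose_one, hP]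
  · rw [mul_sub, sub_mul, sub_mul, hPP]; simp

end Steering


/-! ### Transferring the disentangler to the unmeasured state -/

section LocalDisentangling

variable {ι : Type} [Fintype ι] [DecidableEq ι] {K : ι → Type} [∀ i, Fintype (K i)]
  [∀ i, DecidableEq (K i)]

/-- The product of the two ranks is the rank of the complement `B` of both regions, and the
dimension of `B` bounds it. Thus the gap between uncorrelated regions is large enough to purify
either of them. -/
theorem srank_le_card_of_uncorr {X T B : Finset ι} {u : (∀ i, K i) → ℂ} (hu : u ≠ 0)
    (hXT : Disjoint X T) (hB : (X ∪ T)ᶜ = B) (h : Uncorr X T u) :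
    srank X u ≤ Fintype.card (∀ i : {i // i ∈ B}, K i) ∧
      srank T u ≤ Fintype.card (∀ i : {i // i ∈ B}, K i) := by
  have h1 := srank_union hXT hu h
  rw [← srank_compl, hB] at h1
  have h2 := h1 ▸ srank_le_card B u
  exact ⟨(Nat.le_mul_of_pos_right _ (Nat.pos_of_ne_zero (srank_ne_zero hu T))).trans h2,
    (Nat.le_mul_of_pos_left _ (Nat.pos_of_ne_zero (srank_ne_zero hu X))).trans h2⟩

/-- An operation on a region uncorrelated with `F` does not change the state of `F`, up to
normalization. -/
theorem expVal_mulVec_of_uncorr {b F : Finset ι} (hbF : Disjoint b F) {Ψ : (∀ i, K i) → ℂ}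
    (h : Uncorr b F Ψ) {Z M : Matrix (∀ i, K i) (∀ i, K i) ℂ} (hZ : SuppOn b Z) (hM : SuppOn F M) :
    expVal (Z *ᵥ Ψ) M * (star Ψ ⬝ᵥ Ψ) = (star (Z *ᵥ Ψ) ⬝ᵥ (Z *ᵥ Ψ)) * expVal Ψ M := by
  rw [← expVal_one (Z *ᵥ Ψ), expVal_mulVec, expVal_mulVec, mul_one, mul_assoc,
    ← hZ.commute hM hbF, ← mul_assoc]
  exact h _ _ (hZ.conjTranspose.mul hZ) hM

/-- The disentangler is constructed for the vector after the extremal measurement on `b`. On regions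
uncorrelated with `b` the measurement is invisible, so the same unitary removes the correlations of
`Ψ`. -/
theorem exists_local_disentangler {b X B₁ B₂ Y : Finset ι} {Ψ : (∀ i, K i) → ℂ} (hΨ : Ψ ≠ 0)
    (hb : b ⊆ X) (hXB : Disjoint X B₁) (hYB : Disjoint Y B₂) (hc : (X ∪ B₁)ᶜ = Y ∪ B₂)
    (h : ∀ W, SuppOn X W → SteersTo b (Y ∪ B₂) Ψ W) (h' : ∀ W, SuppOn (X ∪ B₁) W → SteersTo b Y Ψ W) :
    ∃ U ∈ Matrix.unitaryGroup (∀ i, K i) ℂ, SuppOn (B₁ ∪ B₂) U ∧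
      ∀ A B, A ⊆ X ∪ B₁ → B ⊆ Y ∪ B₂ → Disjoint b (A ∪ B ∪ (B₁ ∪ B₂)) →
        Uncorr b (A ∪ B ∪ (B₁ ∪ B₂)) Ψ → Uncorr A B (U *ᵥ Ψ) := by
  have hd : Disjoint (X ∪ B₁) (Y ∪ B₂) := hc ▸ disjoint_compl_right
  have hXT : Disjoint X (Y ∪ B₂) := hd.mono_left Finset.subset_union_left
  have hXT' : Disjoint (X ∪ B₁) Y := hd.mono_right Finset.subset_union_left
  obtain ⟨Z, hZ, hu, hu1, hu2⟩ := exists_uncorr_of_steersTo hΨ hb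
    (Finset.subset_union_left (s₂ := B₁)) (Finset.subset_union_left (s₂ := B₂)) hXT hXT' h h'
  have hu0 : Z *ᵥ Ψ ≠ 0 := fun h => by simp [h, vecNormSq] at hu
  have hmem : ∀ i, ¬(i ∈ X ∨ i ∈ B₁) ↔ i ∈ Y ∨ i ∈ B₂ := fun i => by
    simpa using Finset.ext_iff.1 hc i
  have hXB' : ∀ i, i ∈ X → i ∉ B₁ := fun i hi => Finset.disjoint_left.1 hXB hi
  have hYB' : ∀ i, i ∈ Y → i ∉ B₂ := fun i hi => Finset.disjoint_left.1 hYB hi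
  have c1 : (X ∪ (Y ∪ B₂))ᶜ = B₁ := by
    ext i
    have h1 := hmem i; have h2 := hXB' i
    simp only [Finset.mem_compl, Finset.mem_union]
    tauto
  have c2 : ((X ∪ B₁) ∪ Y)ᶜ = B₂ := by
    ext i
    have h1 := hmem i; have h2 := hYB' i
    simp only [Finset.mem_compl, Finset.mem_union]
    tauto
  have c3 : (B₁ ∪ B₂)ᶜ = X ∪ Y := by
    ext i
    have h1 := hmem i; have h2 := hYB' i; have h3 := hXB' i
    simp only [Finset.mem_compl, Finset.mem_union]
    tauto
  obtain ⟨U, hU, hUs, hprod⟩ := exists_disentangler (hXT.mono_right Finset.subset_union_left) hXB hYB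
    hc c3 hu0 (hu1.mono le_rfl Finset.subset_union_left) (srank_le_card_of_uncorr hu0 hXT c1 hu1).1
    (srank_le_card_of_uncorr hu0 hXT' c2 hu2).2
  refine ⟨U, hU, hUs, fun A B hA hB hdisj huc O O' hO hO' => ?_⟩
  have huu : star (Z *ᵥ Ψ) ⬝ᵥ (Z *ᵥ Ψ) = 1 := by
    rw [← expVal_one, expVal_one_eq_vecNormSq, hu, Complex.ofReal_one]
  have huU : star (U *ᵥ (Z *ᵥ Ψ)) ⬝ᵥ (U *ᵥ (Z *ᵥ Ψ)) = 1 := by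
    rw [← expVal_one, expVal_mulVec, mul_one, unitary_conjTranspose_mul hU, expVal_one, huu]
  have hUΨ : star (U *ᵥ Ψ) ⬝ᵥ (U *ᵥ Ψ) = star Ψ ⬝ᵥ Ψ := by
    rw [← expVal_one, expVal_mulVec, mul_one, unitary_conjTranspose_mul hU, expVal_one]
  have key : ∀ M, SuppOn (A ∪ B) M →
      expVal (U *ᵥ Ψ) M = expVal (U *ᵥ (Z *ᵥ Ψ)) M * (star Ψ ⬝ᵥ Ψ) := by
    intro M hM
    have hUs' := hUs.mono (Finset.subset_union_right (s₁ := A ∪ B))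
    have := expVal_mulVec_of_uncorr hdisj huc hZ ((hUs'.conjTranspose.mul
      (hM.mono Finset.subset_union_left)).mul hUs')
    rw [huu, one_mul] at this
    rw [expVal_mulVec, expVal_mulVec, this]
  have hp := hprod.uncorr hA (hd.mono_right hB) O O' hO hO'
  rw [huU, mul_one] at hp
  rw [hUΨ, key _ ((hO.mono Finset.subset_union_left).mul (hO'.mono Finset.subset_union_right)),
    key _ (hO.mono Finset.subset_union_left), key _ (hO'.mono Finset.subset_union_right), hp]
  ring

end LocalDisentangling

/-! ### Steering in states prepared by circuits -/

section CircuitSteering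

variable {L : ℕ} [NeZero L] {κ τ β : ZMod L → Type} [∀ x, Fintype (κ x)] [∀ x, DecidableEq (κ x)]
  [∀ x, Fintype (τ x)] [∀ x, DecidableEq (τ x)] [∀ x, Fintype (β x)] [∀ x, DecidableEq (β x)]

theorem isProductAcross_prodVec (v : ∀ x, κ x → ℂ) (H : Finset (ZMod L)) :
    IsProductAcross H (prodVec v) := by
  refine ⟨fun c => ∏ x ∈ H, v x (c x), fun c => ∏ x ∈ Hᶜ, v x (c x), fun c c' h => ?_,
    fun c c' h => ?_, ?_⟩
  · exact Finset.prod_congr rfl fun x hx => by rw [h x (by simpa using hx)]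
  · exact Finset.prod_congr rfl fun x hx => by rw [h x (by simpa using hx)]
  · funext c
    exact (Finset.prod_mul_prod_compl H _).symm

/-- The gates near the two cuts are pulled to the end of the circuit; what is left factorizes across
the cuts. -/
theorem Circ.exists_cut {R n : ℕ} (hR : 3 * R < L) {K : Matrix (Conf τ) (Conf τ) ℂ}
    (hK : Circ (IsArc R) n K) (v : ∀ x, τ x → ℂ) (m m' : ℤ) :
    ∃ M M' Φ, M ∈ Matrix.unitaryGroup (Conf τ) ℂ ∧ M' ∈ Matrix.unitaryGroup (Conf τ) ℂ ∧
      SuppOn (seg L (m - (R + n * R : ℕ)) (m + (R + n * R : ℕ))) M ∧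
      SuppOn (seg L (m' - (R + n * R : ℕ)) (m' + (R + n * R : ℕ))) M' ∧
      IsProductAcross (seg L m m') Φ ∧ K *ᵥ prodVec v = M *ᵥ (M' *ᵥ Φ) := by
  have hp : ∀ S : Finset (ZMod L), IsArc R S → SmallSupp R S := fun S => smallSupp_of_isArc
  obtain ⟨M, K₁, hM, hMs, hK₁, rfl⟩ := hK.split hp (N := seg L (m - R) (m + R))
    (q := fun S => S ⊆ seg L (m - R) (m + R)) fun S _ hS => hS
  obtain ⟨M', K₂, hM', hMs', hK₂, rfl⟩ := hK₁.split (fun S hS => hp S hS.1)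
    (N := seg L (m' - R) (m' + R)) (q := fun S => S ⊆ seg L (m' - R) (m' + R)) fun S _ hS => hS
  obtain ⟨U₁, U₂, hU₁, hU₂, rfl⟩ := hK₂.factor (H := seg L m m') fun S hS =>
    (hp S hS.1.1).subset_or_disjoint hR hS.1.2 hS.2
  have hs : ∀ m : ℤ, nbhd (n * R) (seg L (m - R) (m + R)) ⊆
      seg L (m - (R + n * R : ℕ)) (m + (R + n * R : ℕ)) := fun m =>
    (nbhd_seg _ _ _).trans (seg_mono (by push_cast; lia) (by push_cast; lia))
  refine ⟨M, M', (U₁ * U₂) *ᵥ prodVec v, hM, hM', hMs.mono (hs m), hMs'.mono (hs m'), ?_, ?_⟩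
  · refine (isProductAcross_prodVec v _).mulVec (hU₁.suppOn fun S hS => hS.2)
      (hU₂.suppOn (N := (seg L m m')ᶜ) fun S hS => ?_) le_rfl disjoint_compl_right
    rcases (hp S hS.1.1.1).subset_or_disjoint hR hS.1.1.2 hS.1.2 with h | h
    · exact (hS.2 h).elim
    · exact Finset.subset_compl_iff_disjoint_left.2 h
  · rw [Matrix.mulVec_mulVec, Matrix.mulVec_mulVec, Matrix.mul_assoc]

/-- Up to unitaries at two cuts just after `p` and just after `q`, the prepared vector is a product.
Seen from the region beyond both cuts, an operator on [p, q) is therefore a mixture of operators on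
the short piece between `p` and the first cut. -/
theorem steersTo_of_circ {R n ρ : ℕ} (hR : 3 * R < L) (e : ∀ x, τ x ≃ κ x × β x)
    {K : Matrix (Conf τ) (Conf τ) ℂ} (hK : Circ (IsArc R) n K) {v : ∀ x, τ x → ℂ} {Ψ : Conf κ → ℂ}
    {h : Conf β → ℂ} (hh : h ≠ 0) (hΨ : K *ᵥ prodVec v = tens e Ψ h) (hρ : ρ = R + n * R)
    {p p' q : ℤ} (hp : p + 2 * ρ ≤ p') (hp' : p' ≤ q) (hq : q + 2 * ρ ≤ p + L)
    {W : Matrix (Conf κ) (Conf κ) ℂ} (hW : SuppOn (seg L p q) W) :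
    SteersTo (seg L p p') (seg L (q + 2 * ρ) (p + L)) Ψ W := by
  obtain ⟨M, M', Φ, hM, hM', hMs, hMs', hΦ, hKΦ⟩ := hK.exists_cut hR v (p + ρ) (q + ρ)
  rw [← hρ] at hMs hMs'
  replace hMs : SuppOn (seg L p p') M := hMs.mono (seg_mono (by lia) (by lia))
  replace hMs' : SuppOn (seg L q (q + 2 * ρ)) M' := hMs'.mono (seg_mono (by lia) (by lia))
  have hd : Disjoint (seg L p q) (seg L q (q + 2 * ρ)) := seg_disjoint le_rfl hq
  have hd' : Disjoint (seg L (q + 2 * ρ) (p + L)) (seg L q (q + 2 * ρ)) :=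
    (seg_disjoint le_rfl (by lia)).symm
  have hbs : seg L p p' ⊆ seg L p q := seg_mono le_rfl hp'
  have hΦ' := hΦ.compl
  rw [seg_compl] at hΦ'
  -- The unitary `M` at the first cut is included in the operator; the unitary `M'` at the second
  -- cut commutes with it and is not seen by the observables.
  obtain ⟨z, hz, hzO⟩ := exists_kraus ((suppOn_liftOp e hW).mul (hMs.mono hbs)) hΦ'
  have hzb : ∀ c, SuppOn (seg L p p') (z c) := by
    intro c
    refine (hz c).mono fun x hx => ?_
    obtain ⟨h1, h2⟩ := Finset.mem_inter.1 hx
    by_contra h3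
    have h4 : x ∈ seg L p' q := by
      rw [← seg_union (by lia) hp', Finset.mem_union] at h1
      exact h1.resolve_left h3
    exact Finset.disjoint_left.1 (seg_disjoint (by lia) (by lia)) h4 h2
  have hN := sum_norm_sq_pos hh
  set N : ℝ := ∑ i, ‖h i‖ ^ 2 with hNdef
  have hNN : (((√N)⁻¹ : ℝ) : ℂ) * (((√N)⁻¹ : ℝ) : ℂ) * (N : ℂ) = 1 := by
    norm_cast
    rw [← mul_inv, Real.mul_self_sqrt hN.le, inv_mul_cancel₀ hN.ne']
  refine ⟨Conf τ × Conf β, inferInstance,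
    fun k => (((√N)⁻¹ : ℝ) : ℂ) • sliceTens e (z k.1 * Mᴴ) h k.2, fun k =>
      (suppOn_sliceTens e ((hzb k.1).mul hMs.conjTranspose) h k.2).smul _, fun O hO => ?_⟩
  have hlO := suppOn_liftOp e hO
  have drop : ∀ Θ : Conf τ → ℂ, expVal (M' *ᵥ Θ) (liftOp e O) = expVal Θ (liftOp e O) := by
    intro Θ
    rw [expVal_mulVec, hlO.conj_eq hMs' hd' hM']
  have h1 : expVal (W *ᵥ Ψ) O * N = ∑ c, expVal (z c *ᵥ Φ) (liftOp e O) := by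
    rw [← hzO _ (hlO.mono (seg_mono (by lia) (by lia))), ← drop, Matrix.mulVec_mulVec,
      ← (((suppOn_liftOp e hW).mul (hMs.mono hbs))).commute hMs' hd, ← Matrix.mulVec_mulVec,
      ← Matrix.mulVec_mulVec, ← hKΦ, hΨ, liftOp_mulVec_tens, expVal_tens_liftOp,
      dotProduct_star_self_eq_ofReal]
  -- Undoing `M` and restoring `M'` turns `Φ` back into `Ψ ⊗ h`; slicing along the environment then
  -- gives operators on the system alone.
  have h2 : ∀ c, expVal (z c *ᵥ Φ) (liftOp e O) =
      ∑ d, expVal (sliceTens e (z c * Mᴴ) h d *ᵥ Ψ) O := by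
    intro c
    rw [← expVal_tens, ← hΨ, hKΦ, ← drop, Matrix.mulVec_mulVec, Matrix.mulVec_mulVec,
      ← (hzb c).commute hMs' (hd.mono_left hbs), ← Matrix.mulVec_mulVec, mul_assoc,
      unitary_conjTranspose_mul hM, mul_one]
  have h3 : expVal (W *ᵥ Ψ) O * N = ∑ k : Conf τ × Conf β,
      expVal (sliceTens e (z k.1 * Mᴴ) h k.2 *ᵥ Ψ) O := by
    rw [h1, Fintype.sum_prod_type]
    exact Finset.sum_congr rfl fun c _ => h2 c
  simp only [Matrix.smul_mulVec, expVal_smul, Complex.star_def, Complex.conj_ofReal]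
  rw [← Finset.mul_sum, ← h3]
  linear_combination -(expVal (W *ᵥ Ψ) O) * hNN

end CircuitSteering


/-! ### A disentangling unitary for each cut -/

section CutUnitaries

variable {L : ℕ} [NeZero L] {κ τ β : ZMod L → Type} [∀ x, Fintype (κ x)] [∀ x, DecidableEq (κ x)]
  [∀ x, Fintype (τ x)] [∀ x, DecidableEq (τ x)] [∀ x, Fintype (β x)] [∀ x, DecidableEq (β x)]
  {R n ρ : ℕ} {e : ∀ x, τ x ≃ κ x × β x} {K : Matrix (Conf τ) (Conf τ) ℂ} {v : ∀ x, τ x → ℂ}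
  {Ψ : Conf κ → ℂ} {h : Conf β → ℂ}

/-- Pulled back through the circuit, observables with disjoint light cones act on a product vector;
the environment contributes only a common norm. -/
theorem uncorr_of_circ (hK : Circ (IsArc R) n K) (hh : h ≠ 0)
    (hΨ : K *ᵥ prodVec v = tens e Ψ h) {A B : Finset (ZMod L)}
    (hAB : Disjoint (nbhd (n * R) A) (nbhd (n * R) B)) : Uncorr A B Ψ := by
  intro O O' hO hO'
  have hp : ∀ S : Finset (ZMod L), IsArc R S → SmallSupp R S := fun S => smallSupp_of_isArc
  have h1 := (hK.conj hp (suppOn_liftOp e hO)).1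
  have h2 := (hK.conj hp (suppOn_liftOp e hO')).1
  have h3 := (isProductAcross_prodVec v (nbhd (n * R) A)).uncorr le_rfl hAB _ _ h1 h2
  have hKK := unitary_mul_conjTranspose hK.unitary
  have hKK' := unitary_conjTranspose_mul hK.unitary
  have key : ∀ O, expVal (prodVec v) (Kᴴ * liftOp e O * K) = expVal Ψ O * (star h ⬝ᵥ h) := by
    intro O
    rw [← expVal_mulVec, hΨ, expVal_tens_liftOp]
  have h4 : Kᴴ * liftOp e O * K * (Kᴴ * liftOp e O' * K) = Kᴴ * liftOp e (O * O') * K := by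
    calc _ = Kᴴ * liftOp e O * (K * Kᴴ) * liftOp e O' * K := by simp only [mul_assoc]
      _ = _ := by rw [hKK, mul_one, liftOp_mul]; simp only [mul_assoc]
  have h5 : star (prodVec v) ⬝ᵥ prodVec v = (star Ψ ⬝ᵥ Ψ) * (star h ⬝ᵥ h) := by
    rw [← expVal_one Ψ, ← key, liftOp_one, mul_one, hKK', expVal_one]
  rw [h4, key, key, key, h5] at h3
  have hN := dotProduct_star_self_ne_zero hh
  apply mul_right_cancel₀ (mul_ne_zero hN hN)
  linear_combination h3

/-- The measured arc has length 2ρ and begins 2ρ after `m + d`. These 2ρ, the arc itself and another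
2ρ behind it give the offset 6ρ, and the two margins keep the light cones of the arc and of the
regions in question disjoint. -/
theorem exists_cut_unitary (hR : 3 * R < L) (hK : Circ (IsArc R) n K) (hh : h ≠ 0) (hΨ0 : Ψ ≠ 0)
    (hΨ : K *ᵥ prodVec v = tens e Ψ h) (hρ : ρ = R + n * R) {d : ℕ} (hd : 2 * ρ ≤ d)
    (hL : d + 8 * ρ ≤ L) (m : ℤ) :
    ∃ U ∈ Matrix.unitaryGroup (Conf κ) ℂ, SuppOn (seg L (m - 2 * ρ) (m + 2 * ρ)) U ∧
      Uncorr (seg L (m + d + 6 * ρ - L) m) (seg L m (m + d)) (U *ᵥ Ψ) := by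
  set p : ℤ := m + d + 2 * ρ with hp
  have hXB : seg L p (m - 2 * ρ + L) ∪ seg L (m - 2 * ρ + L) (m + L) = seg L p (m + L) :=
    seg_union (by lia) (by lia)
  have hYB : seg L (m + L + 2 * ρ) (p + L) ∪ seg L (m + L) (m + L + 2 * ρ) =
      seg L (m + L) (p + L) := by
    rw [Finset.union_comm]; exact seg_union (by lia) (by lia)
  have hBB : seg L (m - 2 * ρ + L) (m + L) ∪ seg L (m + L) (m + L + 2 * ρ) =
      seg L (m - 2 * ρ) (m + 2 * ρ) := by
    rw [seg_union (by lia) (by lia), ← seg_add (m - 2 * ρ) (m + 2 * ρ)]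
    congr 1; ring
  obtain ⟨U, hU, hUs, hUu⟩ := exists_local_disentangler (b := seg L p (p + 2 * ρ))
    (X := seg L p (m - 2 * ρ + L)) (B₁ := seg L (m - 2 * ρ + L) (m + L))
    (B₂ := seg L (m + L) (m + L + 2 * ρ)) (Y := seg L (m + L + 2 * ρ) (p + L)) hΨ0
    (seg_mono le_rfl (by lia)) (seg_disjoint le_rfl (by lia)) (seg_disjoint le_rfl (by lia)).symm
    (by rw [hXB, hYB, seg_compl]) (fun W hW => by
      rw [hYB]
      have := steersTo_of_circ hR e hK hh hΨ hρ (p := p) (p' := p + 2 * ρ) le_rfl (by lia) (by lia)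
        hW
      convert this using 2
      ring) (fun W hW => by
      rw [hXB] at hW
      exact steersTo_of_circ hR e hK hh hΨ hρ (p := p) (p' := p + 2 * ρ) le_rfl (by lia) (by lia)
        hW)
  rw [hBB] at hUs hUu
  refine ⟨U, hU, hUs, ?_⟩
  have e1 : seg L (m + d + 6 * ρ - L) m = seg L (m + d + 6 * ρ) (m + L) := by
    rw [← seg_add]; congr 1; ring
  have e2 : seg L m (m + d) = seg L (m + L) (m + d + L) := (seg_add _ _).symm
  have e3 : seg L (m - 2 * ρ) (m + 2 * ρ) = seg L (m - 2 * ρ + L) (m + 2 * ρ + L) :=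
    (seg_add _ _).symm
  have hsub : seg L (m + d + 6 * ρ - L) m ∪ seg L m (m + d) ∪ seg L (m - 2 * ρ) (m + 2 * ρ) ⊆
      seg L (m + d + 6 * ρ) (m + d + L) := by
    rw [e1, e2, e3]
    exact Finset.union_subset (Finset.union_subset (seg_mono le_rfl (by lia))
      (seg_mono (by lia) le_rfl)) (seg_mono (by lia) (by lia))
  have hn : (n * R : ℤ) ≤ ρ := by rw [hρ]; push_cast; lia
  refine hUu _ _ ?_ ?_ ?_ ?_
  · rw [hXB, e1]; exact seg_mono (by lia) le_rfl
  · rw [hYB, e2]; exact seg_mono le_rfl (by lia)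
  · exact (seg_disjoint (by lia) (by lia)).mono_right hsub
  · refine (uncorr_of_circ hK hh hΨ ?_).mono le_rfl hsub
    exact (seg_disjoint (a := p - (n * R : ℕ)) (b := p + 2 * ρ + (n * R : ℕ))
      (c := m + d + 6 * ρ - (n * R : ℕ)) (d := m + d + L + (n * R : ℕ)) (by push_cast; lia)
      (by push_cast; lia)).mono (nbhd_seg _ _ _) (nbhd_seg _ _ _)

end CutUnitaries

/-! ### Layers of disjoint gates -/

section Layers

variable {ι : Type} [Fintype ι] [DecidableEq ι] {K : ι → Type} [∀ i, Fintype (K i)]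
  [∀ i, DecidableEq (K i)]

/-- Only gates that meet `A'` or `B'` survive the conjugation of observables there, and these gates
do not leave `A` and `B`. -/
theorem Uncorr.mulVec_layer {A B A' B' : Finset ι} {φ : (∀ i, K i) → ℂ} (h : Uncorr A B φ)
    {p : Finset ι → Prop} {V : Matrix (∀ i, K i) (∀ i, K i) ℂ} (hV : Layer p V) (hA : A' ⊆ A)
    (hB : B' ⊆ B) (hpA : ∀ S, p S → ¬ Disjoint A' S → S ⊆ A)
    (hpB : ∀ S, p S → ¬ Disjoint B' S → S ⊆ B) : Uncorr A' B' (V *ᵥ φ) := by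
  intro O O' hO hO'
  have key : ∀ {A A' : Finset ι} {O : Matrix (∀ i, K i) (∀ i, K i) ℂ}, A' ⊆ A →
      (∀ S, p S → ¬ Disjoint A' S → S ⊆ A) → SuppOn A' O → SuppOn A (Vᴴ * O * V) := by
    intro A A' O hA hpA hO
    obtain ⟨w, hw, h1, -⟩ := hV.truncate hO
    have hws := hw.suppOn (N := A) fun S hS => hpA S hS.1 hS.2
    rw [h1]
    exact (hws.conjTranspose.mul (hO.mono hA)).mul hws
  have h1 := h _ _ (key hA hpA hO) (key hB hpB hO')
  have hVV := unitary_mul_conjTranspose hV.unitary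
  have h4 : Vᴴ * O * V * (Vᴴ * O' * V) = Vᴴ * (O * O') * V := by
    calc _ = Vᴴ * O * (V * Vᴴ) * O' * V := by simp only [mul_assoc]
      _ = _ := by rw [hVV, mul_one]; simp only [mul_assoc]
  have h5 : star (V *ᵥ φ) ⬝ᵥ (V *ᵥ φ) = star φ ⬝ᵥ φ := by
    rw [← expVal_one, expVal_mulVec, mul_one, unitary_conjTranspose_mul hV.unitary, expVal_one]
  rw [expVal_mulVec, expVal_mulVec, expVal_mulVec, h5, ← h4]
  exact h1

theorem Layer.conjTranspose {p : Finset ι → Prop} {V : Matrix (∀ i, K i) (∀ i, K i) ℂ}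
    (hV : Layer p V) : Layer p Vᴴ := by
  obtain ⟨g, hg, hd, rfl⟩ := hV
  refine ⟨(g.map fun G => (G.1, G.2ᴴ)).reverse, fun G hG => ?_, ?_, ?_⟩
  · obtain ⟨H, hH, rfl⟩ := List.mem_map.1 (List.mem_reverse.1 hG)
    exact ⟨(hg H hH).1, (hg H hH).2.1.conjTranspose, conjTranspose_mem_unitary (hg H hH).2.2⟩
  · rw [List.pairwise_reverse, List.pairwise_map]
    exact hd.imp fun h => h.symm
  · rw [Matrix.conjTranspose_list_prod, List.map_reverse, List.map_map, List.map_map]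
    rfl

theorem Layer.isLayer {L : ℕ} [NeZero L] {κ : ZMod L → Type} [∀ x, Fintype (κ x)]
    [∀ x, DecidableEq (κ x)] {R : ℕ} {U : Matrix (Conf κ) (Conf κ) ℂ} (h : Layer (IsArc R) U) :
    IsLayer R U := by
  obtain ⟨g, hg, hd, rfl⟩ := h
  exact ⟨g, fun G hG => ⟨(hg G hG).1, (hg G hG).2.1.isSupportedOn, (hg G hG).2.2⟩, hd, rfl⟩

theorem layer_prod_gates {S : ℕ → Finset ι} {U : ℕ → Matrix (∀ i, K i) (∀ i, K i) ℂ} {l : List ℕ}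
    (hl : l.Nodup) (hU : ∀ j ∈ l, U j ∈ Matrix.unitaryGroup (∀ i, K i) ℂ)
    (hS : ∀ j ∈ l, SuppOn (S j) (U j)) (hd : ∀ i ∈ l, ∀ j ∈ l, i ≠ j → Disjoint (S i) (S j)) :
    Layer (fun T => ∃ j ∈ l, T = S j) (l.map U).prod := by
  refine ⟨l.map fun j => (S j, U j), fun G hG => ?_, ?_, ?_⟩
  · obtain ⟨j, hj, rfl⟩ := List.mem_map.1 hG
    exact ⟨⟨j, hj, rfl⟩, hS j hj, hU j hj⟩
  · rw [List.pairwise_map]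
    exact hl.imp_of_mem fun hi hj hij => hd _ hi _ hj hij
  · rw [List.map_map]; rfl

theorem prod_gates_erase {S : ℕ → Finset ι} {U : ℕ → Matrix (∀ i, K i) (∀ i, K i) ℂ} {l : List ℕ}
    (hS : ∀ j ∈ l, SuppOn (S j) (U j)) (hl : l.Nodup)
    (hd : ∀ i ∈ l, ∀ j ∈ l, i ≠ j → Disjoint (S i) (S j))
    {j : ℕ} (hj : j ∈ l) : (l.map U).prod = ((l.erase j).map U).prod * U j := by
  have hperm : (l.map U).Perm ((l.erase j ++ [j]).map U) :=
    ((List.perm_cons_erase hj).trans (List.perm_append_singleton j _).symm).map U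
  rw [hperm.prod_eq' ?_]
  · simp
  · rw [List.pairwise_map]
    exact hl.imp_of_mem fun hi hj hij => (hS _ hi).commute (hS _ hj) (hd _ hi _ hj hij)

end Layers


/-! ### Preparing product vectors by local unitaries -/

section PreparingProducts

variable {ι : Type} [Fintype ι] [DecidableEq ι] {K : ι → Type} [∀ i, Fintype (K i)]
  [∀ i, DecidableEq (K i)]

/-- Off `S` both vectors are constant, so their reduced matrices there have all entries equal to the
squared norm, and Uhlmann's theorem applies. -/
theorem exists_unitary_of_dependsOn {S : Finset ι} {f g : (∀ i, K i) → ℂ}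
    (hf : DependsOn f (↑S : Set ι)) (hg : DependsOn g (↑S : Set ι))
    (h : vecNormSq f = vecNormSq g) :
    ∃ U ∈ Matrix.unitaryGroup (∀ i, K i) ℂ, SuppOn S U ∧ U *ᵥ f = g := by
  refine exists_suppOn_unitary ?_
  have key : ∀ f : (∀ i, K i) → ℂ, DependsOn f (↑S : Set ι) → ∀ c c',
      redMat Sᶜ f c c' = (vecNormSq f : ℂ) := by
    intro f hf c c'
    have h1 : ∀ c d, cutMat Sᶜ f c d = f d := fun c d => by
      rw [cutMat]
      exact hf fun i hi => by simp [show i ∈ S from hi]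
    rw [redMat, Matrix.mul_apply, vecNormSq]
    push_cast
    refine Finset.sum_congr rfl fun d _ => ?_
    rw [Matrix.conjTranspose_apply, h1, h1, Complex.star_def, Complex.mul_conj']
  ext c c'
  rw [key f hf, key g hg, h]

/-- The basis vector of a configuration, on the region `S`. -/
def basisVec (c₀ : ∀ i, K i) (S : Finset ι) : (∀ i, K i) → ℂ :=
  fun c => ∏ i ∈ S, if c i = c₀ i then 1 else 0

theorem dependsOn_basisVec (c₀ : ∀ i, K i) (S : Finset ι) :
    DependsOn (basisVec c₀ S) (↑S : Set ι) := fun c c' h =>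
  Finset.prod_congr rfl fun i hi => by rw [h i (by simpa using hi)]

theorem basisVec_ne_zero (c₀ : ∀ i, K i) (S : Finset ι) : basisVec c₀ S ≠ 0 := fun h => by
  simpa [basisVec] using congrFun h c₀

theorem basisVec_union (c₀ : ∀ i, K i) {S T : Finset ι} (h : Disjoint S T) :
    basisVec c₀ (S ∪ T) = basisVec c₀ S * basisVec c₀ T := by
  funext c
  exact Finset.prod_union h

theorem exists_unitary_smul {S : Finset ι} (c₀ : ∀ i, K i) {f : (∀ i, K i) → ℂ}
    (hf : DependsOn f (↑S : Set ι)) (hf0 : f ≠ 0) :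
    ∃ U ∈ Matrix.unitaryGroup (∀ i, K i) ℂ, SuppOn S U ∧ ∃ z : ℂ, z ≠ 0 ∧
      U *ᵥ basisVec c₀ S = z • f := by
  have h1 := vecNormSq_pos hf0
  have h2 := vecNormSq_pos (basisVec_ne_zero c₀ S)
  set t : ℝ := √(vecNormSq (basisVec c₀ S) / vecNormSq f) with ht
  have htt : t * t = vecNormSq (basisVec c₀ S) / vecNormSq f := Real.mul_self_sqrt (by positivity)
  have ht0 : t ≠ 0 := by
    intro h0
    rw [h0, zero_mul] at htt
    exact (div_pos h2 h1).ne htt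
  have hd : DependsOn ((t : ℂ) • f) (↑S : Set ι) := fun c c' h => by simp [hf h]
  obtain ⟨U, hU, hUs, hUf⟩ := exists_unitary_of_dependsOn (dependsOn_basisVec c₀ S) hd (by
    rw [vecNormSq_smul, htt, div_mul_cancel₀ _ h1.ne'])
  exact ⟨U, hU, hUs, t, by exact_mod_cast ht0, hUf⟩

theorem list_prod_map_apply {α γ : Type} (l : List γ) (f : γ → α → ℂ) (c : α) :
    (l.map f).prod c = (l.map fun j => f j c).prod := by
  induction l with
  | nil => simp
  | cons j l ih => simp [ih]

theorem prod_gates_mulVec_basisVec {S : ℕ → Finset ι} {U : ℕ → Matrix (∀ i, K i) (∀ i, K i) ℂ}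
    {f : ℕ → (∀ i, K i) → ℂ} (c₀ : ∀ i, K i) (l : List ℕ) (hl : l.Nodup)
    (hUs : ∀ j ∈ l, SuppOn (S j) (U j)) (hf : ∀ j ∈ l, DependsOn (f j) (↑(S j) : Set ι))
    (hU : ∀ j ∈ l, U j *ᵥ basisVec c₀ (S j) = f j)
    (hd : ∀ i ∈ l, ∀ j ∈ l, i ≠ j → Disjoint (S i) (S j)) (T : Finset ι)
    (hT : ∀ j ∈ l, Disjoint (S j) T) :
    (l.map U).prod *ᵥ basisVec c₀ (l.toFinset.biUnion S ∪ T) =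
      (l.map f).prod * basisVec c₀ T := by
  induction l generalizing T with
  | nil => simp
  | cons j l ih =>
    have hj := List.mem_cons_self (a := j) (l := l)
    have hjl := (List.nodup_cons.1 hl).1
    have hm : ∀ i ∈ l, i ∈ j :: l := fun i hi => List.mem_cons_of_mem _ hi
    have hne : ∀ i ∈ l, i ≠ j := fun i hi h => hjl (h ▸ hi)
    have h1 := ih (List.nodup_cons.1 hl).2 (fun i hi => hUs i (hm i hi)) (fun i hi => hf i (hm i hi))
      (fun i hi => hU i (hm i hi)) (fun i hi k hk => hd i (hm i hi) k (hm k hk)) (S j ∪ T)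
      (fun i hi => Finset.disjoint_union_right.2 ⟨hd i (hm i hi) j hj (hne i hi), hT i (hm i hi)⟩)
    have h2 : (j :: l).toFinset.biUnion S ∪ T = l.toFinset.biUnion S ∪ (S j ∪ T) := by
      rw [List.toFinset_cons, Finset.biUnion_insert, Finset.union_comm (S j), Finset.union_assoc]
    have h3 : DependsOn (l.map f).prod (↑(S j)ᶜ : Set ι) := by
      intro c c' h
      rw [list_prod_map_apply, list_prod_map_apply]
      congr 1
      refine List.map_congr_left fun i hi => ?_
      refine hf i (hm i hi) fun x hx => h x ?_
      have := Finset.disjoint_left.1 (hd i (hm i hi) j hj (hne i hi)) (show x ∈ S i from hx)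
      simpa using this
    have h4 : DependsOn (basisVec c₀ T) (↑(S j)ᶜ : Set ι) :=
      (dependsOn_basisVec c₀ T).mono (coe_subset_coe_compl (hT j hj).symm)
    rw [h2, List.map_cons, List.prod_cons, ← Matrix.mulVec_mulVec, h1,
      basisVec_union c₀ (hT j hj), (hUs j hj).mulVec_mul' h3, (hUs j hj).mulVec_mul h4, hU j hj,
      List.map_cons, List.prod_cons]
    ring

end PreparingProducts

/-! ### Criteria for short-range entanglement -/

section ShortRange

variable {L : ℕ} [NeZero L] {κ : ZMod L → Type} [∀ x, Fintype (κ x)] [∀ x, DecidableEq (κ x)]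

theorem isUnitVec_basis {n : Type} [Fintype n] [DecidableEq n] (k₀ : n) :
    IsUnitVec fun k => if k = k₀ then (1 : ℂ) else 0 := by
  have : ∀ k, ‖(if k = k₀ then (1 : ℂ) else 0)‖ ^ 2 = if k = k₀ then (1 : ℝ) else 0 := fun k => by
    split_ifs <;> simp
  simp [IsUnitVec, this]

theorem vecNormSq_basisVec_univ (c₀ : Conf κ) : vecNormSq (basisVec c₀ Finset.univ) = 1 := by
  have : ∀ c : Conf κ, basisVec c₀ Finset.univ c = if c = c₀ then 1 else 0 := by
    intro c
    rw [basisVec, Finset.prod_ite_zero]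
    simp [funext_iff]
  have h2 : ∀ c : Conf κ, ‖(if c = c₀ then (1 : ℂ) else 0)‖ ^ 2 = if c = c₀ then (1 : ℝ) else 0 :=
    fun c => by split_ifs <;> simp
  simp only [vecNormSq, this, h2, Finset.sum_ite_eq', Finset.mem_univ, if_true]

theorem vecNormSq_unitary {n : Type} [Fintype n] [DecidableEq n] {U : Matrix n n ℂ}
    (hU : U ∈ Matrix.unitaryGroup n ℂ) (ψ : n → ℂ) : vecNormSq (U *ᵥ ψ) = vecNormSq ψ := by
  have := expVal_mulVec ψ U 1
  rw [mul_one, unitary_conjTranspose_mul hU, expVal_one_eq_vecNormSq, expVal_one_eq_vecNormSq] at this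
  exact_mod_cast this

/-- A global phase counts as a gate on the empty arc. -/
theorem layer_smul_one {R : ℕ} {z : ℂ} (hz : ‖z‖ = 1) :
    Layer (IsArc R) (z • (1 : Matrix (Conf κ) (Conf κ) ℂ)) := by
  refine ⟨[(∅, z • 1)], fun G hG => ?_, List.pairwise_singleton _ _, by simp⟩
  obtain rfl := List.mem_singleton.1 hG
  refine ⟨⟨0, 0, by lia, by simp [arc]⟩, (suppOn_one ∅).smul z, ?_⟩
  rw [Matrix.mem_unitaryGroup_iff, Matrix.star_eq_conjTranspose, Matrix.conjTranspose_smul,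
    Matrix.conjTranspose_one, Matrix.smul_mul, Matrix.mul_smul, one_mul, smul_smul,
    Complex.star_def, Complex.mul_conj', hz]
  simp

/-- Besides `V` and `W` the third layer carries the scalar, which has modulus one because both sides
are normalized. -/
theorem isSRE_of_layers {R : ℕ} {V W : Matrix (Conf κ) (Conf κ) ℂ} (hV : Layer (IsArc R) V)
    (hW : Layer (IsArc R) W) {c₀ : Conf κ} {Ψ : Conf κ → ℂ} (hΨ : IsUnitVec Ψ) {z : ℂ}
    (h : Ψ = z • (V *ᵥ (W *ᵥ basisVec c₀ Finset.univ))) : IsSRE R 3 Ψ := by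
  have hz : ‖z‖ = 1 := by
    have h1 : vecNormSq Ψ = 1 := hΨ
    have h2 : vecNormSq (z • (V *ᵥ (W *ᵥ basisVec c₀ Finset.univ))) = ‖z‖ ^ 2 := by
      have : ∀ ψ : Conf κ → ℂ, vecNormSq (z • ψ) = ‖z‖ ^ 2 * vecNormSq ψ := by
        intro ψ
        simp [vecNormSq, mul_pow, Finset.mul_sum]
      rw [this, vecNormSq_unitary hV.unitary, vecNormSq_unitary hW.unitary,
        vecNormSq_basisVec_univ, mul_one]
    rw [h, h2] at h1
    exact (pow_eq_one_iff_of_nonneg (norm_nonneg z) two_ne_zero).1 h1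
  refine ⟨fun x k => if k = c₀ x then 1 else 0, z • 1 * (V * W), fun x => isUnitVec_basis _,
    ⟨[z • 1, V, W], by simp, ?_, by simp⟩, ?_⟩
  · intro w hw
    simp only [List.mem_cons, List.not_mem_nil, or_false] at hw
    rcases hw with rfl | rfl | rfl
    exacts [(layer_smul_one hz).isLayer, hV.isLayer, hW.isLayer]
  · rw [h, ← Matrix.mulVec_mulVec, ← Matrix.mulVec_mulVec, Matrix.smul_mulVec, Matrix.one_mulVec]
    rfl

/-- On a ring no longer than the range, one gate on the whole ring prepares any state. -/
theorem isSRE_of_le {R : ℕ} (hR : L ≤ R) {Ψ : Conf κ → ℂ} (hΨ : IsUnitVec Ψ) : IsSRE R 3 Ψ := by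
  have hΨ0 : Ψ ≠ 0 := by
    rintro rfl
    simp [IsUnitVec] at hΨ
  obtain ⟨c₀, -⟩ := Function.ne_iff.1 hΨ0
  obtain ⟨U, hU, hUs, hUf⟩ := exists_unitary_of_dependsOn (dependsOn_basisVec c₀ Finset.univ)
    (g := Ψ) (fun c c' h => by rw [show c = c' from funext fun x => h x (by simp)])
    ((vecNormSq_basisVec_univ c₀).trans hΨ.symm)
  have harc : IsArc R (Finset.univ : Finset (ZMod L)) := by
    refine ⟨((0 : ℤ) : ZMod L), L, hR, ?_⟩
    rw [arc_eq_seg, seg_eq_univ le_rfl]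
  refine isSRE_of_layers (V := U) (W := 1) (c₀ := c₀) (z := 1) ⟨[(Finset.univ, U)], fun G hG => ?_,
    List.pairwise_singleton _ _, by simp⟩ (layer_one _) hΨ (by simp [hUf])
  obtain rfl := List.mem_singleton.1 hG
  exact ⟨harc, hUs, hU⟩

/-- A state that is a product over disjoint cells covering the ring is prepared by one gate on
each cell. -/
theorem exists_layer_of_cells {R k : ℕ} {Z : ℕ → Finset (ZMod L)}
    (hZ : ∀ j < k, IsArc R (Z j)) (hd : ∀ i < k, ∀ j < k, i ≠ j → Disjoint (Z i) (Z j))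
    (hcov : (Finset.range k).biUnion Z = Finset.univ) {ψ : Conf κ → ℂ} (hψ : ψ ≠ 0)
    (h : ∀ j < k, srank (Z j) ψ ≤ 1) :
    ∃ (c₀ : Conf κ) (W : Matrix (Conf κ) (Conf κ) ℂ) (z : ℂ), Layer (IsArc R) W ∧
      ψ = z • (W *ᵥ basisVec c₀ Finset.univ) := by
  have h1 : ∀ j, ∃ F G : Conf κ → ℂ, j < k → DependsOn F (↑(Z j) : Set (ZMod L)) ∧
      DependsOn G (↑(Z j)ᶜ : Set (ZMod L)) ∧ ψ = F * G := by
    intro j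
    by_cases hj : j < k
    · obtain ⟨F, G, hFG⟩ := isProductAcross_of_srank_le_one (h j hj)
      exact ⟨F, G, fun _ => hFG⟩
    · exact ⟨0, 0, fun h => (hj h).elim⟩
  choose F G hFG using h1
  obtain ⟨c₀, hc₀⟩ := Function.ne_iff.1 hψ
  have hF0 : ∀ j < k, F j ≠ 0 := by
    intro j hj h0
    have := (hFG j hj).2.2
    rw [h0, zero_mul] at this
    exact hψ this
  have h2 : ∀ j, ∃ (U : Matrix (Conf κ) (Conf κ) ℂ) (z : ℂ), j < k →
      U ∈ Matrix.unitaryGroup (Conf κ) ℂ ∧ SuppOn (Z j) U ∧ z ≠ 0 ∧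
        U *ᵥ basisVec c₀ (Z j) = z • F j := by
    intro j
    by_cases hj : j < k
    · obtain ⟨U, hU, hUs, z, hz, hUz⟩ := exists_unitary_smul c₀ (hFG j hj).1 (hF0 j hj)
      exact ⟨U, z, fun _ => ⟨hU, hUs, hz, hUz⟩⟩
    · exact ⟨0, 0, fun h => (hj h).elim⟩
  choose U z hU using h2
  have hlay := (layer_prod_gates (List.nodup_range (n := k)) (U := U) (S := Z)
    (fun j hj => (hU j (List.mem_range.1 hj)).1) (fun j hj => (hU j (List.mem_range.1 hj)).2.1)
    (fun i hi j hj => hd i (List.mem_range.1 hi) j (List.mem_range.1 hj))).mono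
    (p' := IsArc R) fun S ⟨j, hj, hS⟩ => hS ▸ hZ j (List.mem_range.1 hj)
  have hprod := prod_gates_mulVec_basisVec (S := Z) (U := U) (f := fun j => z j • F j) c₀
    (List.range k) List.nodup_range (fun j hj => (hU j (List.mem_range.1 hj)).2.1)
    (fun j hj c c' h => by simp [(hFG j (List.mem_range.1 hj)).1 h])
    (fun j hj => (hU j (List.mem_range.1 hj)).2.2.2)
    (fun i hi j hj => hd i (List.mem_range.1 hi) j (List.mem_range.1 hj)) ∅ (by simp)
  have hun : (List.range k).toFinset.biUnion Z ∪ ∅ = Finset.univ := by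
    rw [List.toFinset_range, Finset.union_empty, hcov]
  rw [hun] at hprod
  refine ⟨c₀, _, ψ c₀ * (∏ j ∈ Finset.range k, F j c₀ * z j)⁻¹, hlay, ?_⟩
  have h3 : ∀ c, ψ c = ψ c₀ * ∏ j ∈ Finset.range k, F j c / F j c₀ := by
    intro c
    have := eq_prod_of_cells (Finset.range k) Z
      (fun i hi j hj => hd i (Finset.mem_range.1 hi) j (Finset.mem_range.1 hj))
      (fun j hj => (hFG j (Finset.mem_range.1 hj)).1)
      (fun j hj => (hFG j (Finset.mem_range.1 hj)).2.1)
      (fun j hj => (hFG j (Finset.mem_range.1 hj)).2.2) hc₀ c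
    rw [hcov, Finset.piecewise_univ] at this
    exact this
  have h4 : ∀ c, ((List.range k).map fun j => z j • F j).prod c =
      ∏ j ∈ Finset.range k, z j * F j c := by
    intro c
    rw [list_prod_map_apply]
    rfl
  funext c
  rw [Pi.smul_apply, hprod, Pi.mul_apply, h4, h3 c]
  have hz : ∏ j ∈ Finset.range k, z j ≠ 0 :=
    Finset.prod_ne_zero_iff.2 fun j hj => (hU j (Finset.mem_range.1 hj)).2.2.1
  simp only [Finset.prod_div_distrib, Finset.prod_mul_distrib, smul_eq_mul, basisVec,
    Finset.prod_empty, mul_one, mul_inv]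
  field_simp

end ShortRange


/-! ### Invertible states on a ring are short-range entangled -/

section InvertibleStates

variable {L : ℕ} [NeZero L]

theorem isArc_seg {a b : ℤ} {R : ℕ} (hab : a ≤ b) (h : b ≤ a + R) : IsArc R (seg L a b) :=
  ⟨_, _, by lia, seg_eq_arc hab⟩

/-- A disentangler at another cut that meets the shortened region lies inside the full one: its
support has length 4ρ, which is the amount cut off at the far end, and it does not reach across `m`.
-/
theorem seg_subset_left_of_meets {m μ ρ c : ℤ} (hμ : m - L + 2 * ρ ≤ μ) (hμ' : μ + 2 * ρ ≤ m) (hc : m - L ≤ c)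
    (h : ¬ Disjoint (seg L (c + 4 * ρ) m) (seg L (μ - 2 * ρ) (μ + 2 * ρ))) :
    seg L (μ - 2 * ρ) (μ + 2 * ρ) ⊆ seg L c m := by
  obtain ⟨x, hx, hx'⟩ := Finset.not_disjoint_iff.1 h
  obtain ⟨i, hi1, hi2, rfl⟩ := mem_seg.1 hx
  obtain ⟨j, hj1, hj2, hij⟩ := mem_seg.1 hx'
  have := eq_of_cast_eq hij (by lia) (by lia)
  exact seg_mono (by lia) hμ'

theorem seg_subset_right_of_meets {m μ ρ c : ℤ} (hμ : m + 2 * ρ ≤ μ) (hμ' : μ + 2 * ρ ≤ m + L) (hc : c ≤ m + L)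
    (h : ¬ Disjoint (seg L m (c - 4 * ρ)) (seg L (μ - 2 * ρ) (μ + 2 * ρ))) :
    seg L (μ - 2 * ρ) (μ + 2 * ρ) ⊆ seg L m c := by
  obtain ⟨x, hx, hx'⟩ := Finset.not_disjoint_iff.1 h
  obtain ⟨i, hi1, hi2, rfl⟩ := mem_seg.1 hx
  obtain ⟨j, hj1, hj2, hij⟩ := mem_seg.1 hx'
  have := eq_of_cast_eq hij (by lia) (by lia)
  exact seg_mono (by lia) (by lia)

variable {κ τ β : ZMod L → Type} [∀ x, Fintype (κ x)] [∀ x, DecidableEq (κ x)]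
  [∀ x, Fintype (τ x)] [∀ x, DecidableEq (τ x)] [∀ x, Fintype (β x)] [∀ x, DecidableEq (β x)]

/-- The positions of `k` cuts of the ring, at distance `D` from each other, and the end point. -/
def cutPos (L D k j : ℕ) : ℤ := if j < k then j * D else L

/-- All cells have length `D` except the last, which absorbs the remainder of the division and is
shorter than `2 * D`. -/
theorem cutPos_succ {L D k j : ℕ} (hk : k = L / D) (hD : 0 < D) (hj : j < k) :
    cutPos L D k j + D ≤ cutPos L D k (j + 1) ∧
      cutPos L D k (j + 1) ≤ cutPos L D k j + 2 * D := by
  have h1 : k * D ≤ L := hk ▸ Nat.div_mul_le_self L D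
  have h2 : L < (k + 1) * D := by rw [hk, mul_comm]; exact Nat.lt_mul_div_succ L hD
  have h1' : (k : ℤ) * D ≤ L := by exact_mod_cast h1
  have h2' : (L : ℤ) < (k + 1) * D := by exact_mod_cast h2
  simp only [cutPos, if_pos hj]
  split_ifs with h
  · push_cast
    constructor <;> nlinarith
  · obtain rfl : k = j + 1 := by lia
    push_cast at h1' h2'
    constructor <;> nlinarith

theorem cutPos_add_le {L D k : ℕ} (hk : k = L / D) (hD : 0 < D) {i j : ℕ} (hij : i < j)
    (hj : j ≤ k) : cutPos L D k i + D ≤ cutPos L D k j := by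
  induction j, hij using Nat.le_induction with
  | base => exact (cutPos_succ hk hD (by lia)).1
  | succ j hij ih =>
    have h1 := (cutPos_succ hk hD (j := j) (by lia)).1
    have h2 := ih (by lia)
    lia

theorem cutPos_zero {L D k : ℕ} (hk : 0 < k) : cutPos L D k 0 = 0 := by simp [cutPos, hk]

theorem cutPos_self (L D k : ℕ) : cutPos L D k k = L := by simp [cutPos]

theorem biUnion_cells {D k : ℕ} (hk : k = L / D) (hD : 0 < D) (hk0 : 0 < k) :
    (Finset.range k).biUnion (fun j => seg L (cutPos L D k j) (cutPos L D k (j + 1))) =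
      Finset.univ := by
  have key : ∀ t ≤ k, (Finset.range t).biUnion
      (fun j => seg L (cutPos L D k j) (cutPos L D k (j + 1))) = seg L 0 (cutPos L D k t) := by
    intro t ht
    induction t with
    | zero => simp [cutPos_zero hk0, seg]
    | succ t ih =>
      rw [Finset.range_add_one, Finset.biUnion_insert, ih (by lia), Finset.union_comm]
      refine seg_union ?_ (by have := (cutPos_succ hk hD (j := t) (by lia)).1; lia)
      rcases Nat.eq_zero_or_pos t with rfl | h0
      · rw [cutPos_zero hk0]
      · have := cutPos_add_le hk hD h0 (by lia : t ≤ k)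
        rw [cutPos_zero hk0] at this
        lia
  rw [key k le_rfl, cutPos_self, seg_eq_univ (by lia)]

/-- Let P, A, B, C be the consecutive arcs from d − L over a, b, c to d, and r the rank. Purity of
the whole gives r(C) = r(P ∪ A ∪ B) = r(P)r(A)r(B) and r(A)r(C) = r(A ∪ C) = r(P ∪ B) = r(P)r(B).
Hence r(C) = r(A)²r(C). -/
theorem srank_cell_eq_one {ψ : Conf κ → ℂ} (hψ : ψ ≠ 0) {a b c d : ℤ} (hab : a ≤ b) (hbc : b ≤ c)
    (hcd : c ≤ d) (hda : d ≤ a + L)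
    (h1 : Uncorr (seg L (d - L) a) (seg L a c) ψ) (h2 : Uncorr (seg L a b) (seg L b c) ψ)
    (h3 : Uncorr (seg L a b) (seg L c d) ψ) : srank (seg L a b) ψ = 1 := by
  have e1 : srank (seg L c d) ψ = srank (seg L (d - L) a) ψ * srank (seg L a c) ψ := by
    rw [← srank_union (seg_disjoint le_rfl (by lia)) hψ h1, seg_union (by lia) (by lia),
      ← srank_compl (seg L (d - L) c), seg_compl]
    congr 2; ring
  have e2 : srank (seg L a c) ψ = srank (seg L a b) ψ * srank (seg L b c) ψ := by
    rw [← srank_union (seg_disjoint le_rfl (by lia)) hψ h2, seg_union hab hbc]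
  have e3 : srank (seg L (d - L) a ∪ seg L b c) ψ =
      srank (seg L (d - L) a) ψ * srank (seg L b c) ψ :=
    srank_union (seg_disjoint hab (by lia)) hψ (h1.mono le_rfl (seg_mono hab le_rfl))
  have e4 : srank (seg L a b ∪ seg L c d) ψ = srank (seg L a b) ψ * srank (seg L c d) ψ :=
    srank_union (seg_disjoint hbc (by lia)) hψ h3
  have e5 : (seg L a b ∪ seg L c d)ᶜ = seg L (d - L) a ∪ seg L b c := by
    have hu : seg L (d - L) a ∪ seg L b c ∪ (seg L a b ∪ seg L c d) = Finset.univ := by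
      have : seg L (d - L) a ∪ (seg L a b ∪ (seg L b c ∪ seg L c d)) = Finset.univ := by
        rw [seg_union hbc hcd, seg_union hab (by lia), seg_union (by lia) (by lia),
          seg_eq_univ (by lia)]
      rw [← this]
      ext x; simp only [Finset.mem_union]; tauto
    have hd : Disjoint (seg L (d - L) a ∪ seg L b c) (seg L a b ∪ seg L c d) := by
      rw [Finset.disjoint_union_left, Finset.disjoint_union_right, Finset.disjoint_union_right]
      exact ⟨⟨seg_disjoint le_rfl (by lia), seg_disjoint (by lia) (by lia)⟩,
        (seg_disjoint le_rfl (by lia)).symm, seg_disjoint le_rfl (by lia)⟩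
    exact (IsCompl.of_eq (Finset.disjoint_iff_inter_eq_empty.1 hd.symm)
      (by rw [Finset.sup_eq_union, Finset.union_comm]; exact hu)).compl_eq
  rw [← srank_compl, e5, e3] at e4
  have n1 := Nat.pos_of_ne_zero (srank_ne_zero hψ (seg L c d))
  have e6 : srank (seg L c d) ψ = srank (seg L a b) ψ * srank (seg L a b) ψ *
      srank (seg L c d) ψ := by
    calc _ = srank (seg L a b) ψ * (srank (seg L (d - L) a) ψ * srank (seg L b c) ψ) := by
          rw [e1, e2]; ring
      _ = _ := by rw [e4]; ring
  have e7 : srank (seg L a b) ψ * srank (seg L a b) ψ = 1 :=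
    Nat.eq_of_mul_eq_mul_right n1 (by rw [one_mul]; exact e6.symm)
  exact Nat.eq_one_of_mul_eq_one_left e7

/-- The disentanglers at cuts 4ρ apart have disjoint supports and form one layer; after it every
cell is pure, and one more layer prepares the cells. Cells have length at most 8ρ. A cell and the
arc starting 18ρ after its left end must have disjoint light cones through both the layer and the
circuit, and 18ρ = 8ρ + 2(4ρ + ρ); around the ring, that arc ends at 32ρ, so 32ρ + 2(4ρ + ρ) = 42ρ
sites suffice. Shorter rings need a single gate. -/
theorem isSRE_of_circ {R n ρ : ℕ} (hR : 1 ≤ R) {e : ∀ x, τ x ≃ κ x × β x}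
    {K : Matrix (Conf τ) (Conf τ) ℂ} (hK : Circ (IsArc R) n K) {v : ∀ x, τ x → ℂ} {Ψ : Conf κ → ℂ}
    (hΨ : IsUnitVec Ψ) {h : Conf β → ℂ} (hh : h ≠ 0) (hKΨ : K *ᵥ prodVec v = tens e Ψ h)
    (hρ : ρ = R + n * R) : IsSRE (42 * ρ) 3 Ψ := by
  rcases le_total L (42 * ρ) with hL | hL
  · exact isSRE_of_le hL hΨ
  have hΨ0 : Ψ ≠ 0 := by
    rintro rfl
    simp [IsUnitVec] at hΨ
  have hρ1 : 1 ≤ ρ := by lia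
  have hRL : 3 * R < L := by
    have : R ≤ ρ := by lia
    lia
  have hn : (n * R : ℤ) ≤ ρ := by rw [hρ]; push_cast; lia
  set D := 4 * ρ with hD
  have hD0 : 0 < D := by lia
  set k := L / D with hk
  have hk0 : 0 < k := Nat.div_pos (by lia) hD0
  set m := cutPos L D k with hm
  have hm0 : m 0 = 0 := cutPos_zero hk0
  have hmk : m k = L := cutPos_self L D k
  have hlt : ∀ {i j : ℕ}, i < j → j ≤ k → m i + D ≤ m j := fun hij hj => cutPos_add_le hk hD0 hij hj
  have hnn : ∀ j ≤ k, 0 ≤ m j := by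
    intro j hj
    rcases Nat.eq_zero_or_pos j with rfl | h0
    · exact hm0.ge
    · have := hlt h0 hj
      lia
  have hle : ∀ j < k, m j + D ≤ L := fun j hj => hmk ▸ hlt hj le_rfl
  -- The value 22ρ is 18ρ plus the 4ρ lost to neighbouring disentanglers; with the offset 6ρ and
  -- another 4ρ, the left region then starts at 32ρ.
  choose U hU hUs hUc using fun j => exists_cut_unitary (ρ := ρ) hRL hK hh hΨ0 hKΨ hρ (d := 22 * ρ)
    (by lia) (by lia) (m j)
  set S : ℕ → Finset (ZMod L) := fun j => seg L (m j - 2 * ρ) (m j + 2 * ρ) with hS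
  have hSarc : ∀ j, IsArc (4 * ρ) (S j) := fun j => isArc_seg (by lia) (by push_cast; lia)
  have hSd : ∀ i ∈ List.range k, ∀ j ∈ List.range k, i ≠ j → Disjoint (S i) (S j) := by
    have h1 : ∀ i j, i < j → j < k → Disjoint (S i) (S j) := by
      intro i j hij hj
      have h1 := hlt hij hj.le
      have h2 := hle j hj
      have h3 := hnn i (by lia)
      exact seg_disjoint (by lia) (by lia)
    intro i hi j hj hij
    rw [List.mem_range] at hi hj
    rcases lt_or_gt_of_ne hij with h | h
    exacts [h1 i j h hj, (h1 j i h hi).symm]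
  have hV := layer_prod_gates (List.nodup_range (n := k)) (fun j _ => hU j) (fun j _ => hUs j) hSd
  set V := ((List.range k).map U).prod with hVdef
  have hV' : Layer (IsArc (4 * ρ)) V := hV.mono fun T ⟨j, _, hT⟩ => hT ▸ hSarc j
  have hcut : ∀ j < k, Uncorr (seg L (m j + 32 * ρ - L) (m j)) (seg L (m j) (m j + 18 * ρ))
      (V *ᵥ Ψ) := by
    intro j hj
    have hj' := List.mem_range.2 hj
    have hVe := layer_prod_gates ((List.nodup_range (n := k)).erase j) (U := U) (S := S)
      (fun i _ => hU i) (fun i _ => hUs i)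
      fun a ha b hb => hSd a (List.mem_of_mem_erase ha) b (List.mem_of_mem_erase hb)
    -- The disentangler at the cut `j` is applied first; the others lie on one side of this cut and
    -- preserve the absence of correlations.
    rw [hVdef, prod_gates_erase (fun i _ => hUs i) List.nodup_range hSd hj', ← Matrix.mulVec_mulVec]
    have hpos : ∀ i ∈ (List.range k).erase j, i ≠ j ∧ i < k := fun i hi =>
      ⟨(List.Nodup.mem_erase_iff List.nodup_range).1 hi |>.1,
        List.mem_range.1 (List.mem_of_mem_erase hi)⟩
    refine (hUc j).mulVec_layer hVe (seg_mono (by lia) le_rfl) (seg_mono le_rfl (by push_cast; lia))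
      ?_ ?_
    · rintro _ ⟨i, hi, rfl⟩ hdis
      obtain ⟨hij, hik⟩ := hpos i hi
      have e1 : m j + 32 * ρ - L = (m j + (22 * ρ : ℕ) + 6 * ρ - L) + 4 * (ρ : ℤ) := by
        push_cast; ring
      rw [e1] at hdis
      rcases lt_or_gt_of_ne hij with h | h
      · have h1 := hlt h hj.le
        have h2 := hle j hj
        have h3 := hnn i (by lia)
        exact seg_subset_left_of_meets (by lia) (by lia) (by push_cast; lia) hdis
      · have h1 := hlt h hik.le
        have h2 := hle i hik
        have h3 := hnn j (by lia)
        have e2 : S i = seg L ((m i - L) - 2 * ρ) ((m i - L) + 2 * ρ) := by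
          rw [← seg_add ((m i - L) - 2 * ρ)]
          simp only [hS]
          congr 1 <;> ring
        rw [e2] at hdis ⊢
        exact seg_subset_left_of_meets (by lia) (by lia) (by push_cast; lia) hdis
    · rintro _ ⟨i, hi, rfl⟩ hdis
      obtain ⟨hij, hik⟩ := hpos i hi
      have e1 : m j + 18 * ρ = (m j + (22 * ρ : ℕ)) - 4 * (ρ : ℤ) := by push_cast; ring
      rw [e1] at hdis
      rcases lt_or_gt_of_ne hij with h | h
      · have h1 := hlt h hj.le
        have h2 := hle j hj
        have h3 := hnn i (by lia)
        have e2 : S i = seg L ((m i + L) - 2 * ρ) ((m i + L) + 2 * ρ) := by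
          simp only [hS]
          rw [← seg_add (m i - 2 * ρ)]
          congr 1 <;> ring
        rw [e2] at hdis ⊢
        exact seg_subset_right_of_meets (by lia) (by lia) (by push_cast; lia) hdis
      · have h1 := hlt h hik.le
        have h2 := hle i hik
        have h3 := hnn j (by lia)
        exact seg_subset_right_of_meets (by lia) (by lia) (by push_cast; lia) hdis
  have hcut' : ∀ j ≤ k, Uncorr (seg L (m j + 32 * ρ - L) (m j)) (seg L (m j) (m j + 18 * ρ))
      (V *ᵥ Ψ) := by
    intro j hj
    rcases hj.lt_or_eq with h | rfl
    · exact hcut j h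
    -- The end point of the last cell is the cut at 0, one turn further.
    · have h0 := hcut 0 hk0
      rw [hm0, ← seg_add (0 + 32 * ρ - L) 0, ← seg_add 0 (0 + 18 * ρ)] at h0
      rw [hmk]
      convert h0 using 2 <;> ring
  have hψ0 := mulVec_unitary_ne_zero hV.unitary hΨ0
  have hrank : ∀ j < k, srank (seg L (m j) (m (j + 1))) (V *ᵥ Ψ) = 1 := by
    intro j hj
    obtain ⟨h1, h2⟩ := cutPos_succ hk hD0 hj
    rw [← hm] at h1 h2
    refine srank_cell_eq_one (c := m j + 18 * ρ) (d := m j + 32 * ρ) hψ0 (by lia) (by lia) (by lia)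
      (by lia) (hcut j hj) ?_ ?_
    · exact (hcut' (j + 1) hj).mono (seg_mono (by lia) le_rfl) (seg_mono le_rfl (by lia))
    · have hc1 := nbhd_seg (L := L) (4 * ρ) (m j) (m (j + 1))
      have hc2 := nbhd_seg (L := L) (4 * ρ) (m j + 18 * ρ) (m j + 32 * ρ)
      refine Uncorr.mulVec_layer (A := nbhd (4 * ρ) (seg L (m j) (m (j + 1))))
        (B := nbhd (4 * ρ) (seg L (m j + 18 * ρ) (m j + 32 * ρ))) ?_ hV' (subset_nbhd _ _)
        (subset_nbhd _ _) (fun T hT h => (smallSupp_of_isArc hT).subset_nbhd h)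
        (fun T hT h => (smallSupp_of_isArc hT).subset_nbhd h)
      refine uncorr_of_circ hK hh hKΨ ?_
      refine (seg_disjoint (a := m j - (4 * ρ : ℕ) - (n * R : ℕ))
        (b := m (j + 1) + (4 * ρ : ℕ) + (n * R : ℕ)) (c := m j + 18 * ρ - (4 * ρ : ℕ) - (n * R : ℕ))
        (d := m j + 32 * ρ + (4 * ρ : ℕ) + (n * R : ℕ)) (by push_cast; lia)
        (by push_cast; lia)).mono ?_ ?_
      · exact (nbhd_mono le_rfl hc1).trans (nbhd_seg _ _ _)
      · exact (nbhd_mono le_rfl hc2).trans (nbhd_seg _ _ _)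
  obtain ⟨c₀, W, z, hW, hWz⟩ := exists_layer_of_cells (R := 42 * ρ) (k := k)
    (Z := fun j => seg L (m j) (m (j + 1))) (fun j hj => by
      obtain ⟨h1, h2⟩ := cutPos_succ hk hD0 hj
      rw [← hm] at h1 h2
      exact isArc_seg (by lia) (by push_cast; lia)) (by
      have h1 : ∀ i j, i < j → j < k → Disjoint (seg L (m i) (m (i + 1))) (seg L (m j) (m (j + 1))) := by
        intro i j hij hj
        have h2 : m (i + 1) ≤ m j := by
          rcases (show i + 1 ≤ j from hij).lt_or_eq with h | h
          · have := hlt h hj.le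
            lia
          · rw [h]
        have h3 : m (j + 1) ≤ L := by
          rcases (show j + 1 ≤ k from hj).lt_or_eq with h | h
          · have := hle (j + 1) h
            lia
          · rw [h, hmk]
        have h4 := hnn i (by lia)
        exact seg_disjoint h2 (by lia)
      intro i hi j hj hij
      rcases lt_or_gt_of_ne hij with h | h
      exacts [h1 i j h hj, (h1 j i h hi).symm]) (biUnion_cells hk hD0 hk0) hψ0
    fun j hj => (hrank j hj).le
  refine isSRE_of_layers (V := Vᴴ) (W := W) (c₀ := c₀) (z := z) ((hV'.mono
    fun T ⟨x, l, hl, hT⟩ => ⟨x, l, by lia, hT⟩).conjTranspose) hW hΨ ?_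
  rw [← Matrix.mulVec_smul, ← hWz, Matrix.mulVec_mulVec, unitary_conjTranspose_mul hV.unitary,
    Matrix.one_mulVec]

end InvertibleStates


/-! ### Vectors determined by local annihilators -/

section LocalAnsatz

variable {ι : Type} [Fintype ι] [DecidableEq ι] {K : ι → Type} [∀ i, Fintype (K i)]
  [∀ i, DecidableEq (K i)]

/-- A row vector in the left kernel is turned into an operator on the complement of `g`, with all
output in the fixed configuration `a`. -/
theorem vecMul_cutMat_eq_zero {g : Finset ι} {ψ θ : (∀ i, K i) → ℂ}
    (h : ∀ X, SuppOn gᶜ X → X *ᵥ ψ = 0 → X *ᵥ θ = 0) {f : (∀ i, K i) → ℂ}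
    (hf : f ᵥ* cutMat gᶜ ψ = 0) : f ᵥ* cutMat gᶜ θ = 0 := by
  funext a
  have key : ∀ (χ : (∀ i, K i) → ℂ) (c : ∀ i, K i), ((∑ d, f d • matUnit gᶜ a d) *ᵥ χ) c =
      if ∀ i ∈ gᶜ, c i = a i then (f ᵥ* cutMat gᶜ χ) c else 0 := by
    intro χ c
    rw [Matrix.sum_mulVec, Finset.sum_apply]
    simp only [Matrix.smul_mulVec, Pi.smul_apply, matUnit_mulVec, smul_eq_mul, mul_ite, mul_zero]
    split_ifs
    · rfl
    · simp
  have h1 := h (∑ d, f d • matUnit gᶜ a d)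
    (SuppOn.sum _ fun d _ => (suppOn_matUnit gᶜ a d).smul _) (by
      funext c
      rw [key, hf]
      simp)
  have h2 := congrFun h1 a
  rwa [key, if_pos fun _ _ => rfl] at h2

/-- The hypothesis says that left-kernel vectors of the matrix of `ψ` also annihilate that of `θ`,
so the column space of the latter is contained in that of the former. The resulting right factor is
an operator on `g`. -/
theorem exists_suppOn_mulVec_eq {g : Finset ι} {ψ θ : (∀ i, K i) → ℂ}
    (h : ∀ X, SuppOn gᶜ X → X *ᵥ ψ = 0 → X *ᵥ θ = 0) : ∃ O, SuppOn g O ∧ θ = O *ᵥ ψ := by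
  obtain ⟨k, C, R, Li, S, hM, hL, hS⟩ : ∃ (k : ℕ) (C : Matrix (∀ i, K i) (Fin k) ℂ)
      (R : Matrix (Fin k) (∀ i, K i) ℂ) (Li : Matrix (Fin k) (∀ i, K i) ℂ)
      (S : Matrix (∀ i, K i) (Fin k) ℂ), cutMat gᶜ ψ = C * R ∧ Li * C = 1 ∧ R * S = 1 :=
    ⟨_, (cutMat gᶜ ψ).exists_rank_factorization⟩
  have h1 : (1 - C * Li) * cutMat gᶜ θ = 0 := by
    have h0 : (1 - C * Li) * cutMat gᶜ ψ = 0 := by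
      rw [hM, Matrix.sub_mul, Matrix.one_mul, Matrix.mul_assoc, ← Matrix.mul_assoc Li, hL,
        Matrix.one_mul, sub_self]
    funext c
    exact vecMul_cutMat_eq_zero h (congrFun h0 c)
  rw [Matrix.sub_mul, Matrix.one_mul, sub_eq_zero] at h1
  set Q := S * (Li * cutMat gᶜ θ) with hQ
  have h2 : cutMat gᶜ θ = cutMat gᶜ ψ * Q := by
    rw [hQ, ← Matrix.mul_assoc]
    conv_rhs => rw [hM]
    rw [Matrix.mul_assoc C R S, hS, Matrix.mul_one, ← Matrix.mul_assoc]
    exact h1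
  rcases isEmpty_or_nonempty (∀ i, K i) with hK | ⟨⟨c₀⟩⟩
  · exact ⟨0, SuppOn.zero g, funext fun c => (hK.false c).elim⟩
  -- The number of configurations with a given restriction to `g`; each contributes the same value
  -- to the sum below.
  set N : ℂ := ((Finset.univ.filter fun d : ∀ i, K i => ∀ i ∈ g, d i = c₀ i).card : ℂ) with hN
  have hN0 : N ≠ 0 := by
    rw [hN, Nat.cast_ne_zero, Finset.card_ne_zero]
    exact ⟨c₀, by simp⟩
  refine ⟨N⁻¹ • ∑ d, ∑ d', Q d' d • matUnit g d d', SuppOn.smul (SuppOn.sum _ fun d _ =>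
    SuppOn.sum _ fun d' _ => (suppOn_matUnit g d d').smul _) _, ?_⟩
  funext c
  have h3 : ∀ d, ((∑ d', Q d' d • matUnit g d d') *ᵥ ψ) c =
      if ∀ i ∈ g, d i = c i then θ c else 0 := by
    intro d
    rw [Matrix.sum_mulVec, Finset.sum_apply]
    simp only [Matrix.smul_mulVec, Pi.smul_apply, matUnit_mulVec, smul_eq_mul, mul_ite, mul_zero]
    by_cases hd : ∀ i ∈ g, d i = c i
    · rw [if_pos hd]
      have h4 := congrFun (congrFun h2 c) d
      rw [Matrix.mul_apply] at h4
      simp only [cutMat, Finset.piecewise_compl] at h4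
      have h5 : g.piecewise d c = c := by
        funext i
        by_cases hi : i ∈ g
        · simp [hi, hd i hi]
        · simp [hi]
      rw [h5] at h4
      rw [h4]
      refine Finset.sum_congr rfl fun d' _ => ?_
      rw [if_pos fun i hi => (hd i hi).symm, mul_comm]
    · rw [if_neg hd]
      exact Finset.sum_eq_zero fun d' _ => if_neg fun h => hd fun i hi => (h i hi).symm
  rw [Matrix.smul_mulVec, Pi.smul_apply, Matrix.sum_mulVec, Finset.sum_apply]
  simp only [h3]
  rw [← Finset.sum_filter, Finset.sum_const, card_filter_agree g c c₀, nsmul_eq_mul, smul_eq_mul,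
    ← hN, ← mul_assoc, inv_mul_cancel₀ hN0, one_mul]

theorem star_dotProduct_mulVec {n : Type} [Fintype n] (ψ φ : n → ℂ) (A B : Matrix n n ℂ) :
    star (A *ᵥ ψ) ⬝ᵥ (B *ᵥ φ) = star ψ ⬝ᵥ ((Aᴴ * B) *ᵥ φ) := by
  rw [Matrix.star_mulVec, ← Matrix.dotProduct_mulVec, Matrix.mulVec_mulVec]

/-- Writing `θ` as O ψ on one side and as O' ψ on the other gives ⟨θ,θ⟩⟨ψ,ψ⟩ = ⟨θ,ψ⟩⟨ψ,θ⟩, the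
equality case of the Cauchy–Schwarz inequality. -/
theorem Uncorr.eq_smul {g g' : Finset ι} {ψ θ : (∀ i, K i) → ℂ} (h : Uncorr g g' ψ) (hψ : ψ ≠ 0)
    {O O' : Matrix (∀ i, K i) (∀ i, K i) ℂ} (hO : SuppOn g O)
    (hO' : SuppOn g' O') (hθ : θ = O *ᵥ ψ) (hθ' : θ = O' *ᵥ ψ) : ∃ z : ℂ, θ = z • ψ := by
  have hS := dotProduct_star_self_ne_zero hψ
  have h1 : (star θ ⬝ᵥ θ) * (star ψ ⬝ᵥ ψ) = (star θ ⬝ᵥ ψ) * (star ψ ⬝ᵥ θ) := by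
    have h2 : star ψ ⬝ᵥ (Oᴴ *ᵥ ψ) = star θ ⬝ᵥ ψ := by
      have := star_dotProduct_mulVec ψ ψ O 1
      rwa [Matrix.one_mulVec, mul_one, ← hθ, eq_comm] at this
    have := h Oᴴ O' hO.conjTranspose hO'
    rwa [expVal, ← star_dotProduct_mulVec, ← hθ, ← hθ', expVal, expVal, ← hθ', h2] at this
  have h2 : star (star ψ ⬝ᵥ ψ) = star ψ ⬝ᵥ ψ := by
    exact (Matrix.star_dotProduct _ _).symm
  have h3 : star (star ψ ⬝ᵥ θ) = star θ ⬝ᵥ ψ := by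
    exact (Matrix.star_dotProduct _ _).symm
  refine ⟨(star ψ ⬝ᵥ θ) / (star ψ ⬝ᵥ ψ), ?_⟩
  have h4 : (star ψ ⬝ᵥ ψ) • θ - (star ψ ⬝ᵥ θ) • ψ = 0 := by
    rw [← dotProduct_star_self_eq_zero]
    simp only [star_sub, star_smul, h2, h3, sub_dotProduct, dotProduct_sub, smul_dotProduct,
      dotProduct_smul, smul_eq_mul]
    linear_combination (star ψ ⬝ᵥ ψ) * h1
  rw [div_eq_inv_mul, mul_smul, ← sub_eq_zero.1 h4, inv_smul_smul₀ hS]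

end LocalAnsatz

/-! ### Superpositions of a basis state and its global flip -/

section SymmetricInput

variable {L : ℕ} [NeZero L] {α : ZMod L → Type} [∀ x, Fintype (α x)] [∀ x, DecidableEq (α x)]

/-- The basis state `c` of the qubits, with ancillas in the product state `⨂ₓ v x`. -/
def inputVec (v : ∀ x, α x → ℂ) (c : Conf (Qubits L)) : Conf (fun x => Qubits L x × α x) → ℂ :=
  tens (fun x => Equiv.refl (Qubits L x × α x)) (basisVec c Finset.univ) (prodVec v)

theorem inputVec_eq_prodVec (v : ∀ x, α x → ℂ) (c : Conf (Qubits L)) :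
    inputVec v c = prodVec fun x p => (if p.1 = c x then 1 else 0) * v x p.2 := by
  funext t
  simp only [inputVec, tens, basisVec, prodVec, pairing, Equiv.coe_fn_mk, Equiv.refl_apply,
    Finset.prod_mul_distrib]
  rfl

theorem fst_eq_of_inputVec_ne_zero {v : ∀ x, α x → ℂ} {c : Conf (Qubits L)}
    {t : Conf fun x => Qubits L x × α x} (h : inputVec v c t ≠ 0) (x : ZMod L) :
    (t x).1 = c x := by
  rw [inputVec_eq_prodVec] at h
  by_contra hx
  exact h (Finset.prod_eq_zero (Finset.mem_univ x) ((congrArg (· * _) (if_neg hx)).trans (zero_mul _)))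

/-- An operator that does not act at `x` cannot connect two basis states that differ there. Hence
observables missing a site see a superposition of a configuration and its global flip as a mixture
(`expVal_inputVec_add`). -/
theorem inputVec_cross {v : ∀ x, α x → ℂ} {c c' : Conf (Qubits L)} {N : Finset (ZMod L)}
    {x : ZMod L} (hx : x ∉ N) (hc : c x ≠ c' x)
    {B : Matrix (Conf fun x => Qubits L x × α x) (Conf fun x => Qubits L x × α x) ℂ}
    (hB : SuppOn N B) : star (inputVec v c) ⬝ᵥ (B *ᵥ inputVec v c') = 0 := by
  simp only [dotProduct, Matrix.mulVec, Finset.mul_sum]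
  refine Finset.sum_eq_zero fun t _ => Finset.sum_eq_zero fun t' _ => ?_
  by_contra h
  obtain ⟨h1, h2⟩ := mul_ne_zero_iff.1 h
  obtain ⟨h3, h4⟩ := mul_ne_zero_iff.1 h2
  have h5 : inputVec v c t ≠ 0 := fun h0 => h1 (by rw [Pi.star_apply, h0, star_zero])
  have h6 := hB.eq_of_ne_zero h3 x hx
  exact hc (by rw [← fst_eq_of_inputVec_ne_zero h5, h6, fst_eq_of_inputVec_ne_zero h4])

theorem basisVec_univ_apply (c d : Conf (Qubits L)) :
    basisVec c Finset.univ d = if d = c then 1 else 0 := by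
  rw [basisVec, Finset.prod_ite_zero]
  simp [funext_iff]

theorem xOn_mulVec_basisVec (T : Finset (ZMod L)) (c : Conf (Qubits L)) :
    xOn T *ᵥ basisVec c Finset.univ = basisVec (flipOn T c) Finset.univ := by
  funext d
  simp only [Matrix.mulVec, dotProduct, xOn, basisVec_univ_apply, mul_ite, mul_one, mul_zero,
    Finset.sum_ite_eq', Finset.mem_univ, if_true]
  congr 1
  rw [eq_iff_iff, eq_comm, flipOn_eq_iff]

theorem liftOp_xOn_mulVec_inputVec (v : ∀ x, α x → ℂ) (T : Finset (ZMod L))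
    (c : Conf (Qubits L)) :
    liftOp (fun x => Equiv.refl (Qubits L x × α x)) (xOn T) *ᵥ inputVec v c =
      inputVec v (flipOn T c) := by
  rw [inputVec, liftOp_mulVec_tens, xOn_mulVec_basisVec, inputVec]

theorem expVal_inputVec_flipOn {v : ∀ x, α x → ℂ} {N T : Finset (ZMod L)}
    {B : Matrix (Conf fun x => Qubits L x × α x) (Conf fun x => Qubits L x × α x) ℂ}
    (hB : SuppOn N B) (h : Disjoint N T) (c : Conf (Qubits L)) :
    expVal (inputVec v (flipOn T c)) B = expVal (inputVec v c) B := by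
  rw [← liftOp_xOn_mulVec_inputVec, expVal_mulVec,
    hB.conj_eq (suppOn_liftOp _ (suppOn_xOn T)) h (liftOp_unitary _ (xOn_unitary T))]

theorem expVal_inputVec_add {v : ∀ x, α x → ℂ} {N : Finset (ZMod L)} (hN : N ≠ Finset.univ)
    {B : Matrix (Conf fun x => Qubits L x × α x) (Conf fun x => Qubits L x × α x) ℂ}
    (hB : SuppOn N B) (c : Conf (Qubits L)) {z : ℂ} (hz : star z * z = 1) :
    expVal (inputVec v c + z • inputVec v (flipOn Finset.univ c)) B =
      expVal (inputVec v c) B + expVal (inputVec v (flipOn Finset.univ c)) B := by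
  obtain ⟨x, hx⟩ : ∃ x, x ∉ N := by
    by_contra! h
    exact hN (Finset.eq_univ_of_forall h)
  have hc : c x ≠ flipOn Finset.univ c x := by
    simp [flipOn]
  have h1 := inputVec_cross (v := v) hx hc hB
  have h2 := inputVec_cross (v := v) hx hc.symm hB
  rw [expVal, Matrix.mulVec_add, Matrix.mulVec_smul, star_add, star_smul]
  simp only [add_dotProduct, dotProduct_add, smul_dotProduct, dotProduct_smul, h1, h2, smul_eq_mul,
    mul_zero, add_zero, zero_add, ← mul_assoc]
  rw [mul_comm z, hz, one_mul]
  rfl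

variable {κ β : ZMod L → Type} [∀ x, Fintype (κ x)] [∀ x, DecidableEq (κ x)]
  [∀ x, Fintype (β x)] [∀ x, DecidableEq (β x)] {R n : ℕ}
  {e : ∀ x, Qubits L x × α x ≃ κ x × β x}
  {K : Matrix (Conf fun x => Qubits L x × α x) (Conf fun x => Qubits L x × α x) ℂ}
  {v : ∀ x, α x → ℂ} {Ψ : Conf κ → ℂ}

/-- The circuit `K` turns the superpositions of the basis state `c` and its global flip into `Ψ`
and a state of the environment. -/
def PreparesFromFlips (e : ∀ x, Qubits L x × α x ≃ κ x × β x)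
    (K : Matrix (Conf fun x => Qubits L x × α x) (Conf fun x => Qubits L x × α x) ℂ)
    (v : ∀ x, α x → ℂ) (Ψ : Conf κ → ℂ) : Prop :=
  ∀ c, ∃ (z : ℂ) (h : Conf β → ℂ), star z * z = 1 ∧
    K *ᵥ (inputVec v c + z • inputVec v (flipOn Finset.univ c)) = tens e Ψ h

theorem expVal_sum_of_preparesFromFlips (hΨ : PreparesFromFlips e K v Ψ)
    (c : Conf (Qubits L)) : ∃ H : ℂ, ∀ (A : Finset (ZMod L))
      (O : Matrix (Conf κ) (Conf κ) ℂ), A ≠ Finset.univ → SuppOn A (Kᴴ * liftOp e O * K) →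
      expVal (inputVec v c) (Kᴴ * liftOp e O * K) +
        expVal (inputVec v (flipOn Finset.univ c)) (Kᴴ * liftOp e O * K) = expVal Ψ O * H := by
  obtain ⟨z, h, hz, hc⟩ := hΨ c
  refine ⟨star h ⬝ᵥ h, fun A O hA hO => ?_⟩
  rw [← expVal_inputVec_add hA hO c hz, ← expVal_mulVec, hc, expVal_tens_liftOp]

theorem expVal_conjTranspose_mul_self {m : Type} [Fintype m] [DecidableEq m] (u : m → ℂ)
    (A : Matrix m m ℂ) : expVal u (Aᴴ * A) = (vecNormSq (A *ᵥ u) : ℂ) := by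
  rw [← expVal_one_eq_vecNormSq, expVal_mulVec, mul_one]

/-- For X†X, whose light cone misses a site, the value in the superposition is the sum of the
nonnegative values in its two components. It vanishes, so both do. -/
theorem liftOp_mulVec_inputVec_eq_zero (hK : Circ (IsArc R) n K)
    (hΨ : PreparesFromFlips e K v Ψ) {T : Finset (ZMod L)} (hT : nbhd (n * R) T ≠ Finset.univ)
    {X : Matrix (Conf κ) (Conf κ) ℂ} (hX : SuppOn T X) (hXΨ : X *ᵥ Ψ = 0)
    (c : Conf (Qubits L)) : liftOp e X *ᵥ (K *ᵥ inputVec v c) = 0 := by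
  obtain ⟨H, hH⟩ := expVal_sum_of_preparesFromFlips hΨ c
  have h1 := hH _ (Xᴴ * X) hT
    (hK.conj (fun S => smallSupp_of_isArc) (suppOn_liftOp e (hX.conjTranspose.mul hX))).1
  have h2 : Kᴴ * liftOp e (Xᴴ * X) * K = (liftOp e X * K)ᴴ * (liftOp e X * K) := by
    rw [liftOp_mul, liftOp_conjTranspose, Matrix.conjTranspose_mul]
    simp only [mul_assoc]
  rw [h2, expVal_conjTranspose_mul_self, expVal_conjTranspose_mul_self,
    expVal_conjTranspose_mul_self, hXΨ] at h1
  have h3 : vecNormSq ((liftOp e X * K) *ᵥ inputVec v c) +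
      vecNormSq ((liftOp e X * K) *ᵥ inputVec v (flipOn Finset.univ c)) = 0 := by
    have h0 : vecNormSq (0 : Conf κ → ℂ) = 0 := by simp [vecNormSq]
    rw [h0, Complex.ofReal_zero, zero_mul] at h1
    exact_mod_cast h1
  rw [Matrix.mulVec_mulVec]
  by_contra h4
  have h5 := vecNormSq_pos h4
  have h6 := vecNormSq_nonneg ((liftOp e X * K) *ᵥ inputVec v (flipOn Finset.univ c))
  linarith

/-- For a fixed configuration the mixture with its global flip may correlate the two light cones.
The four choices of flipping either light cone are covered by `c`, by a partial flip of `c`, and by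
their global flips; summing over all four makes the correlation factorize. -/
theorem uncorr_of_preparesFromFlips (hK : Circ (IsArc R) n K) (hΨ0 : Ψ ≠ 0)
    (hv : ∀ c, inputVec v c ≠ 0)
    (hΨ : PreparesFromFlips e K v Ψ) {A B : Finset (ZMod L)}
    (hAB : Disjoint (nbhd (n * R) A) (nbhd (n * R) B))
    (hne : nbhd (n * R) A ∪ nbhd (n * R) B ≠ Finset.univ) : Uncorr A B Ψ := by
  intro O O' hO hO'
  set A' := nbhd (n * R) A
  set B' := nbhd (n * R) B
  have hp : ∀ S : Finset (ZMod L), IsArc R S → SmallSupp R S := fun S => smallSupp_of_isArc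
  have s1 := (hK.conj hp (suppOn_liftOp e hO)).1
  have s2 := (hK.conj hp (suppOn_liftOp e hO')).1
  have hKK := unitary_mul_conjTranspose hK.unitary
  have hKK' := unitary_conjTranspose_mul hK.unitary
  have e0 : Kᴴ * liftOp e (1 : Matrix (Conf κ) (Conf κ) ℂ) * K = 1 := by
    rw [liftOp_one, mul_one, hKK']
  have e3 : Kᴴ * liftOp e (O * O') * K = Kᴴ * liftOp e O * K * (Kᴴ * liftOp e O' * K) := by
    symm
    calc _ = Kᴴ * liftOp e O * (K * Kᴴ) * liftOp e O' * K := by simp only [mul_assoc]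
      _ = _ := by rw [hKK, mul_one, liftOp_mul]; simp only [mul_assoc]
  have s3 : SuppOn (A' ∪ B') (Kᴴ * liftOp e (O * O') * K) := by
    rw [e3]
    exact (s1.mono Finset.subset_union_left).mul (s2.mono Finset.subset_union_right)
  have hne1 : A' ≠ Finset.univ := fun h => hne (by rw [h, Finset.union_eq_left.2 (Finset.subset_univ _)])
  have hne2 : B' ≠ Finset.univ := fun h => hne (by rw [h, Finset.union_eq_right.2 (Finset.subset_univ _)])
  have hprod : ∀ c, expVal (inputVec v c) (Kᴴ * liftOp e (O * O') * K) * expVal (inputVec v c) 1 =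
      expVal (inputVec v c) (Kᴴ * liftOp e O * K) *
        expVal (inputVec v c) (Kᴴ * liftOp e O' * K) := by
    intro c
    rw [e3, expVal_one, inputVec_eq_prodVec]
    exact (isProductAcross_prodVec _ A').uncorr le_rfl hAB _ _ s1 s2
  obtain ⟨c⟩ : Nonempty (Conf (Qubits L)) := inferInstance
  -- Near `A` this looks like `c`, and near `B` like the global flip of `c`.
  set c₁ := flipOn B' c with hc₁
  obtain ⟨H, hH⟩ := expVal_sum_of_preparesFromFlips hΨ c
  obtain ⟨H₁, hH₁⟩ := expVal_sum_of_preparesFromFlips hΨ c₁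
  have hcomm : flipOn Finset.univ c₁ = flipOn B' (flipOn Finset.univ c) := by
    funext x
    simp only [hc₁, flipOn, Finset.mem_univ, if_true]
    split_ifs <;> rfl
  have hbar : flipOn Finset.univ c = flipOn B'ᶜ c₁ := by
    rw [hc₁, ← flipOn_union disjoint_compl_left, Finset.union_comm, Finset.union_compl]
  have hbar₁ : flipOn Finset.univ c₁ = flipOn B'ᶜ c := by
    have := flipOn_union (disjoint_compl_left : Disjoint B'ᶜ B') c₁
    rwa [Finset.union_comm, Finset.union_compl, hc₁, flipOn_flipOn, ← hc₁] at this
  have n1 : ∀ T d, expVal (inputVec v (flipOn T d)) 1 = expVal (inputVec v d) 1 := fun T d =>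
    expVal_inputVec_flipOn (suppOn_one ∅) (Finset.disjoint_empty_left T) d
  have a1 : expVal (inputVec v c₁) (Kᴴ * liftOp e O * K) =
      expVal (inputVec v c) (Kᴴ * liftOp e O * K) := expVal_inputVec_flipOn s1 hAB c
  have a2 : expVal (inputVec v (flipOn Finset.univ c₁)) (Kᴴ * liftOp e O * K) =
      expVal (inputVec v (flipOn Finset.univ c)) (Kᴴ * liftOp e O * K) := by
    rw [hcomm]
    exact expVal_inputVec_flipOn s1 hAB _
  have b1 : expVal (inputVec v (flipOn Finset.univ c)) (Kᴴ * liftOp e O' * K) =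
      expVal (inputVec v c₁) (Kᴴ * liftOp e O' * K) := by
    rw [hbar]
    exact expVal_inputVec_flipOn s2 disjoint_compl_right _
  have b2 : expVal (inputVec v (flipOn Finset.univ c₁)) (Kᴴ * liftOp e O' * K) =
      expVal (inputVec v c) (Kᴴ * liftOp e O' * K) := by
    rw [hbar₁]
    exact expVal_inputVec_flipOn s2 disjoint_compl_right _
  have t0 := hH _ 1 hne1 (by rw [e0]; exact suppOn_one _)
  have t0' := hH₁ _ 1 hne1 (by rw [e0]; exact suppOn_one _)
  have t1 := hH _ O hne1 s1
  have t2 := hH _ O' hne2 s2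
  have t3 := hH _ (O * O') hne s3
  have t3' := hH₁ _ (O * O') hne s3
  have p1 := hprod c
  have p2 := hprod (flipOn Finset.univ c)
  have p3 := hprod c₁
  have p4 := hprod (flipOn Finset.univ c₁)
  have m1 : expVal (inputVec v c₁) 1 = expVal (inputVec v c) 1 := n1 B' c
  rw [e0, n1 Finset.univ c, expVal_one Ψ] at t0
  rw [e0, n1 Finset.univ c₁, expVal_one Ψ] at t0'
  rw [n1 Finset.univ c] at p2
  rw [n1 Finset.univ c₁] at p4
  rw [m1] at t0' p3 p4
  rw [a1] at p3
  rw [a2, b2] at p4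
  rw [b1] at p2
  rw [b1] at t2
  have hS := dotProduct_star_self_ne_zero hΨ0
  have hN : expVal (inputVec v c) 1 ≠ 0 := by
    rw [expVal_one]
    exact dotProduct_star_self_ne_zero (hv c)
  have hHH : H₁ = H := mul_left_cancel₀ hS (t0'.symm.trans t0)
  rw [hHH] at t3'
  have hH0 : H ≠ 0 := by
    rintro rfl
    rw [mul_zero, ← two_mul] at t0
    exact hN (by simpa using t0)
  apply mul_right_cancel₀ (mul_ne_zero hH0 hH0)
  generalize expVal (inputVec v c) 1 = N at *
  generalize star Ψ ⬝ᵥ Ψ = S at *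
  generalize expVal Ψ (O * O') = w at *
  generalize expVal Ψ O = x at *
  generalize expVal Ψ O' = y at *
  generalize expVal (inputVec v c) (Kᴴ * liftOp e O' * K) = b at *
  generalize expVal (inputVec v c₁) (Kᴴ * liftOp e O' * K) = b' at *
  linear_combination (-w * H) * t0 - N * t3 - N * t3' + p1 + p2 + p3 + p4 + t1 * (b + b') +
    t2 * x * H

theorem seg_ne_univ {a b : ℤ} (h : b < a + L) : seg L a b ≠ Finset.univ := by
  intro h'
  have h1 : ((max a b : ℤ) : ZMod L) ∈ seg L a b := h' ▸ Finset.mem_univ _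
  obtain ⟨i, hi, hi', h2⟩ := mem_seg.1 h1
  have := eq_of_cast_eq h2 (by lia) (by lia)
  lia

/-- The complement of an arc of length 2ρ has a light cone that misses a site, so each environment
slice equals an operator on that arc applied to `Ψ`. The arcs starting at 0 and at 4ρ are
uncorrelated in `Ψ`, so each slice is a multiple of `Ψ`. -/
theorem exists_tens_of_preparesFromFlips {ρ : ℕ} (hR : 1 ≤ R) (hρ : ρ = R + n * R)
    (hL : 42 * ρ ≤ L) (hK : Circ (IsArc R) n K) (hΨ0 : Ψ ≠ 0) (hv : ∀ c, inputVec v c ≠ 0)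
    (hΨ : PreparesFromFlips e K v Ψ) (c : Conf (Qubits L)) :
    ∃ μ, K *ᵥ inputVec v c = tens e Ψ μ := by
  have hn : ((n * R : ℕ) : ℤ) < ρ := by lia
  have n1 := nbhd_seg (L := L) (n * R) 0 (2 * ρ)
  have n2 := nbhd_seg (L := L) (n * R) (4 * ρ) (6 * ρ)
  have hu : Uncorr (seg L 0 (2 * ρ)) (seg L (4 * ρ) (6 * ρ)) Ψ := by
    refine uncorr_of_preparesFromFlips hK hΨ0 hv hΨ ?_ fun h => ?_
    · exact (seg_disjoint (by lia) (by lia)).mono n1 n2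
    · have h1 := Finset.union_subset_union n1 n2
      rw [h] at h1
      have h2 : seg L (-(ρ : ℤ)) (7 * ρ) = Finset.univ := Finset.univ_subset_iff.1
        (h1.trans (Finset.union_subset (seg_mono (by lia) (by lia)) (seg_mono (by lia) (by lia))))
      exact seg_ne_univ (by lia) h2
  have hgap : ∀ a : ℤ, ∀ X : Matrix (Conf κ) (Conf κ) ℂ, SuppOn (seg L a (a + 2 * ρ))ᶜ X →
      X *ᵥ Ψ = 0 → liftOp e X *ᵥ (K *ᵥ inputVec v c) = 0 := by
    intro a X hX hXΨ
    refine liftOp_mulVec_inputVec_eq_zero hK hΨ (fun h => ?_) hX hXΨ c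
    have h1 := nbhd_seg (L := L) (n * R) (a + 2 * ρ) (a + L)
    rw [← seg_compl, h] at h1
    exact seg_ne_univ (by lia) (Finset.univ_subset_iff.1 h1)
  have hslice : ∀ z : Conf β, ∃ μ : ℂ,
      (fun y => (K *ᵥ inputVec v c) ((pairing e).symm (y, z))) = μ • Ψ := by
    intro z
    have hO : ∀ a : ℤ, ∃ O, SuppOn (seg L a (a + 2 * ρ)) O ∧
        (fun y => (K *ᵥ inputVec v c) ((pairing e).symm (y, z))) = O *ᵥ Ψ := by
      refine fun a => exists_suppOn_mulVec_eq fun X hX hXΨ => ?_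
      funext y
      have := congrFun (hgap a X hX hXΨ) ((pairing e).symm (y, z))
      rwa [liftOp_mulVec] at this
    obtain ⟨O, hO1, hO2⟩ := hO 0
    obtain ⟨O', hO1', hO2'⟩ := hO (4 * ρ)
    exact hu.eq_smul hΨ0 (hO1.mono (seg_mono (by lia) (by lia)))
      (hO1'.mono (seg_mono (by lia) (by lia))) hO2 hO2'
  choose μ hμ using hslice
  refine ⟨μ, ?_⟩
  funext t
  obtain ⟨⟨y, z⟩, rfl⟩ := (pairing e).symm.surjective t
  have := congrFun (hμ z) y
  simp only [Pi.smul_apply, smul_eq_mul] at this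
  rw [this, tens, Equiv.apply_symm_apply, mul_comm]

theorem isSRE_of_preparesFromFlips {ρ : ℕ} (hR : 1 ≤ R) (hρ : ρ = R + n * R)
    (hK : Circ (IsArc R) n K) (hv : ∀ c, inputVec v c ≠ 0) (hΨ1 : IsUnitVec Ψ)
    (hΨ : PreparesFromFlips e K v Ψ) : IsSRE (42 * ρ) 3 Ψ := by
  rcases le_total L (42 * ρ) with hL | hL
  · exact isSRE_of_le hL hΨ1
  have hΨ0 : Ψ ≠ 0 := by
    rintro rfl
    simp [IsUnitVec] at hΨ1
  obtain ⟨c⟩ : Nonempty (Conf (Qubits L)) := inferInstance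
  obtain ⟨μ, hμ⟩ := exists_tens_of_preparesFromFlips hR hρ hL hK hΨ0 hv hΨ c
  have hμ0 : μ ≠ 0 := by
    rintro rfl
    have h0 : K *ᵥ inputVec v c = 0 := by
      rw [hμ]
      funext t
      simp [tens]
    refine hv c ?_
    rw [← Matrix.one_mulVec (inputVec v c), ← unitary_conjTranspose_mul hK.unitary,
      ← Matrix.mulVec_mulVec, h0, Matrix.mulVec_zero]
  rw [inputVec_eq_prodVec] at hμ
  exact isSRE_of_circ hR hK hΨ1 hμ0 hμ hρ

end SymmetricInput

/-! ### Second part of the theorem -/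

section PreparedFromCZX

variable {L : ℕ} [NeZero L] {κ : ZMod L → Type} [∀ x, Fintype (κ x)] [∀ x, DecidableEq (κ x)]

theorem sum_pureState_basisVec :
    ∑ c : Conf (Qubits L), pureState (basisVec c Finset.univ) = 1 := by
  ext d d'
  rw [Matrix.sum_apply, Finset.sum_eq_single d]
  · simp [pureState, Matrix.vecMulVec_apply, basisVec_univ_apply, Matrix.one_apply, apply_ite star,
      eq_comm]
  · intro c _ hc
    simp [pureState, Matrix.vecMulVec_apply, basisVec_univ_apply, hc.symm]
  · simp

/-- The Hermitian matrix M = 1 + sU satisfies M² = 2M, so M/2 = MM†/4. Inserting the basis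
resolution of the identity between the factors exhibits the mixture. -/
theorem czxState_eq_sum (hL : Even L) (s : ℤˣ) :
    czxState L s = ∑ c : Conf (Qubits L), (((2 ^ (L + 1))⁻¹ : ℝ) : ℂ) •
      pureState ((1 + ((s : ℤ) : ℂ) • czx L) *ᵥ basisVec c Finset.univ) := by
  set M := 1 + ((s : ℤ) : ℂ) • czx L with hM
  have hs : star (((s : ℤ) : ℂ)) = ((s : ℤ) : ℂ) := by
    rw [Complex.star_def, map_intCast]
  have hMH : Mᴴ = M := by
    rw [hM, Matrix.conjTranspose_add, Matrix.conjTranspose_one, Matrix.conjTranspose_smul,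
      czx_conjTranspose hL, hs]
  have hMM : M * M = (2 : ℂ) • M := by
    have h1 : (((s : ℤ) : ℂ) • czx L) * (((s : ℤ) : ℂ) • czx L) = 1 := by
      rw [Matrix.mul_smul, Matrix.smul_mul, czx_mul_self hL, smul_smul, intUnit_cast_mul_self,
        one_smul]
    rw [hM, mul_add, add_mul, add_mul, h1, mul_one, mul_one, one_mul, two_smul]
    abel
  have h1 : ∀ c : Conf (Qubits L), pureState (M *ᵥ basisVec c Finset.univ) =
      M * pureState (basisVec c Finset.univ) * M := by
    intro c
    rw [← mul_pureState_mul, hMH]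
  simp only [h1]
  rw [← Finset.smul_sum, ← Finset.sum_mul, ← Finset.mul_sum, sum_pureState_basisVec, mul_one, hMM,
    smul_smul, czxState]
  congr 1
  push_cast
  rw [pow_succ, mul_inv, mul_assoc, inv_mul_cancel₀ two_ne_zero, mul_one]

theorem czx_mulVec_basisVec (c : Conf (Qubits L)) : ∃ z : ℂ, star z * z = 1 ∧
    czx L *ᵥ basisVec c Finset.univ = z • basisVec (flipOn Finset.univ c) Finset.univ := by
  refine ⟨∏ x, (czSigns L ∅).sign x c, ?_, ?_⟩
  · rw [star_prod]
    simp only [BondSigns.star_sign, ← Finset.prod_mul_distrib, BondSigns.sign_mul_self,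
      Finset.prod_const_one]
  · rw [czx, allX_eq, allCZ_eq, ← Matrix.mulVec_mulVec, ← xOn_mulVec_basisVec, ← Matrix.mulVec_smul]
    congr 1
    funext d
    rw [BondSigns.gate, Matrix.mulVec_diagonal, Pi.smul_apply, basisVec_univ_apply, smul_eq_mul]
    split_ifs with h
    · rw [h]
    · simp

theorem isSRE_of_prepared_from_czxState {R D : ℕ} (hL : Even L) {s : ℤˣ} {Ψ : Conf κ → ℂ}
    {E : Matrix (Conf (Qubits L)) (Conf (Qubits L)) ℂ → Matrix (Conf κ) (Conf κ) ℂ}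
    (hΨ : IsUnitVec Ψ) (hE : IsLocalChannel R D E) (hEΨ : E (czxState L s) = pureState Ψ)
    {R₁ ρ : ℕ} (hR₁ : R₁ = max R 1) (hρ : ρ = R₁ + (D + D) * R₁) : IsSRE (42 * ρ) 3 Ψ := by
  obtain ⟨a, b, e, K, v, hK, hv, hker⟩ := hE.exists_circ
  have hΨ1 : star Ψ ⬝ᵥ Ψ = 1 := by
    rw [dotProduct_star_self_eq_ofReal, hΨ, Complex.ofReal_one]
  have hσ : (0 : ℝ) < (2 ^ (L + 1))⁻¹ := by positivity
  have hin : ∀ c : Conf (Qubits L), inputVec v c ≠ 0 := fun c =>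
    tens_ne_zero (fun x => Equiv.refl (Qubits L x × Fin (a x))) (basisVec_ne_zero c Finset.univ)
      (prodVec_ne_zero hv)
  refine isSRE_of_preparesFromFlips (R := R₁) (n := D + D) (e := e) (K := K) (v := v) (by lia) hρ
    (hK.mono fun S ⟨x, k, hk, hS⟩ => ⟨x, k, by lia, hS⟩) hin hΨ fun c => ?_
  have h1 := hker (Conf (Qubits L)) (fun _ => (2 ^ (L + 1))⁻¹)
    (fun c => (1 + ((s : ℤ) : ℂ) • czx L) *ᵥ basisVec c Finset.univ) (1 - pureState Ψ)
    (fun _ => hσ.le) (by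
      rw [← czxState_eq_sum hL, hEΨ, sub_mul, one_mul, pureState, Matrix.vecMulVec_mul_vecMulVec,
        hΨ1]
      simp) c hσ
  obtain ⟨h, hh⟩ := exists_tens_of_liftOp_eq_zero e h1
  obtain ⟨z, hz, hcz⟩ := czx_mulVec_basisVec c
  refine ⟨((s : ℤ) : ℂ) * z, h, ?_, ?_⟩
  · have hs : star (((s : ℤ) : ℂ)) = ((s : ℤ) : ℂ) := by
      rw [Complex.star_def, map_intCast]
    rw [star_mul', hs]
    linear_combination (star z * z) * intUnit_cast_mul_self s + hz
  · rw [← hh]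
    congr 1
    rw [Matrix.add_mulVec, Matrix.one_mulVec, Matrix.smul_mulVec, hcz, smul_smul]
    funext t
    simp only [inputVec, tens, Pi.add_apply, Pi.smul_apply, smul_eq_mul]
    ring

end PreparedFromCZX

/-! ### The three statements -/

theorem mainTheorem2 :
    -- a pure state that prepares `ρ_±` is long-range entangled, and even long-range tripartite
    -- entangled
    (∀ R D R' D' : ℕ, ∃ ℓ : ℕ, ∀ (L : ℕ) [NeZero L], Even L → ∀ (s : ℤˣ)
      (κ : ZMod L → Type) [∀ x, Fintype (κ x)] [∀ x, DecidableEq (κ x)]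
      (Ψ₁ : Conf κ → ℂ) (E₁ : Matrix (Conf κ) (Conf κ) ℂ →
        Matrix (Conf (Qubits L)) (Conf (Qubits L)) ℂ),
      IsUnitVec Ψ₁ → IsLocalChannel R D E₁ → E₁ (pureState Ψ₁) = czxState L s →
        (ℓ ≤ L → ¬ IsSRE R' D' Ψ₁) ∧
        (∀ (κ' : ZMod L → Type) [∀ x, Fintype (κ' x)] [∀ x, DecidableEq (κ' x)]
          (P : Fin 3 → Finset (ZMod L)) (σ : Matrix (Conf κ') (Conf κ') ℂ)
          (E : Matrix (Conf κ') (Conf κ') ℂ → Matrix (Conf κ) (Conf κ) ℂ),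
          IsArcPartition ℓ P → IsPartSeparable P σ → IsLocalChannel R' D' E →
            E σ ≠ pureState Ψ₁)) ∧
    -- a pure state that is prepared from `ρ_±` is short-range entangled
    (∀ R D : ℕ, ∃ R' D' : ℕ, ∀ (L : ℕ) [NeZero L], Even L → ∀ (s : ℤˣ)
      (κ : ZMod L → Type) [∀ x, Fintype (κ x)] [∀ x, DecidableEq (κ x)]
      (Ψ₂ : Conf κ → ℂ) (E₂ : Matrix (Conf (Qubits L)) (Conf (Qubits L)) ℂ →
        Matrix (Conf κ) (Conf κ) ℂ),
      IsUnitVec Ψ₂ → IsLocalChannel R D E₂ → E₂ (czxState L s) = pureState Ψ₂ →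
        IsSRE R' D' Ψ₂) ∧
    -- `ρ_±` is not two-way connected to any pure state
    (∀ R D : ℕ, ∃ L₀ : ℕ, ∀ (L : ℕ) [NeZero L], L₀ ≤ L → Even L → ∀ (s : ℤˣ)
      (κ : ZMod L → Type) [∀ x, Fintype (κ x)] [∀ x, DecidableEq (κ x)]
      (Ψ : Conf κ → ℂ), IsUnitVec Ψ →
        ¬ ∃ (E₁ : Matrix (Conf κ) (Conf κ) ℂ → Matrix (Conf (Qubits L)) (Conf (Qubits L)) ℂ)
            (E₂ : Matrix (Conf (Qubits L)) (Conf (Qubits L)) ℂ → Matrix (Conf κ) (Conf κ) ℂ),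
            IsLocalChannel R D E₁ ∧ IsLocalChannel R D E₂ ∧
            E₁ (pureState Ψ) = czxState L s ∧ E₂ (czxState L s) = pureState Ψ) := by
  have h1 : ∀ R D R' D' : ℕ, ∃ ℓ : ℕ, ∀ (L : ℕ) [NeZero L], Even L → ∀ (s : ℤˣ)
      (κ : ZMod L → Type) [∀ x, Fintype (κ x)] [∀ x, DecidableEq (κ x)]
      (Ψ₁ : Conf κ → ℂ) (E₁ : Matrix (Conf κ) (Conf κ) ℂ →
        Matrix (Conf (Qubits L)) (Conf (Qubits L)) ℂ),
      IsUnitVec Ψ₁ → IsLocalChannel R D E₁ → E₁ (pureState Ψ₁) = czxState L s →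
        (ℓ ≤ L → ¬ IsSRE R' D' Ψ₁) ∧
        (∀ (κ' : ZMod L → Type) [∀ x, Fintype (κ' x)] [∀ x, DecidableEq (κ' x)]
          (P : Fin 3 → Finset (ZMod L)) (σ : Matrix (Conf κ') (Conf κ') ℂ)
          (E : Matrix (Conf κ') (Conf κ') ℂ → Matrix (Conf κ) (Conf κ) ℂ),
          IsArcPartition ℓ P → IsPartSeparable P σ → IsLocalChannel R' D' E →
            E σ ≠ pureState Ψ₁) := by
    intro R D R' D'
    -- One constant serves both claims. The tripartite one needs depth `D' + D'`, since its channel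
    -- may also have to prepare ancillas; this exceeds the requirement of the other.
    refine ⟨12 * (2 * (((D' + D') + (D + D)) * max (max R R') 1) + max (max R R') 1 + 2),
      fun L _ hL s κ _ _ Ψ E hΨ hE hEΨ => ⟨fun hℓ => ?_, fun κ' _ _ P σ E' hP hσ hE' => ?_⟩⟩
    · refine czx_preparation_not_sre hL hE hEΨ rfl rfl (le_trans ?_ hℓ)
      gcongr
      lia
    · exact czx_preparation_not_tripartite hL hΨ hE hEΨ rfl rfl hP hσ hE'
  have h2 : ∀ R D : ℕ, ∃ R' D' : ℕ, ∀ (L : ℕ) [NeZero L], Even L → ∀ (s : ℤˣ)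
      (κ : ZMod L → Type) [∀ x, Fintype (κ x)] [∀ x, DecidableEq (κ x)]
      (Ψ₂ : Conf κ → ℂ) (E₂ : Matrix (Conf (Qubits L)) (Conf (Qubits L)) ℂ →
        Matrix (Conf κ) (Conf κ) ℂ),
      IsUnitVec Ψ₂ → IsLocalChannel R D E₂ → E₂ (czxState L s) = pureState Ψ₂ →
        IsSRE R' D' Ψ₂ := fun R D =>
    ⟨42 * (max R 1 + (D + D) * max R 1), 3, fun L _ hL s κ _ _ Ψ E hΨ hE hEΨ =>
      isSRE_of_prepared_from_czxState hL hΨ hE hEΨ rfl rfl⟩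
  refine ⟨h1, h2, fun R D => ?_⟩
  obtain ⟨R', D', hSRE⟩ := h2 R D
  obtain ⟨ℓ, hℓ⟩ := h1 R D R' D'
  refine ⟨ℓ, fun L _ hLℓ hL s κ _ _ Ψ hΨ => ?_⟩
  rintro ⟨E₁, E₂, hE₁, hE₂, h₁, h₂⟩
  exact (hℓ L hL s κ Ψ E₁ hΨ hE₁ h₁).1 hLℓ (hSRE L hL s κ Ψ E₂ hΨ hE₂ h₂)
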